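/- **Proposition (invariant measures for infinite-size noisy systems).** *Setting.* Let $X=[-\frac12,\frac12]$ with Lebesgue measure $\lambda$, and let $\mathsf P(X)$ be the set of Borel probability measures on $X$ with the topology of weak convergence and its Borel $\sigma$-algebra. For $|r|<\frac23$ let $T_r:X\to X$ be $T_r(x)=f_r(x)$ for $x\le-\frac r4$ and $T_r(x)=f_r(x)-1$ for $x>-\frac r4$, where $f_r(x)=\frac{(r+4)x+r+1}{2rx+2}$. Its unique invariant probability density is $$u_r(x)=\Big(\log\tfrac{r^2-4}{9r^2-4}\Big)^{-1}\frac{2r^2}{(rx-(1-r))(rx-(1+r))}\quad(r\ne0),\qquad u_0=1.$$ Call $f$ *S-shaped* on an interval $I$ symmetric about $0$ if $f'>0$ on $I$, $f$ is odd on $I$, and $f''(x)<0$ for all $x\in I$ with $x>0$. The feedback function $G:X\to[-\frac4{10},\frac4{10}]$ is real-analytic on the closed interval $X$ (so it extends analytically to a neighbourhood of $X$; the extension is also called $G$) and S-shaped on $X$. For a probability measure $\nu$ or a density $u$ on $X$ the field is $\phi(\nu)=\int_X x\,d\nu(x)$, $\phi(u)=\int_X x\,u(x)\,dx$. Put $H(r)=G(\phi(u_r))$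 for $|r|<\frac23$. Assume * (I) $G'(x)\le25-50|G(x)|$ for all $x\in X$; * (II) $H$ is S-shaped on $[-\frac4{10},\frac4{10}]$; * (bistable regime) $G'(0)>6$; let $r_*$ be the unique positive fixed point of $H$. For $y\in Y=[-\frac23,\frac23]$ let $w_y(x)=\frac{1-y^2/4}{(1-xy)^2}$ ($x\in X$), let $\mathcal D'=\{\int_Yw_\bullet\,d\mu:\mu\in\mathsf P(Y)\}$ (densities with representing measure $\mu$), and for $0<|r|<\frac23$ let $\mu_r$ be the measure on $[\frac r{1+r},\frac r{1-r}]$ with Lebesgue density $\big(\log\frac{r^2-4}{9r^2-4}\big)^{-1}\frac1{1-y^2/4}$, so that $u_r=\int w_\bullet\,d\mu_r$. Let $\mathsf d(\mu,\nu)=\int_{\mathbb R}|F_\mu(x)-F_\nu(x)|\,dx$ be the Wasserstein distance, $F_\mu$ denoting the distribution function of $\mu$. For $\delta>0$ let $\mathcal U_\delta^{\pm}\subseteq\mathsf P(X)$ be the set of all measures $u\cdot\lambda$ whose density $u=\int_Yw_\bullet\,d\mu\in\mathcal D'$ has a representing measure $\mu\in\mathsf P(Y)$ with $\mathsf d(\mu,\mu_{\pm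 r_*})\le\delta$. *Noise.* Let $\eta_1,\eta_2,\dots$ be i.i.d. real random variables whose law $\varrho$ is symmetric, supported on $[-\varepsilon,\varepsilon]$ and not the point mass at $0$. The noisy finite-size systems are the Markov processes on $X^N$, $N\ge1$, given by $$(\xi_{n+1})_i=T_{r}\big((\xi_n)_i\big),\qquad r=G\Big(\tfrac1N\textstyle\sum_j(\xi_n)_j+\eta_{n+1}\Big),$$ and the noisy infinite-size system is the Markov process on $\mathsf P(X)$ given by $$\Xi_{n+1}=\Xi_n\circ T_{r}^{-1},\qquad r=G(\phi(\Xi_n)+\eta_{n+1}).$$ *Claim.* For every $\delta>0$ there is $\varepsilon_0>0$ such that for every $\varepsilon\in(0,\varepsilon_0)$ and every such noise law $\varrho$ the following holds. 1. Every stationary distribution $Q$ of $(\Xi_n)$ that gives full mass to the measures absolutely continuous with respect to $\lambda$ satisfies $Q(\mathcal U_\delta^-\cup\mathcal U_\delta^+)=1$. 2. For each $N$ let $\boldsymbol\mu_{N,\varepsilon}$ be a stationary probability measure of $(\xi_n)$ on $X^N$ that is absolutely continuous with respect to $\lambda^N$, and let $Q_\varepsilon$ be any weak limit, along a sequence of sizes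 $N\to\infty$, of the laws under $\boldsymbol\mu_{N,\varepsilon}$ of the empirical measures $\frac1N\sum_{i=1}^N\delta_{x_i}$. Then $Q_\varepsilon$ is a stationary distribution of $(\Xi_n)$, and $Q_\varepsilon=\frac12(Q^-+Q^+)$ with probability measures $Q^\pm$ on $\mathsf P(X)$ such that $Q^-(\mathcal U_\delta^-)=1$ and $Q^+(\mathcal U_\delta^+)=1$. -/

import Mathlib

open MeasureTheory Set Filter Topology

noncomputable section

namespace GCM

/-! ### Measures on a compact interval: the Borel structure of the space of probability measures -/

/-- The single-site phase space `X = [-1/2, 1/2]`. -/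
abbrev Site : Set ℝ := Set.Icc (-1 / 2) (1 / 2)

/-- The interval `Y = [-2/3, 2/3]` that carries the representing measures. -/
abbrev ParamY : Set ℝ := Set.Icc (-2 / 3) (2 / 3)

/-- Lebesgue measure `λ` on `X`. -/
def leb : Measure Site := Measure.comap Subtype.val volume

open TopologicalSpace in
/-- The measurable structure that Mathlib puts on `P(X)` (generated by the evaluations
`ν ↦ ν A`) is the Borel σ-algebra of the topology of weak convergence. -/
instance instBorelSpacePX : BorelSpace (ProbabilityMeasure Site) := by
  constructor
  apply le_antisymm
  · have hm : @Measurable _ _ (borel (ProbabilityMeasure Site)) _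
        (fun ν : ProbabilityMeasure Site => (ν : Measure Site)) := by
      let : MeasurableSpace (ProbabilityMeasure Site) := borel _
      have : BorelSpace (ProbabilityMeasure Site) := ⟨rfl⟩
      refine Measurable.measure_of_isPiSystem_of_isProbabilityMeasure
        (S := {s : Set Site | IsClosed s}) ?_ isPiSystem_isClosed ?_
      · rw [← borel_eq_generateFrom_isClosed]
        exact BorelSpace.measurable_eq
      · intro F hF
        obtain ⟨δ, -, hδ, hlim⟩ := exists_seq_strictAnti_tendsto (0 : ℝ)
        refine measurable_of_tendsto_metrizable
          (f := fun n (ν : ProbabilityMeasure Site) =>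
            ∫⁻ x, (thickenedIndicator (hδ n) F x : ENNReal) ∂(ν : Measure Site)) ?_ ?_
        · intro n
          exact (ProbabilityMeasure.continuous_lintegral_boundedContinuousFunction _).measurable
        · rw [tendsto_pi_nhds]
          intro ν
          exact tendsto_lintegral_thickenedIndicator_of_isClosed _ hF hδ hlim
    exact (Measurable.subtype_mk (h := fun ν => ν.2) hm).le_map
  · have key : (inferInstance : TopologicalSpace (ProbabilityMeasure Site)) =
        generateFrom {s | ∃ f : BoundedContinuousFunction Site NNReal, ∃ U : Set ENNReal,
          IsOpen U ∧ (fun ν : ProbabilityMeasure Site =>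
            ∫⁻ x, (f x : ENNReal) ∂(ν : Measure Site)) ⁻¹' U = s} := by
      apply le_antisymm
      · refine le_generateFrom ?_
        rintro s ⟨f, U, hU, rfl⟩
        exact hU.preimage (ProbabilityMeasure.continuous_lintegral_boundedContinuousFunction f)
      · refine le_of_nhds_le_nhds fun ν => ?_
        refine (ProbabilityMeasure.tendsto_iff_forall_lintegral_tendsto
          (μs := id) (μ := ν)).2 fun f => ?_
        rw [tendsto_nhds]
        intro U hU hν
        have ho := isOpen_generateFrom_of_mem (g := {s | ∃ f : BoundedContinuousFunction Site NNReal,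
          ∃ U : Set ENNReal, IsOpen U ∧ (fun ν : ProbabilityMeasure Site =>
            ∫⁻ x, (f x : ENNReal) ∂(ν : Measure Site)) ⁻¹' U = s}) ⟨f, U, hU, rfl⟩
        exact (@IsOpen.mem_nhds_iff _ (generateFrom _) ν _ ho).2 hν
    have : SecondCountableTopology (ProbabilityMeasure Site) := by
      let := TopologicalSpace.metrizableSpaceMetric (ProbabilityMeasure Site)
      infer_instance
    rw [borel_eq_generateFrom_of_subbasis key]
    refine MeasurableSpace.generateFrom_le ?_
    rintro s ⟨f, U, hU, rfl⟩
    exact ((Measure.measurable_lintegral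
      (f.continuous.measurable.coe_nnreal_ennreal)).comp measurable_subtype_coe) hU.measurableSet

/-! ### The single-site maps -/

/-- The branch `f_{M_r}(x) = ((r+4)x + r+1) / (2rx + 2)`. -/
def fracMap (r x : ℝ) : ℝ := ((r + 4) * x + (r + 1)) / (2 * r * x + 2)

/-- `f_{M_r}` modulo `ℤ + 1/2`, for `x ∈ X`; the cut is at `α_r = -r/4`. -/
def siteFun (r x : ℝ) : ℝ := if x ≤ -r / 4 then fracMap r x else fracMap r x - 1

/-- The single-site map `T_r : X → X`. The projection only gives it its codomain:
it changes nothing for `|r| < 2`, see `coe_siteMap`. -/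
def siteMap (r : ℝ) (x : Site) : Site :=
  Set.projIcc (-1 / 2) (1 / 2) (by norm_num) (siteFun r x)

theorem siteFun_mem {r x : ℝ} (hr : |r| < 2) (hx : x ∈ Site) : siteFun r x ∈ Site := by
  obtain ⟨hr1, hr2⟩ := abs_lt.1 hr
  obtain ⟨hx1, hx2⟩ := hx
  have hd : 0 < 2 * r * x + 2 := by
    have h1 : |r * x| < 1 := by
      rw [abs_mul]
      have h2 : |x| ≤ 1 / 2 := abs_le.2 ⟨by linarith, hx2⟩
      nlinarith [abs_nonneg r, abs_nonneg x]
    nlinarith [(abs_lt.1 h1).1]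
  unfold siteFun fracMap
  split_ifs with h
  · constructor
    · rw [le_div_iff₀ hd]; nlinarith
    · rw [div_le_iff₀ hd]; nlinarith
  · rw [not_le] at h
    constructor
    · rw [le_sub_iff_add_le, le_div_iff₀ hd]; nlinarith
    · rw [sub_le_iff_le_add, div_le_iff₀ hd]; nlinarith

theorem coe_siteMap {r : ℝ} (hr : |r| < 2) (x : Site) : (siteMap r x : ℝ) = siteFun r x := by
  unfold siteMap
  rw [Set.projIcc_of_mem _ (siteFun_mem hr x.2)]

theorem measurable_siteMap (r : ℝ) : Measurable (siteMap r) := by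
  have h : Measurable (siteFun r) := by
    unfold siteFun fracMap
    exact Measurable.ite measurableSet_Iic (by fun_prop) (by fun_prop)
  exact continuous_projIcc.measurable.comp (h.comp measurable_subtype_coe)

/-! ### Feedback -/

/-- S-shaped on `s`: increasing with positive derivative, odd, and strictly concave to the right
of `0`. -/
def SShapedOn (f : ℝ → ℝ) (s : Set ℝ) : Prop :=
  (∀ x ∈ s, 0 < deriv f x) ∧ (∀ x ∈ s, f (-x) = -f x) ∧
    ∀ x ∈ s, 0 < x → deriv (deriv f) x < 0

/-- A feedback function `G : X → [-0.4, 0.4]`: real-analytic on the closed interval `X` (that is,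
analytic at each of its points, hence on a neighbourhood of `X`) and S-shaped. -/
structure IsFeedback (G : ℝ → ℝ) : Prop where
  analytic : AnalyticOnNhd ℝ G Site
  mapsTo : Set.MapsTo G Site (Set.Icc (-2 / 5) (2 / 5))
  sShaped : SShapedOn G Site

/-- The field `φ(ν)` of a probability measure on `X`: its mean. -/
def field (ν : ProbabilityMeasure Site) : ℝ := ∫ x, (x : ℝ) ∂(ν : Measure Site)

/-- The field `φ(u)` of a density `u` on `X`. -/
def fieldOfDensity (u : ℝ → ℝ) : ℝ := ∫ x in Site, x * u x

/-- The normalising constant `log ((r² - 4) / (9r² - 4))` for `u_r` and `μ_r`. -/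
def logConst (r : ℝ) : ℝ := Real.log ((r ^ 2 - 4) / (9 * r ^ 2 - 4))

/-- The `T_r`-invariant probability density `u_r` on `X`, for `|r| < 2/3`. -/
def invDensity (r x : ℝ) : ℝ :=
  if r = 0 then 1
  else (logConst r)⁻¹ * (2 * r ^ 2 / ((r * x - (1 - r)) * (r * x - (1 + r))))

/-- `H(r) = G(φ(u_r))`. -/
def feedbackH (G : ℝ → ℝ) (r : ℝ) : ℝ := G (fieldOfDensity (invDensity r))

/-! ### Representing measures -/

/-- The density `w_y` on `X`. -/
def wDens (y x : ℝ) : ℝ := (1 - y ^ 2 / 4) / (1 - x * y) ^ 2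

/-- The mixture `∫_Y w_y dμ(y)`. -/
def mixDensity (μ : Measure ℝ) (x : ℝ) : ℝ := ∫ y, wDens y x ∂μ

/-- `μ ∈ P(Y)`, viewed as a measure on the line. -/
def IsProbOnY (μ : Measure ℝ) : Prop := IsProbabilityMeasure μ ∧ μ ParamYᶜ = 0

/-- The representing measure `μ_r` of `u_r`, for `|r| < 2/3`: the point mass at `0` if `r = 0`,
and otherwise the measure on `Y_r = [r/(1+r), r/(1-r)]` with density proportional to
`1/(1 - y²/4)`. -/
def reprMeasure (r : ℝ) : Measure ℝ :=
  if r = 0 then Measure.dirac 0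
  else (volume.restrict (Set.Icc (r / (1 + r)) (r / (1 - r)))).withDensity
    fun y => ENNReal.ofReal ((logConst r)⁻¹ / (1 - y ^ 2 / 4))

/-- The Wasserstein distance `∫ |F_μ(x) - F_ν(x)| dx`, with `F` the distribution function. -/
def wasserstein (μ ν : Measure ℝ) : ℝ := ∫ x, |μ.real (Set.Iic x) - ν.real (Set.Iic x)|

/-- The measures `u·λ` whose density `u = ∫_Y w_• dμ` lies in `D'` and has a representing measure
`μ ∈ P(Y)` within Wasserstein distance `δ` of `μ_r`. -/
def nearSet (r δ : ℝ) : Set (ProbabilityMeasure Site) :=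
  {ν | ∃ μ : Measure ℝ, IsProbOnY μ ∧
    (ν : Measure Site) = leb.withDensity (fun x => ENNReal.ofReal (mixDensity μ x)) ∧
    wasserstein μ (reprMeasure r) ≤ δ}

/-! ### The noisy systems -/

/-- `ϱ` is a symmetric probability distribution on `[-ε, ε]` that is not the point mass at `0`. -/
structure IsNoise (ϱ : Measure ℝ) (ε : ℝ) : Prop where
  prob : IsProbabilityMeasure ϱ
  symm : ϱ.map (fun t => -t) = ϱ
  bounded : ϱ (Set.Icc (-ε) ε)ᶜ = 0
  nontrivial : ϱ ≠ Measure.dirac 0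

/-- `m` is a stationary measure of the Markov chain `s_{n+1} = Φ(s_n, η_{n+1})` with i.i.d.
`η_n` of law `ϱ`, whose transition probabilities are `K(s, A) = ϱ {t | Φ(s, t) ∈ A}`. -/
def IsStationary {S : Type*} [MeasurableSpace S] (Φ : S → ℝ → S) (ϱ : Measure ℝ)
    (m : Measure S) : Prop :=
  ∀ A : Set S, MeasurableSet A → m A = ∫⁻ s, ϱ {t | Φ s t ∈ A} ∂m

/-- One step of the measure-valued process: `ν ↦ ν ∘ T_r⁻¹` with `r = G(φ(ν) + t)`. -/
def noisyStep (G : ℝ → ℝ) (ν : ProbabilityMeasure Site) (t : ℝ) : ProbabilityMeasure Site :=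
  ν.map (measurable_siteMap (G (field ν + t))).aemeasurable

/-- One step of the noisy system of `N + 1` globally coupled maps:
`x_i ↦ T_r(x_i)` with `r = G(φ(x) + t)`, `φ(x)` the average of the `x_i`. -/
def coupledStep (G : ℝ → ℝ) (N : ℕ) (x : Fin (N + 1) → Site) (t : ℝ) : Fin (N + 1) → Site :=
  fun i => siteMap (G ((∑ j, (x j : ℝ)) / (N + 1) + t)) (x i)

/-- The empirical measure of a configuration of `N + 1` points. -/
def empirical (N : ℕ) (x : Fin (N + 1) → Site) : ProbabilityMeasure Site :=
  ⟨((N : ENNReal) + 1)⁻¹ • ∑ i, Measure.dirac (x i), ⟨by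
    simp only [Measure.smul_apply, Measure.finsetSum_apply, measure_univ, Finset.sum_const,
      Finset.card_univ, Fintype.card_fin, nsmul_eq_mul, mul_one, smul_eq_mul, Nat.cast_add,
      Nat.cast_one]
    exact ENNReal.inv_mul_cancel (by simp) (by simp)⟩⟩

theorem measurable_empirical (N : ℕ) : Measurable (empirical N) := by
  refine Measurable.subtype_mk (Measure.measurable_of_measurable_coe _ fun s hs => ?_)
  simp only [Measure.smul_apply, Measure.finsetSum_apply, smul_eq_mul]
  refine Measurable.const_mul (Finset.measurable_sum _ fun i _ => ?_) _
  exact (Measure.measurable_coe hs).comp (Measure.measurable_dirac.comp (measurable_pi_apply i))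

/-- The law on `P(X)` of the empirical measure of a random configuration. -/
def empiricalLaw (N : ℕ) (m : ProbabilityMeasure (Fin (N + 1) → Site)) :
    ProbabilityMeasure (ProbabilityMeasure Site) :=
  m.map (measurable_empirical N).aemeasurable

/-- `m` is a stationary probability measure of the noisy system of `N + 1` maps that is absolutely
continuous with respect to Lebesgue measure on `X^{N+1}`. -/
def IsACStationary (G : ℝ → ℝ) (ϱ : Measure ℝ) (N : ℕ)
    (m : ProbabilityMeasure (Fin (N + 1) → Site)) : Prop :=
  (m : Measure (Fin (N + 1) → Site)) ≪ Measure.pi (fun _ => leb) ∧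
    IsStationary (coupledStep G N) ϱ (m : Measure (Fin (N + 1) → Site))

end GCM

end

namespace GCM

open ProbabilityTheory

theorem map_val_leb : leb.map (Subtype.val : Site → ℝ) = volume.restrict Site := by
  unfold leb
  rw [map_comap_subtype_coe measurableSet_Icc]

instance : IsProbabilityMeasure leb := by
  constructor
  have h : leb.map (Subtype.val : Site → ℝ) univ = 1 := by
    rw [map_val_leb]; simp; norm_num
  rwa [Measure.map_apply measurable_subtype_coe MeasurableSet.univ, preimage_univ] at h

/-- The parameter interval on which the mixtures are studied. -/
abbrev Par : Set ℝ := Set.Icc (-1) 1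

/-- The distribution function of the density `w_y`. -/
noncomputable def cdfW (y x : ℝ) : ℝ := (1 - y / 2) * (x + 1 / 2) / (1 - x * y)

theorem one_sub_mul_pos {x y : ℝ} (hx : x ∈ Site) (hy : y ∈ Par) : 1 / 2 ≤ 1 - x * y := by
  obtain ⟨h1, h2⟩ := hx; obtain ⟨h3, h4⟩ := hy
  nlinarith [mul_nonneg (by linarith : 0 ≤ x + 1 / 2) (by linarith : 0 ≤ 1 + y),
    mul_nonneg (by linarith : 0 ≤ 1 / 2 - x) (by linarith : 0 ≤ 1 - y),
    mul_nonneg (by linarith : 0 ≤ x + 1 / 2) (by linarith : 0 ≤ 1 - y),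
    mul_nonneg (by linarith : 0 ≤ 1 / 2 - x) (by linarith : 0 ≤ 1 + y)]

theorem wDens_nonneg {x y : ℝ} (hy : y ∈ Par) : 0 ≤ wDens y x := by
  obtain ⟨h3, h4⟩ := hy
  unfold wDens
  have : 0 ≤ 1 - y ^ 2 / 4 := by nlinarith
  positivity

theorem measurable_wDens : Measurable fun p : ℝ × ℝ => wDens p.1 p.2 := by
  unfold wDens; fun_prop

theorem hasDerivAt_cdfW {x y : ℝ} (h : 1 - x * y ≠ 0) :
    HasDerivAt (cdfW y) (wDens y x) x := by
  unfold cdfW wDens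
  have h1 : HasDerivAt (fun x : ℝ => (1 - y / 2) * (x + 1 / 2)) ((1 - y / 2) * 1) x :=
    ((hasDerivAt_id x).add_const _).const_mul _
  have h2 : HasDerivAt (fun x : ℝ => 1 - x * y) (-(1 * y)) x :=
    ((hasDerivAt_id x).mul_const y).const_sub 1
  refine (h1.div h2 h).congr_deriv ?_
  rw [div_left_inj' (by positivity)]
  ring

/-- The law on `X` with density `w_y`. -/
noncomputable def wLaw (y : ℝ) : Measure Site :=
  leb.withDensity fun x => ENNReal.ofReal (wDens y x)

theorem continuousOn_wDens {y : ℝ} (hy : y ∈ Par) : ContinuousOn (wDens y) Site := by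
  unfold wDens
  refine ContinuousOn.div continuousOn_const (by fun_prop) fun x hx => ?_
  have := one_sub_mul_pos hx hy
  positivity

theorem lintegral_leb (f : ℝ → ENNReal) (hf : Measurable f) :
    ∫⁻ x, f x ∂leb = ∫⁻ x in Site, f x := by
  rw [← map_val_leb, lintegral_map hf measurable_subtype_coe]

theorem integral_leb (f : ℝ → ℝ) : ∫ x, f x ∂leb = ∫ x in Site, f x := by
  rw [← map_val_leb, (MeasurableEmbedding.subtype_coe measurableSet_Icc).integral_map]

theorem wLaw_Iic {y : ℝ} (hy : y ∈ Par) (z : Site) :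
    wLaw y (Iic z) = ENNReal.ofReal (cdfW y z) := by
  have hsub : Icc (-1 / 2 : ℝ) z ⊆ Site := Icc_subset_Icc_right z.2.2
  have hc : ContinuousOn (wDens y) (Icc (-1 / 2 : ℝ) z) := (continuousOn_wDens hy).mono hsub
  unfold wLaw
  rw [withDensity_apply _ measurableSet_Iic, ← lintegral_indicator measurableSet_Iic]
  have h1 : ∀ x : Site, (Iic z).indicator (fun x : Site => ENNReal.ofReal (wDens y x)) x =
      (Iic (z : ℝ)).indicator (fun x : ℝ => ENNReal.ofReal (wDens y x)) (x : ℝ) := by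
    intro x
    simp only [indicator, mem_Iic, Subtype.coe_le_coe]
  simp only [h1]
  have hm : Measurable fun x : ℝ => ENNReal.ofReal (wDens y x) :=
    (measurable_wDens.comp (measurable_const.prodMk measurable_id)).ennreal_ofReal
  rw [lintegral_leb _ (hm.indicator measurableSet_Iic), lintegral_indicator measurableSet_Iic,
    Measure.restrict_restrict measurableSet_Iic]
  have h2 : Iic (z : ℝ) ∩ Site = Icc (-1 / 2 : ℝ) z := by
    ext x; simp only [mem_inter_iff, mem_Iic, mem_Icc]
    exact ⟨fun h => ⟨h.2.1, h.1⟩, fun h => ⟨h.2, h.1, h.2.trans z.2.2⟩⟩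
  rw [h2, ← ofReal_integral_eq_lintegral_ofReal (hc.integrableOn_Icc)
    (ae_of_all _ fun x => wDens_nonneg hy), integral_Icc_eq_integral_Ioc,
    ← intervalIntegral.integral_of_le z.2.1]
  congr 1
  rw [intervalIntegral.integral_eq_sub_of_hasDerivAt (f := cdfW y)]
  · unfold cdfW; norm_num
  · intro x hx
    rw [uIcc_of_le z.2.1] at hx
    have := one_sub_mul_pos (hsub hx) hy
    exact hasDerivAt_cdfW (by positivity)
  · exact (hc.mono (by rw [uIcc_of_le z.2.1])).intervalIntegrable

theorem isProbabilityMeasure_wLaw {y : ℝ} (hy : y ∈ Par) : IsProbabilityMeasure (wLaw y) := by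
  constructor
  have h := wLaw_Iic hy ⟨1 / 2, by norm_num⟩
  have h1 : Iic (⟨1 / 2, by norm_num⟩ : Site) = univ := by
    ext x; simp only [mem_Iic, mem_univ, iff_true]; exact x.2.2
  rw [h1] at h
  rw [h]
  have := one_sub_mul_pos (x := 1 / 2) (by norm_num) hy
  have h2 : cdfW y (1 / 2) = 1 := by
    unfold cdfW
    rw [div_eq_one_iff_eq (by positivity)]; ring
  rw [h2, ENNReal.ofReal_one]

/-- The kernel `y ↦ w_y·λ`. -/
noncomputable def wKer : Kernel Par Site where
  toFun y := wLaw y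
  measurable' := by
    refine Measure.measurable_of_measurable_coe _ fun s hs => ?_
    simp only [wLaw, withDensity_apply _ hs]
    refine Measurable.lintegral_prod_right' (f := fun p : Par × Site =>
      ENNReal.ofReal (wDens p.1 p.2)) ?_
    exact (measurable_wDens.comp (by fun_prop : Measurable fun p : Par × Site =>
      ((p.1 : ℝ), (p.2 : ℝ)))).ennreal_ofReal

theorem wKer_apply (y : Par) : wKer y = wLaw y := rfl

instance : IsMarkovKernel wKer := ⟨fun y => isProbabilityMeasure_wLaw y.2⟩

/-! ### The dual branches -/

/-- The quantity through which the dual step depends on `r` and `y`. -/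
noncomputable def comb (r y : ℝ) : ℝ := (r + y) / (4 + r * y)

theorem four_add_pos {r y : ℝ} (hr : |r| ≤ 1 / 2) (hy : y ∈ Par) : 3 ≤ 4 + r * y := by
  obtain ⟨h1, h2⟩ := abs_le.1 hr; obtain ⟨h3, h4⟩ := hy
  nlinarith

theorem abs_comb_le {r y : ℝ} (hr : |r| ≤ 1 / 2) (hy : y ∈ Par) : |comb r y| ≤ 1 / 3 := by
  have h := four_add_pos hr hy
  obtain ⟨h1, h2⟩ := abs_le.1 hr; obtain ⟨h3, h4⟩ := hy
  unfold comb
  rw [abs_le]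
  constructor
  · rw [le_div_iff₀ (by linarith)]; nlinarith
  · rw [div_le_iff₀ (by linarith)]; nlinarith

/-- The lower and the upper image of a parameter. -/
noncomputable def lowImg (q : ℝ) : ℝ := 2 * q / (1 + q)
noncomputable def highImg (q : ℝ) : ℝ := 2 * q / (1 - q)

theorem lowImg_mem {q : ℝ} (hq : |q| ≤ 1 / 3) : lowImg q ∈ Par := by
  obtain ⟨h1, h2⟩ := abs_le.1 hq
  unfold lowImg
  constructor
  · rw [le_div_iff₀ (by linarith)]; linarith
  · rw [div_le_iff₀ (by linarith)]; linarith

theorem highImg_mem {q : ℝ} (hq : |q| ≤ 1 / 3) : highImg q ∈ Par := by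
  obtain ⟨h1, h2⟩ := abs_le.1 hq
  unfold highImg
  constructor
  · rw [le_div_iff₀ (by linarith)]; linarith
  · rw [div_le_iff₀ (by linarith)]; linarith

noncomputable def lowPt (r : ℝ) (y : Par) : Par :=
  projIcc (-1) 1 (by norm_num) (lowImg (comb r y))
noncomputable def highPt (r : ℝ) (y : Par) : Par :=
  projIcc (-1) 1 (by norm_num) (highImg (comb r y))

theorem coe_lowPt {r : ℝ} (hr : |r| ≤ 1 / 2) (y : Par) :
    (lowPt r y : ℝ) = lowImg (comb r y) := by
  unfold lowPt; rw [projIcc_of_mem _ (lowImg_mem (abs_comb_le hr y.2))]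

theorem coe_highPt {r : ℝ} (hr : |r| ≤ 1 / 2) (y : Par) :
    (highPt r y : ℝ) = highImg (comb r y) := by
  unfold highPt; rw [projIcc_of_mem _ (highImg_mem (abs_comb_le hr y.2))]

theorem measurable_comb (r : ℝ) : Measurable fun y : Par => comb r y := by
  unfold comb; fun_prop

theorem measurable_lowPt (r : ℝ) : Measurable (lowPt r) := by
  have : Measurable lowImg := by unfold lowImg; fun_prop
  exact continuous_projIcc.measurable.comp (this.comp (measurable_comb r))

theorem measurable_highPt (r : ℝ) : Measurable (highPt r) := by
  have : Measurable highImg := by unfold highImg; fun_prop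
  exact continuous_projIcc.measurable.comp (this.comp (measurable_comb r))

/-- The action of `T_r` on representing measures. -/
noncomputable def stepKer (r : ℝ) : Kernel Par Par where
  toFun y := ENNReal.ofReal (1 / 2 - comb r y) • Measure.dirac (lowPt r y) +
    ENNReal.ofReal (1 / 2 + comb r y) • Measure.dirac (highPt r y)
  measurable' := by
    have h := measurable_comb r
    refine Measure.measurable_of_measurable_coe _ fun s hs => ?_
    simp only [Measure.add_apply, Measure.smul_apply, smul_eq_mul]
    refine Measurable.add (Measurable.mul ?_ ?_) (Measurable.mul ?_ ?_)
    · exact (h.const_sub _).ennreal_ofReal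
    · exact (Measure.measurable_coe hs).comp (Measure.measurable_dirac.comp (measurable_lowPt r))
    · exact (h.const_add _).ennreal_ofReal
    · exact (Measure.measurable_coe hs).comp (Measure.measurable_dirac.comp (measurable_highPt r))

theorem stepKer_apply (r : ℝ) (y : Par) : stepKer r y =
    ENNReal.ofReal (1 / 2 - comb r y) • Measure.dirac (lowPt r y) +
    ENNReal.ofReal (1 / 2 + comb r y) • Measure.dirac (highPt r y) := rfl

theorem isMarkovKernel_stepKer {r : ℝ} (hr : |r| ≤ 1 / 2) : IsMarkovKernel (stepKer r) := by
  refine ⟨fun y => ⟨?_⟩⟩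
  obtain ⟨h1, h2⟩ := abs_le.1 (abs_comb_le hr y.2)
  rw [stepKer_apply]
  simp only [Measure.add_apply, Measure.smul_apply, measure_univ, smul_eq_mul, mul_one]
  rw [← ENNReal.ofReal_add (by linarith) (by linarith)]
  norm_num

/-- The inverse of `fracMap r`. -/
noncomputable def fracInv (r z : ℝ) : ℝ := (2 * z - r - 1) / (r + 4 - 2 * r * z)

theorem fracInv_den_pos {r z : ℝ} (hr : |r| ≤ 1 / 2) (hz : z ∈ Icc (-1 / 2 : ℝ) (3 / 2)) :
    0 < r + 4 - 2 * r * z := by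
  obtain ⟨h1, h2⟩ := abs_le.1 hr; obtain ⟨h3, h4⟩ := hz
  nlinarith

theorem fracMap_den_pos {r x : ℝ} (hr : |r| ≤ 1 / 2) (hx : x ∈ Site) : 0 < 2 * r * x + 2 := by
  obtain ⟨h1, h2⟩ := abs_le.1 hr; obtain ⟨h3, h4⟩ := hx
  nlinarith

theorem fracInv_mem {r z : ℝ} (hr : |r| ≤ 1 / 2) (hz : z ∈ Icc (-1 / 2 : ℝ) (3 / 2)) :
    fracInv r z ∈ Site := by
  have h := fracInv_den_pos hr hz
  obtain ⟨h1, h2⟩ := abs_le.1 hr; obtain ⟨h3, h4⟩ := hz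
  unfold fracInv
  constructor
  · rw [le_div_iff₀ h]; nlinarith
  · rw [div_le_iff₀ h]; nlinarith

theorem fracMap_le_iff {r x z : ℝ} (hr : |r| ≤ 1 / 2) (hx : x ∈ Site)
    (hz : z ∈ Icc (-1 / 2 : ℝ) (3 / 2)) : fracMap r x ≤ z ↔ x ≤ fracInv r z := by
  unfold fracMap fracInv
  rw [div_le_iff₀ (fracMap_den_pos hr hx), le_div_iff₀ (fracInv_den_pos hr hz)]
  constructor <;> intro h <;> linarith

theorem fracInv_mul {r z : ℝ} (hr : |r| ≤ 1 / 2) (hz : z ∈ Icc (-1 / 2 : ℝ) (3 / 2)) :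
    fracInv r z * (r + 4 - 2 * r * z) = 2 * z - r - 1 :=
  div_mul_cancel₀ _ (fracInv_den_pos hr hz).ne'

theorem fracMap_fracInv {r z : ℝ} (hr : |r| ≤ 1 / 2) (hz : z ∈ Icc (-1 / 2 : ℝ) (3 / 2)) :
    fracMap r (fracInv r z) = z := by
  have h := fracInv_mul hr hz
  have h2 := fracMap_den_pos hr (fracInv_mem hr hz)
  unfold fracMap
  rw [div_eq_iff h2.ne']
  linear_combination h

theorem fracInv_half (r : ℝ) : fracInv r (1 / 2) = -r / 4 := by
  unfold fracInv
  rw [show r + 4 - 2 * r * (1 / 2) = 4 by ring]; ring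

theorem fracInv_mono {r z z' : ℝ} (hr : |r| ≤ 1 / 2) (hz : z ∈ Icc (-1 / 2 : ℝ) (3 / 2))
    (hz' : z' ∈ Icc (-1 / 2 : ℝ) (3 / 2)) (h : z ≤ z') : fracInv r z ≤ fracInv r z' := by
  rw [← fracMap_le_iff hr (fracInv_mem hr hz) hz', fracMap_fracInv hr hz]; exact h

theorem siteMap_le_iff {r : ℝ} (hr : |r| ≤ 1 / 2) (x z : Site) :
    siteMap r x ≤ z ↔ (x : ℝ) ≤ fracInv r z ∨
      (-r / 4 < (x : ℝ) ∧ (x : ℝ) ≤ fracInv r (z + 1)) := by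
  have hz := z.2
  have hz1 : (z : ℝ) ∈ Icc (-1 / 2 : ℝ) (3 / 2) := ⟨hz.1, by linarith [hz.2]⟩
  have hz2 : (z : ℝ) + 1 ∈ Icc (-1 / 2 : ℝ) (3 / 2) := ⟨by linarith [hz.1], by linarith [hz.2]⟩
  have hc : fracInv r z ≤ -r / 4 := by
    rw [← fracInv_half]; exact fracInv_mono hr hz1 (by norm_num) (by linarith [hz.2])
  rw [← Subtype.coe_le_coe, coe_siteMap (by linarith)]
  unfold siteFun
  split_ifs with h
  · rw [fracMap_le_iff hr x.2 hz1]
    constructor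
    · exact Or.inl
    · rintro (h1 | h1)
      · exact h1
      · exact absurd h (not_le.2 h1.1)
  · rw [not_le] at h
    rw [sub_le_iff_le_add, fracMap_le_iff hr x.2 hz2]
    constructor
    · exact fun h1 => Or.inr ⟨h, h1⟩
    · rintro (h1 | h1)
      · linarith
      · exact h1.2

theorem comb_mul {r y : ℝ} (hr : |r| ≤ 1 / 2) (hy : y ∈ Par) :
    comb r y * (4 + r * y) = r + y :=
  div_mul_cancel₀ _ (by linarith [four_add_pos hr hy])

theorem lowImg_mul {r y : ℝ} (hr : |r| ≤ 1 / 2) (hy : y ∈ Par) :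
    lowImg (comb r y) * (4 + r * y + (r + y)) = 2 * (r + y) := by
  have h5 := abs_le.1 (abs_comb_le hr hy)
  have h6 : lowImg (comb r y) * (1 + comb r y) = 2 * comb r y :=
    div_mul_cancel₀ _ (by linarith)
  linear_combination (4 + r * y) * h6 + (2 - lowImg (comb r y)) * comb_mul hr hy

theorem highImg_mul {r y : ℝ} (hr : |r| ≤ 1 / 2) (hy : y ∈ Par) :
    highImg (comb r y) * (4 + r * y - (r + y)) = 2 * (r + y) := by
  have h5 := abs_le.1 (abs_comb_le hr hy)
  have h6 : highImg (comb r y) * (1 - comb r y) = 2 * comb r y :=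
    div_mul_cancel₀ _ (by linarith)
  linear_combination (4 + r * y) * h6 + (2 + highImg (comb r y)) * comb_mul hr hy

theorem cdfW_fracInv_low {r y z : ℝ} (hr : |r| ≤ 1 / 2) (hy : y ∈ Par) (hz : z ∈ Site) :
    cdfW y (fracInv r z) = (1 / 2 - comb r y) * cdfW (lowImg (comb r y)) z := by
  have hz1 : z ∈ Icc (-1 / 2 : ℝ) (3 / 2) := ⟨hz.1, by linarith [hz.2]⟩
  have h1 := fracInv_den_pos hr hz1
  have h2 := one_sub_mul_pos (fracInv_mem hr hz1) hy
  have h3 := one_sub_mul_pos hz (lowImg_mem (abs_comb_le hr hy))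
  have hq := comb_mul hr hy
  have hl := lowImg_mul hr hy
  have hg := fracInv_mul hr hz1
  unfold cdfW
  generalize fracInv r z = g at *
  generalize lowImg (comb r y) = l at *
  generalize comb r y = q at *
  have k1 : (1 - g * y) * (r + 4 - 2 * r * z) = 4 + r * y + (r + y) - z * (2 * (r + y)) := by
    linear_combination -y * hg
  have k2 : (1 - z * l) * (4 + r * y + (r + y)) =
      4 + r * y + (r + y) - z * (2 * (r + y)) := by
    linear_combination -z * hl
  have h8 : 0 < 4 + r * y + (r + y) - z * (2 * (r + y)) := by
    rw [← k1]; exact mul_pos (by linarith) h1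
  have e1 : (1 - y / 2) * (g + 1 / 2) / (1 - g * y) = (1 - y / 2) * (2 - r) * (z + 1 / 2) /
      (4 + r * y + (r + y) - z * (2 * (r + y))) := by
    rw [div_eq_div_iff (by linarith) h8.ne']
    linear_combination (1 - y / 2) * (1 - g * y) * hg - (1 - y / 2) * (g + 1 / 2) * k1
  have e2 : (1 / 2 - q) * ((1 - l / 2) * (z + 1 / 2) / (1 - z * l)) =
      (1 - y / 2) * (2 - r) * (z + 1 / 2) / (4 + r * y + (r + y) - z * (2 * (r + y))) := by
    rw [← mul_div_assoc, div_eq_div_iff (by linarith) h8.ne']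
    linear_combination -(1 / 2 - q) * (1 - l / 2) * (z + 1 / 2) * k2 +
      (z + 1 / 2) * (1 - z * l) * (-(1 / 2 - q) / 2 * hl - hq)
  rw [e1, e2]

theorem cdfW_fracInv_high {r y z : ℝ} (hr : |r| ≤ 1 / 2) (hy : y ∈ Par) (hz : z ∈ Site) :
    cdfW y (fracInv r (z + 1)) - cdfW y (-r / 4) =
      (1 / 2 + comb r y) * cdfW (highImg (comb r y)) z := by
  have hz1 : z + 1 ∈ Icc (-1 / 2 : ℝ) (3 / 2) := ⟨by linarith [hz.1], by linarith [hz.2]⟩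
  have h1 := fracInv_den_pos hr hz1
  have h2 := one_sub_mul_pos (fracInv_mem hr hz1) hy
  have h3 := one_sub_mul_pos hz (highImg_mem (abs_comb_le hr hy))
  have h4 := four_add_pos hr hy
  have hq := comb_mul hr hy
  have hl := highImg_mul hr hy
  have hg := fracInv_mul hr hz1
  unfold cdfW
  generalize fracInv r (z + 1) = g at *
  generalize highImg (comb r y) = l at *
  generalize comb r y = q at *
  have k1 : (1 - g * y) * (r + 4 - 2 * r * (z + 1)) =
      4 + r * y - (r + y) - z * (2 * (r + y)) := by
    linear_combination -y * hg
  have k2 : (1 - z * l) * (4 + r * y - (r + y)) =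
      4 + r * y - (r + y) - z * (2 * (r + y)) := by
    linear_combination -z * hl
  have h8 : 0 < 4 + r * y - (r + y) - z * (2 * (r + y)) := by
    rw [← k1]; exact mul_pos (by linarith) h1
  have e1 : (1 - y / 2) * (g + 1 / 2) / (1 - g * y) = (1 - y / 2) * (2 - r) * (z + 3 / 2) /
      (4 + r * y - (r + y) - z * (2 * (r + y))) := by
    rw [div_eq_div_iff (by linarith) h8.ne']
    linear_combination (1 - y / 2) * (1 - g * y) * hg - (1 - y / 2) * (g + 1 / 2) * k1
  have e3 : (1 - y / 2) * (-r / 4 + 1 / 2) / (1 - -r / 4 * y) =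
      (1 - y / 2) * (2 - r) / (4 + r * y) := by
    rw [div_eq_div_iff (by linarith) (by linarith)]; ring
  have e2 : (1 / 2 + q) * ((1 - l / 2) * (z + 1 / 2) / (1 - z * l)) =
      (1 / 2 + q) * (4 + r * y - 2 * (r + y)) * (z + 1 / 2) /
        (4 + r * y - (r + y) - z * (2 * (r + y))) := by
    rw [← mul_div_assoc, div_eq_div_iff (by linarith) h8.ne']
    linear_combination -(1 / 2 + q) * (1 - l / 2) * (z + 1 / 2) * k2 +
      (z + 1 / 2) * (1 - z * l) * (-(1 / 2 + q) / 2 * hl)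
  rw [e1, e2, e3, div_sub_div _ _ h8.ne' (by linarith), div_eq_div_iff
    (mul_pos h8 (by linarith)).ne' h8.ne']
  linear_combination -(4 + r * y - 2 * (r + y)) * (z + 1 / 2) *
    (4 + r * y - (r + y) - z * (2 * (r + y))) * hq

theorem comb_cut_mem {r : ℝ} (hr : |r| ≤ 1 / 2) : -r / 4 ∈ Site := by
  rw [← fracInv_half r]; exact fracInv_mem hr ⟨by norm_num, by norm_num⟩

theorem cdfW_nonneg {y x : ℝ} (hy : y ∈ Par) (hx : x ∈ Site) : 0 ≤ cdfW y x := by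
  have := one_sub_mul_pos hx hy
  unfold cdfW
  exact div_nonneg (mul_nonneg (by linarith [hy.2]) (by linarith [hx.1])) (by linarith)

theorem stepKer_bind_apply (r : ℝ) (y : Par) {A : Set Site} (hA : MeasurableSet A) :
    (stepKer r y).bind wKer A = ENNReal.ofReal (1 / 2 - comb r y) * wLaw (lowPt r y) A +
      ENNReal.ofReal (1 / 2 + comb r y) * wLaw (highPt r y) A := by
  have hm : Measurable fun y : Par => wKer y A := (Kernel.measurable_coe _ hA)
  rw [Measure.bind_apply hA (Kernel.aemeasurable _), stepKer_apply, lintegral_add_measure,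
    lintegral_smul_measure, lintegral_smul_measure, lintegral_dirac' _ hm, lintegral_dirac' _ hm]
  rfl

theorem map_wLaw {r : ℝ} (hr : |r| ≤ 1 / 2) (y : Par) :
    (wLaw y).map (siteMap r) = (stepKer r y).bind wKer := by
  have := isProbabilityMeasure_wLaw y.2
  have := Measure.isProbabilityMeasure_map (μ := wLaw y) (measurable_siteMap r).aemeasurable
  refine Measure.ext_of_Iic _ _ fun z => ?_
  have hz := z.2
  have hz1 : (z : ℝ) ∈ Icc (-1 / 2 : ℝ) (3 / 2) := ⟨hz.1, by linarith [hz.2]⟩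
  have hz2 : (z : ℝ) + 1 ∈ Icc (-1 / 2 : ℝ) (3 / 2) := ⟨by linarith [hz.1], by linarith [hz.2]⟩
  set a : Site := ⟨fracInv r z, fracInv_mem hr hz1⟩ with ha
  set b : Site := ⟨fracInv r (z + 1), fracInv_mem hr hz2⟩ with hb
  set c : Site := ⟨-r / 4, comb_cut_mem hr⟩ with hc
  have hac : a ≤ c := by
    rw [← Subtype.coe_le_coe]
    change fracInv r z ≤ -r / 4
    rw [← fracInv_half]; exact fracInv_mono hr hz1 (by norm_num) (by linarith [hz.2])
  have hcb : c ≤ b := by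
    rw [← Subtype.coe_le_coe]
    change -r / 4 ≤ fracInv r (z + 1)
    rw [← fracInv_half]; exact fracInv_mono hr (by norm_num) hz2 (by linarith [hz.1])
  have hset : siteMap r ⁻¹' Iic z = Iic a ∪ Ioc c b := by
    ext x
    simp only [mem_preimage, mem_Iic, mem_union, mem_Ioc]
    rw [siteMap_le_iff hr]; rfl
  have hdisj : Disjoint (Iic a) (Ioc c b) := by
    rw [Set.disjoint_left]
    intro x h1 h2
    exact absurd (lt_of_lt_of_le h2.1 (le_trans h1 hac)) (lt_irrefl _)
  have hq := abs_le.1 (abs_comb_le hr y.2)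
  rw [Measure.map_apply (measurable_siteMap r) measurableSet_Iic, hset,
    measure_union hdisj measurableSet_Ioc, ← Iic_sdiff_Iic, measure_sdiff (Iic_subset_Iic.2 hcb)
      nullMeasurableSet_Iic (measure_ne_top _ _), wLaw_Iic y.2, wLaw_Iic y.2, wLaw_Iic y.2,
    ← ENNReal.ofReal_sub _ (cdfW_nonneg y.2 c.2), stepKer_bind_apply r y measurableSet_Iic,
    wLaw_Iic (lowPt r y).2, wLaw_Iic (highPt r y).2, coe_lowPt hr, coe_highPt hr,
    ← ENNReal.ofReal_mul (by linarith), ← ENNReal.ofReal_mul (by linarith)]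
  change ENNReal.ofReal (cdfW y (fracInv r z)) +
    ENNReal.ofReal (cdfW y (fracInv r (z + 1)) - cdfW y (-r / 4)) = _
  rw [cdfW_fracInv_low hr y.2 z.2, cdfW_fracInv_high hr y.2 z.2]

/-- The measure on `X` with representing measure `μ`. -/
noncomputable abbrev mix (μ : Measure Par) : Measure Site := μ.bind wKer

theorem map_mix {r : ℝ} (hr : |r| ≤ 1 / 2) (μ : Measure Par) :
    (mix μ).map (siteMap r) = mix (μ.bind (stepKer r)) := by
  have h1 : ∀ y, (wKer.map (siteMap r)) y = (stepKer r y).bind wKer := by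
    intro y
    rw [Kernel.map_apply _ (measurable_siteMap r), wKer_apply, map_wLaw hr]
  unfold mix
  rw [Measure.bind_bind (Kernel.aemeasurable _) (Kernel.aemeasurable _)]
  ext s hs
  rw [Measure.map_apply (measurable_siteMap r) hs, Measure.bind_apply
    (measurable_siteMap r hs) (Kernel.aemeasurable _), Measure.bind_apply hs]
  · refine lintegral_congr fun y => ?_
    rw [← h1 y, Kernel.map_apply' _ (measurable_siteMap r) _ hs]
  · have : (fun a => Measure.bind (stepKer r a) wKer) = wKer.map (siteMap r) := by
      funext y; rw [h1]
    rw [this]; exact Kernel.aemeasurable _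

theorem integral_bind_kernel {α β : Type*} [MeasurableSpace α] [MeasurableSpace β]
    {μ : Measure α} [SFinite μ] {κ : Kernel α β} [IsSFiniteKernel κ] {f : β → ℝ}
    (hf : Integrable f (μ.bind κ)) : ∫ b, f b ∂(μ.bind κ) = ∫ a, ∫ b, f b ∂κ a ∂μ := by
  rw [Measure.comp_eq_comp_const_apply] at hf ⊢
  rw [Kernel.integral_comp hf]
  simp

/-- Nondecreasing functions with Lipschitz constant `1`. -/
def IsTest (f : Par → ℝ) : Prop :=
  ∀ x y : Par, x ≤ y → f x ≤ f y ∧ f y - f x ≤ (y : ℝ) - x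

theorem IsTest.lipschitz {f : Par → ℝ} (hf : IsTest f) : LipschitzWith 1 f := by
  refine LipschitzWith.of_dist_le_mul fun x y => ?_
  rw [NNReal.coe_one, one_mul, Real.dist_eq, Subtype.dist_eq, Real.dist_eq]
  rcases le_total x y with h | h
  · obtain ⟨h1, h2⟩ := hf x y h
    rw [abs_sub_comm, abs_of_nonneg (by linarith), abs_sub_comm,
      abs_of_nonneg (sub_nonneg.2 (Subtype.coe_le_coe.2 h))]
    exact h2
  · obtain ⟨h1, h2⟩ := hf y x h
    rw [abs_of_nonneg (by linarith), abs_of_nonneg (sub_nonneg.2 (Subtype.coe_le_coe.2 h))]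
    exact h2

theorem IsTest.continuous {f : Par → ℝ} (hf : IsTest f) : Continuous f := hf.lipschitz.continuous

theorem IsTest.abs_sub_le {f : Par → ℝ} (hf : IsTest f) (x y : Par) : |f x - f y| ≤ 2 := by
  have h := hf.lipschitz.dist_le_mul x y
  rw [NNReal.coe_one, one_mul, Real.dist_eq, Subtype.dist_eq, Real.dist_eq] at h
  refine h.trans (abs_le.2 ⟨?_, ?_⟩) <;> linarith [x.2.1, x.2.2, y.2.1, y.2.2]

theorem integrable_of_continuous {α : Type*} [TopologicalSpace α] [CompactSpace α]
    [MeasurableSpace α] [OpensMeasurableSpace α] {f : α → ℝ} (hf : Continuous f) (μ : Measure α)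
    [IsFiniteMeasure μ] : Integrable f μ := by
  obtain ⟨C, hC⟩ := (isCompact_range hf).isBounded.exists_norm_le
  exact Integrable.of_bound hf.measurable.aestronglyMeasurable C
    (ae_of_all _ fun x => hC _ (mem_range_self x))

noncomputable def dualOp (r : ℝ) (f : Par → ℝ) (y : Par) : ℝ :=
  (1 / 2 - comb r y) * f (lowPt r y) + (1 / 2 + comb r y) * f (highPt r y)

theorem integral_stepKer {r : ℝ} (hr : |r| ≤ 1 / 2) {f : Par → ℝ} (hf : Continuous f) (y : Par) :
    ∫ z, f z ∂stepKer r y = dualOp r f y := by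
  have hq := abs_le.1 (abs_comb_le hr y.2)
  have hi : ∀ x : Par, Integrable f (Measure.dirac x) := fun x => integrable_of_continuous hf _
  rw [stepKer_apply, integral_add_measure ((hi _).smul_measure ENNReal.ofReal_ne_top)
    ((hi _).smul_measure ENNReal.ofReal_ne_top), integral_smul_measure, integral_smul_measure,
    integral_dirac, integral_dirac, ENNReal.toReal_ofReal (by linarith),
    ENNReal.toReal_ofReal (by linarith)]
  rfl

theorem integral_bind_stepKer {r : ℝ} (hr : |r| ≤ 1 / 2) {f : Par → ℝ} (hf : Continuous f)
    (μ : Measure Par) [IsProbabilityMeasure μ] :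
    ∫ z, f z ∂(μ.bind (stepKer r)) = ∫ y, dualOp r f y ∂μ := by
  have := isMarkovKernel_stepKer hr
  rw [integral_bind_kernel (integrable_of_continuous hf _)]
  exact integral_congr_ae (ae_of_all _ fun y => integral_stepKer hr hf y)

theorem comb_comm (r y : ℝ) : comb r y = comb y r := by
  unfold comb; rw [add_comm, mul_comm]

theorem comb_le_comb {v u u' : ℝ} (hv : |v| ≤ 1) (hu : |u| ≤ 1) (hu' : |u'| ≤ 1) (h : u ≤ u') :
    comb v u ≤ comb v u' := by
  rw [abs_le] at hv hu hu'
  unfold comb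
  rw [div_le_div_iff₀ (by nlinarith) (by nlinarith)]
  nlinarith [mul_nonneg (sub_nonneg.2 h) (by nlinarith : 0 ≤ 4 - v ^ 2)]

theorem lowImg_le {q q' : ℝ} (hq : |q| ≤ 1 / 3) (hq' : |q'| ≤ 1 / 3) (h : q ≤ q') :
    lowImg q ≤ lowImg q' := by
  rw [abs_le] at hq hq'
  unfold lowImg
  rw [div_le_div_iff₀ (by linarith) (by linarith)]
  nlinarith

theorem highImg_le {q q' : ℝ} (hq : |q| ≤ 1 / 3) (hq' : |q'| ≤ 1 / 3) (h : q ≤ q') :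
    highImg q ≤ highImg q' := by
  rw [abs_le] at hq hq'
  unfold highImg
  rw [div_le_div_iff₀ (by linarith) (by linarith)]
  nlinarith

theorem lowImg_le_highImg {q : ℝ} (hq : |q| ≤ 1 / 3) : lowImg q ≤ highImg q := by
  rw [abs_le] at hq
  unfold lowImg highImg
  rw [div_le_div_iff₀ (by linarith) (by linarith)]
  nlinarith [sq_nonneg q]

/-- The mean of the image of a point mass. -/
noncomputable def meanImg (q : ℝ) : ℝ := -4 * q + 6 * (q / (1 - q ^ 2))

theorem meanImg_eq {q : ℝ} (hq : |q| ≤ 1 / 3) :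
    meanImg q = (1 / 2 - q) * lowImg q + (1 / 2 + q) * highImg q := by
  rw [abs_le] at hq
  unfold meanImg lowImg highImg
  have h1 : 1 + q ≠ 0 := by linarith
  have h2 : 1 - q ≠ 0 := by linarith
  have h3 : 1 - q ^ 2 = (1 + q) * (1 - q) := by ring
  rw [h3]
  field_simp
  ring

theorem hasDerivAt_meanImg {q : ℝ} (hq : |q| ≤ 1 / 3) :
    HasDerivAt meanImg (-4 + 6 * ((1 + q ^ 2) / (1 - q ^ 2) ^ 2)) q := by
  rw [abs_le] at hq
  unfold meanImg
  have h3 : 1 - q ^ 2 ≠ 0 := by nlinarith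
  have h := (hasDerivAt_id q).div (((hasDerivAt_id q).pow 2).const_sub 1) h3
  refine (((hasDerivAt_id q).const_mul (-4)).add (h.const_mul 6)).congr_deriv ?_
  simp only [id, mul_one, Pi.pow_apply]
  congr 3
  push_cast
  ring

theorem hasDerivAt_comb {v u : ℝ} (h : 4 + v * u ≠ 0) :
    HasDerivAt (comb v) ((4 - v ^ 2) / (4 + v * u) ^ 2) u := by
  unfold comb
  have h1 := ((hasDerivAt_id u).const_add v).div (((hasDerivAt_id u).const_mul v).const_add 4) h
  refine h1.congr_deriv ?_
  simp only [id]
  congr 1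
  ring

theorem meanImg_deriv_bound {q u p : ℝ} (hq : |q| ≤ 1 / 3) (hu : |u| ≤ 1) (hp : p * (4 - u ^ 2) =
    1 - 4 * q ^ 2) : (-4 + 6 * ((1 + q ^ 2) / (1 - q ^ 2) ^ 2)) * p ≤ 9 / 10 := by
  have hv : q ^ 2 ≤ 1 / 9 := by rw [← sq_abs]; nlinarith [abs_nonneg q]
  have hu2 : u ^ 2 ≤ 1 := by rw [← sq_abs]; nlinarith [abs_nonneg u]
  have hv0 : 0 ≤ q ^ 2 := sq_nonneg q
  generalize q ^ 2 = v at *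
  have hp0 : 0 ≤ p := by
    by_contra h
    rw [not_le] at h
    nlinarith
  have hp1 : 3 * p ≤ 1 - 4 * v := by nlinarith
  have h1 : (0 : ℝ) < (1 - v) ^ 2 := by nlinarith
  have h2 : (-4 + 6 * ((1 + v) / (1 - v) ^ 2)) = (2 + 14 * v - 4 * v ^ 2) / (1 - v) ^ 2 := by
    rw [eq_div_iff h1.ne', add_mul, mul_assoc 6, div_mul_cancel₀ _ h1.ne']; ring
  rw [h2, div_mul_eq_mul_div, div_le_iff₀ h1]
  have h3 : (2 + 14 * v - 4 * v ^ 2) * (3 * p) ≤ (2 + 14 * v - 4 * v ^ 2) * (1 - 4 * v) :=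
    mul_le_mul_of_nonneg_left hp1 (by nlinarith)
  nlinarith [mul_nonneg hv0 (sq_nonneg (v - 1 / 10)), sq_nonneg (v - 9 / 100),
    mul_nonneg hv0 (sub_nonneg.2 hv)]

theorem meanImg_comb_sub_le {v a b : ℝ} (hv : |v| ≤ 1) (ha : |a| ≤ 1) (hb : |b| ≤ 1)
    (hva : ∀ u ∈ Icc a b, |comb v u| ≤ 1 / 3) (h : a ≤ b) :
    meanImg (comb v b) - meanImg (comb v a) ≤ 9 / 10 * (b - a) := by
  have hu : ∀ u ∈ Icc a b, |u| ≤ 1 := fun u hu =>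
    abs_le.2 ⟨by linarith [(abs_le.1 ha).1, hu.1], by linarith [(abs_le.1 hb).2, hu.2]⟩
  have hpos : ∀ u ∈ Icc a b, 0 < 4 + v * u := fun u h1 => by
    obtain ⟨h2, h3⟩ := abs_le.1 (hu u h1)
    obtain ⟨h4, h5⟩ := abs_le.1 hv
    nlinarith
  have hd : ∀ u ∈ Icc a b, HasDerivAt (fun u => meanImg (comb v u))
      ((-4 + 6 * ((1 + comb v u ^ 2) / (1 - comb v u ^ 2) ^ 2)) *
        ((4 - v ^ 2) / (4 + v * u) ^ 2)) u := fun u h1 =>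
    (hasDerivAt_meanImg (hva u h1)).comp u (hasDerivAt_comb (hpos u h1).ne')
  refine Convex.image_sub_le_mul_sub_of_deriv_le (convex_Icc a b)
    (fun u h1 => (hd u h1).continuousAt.continuousWithinAt)
    (fun u h1 => (hd u (interior_subset h1)).differentiableAt.differentiableWithinAt) ?_ a
    (left_mem_Icc.2 h) b (right_mem_Icc.2 h) h
  intro u h1
  have h1 := interior_subset h1
  rw [(hd u h1).deriv]
  refine meanImg_deriv_bound (hva u h1) (hu u h1) ?_
  unfold comb
  have := hpos u h1
  field_simp
  ring

theorem dualOp_comb_sub {r r' : ℝ} {y y' : Par} (hr : |r| ≤ 1 / 2) (hr' : |r'| ≤ 1 / 2)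
    (h : comb r y ≤ comb r' y') {f : Par → ℝ} (hf : IsTest f) :
    dualOp r f y ≤ dualOp r' f y' ∧
      dualOp r' f y' - dualOp r f y ≤ meanImg (comb r' y') - meanImg (comb r y) := by
  have hq := abs_comb_le hr y.2
  have hq' := abs_comb_le hr' y'.2
  have h1 : lowPt r y ≤ lowPt r' y' := by
    rw [← Subtype.coe_le_coe, coe_lowPt hr, coe_lowPt hr']; exact lowImg_le hq hq' h
  have h2 : highPt r y ≤ highPt r' y' := by
    rw [← Subtype.coe_le_coe, coe_highPt hr, coe_highPt hr']; exact highImg_le hq hq' h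
  have h3 : lowPt r y ≤ highPt r y := by
    rw [← Subtype.coe_le_coe, coe_lowPt hr, coe_highPt hr]; exact lowImg_le_highImg hq
  rw [meanImg_eq hq, meanImg_eq hq', ← coe_lowPt hr, ← coe_lowPt hr', ← coe_highPt hr,
    ← coe_highPt hr']
  unfold dualOp
  obtain ⟨a1, a2⟩ := hf _ _ h1
  obtain ⟨b1, b2⟩ := hf _ _ h2
  obtain ⟨c1, c2⟩ := hf _ _ (h3.trans h2)
  rw [abs_le] at hq hq'
  generalize comb r y = q at *
  generalize comb r' y' = q' at *
  have e1 : 0 ≤ 1 / 2 - q' := by linarith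
  have e2 : 0 ≤ 1 / 2 + q := by linarith
  have e3 : 0 ≤ q' - q := by linarith
  constructor
  · nlinarith [mul_nonneg e1 (sub_nonneg.2 a1), mul_nonneg e2 (sub_nonneg.2 b1),
      mul_nonneg e3 (sub_nonneg.2 c1)]
  · nlinarith [mul_nonneg e1 (sub_nonneg.2 a2), mul_nonneg e2 (sub_nonneg.2 b2),
      mul_nonneg e3 (sub_nonneg.2 c2)]

theorem abs_par_le (y : Par) : |(y : ℝ)| ≤ 1 := abs_le.2 y.2

theorem dualOp_isTest {r : ℝ} (hr : |r| ≤ 1 / 2) {f : Par → ℝ} (hf : IsTest f) :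
    IsTest fun y => 10 / 9 * dualOp r f y := by
  intro x y hxy
  have hxy' := Subtype.coe_le_coe.2 hxy
  have hr1 : |r| ≤ 1 := by linarith
  obtain ⟨h1, h2⟩ := dualOp_comb_sub hr hr (comb_le_comb hr1 (abs_par_le x) (abs_par_le y) hxy') hf
  have h3 := meanImg_comb_sub_le hr1 (abs_par_le x) (abs_par_le y)
    (fun u hu => abs_comb_le hr ⟨x.2.1.trans hu.1, hu.2.trans y.2.2⟩) hxy'
  constructor
  · simp only; linarith
  · simp only; linarith

theorem dualOp_sub_le {r r' : ℝ} (hr : |r| ≤ 1 / 2) (hr' : |r'| ≤ 1 / 2) (h : r ≤ r')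
    {f : Par → ℝ} (hf : IsTest f) (y : Par) :
    dualOp r f y ≤ dualOp r' f y ∧ dualOp r' f y - dualOp r f y ≤ 9 / 10 * (r' - r) := by
  have hr1 : |r| ≤ 1 := by linarith
  have hr1' : |r'| ≤ 1 := by linarith
  have hc := comb_le_comb (abs_par_le y) hr1 hr1' h
  have h3 := meanImg_comb_sub_le (abs_par_le y) hr1 hr1' (fun u hu => by
    rw [comb_comm]
    refine abs_comb_le (abs_le.2 ⟨?_, ?_⟩) y.2
    · linarith [(abs_le.1 hr).1, hu.1]
    · linarith [(abs_le.1 hr').2, hu.2]) h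
  rw [comb_comm y, comb_comm y] at hc h3
  obtain ⟨h1, h2⟩ := dualOp_comb_sub hr hr' hc hf
  exact ⟨h1, by linarith⟩

/-! ### The field of a mixture -/

/-- The field of `w_y`. -/
noncomputable def fld (y : ℝ) : ℝ :=
  ∫ x in (-1 / 2 : ℝ)..(1 / 2), (1 / 4 - x ^ 2) * (y / (1 - x * y))

theorem site_eq_uIcc : uIcc (-1 / 2 : ℝ) (1 / 2) = Site := uIcc_of_le (by norm_num)

theorem continuousOn_cdfW {y : ℝ} (hy : y ∈ Par) : ContinuousOn (cdfW y) Site := fun x hx => by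
  have := one_sub_mul_pos hx hy
  exact (hasDerivAt_cdfW (by positivity)).continuousAt.continuousWithinAt

theorem continuousOn_fld_integrand {y : ℝ} (hy : y ∈ Par) :
    ContinuousOn (fun x : ℝ => (1 / 4 - x ^ 2) * (y / (1 - x * y))) Site := by
  refine ContinuousOn.mul (by fun_prop) (ContinuousOn.div (by fun_prop) (by fun_prop) ?_)
  intro x hx
  have := one_sub_mul_pos hx hy
  positivity

theorem intervalIntegrable_of_continuousOn_site {f : ℝ → ℝ} (hf : ContinuousOn f Site) :
    IntervalIntegrable f volume (-1 / 2) (1 / 2) :=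
  ContinuousOn.intervalIntegrable (by rwa [site_eq_uIcc])

theorem setIntegral_site (f : ℝ → ℝ) : ∫ x in Site, f x = ∫ x in (-1 / 2 : ℝ)..(1 / 2), f x := by
  rw [integral_Icc_eq_integral_Ioc, ← intervalIntegral.integral_of_le (by norm_num)]

theorem integral_wLaw {y : ℝ} (hy : y ∈ Par) (f : ℝ → ℝ) :
    ∫ x, f x ∂wLaw y = ∫ x in (-1 / 2 : ℝ)..(1 / 2), wDens y x * f x := by
  have hm : Measurable fun x : Site => wDens y x :=
    measurable_wDens.comp (measurable_const.prodMk measurable_subtype_coe)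
  unfold wLaw
  rw [integral_withDensity_eq_integral_toReal_smul hm.ennreal_ofReal
    (ae_of_all _ fun x => ENNReal.ofReal_lt_top)]
  simp only [ENNReal.toReal_ofReal (wDens_nonneg hy), smul_eq_mul]
  rw [integral_leb (fun x => wDens y x * f x), setIntegral_site]

theorem integral_id_wLaw {y : ℝ} (hy : y ∈ Par) : ∫ x, (x : ℝ) ∂wLaw y = fld y := by
  rw [integral_wLaw hy fun x => x]
  have h1 := intervalIntegral.integral_mul_deriv_eq_deriv_mul (a := -1 / 2) (b := 1 / 2)
    (u := fun x => x) (u' := fun _ => 1) (v := cdfW y) (v' := wDens y)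
    (fun x _ => hasDerivAt_id x)
    (fun x hx => hasDerivAt_cdfW (by
      rw [site_eq_uIcc] at hx; have := one_sub_mul_pos hx hy; positivity))
    (by simp) (intervalIntegrable_of_continuousOn_site (continuousOn_wDens hy))
  have h2 : fld y = ∫ x in (-1 / 2 : ℝ)..(1 / 2), ((x + 1 / 2) - cdfW y x) := by
    unfold fld
    refine intervalIntegral.integral_congr fun x hx => ?_
    rw [site_eq_uIcc] at hx
    have := one_sub_mul_pos hx hy
    have h3 : 1 - x * y ≠ 0 := by positivity
    unfold cdfW
    rw [eq_sub_iff_add_eq, ← mul_div_assoc, ← add_div, div_eq_iff h3]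
    ring
  rw [h2, intervalIntegral.integral_sub (by simp)
    (intervalIntegrable_of_continuousOn_site (continuousOn_cdfW hy))]
  have h4 : cdfW y (1 / 2) = 1 := by
    have := one_sub_mul_pos (x := 1 / 2) (by norm_num) hy
    unfold cdfW
    rw [div_eq_one_iff_eq (by positivity)]; ring
  have h5 : cdfW y (-1 / 2) = 0 := by unfold cdfW; norm_num
  rw [h4, h5] at h1
  simp only [mul_comm _ (wDens y _), one_mul] at h1 ⊢
  have h6 : ∫ x in (-1 / 2 : ℝ)..(1 / 2), (x + 1 / 2) = 1 / 2 := by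
    rw [intervalIntegral.integral_add (by simp) (by simp)]
    simp; norm_num
  rw [h1, h6]; norm_num

theorem integral_quarter_sub_sq : ∫ x in (-1 / 2 : ℝ)..(1 / 2), (1 / 4 - x ^ 2) = 1 / 6 := by
  rw [intervalIntegral.integral_sub (by simp) (by simp)]
  simp; norm_num

theorem fld_mono_lip {y y' : ℝ} (hy : y ∈ Par) (hy' : y' ∈ Par) (h : y ≤ y') :
    fld y ≤ fld y' ∧ fld y' - fld y ≤ 2 / 3 * (y' - y) := by
  have e : fld y' - fld y = ∫ x in (-1 / 2 : ℝ)..(1 / 2),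
      ((1 / 4 - x ^ 2) * (y' / (1 - x * y')) - (1 / 4 - x ^ 2) * (y / (1 - x * y))) := by
    unfold fld
    rw [intervalIntegral.integral_sub
      (intervalIntegrable_of_continuousOn_site (continuousOn_fld_integrand hy'))
      (intervalIntegrable_of_continuousOn_site (continuousOn_fld_integrand hy))]
  have hb : ∀ x ∈ Site, 0 ≤ (1 / 4 - x ^ 2) * (y' / (1 - x * y')) -
      (1 / 4 - x ^ 2) * (y / (1 - x * y)) ∧ (1 / 4 - x ^ 2) * (y' / (1 - x * y')) -
      (1 / 4 - x ^ 2) * (y / (1 - x * y)) ≤ 4 * (y' - y) * (1 / 4 - x ^ 2) := by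
    intro x hx
    have h1 := one_sub_mul_pos hx hy
    have h2 := one_sub_mul_pos hx hy'
    have h3 : y' / (1 - x * y') - y / (1 - x * y) = (y' - y) / ((1 - x * y') * (1 - x * y)) := by
      rw [div_sub_div _ _ (by positivity) (by positivity)]; ring_nf
    have h4 : 0 ≤ 1 / 4 - x ^ 2 := by nlinarith [hx.1, hx.2]
    have h5 : 1 / 4 ≤ (1 - x * y') * (1 - x * y) := by nlinarith
    rw [← mul_sub, h3]
    refine ⟨mul_nonneg h4 (div_nonneg (by linarith) (by linarith)), ?_⟩
    rw [mul_comm]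
    refine mul_le_mul_of_nonneg_right ?_ h4
    rw [div_le_iff₀ (by linarith)]
    nlinarith
  have hi : IntervalIntegrable (fun x : ℝ => (1 / 4 - x ^ 2) * (y' / (1 - x * y')) -
      (1 / 4 - x ^ 2) * (y / (1 - x * y))) volume (-1 / 2) (1 / 2) :=
    (intervalIntegrable_of_continuousOn_site (continuousOn_fld_integrand hy')).sub
      (intervalIntegrable_of_continuousOn_site (continuousOn_fld_integrand hy))
  constructor
  · have := intervalIntegral.integral_nonneg (μ := volume) (by norm_num : (-1 / 2 : ℝ) ≤ 1 / 2)
      (fun x hx => (hb x hx).1)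
    linarith
  · rw [e]
    calc _ ≤ ∫ x in (-1 / 2 : ℝ)..(1 / 2), 4 * (y' - y) * (1 / 4 - x ^ 2) :=
          intervalIntegral.integral_mono_on (by norm_num) hi
            (Continuous.intervalIntegrable (by fun_prop) _ _) fun x hx => (hb x hx).2
      _ = _ := by rw [intervalIntegral.integral_const_mul, integral_quarter_sub_sq]; ring

theorem fld_isTest : IsTest fun y => fld y := by
  intro x y h
  have h' := Subtype.coe_le_coe.2 h
  obtain ⟨h1, h2⟩ := fld_mono_lip x.2 y.2 h'
  exact ⟨h1, by simp only; linarith⟩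

theorem fld_zero : fld 0 = 0 := by simp [fld]

theorem fld_neg (y : ℝ) : fld (-y) = -fld y := by
  unfold fld
  have e : ∀ f : ℝ → ℝ, -∫ x in (-1 / 2 : ℝ)..(1 / 2), f x = ∫ x in (-1 / 2 : ℝ)..(1 / 2), -f x :=
    fun f => intervalIntegral.integral_neg.symm
  have key := intervalIntegral.integral_comp_neg (a := -1 / 2) (b := 1 / 2)
    (fun x : ℝ => -((1 / 4 - x ^ 2) * (y / (1 - x * y))))
  rw [show -(1 / 2 : ℝ) = -1 / 2 by norm_num, show -(-1 / 2 : ℝ) = 1 / 2 by norm_num] at key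
  rw [e, ← key]
  refine intervalIntegral.integral_congr fun x _ => ?_
  rw [neg_div, neg_sq, mul_neg, neg_mul]
  ring

theorem le_fld {y : ℝ} (hy : y ∈ Icc (0 : ℝ) 1) : y / 6 ≤ fld y := by
  have hy' : y ∈ Par := ⟨by linarith [hy.1], hy.2⟩
  have h1 : ∫ x in (-1 / 2 : ℝ)..(1 / 2), ((1 / 4 - x ^ 2) * y + y ^ 2 * ((1 / 4 - x ^ 2) * x)) =
      y / 6 := by
    rw [intervalIntegral.integral_add (Continuous.intervalIntegrable (by fun_prop) _ _)
      (Continuous.intervalIntegrable (by fun_prop) _ _), intervalIntegral.integral_mul_const,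
      integral_quarter_sub_sq, intervalIntegral.integral_const_mul]
    have h2 : ∫ x in (-1 / 2 : ℝ)..(1 / 2), (1 / 4 - x ^ 2) * x = 0 := by
      have := intervalIntegral.integral_comp_neg (a := -1 / 2) (b := 1 / 2)
        (fun x : ℝ => (1 / 4 - x ^ 2) * x)
      simp only [even_two.neg_pow, mul_neg, intervalIntegral.integral_neg] at this
      norm_num at this ⊢
      linarith
    rw [h2]; ring
  rw [← h1]
  unfold fld
  refine intervalIntegral.integral_mono_on (by norm_num)
    (Continuous.intervalIntegrable (by fun_prop) _ _)
    (intervalIntegrable_of_continuousOn_site (continuousOn_fld_integrand hy')) fun x hx => ?_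
  have h3 := one_sub_mul_pos hx hy'
  have h4 : 0 ≤ 1 / 4 - x ^ 2 := by nlinarith [hx.1, hx.2]
  have h5 : (1 / 4 - x ^ 2) * y + y ^ 2 * ((1 / 4 - x ^ 2) * x) =
      (1 / 4 - x ^ 2) * (y * (1 + x * y)) := by ring
  rw [h5]
  refine mul_le_mul_of_nonneg_left ?_ h4
  rw [le_div_iff₀ (by linarith), mul_assoc]
  have : (1 + x * y) * (1 - x * y) ≤ 1 := by nlinarith [sq_nonneg (x * y)]
  nlinarith [hy.1]

theorem abs_fld_le {y : ℝ} (hy : y ∈ Par) : |fld y| ≤ 2 / 3 * |y| := by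
  have h0 : (0 : ℝ) ∈ Par := by norm_num
  rcases le_total 0 y with h | h
  · obtain ⟨h1, h2⟩ := fld_mono_lip h0 hy h
    rw [fld_zero] at h1 h2
    rw [abs_of_nonneg h1, abs_of_nonneg h]; linarith
  · obtain ⟨h1, h2⟩ := fld_mono_lip hy h0 h
    rw [fld_zero] at h1 h2
    rw [abs_of_nonpos h1, abs_of_nonpos h]; linarith

theorem integral_mix {μ : Measure Par} [IsProbabilityMeasure μ] {g : Site → ℝ}
    (hg : Continuous g) : ∫ x, g x ∂mix μ = ∫ y, ∫ x, g x ∂wLaw y ∂μ :=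
  integral_bind_kernel (integrable_of_continuous hg _)

theorem integral_id_mix (μ : Measure Par) [IsProbabilityMeasure μ] :
    ∫ x, (x : ℝ) ∂mix μ = ∫ y, fld y ∂μ := by
  rw [integral_mix continuous_subtype_val]
  exact integral_congr_ae (ae_of_all _ fun y => integral_id_wLaw y.2)

theorem wDens_le {x y : ℝ} (hx : x ∈ Site) (hy : y ∈ Par) : wDens y x ≤ 4 := by
  have h := one_sub_mul_pos hx hy
  unfold wDens
  rw [div_le_iff₀ (by positivity)]
  nlinarith [sq_nonneg y]

theorem mix_eq_withDensity (μ : Measure Par) [IsProbabilityMeasure μ] :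
    mix μ = leb.withDensity fun x => ENNReal.ofReal (mixDensity (μ.map Subtype.val) x) := by
  ext A hA
  rw [mix, Measure.bind_apply hA (Kernel.aemeasurable _), withDensity_apply _ hA]
  simp only [wKer_apply, wLaw, withDensity_apply _ hA]
  rw [lintegral_lintegral_swap]
  · refine setLIntegral_congr_fun hA fun x _ => ?_
    unfold mixDensity
    rw [(MeasurableEmbedding.subtype_coe measurableSet_Icc).integral_map,
      ofReal_integral_eq_lintegral_ofReal]
    · refine Integrable.of_bound ?_ 4 (ae_of_all _ fun y => ?_)
      · exact (measurable_wDens.comp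
          (measurable_subtype_coe.prodMk measurable_const)).aestronglyMeasurable
      · rw [Real.norm_eq_abs, abs_of_nonneg (wDens_nonneg y.2)]; exact wDens_le x.2 y.2
    · exact ae_of_all _ fun y => wDens_nonneg y.2
  · exact ((measurable_wDens.comp (by fun_prop : Measurable fun p : Par × Site =>
      ((p.1 : ℝ), (p.2 : ℝ)))).ennreal_ofReal).aemeasurable

/-! ### The invariant representing measures -/

theorem logConst_arg (r : ℝ) :
    (r ^ 2 - 4) / (9 * r ^ 2 - 4) = (4 - r ^ 2) / (4 - 9 * r ^ 2) := by
  rw [← neg_div_neg_eq]; ring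

theorem logConst_pos {r : ℝ} (h0 : 0 < r) (h1 : r < 2 / 3) : 0 < logConst r := by
  unfold logConst
  rw [logConst_arg r]
  refine Real.log_pos ?_
  rw [lt_div_iff₀ (by nlinarith)]
  nlinarith

theorem endpoints_mem {r : ℝ} (h0 : 0 < r) (h1 : r ≤ 1 / 2) :
    0 < r / (1 + r) ∧ r / (1 + r) ≤ r / (1 - r) ∧ r / (1 - r) ≤ 1 := by
  refine ⟨by positivity, ?_, ?_⟩
  · rw [div_le_div_iff₀ (by linarith) (by linarith)]; nlinarith
  · rw [div_le_iff₀ (by linarith)]; linarith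

theorem support_subset_Par {r : ℝ} (h0 : 0 < r) (h1 : r ≤ 1 / 2) :
    Icc (r / (1 + r)) (r / (1 - r)) ⊆ Par := by
  obtain ⟨a, b, c⟩ := endpoints_mem h0 h1
  exact Icc_subset_Icc (by linarith) c

theorem one_sub_sq_pos {y : ℝ} (hy : y ∈ Par) : 0 < 1 - y ^ 2 / 4 := by
  nlinarith [hy.1, hy.2]

theorem reprMeasure_pos {r : ℝ} (h0 : 0 < r) : reprMeasure r =
    (volume.restrict (Set.Icc (r / (1 + r)) (r / (1 - r)))).withDensity
      fun y => ENNReal.ofReal ((logConst r)⁻¹ / (1 - y ^ 2 / 4)) := by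
  unfold reprMeasure; rw [if_neg h0.ne']

theorem reprDensity_nonneg {r y : ℝ} (h0 : 0 < r) (h1 : r ≤ 1 / 2) (hy : y ∈ Par) :
    0 ≤ (logConst r)⁻¹ / (1 - y ^ 2 / 4) :=
  div_nonneg (inv_nonneg.2 (logConst_pos h0 (by linarith)).le) (one_sub_sq_pos hy).le

theorem integral_reprMeasure {r : ℝ} (h0 : 0 < r) (h1 : r ≤ 1 / 2) (g : ℝ → ℝ) :
    ∫ y, g y ∂reprMeasure r =
      (logConst r)⁻¹ * ∫ y in (r / (1 + r))..(r / (1 - r)), g y * (1 - y ^ 2 / 4)⁻¹ := by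
  have hm : Measurable fun y : ℝ => (logConst r)⁻¹ / (1 - y ^ 2 / 4) := by fun_prop
  rw [reprMeasure_pos h0, integral_withDensity_eq_integral_toReal_smul hm.ennreal_ofReal
    (ae_of_all _ fun x => ENNReal.ofReal_lt_top), ← intervalIntegral.integral_const_mul,
    intervalIntegral.integral_of_le (endpoints_mem h0 h1).2.1, ← integral_Icc_eq_integral_Ioc]
  refine setIntegral_congr_fun measurableSet_Icc fun y hy => ?_
  simp only [smul_eq_mul]
  rw [ENNReal.toReal_ofReal (reprDensity_nonneg h0 h1 (support_subset_Par h0 h1 hy))]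
  rw [div_eq_mul_inv]; ring

theorem integral_inv_one_sub_sq {r : ℝ} (h0 : 0 < r) (h1 : r ≤ 1 / 2) :
    ∫ y in (r / (1 + r))..(r / (1 - r)), (1 - y ^ 2 / 4)⁻¹ = logConst r := by
  have hle := (endpoints_mem h0 h1).2.1
  have hsub := support_subset_Par h0 h1
  have hd : ∀ y ∈ uIcc (r / (1 + r)) (r / (1 - r)), HasDerivAt
      (fun y : ℝ => Real.log (2 + y) - Real.log (2 - y)) (1 - y ^ 2 / 4)⁻¹ y := by
    intro y hy
    rw [uIcc_of_le hle] at hy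
    have hy := hsub hy
    have a1 : 0 < 2 + y := by linarith [hy.1]
    have a2 : 0 < 2 - y := by linarith [hy.2]
    have a3 := one_sub_sq_pos hy
    refine ((((hasDerivAt_id y).const_add 2).log a1.ne').sub
      (((hasDerivAt_id y).const_sub 2).log a2.ne')).congr_deriv ?_
    have : (1 - y ^ 2 / 4) = (2 + y) * (2 - y) / 4 := by ring
    rw [this]
    simp only [id]
    field_simp
    ring
  have hc : ContinuousOn (fun y : ℝ => (1 - y ^ 2 / 4)⁻¹) (uIcc (r / (1 + r)) (r / (1 - r))) := by
    refine ContinuousOn.inv₀ (by fun_prop) fun y hy => ?_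
    rw [uIcc_of_le hle] at hy
    exact (one_sub_sq_pos (hsub hy)).ne'
  rw [intervalIntegral.integral_eq_sub_of_hasDerivAt hd hc.intervalIntegrable]
  have p1 : 0 < 1 - r := by linarith
  have p2 : 0 < 1 + r := by linarith
  have p3 : 0 < 2 - 3 * r := by linarith
  have p4 : 0 < 2 - r := by linarith
  have e1 : 2 + r / (1 - r) = (2 - r) / (1 - r) := by field_simp; ring
  have e2 : 2 - r / (1 - r) = (2 - 3 * r) / (1 - r) := by field_simp; ring
  have e3 : 2 + r / (1 + r) = (2 + 3 * r) / (1 + r) := by field_simp; ring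
  have e4 : 2 - r / (1 + r) = (2 + r) / (1 + r) := by field_simp; ring
  rw [e1, e2, e3, e4, ← Real.log_div (by positivity) (by positivity),
    ← Real.log_div (by positivity) (by positivity), ← Real.log_div (by positivity) (by positivity)]
  unfold logConst
  rw [logConst_arg r]
  congr 1
  have e5 : 4 - 9 * r ^ 2 = (2 - 3 * r) * (2 + 3 * r) := by ring
  rw [e5]
  field_simp
  ring

theorem isProbabilityMeasure_reprMeasure {r : ℝ} (h0 : 0 < r) (h1 : r ≤ 1 / 2) :
    IsProbabilityMeasure (reprMeasure r) := by
  constructor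
  have hsub := support_subset_Par h0 h1
  have hc : ContinuousOn (fun y : ℝ => (logConst r)⁻¹ / (1 - y ^ 2 / 4))
      (Icc (r / (1 + r)) (r / (1 - r))) :=
    ContinuousOn.div continuousOn_const (by fun_prop) fun y hy => (one_sub_sq_pos (hsub hy)).ne'
  have hL := logConst_pos h0 (by linarith)
  rw [reprMeasure_pos h0, withDensity_apply _ MeasurableSet.univ, Measure.restrict_univ,
    ← ofReal_integral_eq_lintegral_ofReal hc.integrableOn_Icc]
  · rw [integral_Icc_eq_integral_Ioc, ← intervalIntegral.integral_of_le (endpoints_mem h0 h1).2.1]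
    simp only [div_eq_mul_inv]
    simp only [← div_eq_mul_inv (_ : ℝ) (4 : ℝ), ← div_eq_mul_inv r]
    rw [intervalIntegral.integral_const_mul, integral_inv_one_sub_sq h0 h1,
      inv_mul_cancel₀ hL.ne', ENNReal.ofReal_one]
  · exact (ae_restrict_mem measurableSet_Icc).mono fun y hy => reprDensity_nonneg h0 h1 (hsub hy)

theorem reprMeasure_compl {r : ℝ} (h0 : 0 < r) {s : Set ℝ}
    (hs : Icc (r / (1 + r)) (r / (1 - r)) ⊆ s) (hm : MeasurableSet s) : reprMeasure r sᶜ = 0 := by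
  rw [reprMeasure_pos h0]
  refine withDensity_absolutelyContinuous _ _ ?_
  rw [Measure.restrict_apply hm.compl]
  have : sᶜ ∩ Icc (r / (1 + r)) (r / (1 - r)) = ∅ := by
    rw [← disjoint_iff_inter_eq_empty, disjoint_compl_left_iff_subset]; exact hs
  rw [this, measure_empty]

/-- The invariant representing measure, on `Par`. -/
noncomputable def invRepr (r : ℝ) : Measure Par := (reprMeasure r).comap Subtype.val

theorem map_invRepr {r : ℝ} (h0 : 0 < r) (h1 : r ≤ 1 / 2) :
    (invRepr r).map Subtype.val = reprMeasure r := by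
  unfold invRepr
  rw [map_comap_subtype_coe measurableSet_Icc]
  exact Measure.restrict_eq_self_of_ae_mem
    (mem_ae_iff.2 (reprMeasure_compl h0 (support_subset_Par h0 h1) measurableSet_Icc))

theorem isProbabilityMeasure_invRepr {r : ℝ} (h0 : 0 < r) (h1 : r ≤ 1 / 2) :
    IsProbabilityMeasure (invRepr r) := by
  constructor
  have := isProbabilityMeasure_reprMeasure h0 h1
  have h2 := measure_univ (μ := reprMeasure r)
  rw [← map_invRepr h0 h1, Measure.map_apply measurable_subtype_coe MeasurableSet.univ] at h2
  simpa using h2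

theorem integral_invRepr {r : ℝ} (h0 : 0 < r) (h1 : r ≤ 1 / 2) (g : ℝ → ℝ) :
    ∫ y, g y ∂invRepr r = ∫ y, g y ∂reprMeasure r := by
  rw [← map_invRepr h0 h1, (MeasurableEmbedding.subtype_coe measurableSet_Icc).integral_map]

theorem hasDerivAt_lowImg {q : ℝ} (h : 1 + q ≠ 0) : HasDerivAt lowImg (2 / (1 + q) ^ 2) q := by
  unfold lowImg
  refine (((hasDerivAt_id q).const_mul 2).div ((hasDerivAt_id q).const_add 1) h).congr_deriv ?_
  simp only [id]; congr 1; ring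

theorem hasDerivAt_highImg {q : ℝ} (h : 1 - q ≠ 0) : HasDerivAt highImg (2 / (1 - q) ^ 2) q := by
  unfold highImg
  refine (((hasDerivAt_id q).const_mul 2).div ((hasDerivAt_id q).const_sub 1) h).congr_deriv ?_
  simp only [id]; congr 1; ring

theorem integral_dualOp_invRepr {r : ℝ} (h0 : 0 < r) (h1 : r ≤ 1 / 2) {f : Par → ℝ}
    (hf : Continuous f) : ∫ y, dualOp r f y ∂invRepr r = ∫ y, f y ∂invRepr r := by
  have hone : (-1 : ℝ) ≤ 1 := by norm_num
  obtain ⟨F, hF, hFf⟩ : ∃ F : ℝ → ℝ, Continuous F ∧ ∀ y : Par, F y = f y :=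
    ⟨fun y => f (projIcc (-1) 1 hone y),
      hf.comp (continuous_projIcc (h := hone)), fun y => by
      simp only [projIcc_val]⟩
  have hr : |r| ≤ 1 / 2 := abs_le.2 ⟨by linarith, h1⟩
  have hle := (endpoints_mem h0 h1).2.1
  have hsub := support_subset_Par h0 h1
  have e1 : ∀ y : Par, dualOp r f y = (fun y : ℝ => (1 / 2 - comb r y) * F (lowImg (comb r y)) +
      (1 / 2 + comb r y) * F (highImg (comb r y))) y := by
    intro y
    unfold dualOp
    rw [← hFf, ← hFf, coe_lowPt hr, coe_highPt hr]
  simp only [e1, ← hFf]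
  rw [integral_invRepr h0 h1 fun y : ℝ => (1 / 2 - comb r y) * F (lowImg (comb r y)) +
      (1 / 2 + comb r y) * F (highImg (comb r y)), integral_invRepr h0 h1, integral_reprMeasure h0 h1,
    integral_reprMeasure h0 h1]
  congr 1
  have hden : ∀ y ∈ uIcc (r / (1 + r)) (r / (1 - r)), y ∈ Par ∧ 0 < 4 + r * y ∧
      |comb r y| ≤ 1 / 3 := by
    intro y hy
    rw [uIcc_of_le hle] at hy
    exact ⟨hsub hy, by linarith [four_add_pos hr (hsub hy)], abs_comb_le hr (hsub hy)⟩
  have hcomb : ContinuousOn (comb r) (uIcc (r / (1 + r)) (r / (1 - r))) := fun y hy =>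
    (hasDerivAt_comb (hden y hy).2.1.ne').continuousAt.continuousWithinAt
  set dlow : ℝ → ℝ := fun y => 2 / (1 + comb r y) ^ 2 * ((4 - r ^ 2) / (4 + r * y) ^ 2) with hdlow
  set dhigh : ℝ → ℝ := fun y => 2 / (1 - comb r y) ^ 2 * ((4 - r ^ 2) / (4 + r * y) ^ 2) with hdhigh
  have hq1 : ∀ y ∈ uIcc (r / (1 + r)) (r / (1 - r)), 0 < 1 + comb r y := fun y hy => by
    linarith [(abs_le.1 (hden y hy).2.2).1]
  have hq2 : ∀ y ∈ uIcc (r / (1 + r)) (r / (1 - r)), 0 < 1 - comb r y := fun y hy => by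
    linarith [(abs_le.1 (hden y hy).2.2).2]
  have hl : ∀ y ∈ uIcc (r / (1 + r)) (r / (1 - r)),
      HasDerivAt (fun y => lowImg (comb r y)) (dlow y) y := fun y hy =>
    (hasDerivAt_lowImg (hq1 y hy).ne').comp y (hasDerivAt_comb (hden y hy).2.1.ne')
  have hh : ∀ y ∈ uIcc (r / (1 + r)) (r / (1 - r)),
      HasDerivAt (fun y => highImg (comb r y)) (dhigh y) y := fun y hy =>
    (hasDerivAt_highImg (hq2 y hy).ne').comp y (hasDerivAt_comb (hden y hy).2.1.ne')
  have hdc : ContinuousOn (fun y : ℝ => (4 - r ^ 2) / (4 + r * y) ^ 2)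
      (uIcc (r / (1 + r)) (r / (1 - r))) :=
    ContinuousOn.div continuousOn_const (by fun_prop) fun y hy =>
      (pow_pos (hden y hy).2.1 2).ne'
  have hlc : ContinuousOn dlow (uIcc (r / (1 + r)) (r / (1 - r))) :=
    (ContinuousOn.div continuousOn_const ((continuousOn_const.add hcomb).pow 2) fun y hy =>
      (pow_pos (hq1 y hy) 2).ne').mul hdc
  have hhc : ContinuousOn dhigh (uIcc (r / (1 + r)) (r / (1 - r))) :=
    (ContinuousOn.div continuousOn_const ((continuousOn_const.sub hcomb).pow 2) fun y hy =>
      (pow_pos (hq2 y hy) 2).ne').mul hdc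
  have hQ : ∀ z ∈ Par, ContinuousAt (fun z : ℝ => F z * (1 - z ^ 2 / 4)⁻¹) z := fun z hz =>
    hF.continuousAt.mul (ContinuousAt.inv₀ (by fun_prop) (one_sub_sq_pos hz).ne')
  have p1 : 0 < 1 - r := by linarith
  have p4 : 0 < 2 - r := by linarith
  have c1 : comb r (r / (1 - r)) = r / (2 - r) := by
    unfold comb
    rw [div_eq_div_iff (hden _ right_mem_uIcc).2.1.ne' p4.ne']
    field_simp
    ring
  have c2 : comb r (r / (1 + r)) = r / (2 + r) := by
    unfold comb
    rw [div_eq_div_iff (hden _ left_mem_uIcc).2.1.ne' (by positivity)]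
    field_simp
    ring
  have v1 : lowImg (comb r (r / (1 + r))) = r / (1 + r) := by
    rw [c2]; unfold lowImg
    have : 1 + r / (2 + r) = 2 * (1 + r) / (2 + r) := by field_simp; ring
    rw [this]; field_simp
  have v2 : lowImg (comb r (r / (1 - r))) = r := by
    rw [c1]; unfold lowImg
    have : 1 + r / (2 - r) = 2 / (2 - r) := by field_simp; ring
    rw [this]; field_simp
  have v3 : highImg (comb r (r / (1 + r))) = r := by
    rw [c2]; unfold highImg
    have : 1 - r / (2 + r) = 2 / (2 + r) := by field_simp; ring
    rw [this]; field_simp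
  have v4 : highImg (comb r (r / (1 - r))) = r / (1 - r) := by
    rw [c1]; unfold highImg
    have : 1 - r / (2 - r) = 2 * (1 - r) / (2 - r) := by field_simp; ring
    rw [this]; field_simp
  have i1 := intervalIntegral.integral_comp_mul_deriv' (g := fun z : ℝ => F z * (1 - z ^ 2 / 4)⁻¹)
    hl hlc (by
      rintro z ⟨y, hy, rfl⟩
      exact (hQ _ (lowImg_mem (hden y hy).2.2)).continuousWithinAt)
  have i2 := intervalIntegral.integral_comp_mul_deriv' (g := fun z : ℝ => F z * (1 - z ^ 2 / 4)⁻¹)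
    hh hhc (by
      rintro z ⟨y, hy, rfl⟩
      exact (hQ _ (highImg_mem (hden y hy).2.2)).continuousWithinAt)
  simp only [v1, v2] at i1
  simp only [v3, v4] at i2
  have hint : ∀ a b, a ∈ Par → b ∈ Par →
      IntervalIntegrable (fun z : ℝ => F z * (1 - z ^ 2 / 4)⁻¹) volume a b := fun a b ha hb =>
    ContinuousOn.intervalIntegrable fun z hz =>
      (hQ z ((ordConnected_Icc.uIcc_subset ha hb) hz)).continuousWithinAt
  have hrP : r ∈ Par := ⟨by linarith, by linarith⟩
  rw [← intervalIntegral.integral_add_adjacent_intervals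
    (hint _ r (hden _ left_mem_uIcc).1 hrP) (hint r _ hrP (hden _ right_mem_uIcc).1), ← i1, ← i2,
    ← intervalIntegral.integral_add]
  · refine intervalIntegral.integral_congr fun y hy => ?_
    obtain ⟨hyP, hy4, hqb⟩ := hden y hy
    have h1q := hq1 y hy
    have h2q := hq2 y hy
    have hq := comb_mul hr hyP
    have hy2 := one_sub_sq_pos hyP
    simp only [Function.comp, hdlow, hdhigh]
    have hkey : (4 - r ^ 2) / (4 + r * y) ^ 2 = (1 - 4 * comb r y ^ 2) / (4 - y ^ 2) := by
      rw [div_eq_div_iff (by positivity) (by linarith)]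
      linear_combination 4 * (comb r y * (4 + r * y) + (r + y)) * hq
    rw [hkey]
    have hqb' := abs_le.1 hqb
    have f1 : (1 - lowImg (comb r y) ^ 2 / 4)⁻¹ =
        (1 + comb r y) ^ 2 / (1 + 2 * comb r y) := by
      rw [inv_eq_one_div, div_eq_div_iff
        (one_sub_sq_pos (lowImg_mem hqb)).ne' (by linarith)]
      unfold lowImg
      field_simp
      ring
    have f2 : (1 - highImg (comb r y) ^ 2 / 4)⁻¹ =
        (1 - comb r y) ^ 2 / (1 - 2 * comb r y) := by
      rw [inv_eq_one_div, div_eq_div_iff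
        (one_sub_sq_pos (highImg_mem hqb)).ne' (by linarith)]
      unfold highImg
      field_simp
      ring
    rw [f1, f2]
    generalize comb r y = q at *
    have e3 : (1 + q) ^ 2 / (1 + 2 * q) * (2 / (1 + q) ^ 2 * ((1 - 4 * q ^ 2) / (4 - y ^ 2))) =
        (1 / 2 - q) * (1 - y ^ 2 / 4)⁻¹ := by
      have a1 : 1 + q * 2 ≠ 0 := by linarith
      have a2 : 4 - y ^ 2 ≠ 0 := by linarith
      have a3 : 1 - y ^ 2 / 4 = (4 - y ^ 2) / 4 := by ring
      rw [a3, show 1 - 4 * q ^ 2 = (1 - 2 * q) * (1 + 2 * q) by ring]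
      field_simp
      ring
    have e4 : (1 - q) ^ 2 / (1 - 2 * q) * (2 / (1 - q) ^ 2 * ((1 - 4 * q ^ 2) / (4 - y ^ 2))) =
        (1 / 2 + q) * (1 - y ^ 2 / 4)⁻¹ := by
      have a1 : 1 - q * 2 ≠ 0 := by linarith
      have a2 : 4 - y ^ 2 ≠ 0 := by linarith
      have a3 : 1 - y ^ 2 / 4 = (4 - y ^ 2) / 4 := by ring
      rw [a3, show 1 - 4 * q ^ 2 = (1 - 2 * q) * (1 + 2 * q) by ring]
      field_simp
      ring
    linear_combination -F (lowImg q) * e3 - F (highImg q) * e4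
  · refine ContinuousOn.intervalIntegrable (ContinuousOn.mul ?_ hlc)
    exact fun y hy => ContinuousAt.comp_continuousWithinAt (g := fun z : ℝ => F z * (1 - z ^ 2 / 4)⁻¹)
      (hQ _ (lowImg_mem (hden y hy).2.2)) (hl y hy).continuousAt.continuousWithinAt
  · refine ContinuousOn.intervalIntegrable (ContinuousOn.mul ?_ hhc)
    exact fun y hy => ContinuousAt.comp_continuousWithinAt (g := fun z : ℝ => F z * (1 - z ^ 2 / 4)⁻¹)
      (hQ _ (highImg_mem (hden y hy).2.2)) (hh y hy).continuousAt.continuousWithinAt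

theorem mixDensity_reprMeasure {r x : ℝ} (h0 : 0 < r) (h1 : r ≤ 1 / 2) (hx : x ∈ Site) :
    mixDensity (reprMeasure r) x = invDensity r x := by
  have hle := (endpoints_mem h0 h1).2.1
  have hsub := support_subset_Par h0 h1
  have hP : ∀ y ∈ uIcc (r / (1 + r)) (r / (1 - r)), y ∈ Par := fun y hy => by
    rw [uIcc_of_le hle] at hy; exact hsub hy
  have hpos : ∀ y ∈ uIcc (r / (1 + r)) (r / (1 - r)), 0 < 1 - x * y := fun y hy => by
    have := one_sub_mul_pos hx (hP y hy); linarith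
  unfold mixDensity invDensity
  rw [integral_reprMeasure h0 h1, if_neg h0.ne']
  congr 1
  have hd : ∀ y ∈ uIcc (r / (1 + r)) (r / (1 - r)),
      HasDerivAt (fun y : ℝ => y / (1 - x * y)) (1 / (1 - x * y) ^ 2) y := by
    intro y hy
    refine ((hasDerivAt_id y).div (((hasDerivAt_id y).const_mul x).const_sub 1)
      (hpos y hy).ne').congr_deriv ?_
    simp only [id]; congr 1; ring
  have hcong : ∫ y in (r / (1 + r))..(r / (1 - r)), wDens y x * (1 - y ^ 2 / 4)⁻¹ =
      ∫ y in (r / (1 + r))..(r / (1 - r)), 1 / (1 - x * y) ^ 2 := by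
    refine intervalIntegral.integral_congr fun y hy => ?_
    have := (one_sub_sq_pos (hP y hy)).ne'
    have := (hpos y hy).ne'
    unfold wDens
    rw [div_mul_eq_mul_div, mul_inv_cancel₀ (one_sub_sq_pos (hP y hy)).ne']
  rw [hcong, intervalIntegral.integral_eq_sub_of_hasDerivAt hd]
  · have p1 : 0 < 1 - r := by linarith
    have a1 : r / (1 - r) / (1 - x * (r / (1 - r))) = r / (1 - r - x * r) := by
      rw [div_div]; congr 1; field_simp
    have a2 : r / (1 + r) / (1 - x * (r / (1 + r))) = r / (1 + r - x * r) := by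
      rw [div_div]; congr 1; field_simp
    have b1 : 0 < 1 - r - x * r := by nlinarith [hx.1, hx.2]
    have b2 : 0 < 1 + r - x * r := by nlinarith [hx.1, hx.2]
    rw [a1, a2, div_sub_div _ _ b1.ne' b2.ne', div_eq_div_iff (by positivity)]
    · ring
    · have : (r * x - (1 - r)) * (r * x - (1 + r)) = (1 - r - x * r) * (1 + r - x * r) := by ring
      rw [this]; positivity
  · refine ContinuousOn.intervalIntegrable (ContinuousOn.div continuousOn_const (by fun_prop) ?_)
    exact fun y hy => (pow_pos (hpos y hy) 2).ne'

theorem fieldOfDensity_invDensity {r : ℝ} (h0 : 0 < r) (h1 : r ≤ 1 / 2) :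
    fieldOfDensity (invDensity r) = ∫ y, fld y ∂invRepr r := by
  have := isProbabilityMeasure_invRepr h0 h1
  rw [← integral_id_mix, mix_eq_withDensity, map_invRepr h0 h1]
  have e : leb.withDensity (fun x => ENNReal.ofReal (mixDensity (reprMeasure r) x)) =
      leb.withDensity (fun x => ENNReal.ofReal (invDensity r x)) := by
    congr 1; funext x; rw [mixDensity_reprMeasure h0 h1 x.2]
  have hm : Measurable fun x : Site => ENNReal.ofReal (invDensity r x) := by
    unfold invDensity; simp only [if_neg h0.ne']; fun_prop
  rw [e, integral_withDensity_eq_integral_toReal_smul hm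
    (ae_of_all _ fun x => ENNReal.ofReal_lt_top)]
  unfold fieldOfDensity
  rw [← integral_leb (fun x => x * invDensity r x)]
  refine integral_congr_ae (ae_of_all _ fun x => ?_)
  have hn : 0 ≤ invDensity r x := by
    rw [← mixDensity_reprMeasure h0 h1 x.2]
    unfold mixDensity
    rw [← integral_invRepr h0 h1 (fun y => wDens y x)]
    exact integral_nonneg fun y => wDens_nonneg y.2
  simp only [smul_eq_mul]
  rw [ENNReal.toReal_ofReal hn, mul_comm]

theorem abs_wDens_sub_le {x y y' : ℝ} (hx : x ∈ Site) (hy : y ∈ Par) (hy' : y' ∈ Par) :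
    |wDens y x - wDens y' x| ≤ 36 * |y - y'| := by
  have h1 := one_sub_mul_pos hx hy
  have h2 := one_sub_mul_pos hx hy'
  have ax : |x| ≤ 1 / 2 := abs_le.2 ⟨by linarith [hx.1], hx.2⟩
  have ay : |y| ≤ 1 := abs_le.2 hy
  have ay' : |y'| ≤ 1 := abs_le.2 hy'
  unfold wDens
  rw [div_sub_div _ _ (by positivity) (by positivity), abs_div]
  have e : (1 - y ^ 2 / 4) * (1 - x * y') ^ 2 - (1 - x * y) ^ 2 * (1 - y' ^ 2 / 4) =
      (y' - y) * (-2 * x + x ^ 2 * (y + y') + (y + y') / 4 - x / 2 * (y * y')) := by ring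
  have hden : 1 / 16 ≤ (1 - x * y) ^ 2 * (1 - x * y') ^ 2 := by
    have a : 1 / 4 ≤ (1 - x * y) ^ 2 := by nlinarith
    have b : 1 / 4 ≤ (1 - x * y') ^ 2 := by nlinarith
    nlinarith
  have hb : |-2 * x + x ^ 2 * (y + y') + (y + y') / 4 - x / 2 * (y * y')| ≤ 9 / 4 := by
    have q1 : |x ^ 2 * (y + y')| ≤ 1 / 2 := by
      rw [abs_mul, abs_pow]
      have : |y + y'| ≤ 2 := (abs_add_le _ _).trans (by linarith)
      nlinarith [abs_nonneg x, abs_nonneg (y + y')]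
    have q2 : |x / 2 * (y * y')| ≤ 1 / 4 := by
      rw [abs_mul, abs_mul, abs_div, abs_two]
      have : |y| * |y'| ≤ 1 := by nlinarith [abs_nonneg y, abs_nonneg y']
      nlinarith [abs_nonneg x, mul_nonneg (abs_nonneg y) (abs_nonneg y')]
    rw [abs_le] at *
    constructor <;> linarith [hy.1, hy.2, hy'.1, hy'.2]
  rw [e, abs_mul, abs_of_pos (by linarith : 0 < (1 - x * y) ^ 2 * (1 - x * y') ^ 2),
    div_le_iff₀ (by linarith), abs_sub_comm y' y]
  nlinarith [abs_nonneg (y - y'), mul_nonneg (abs_nonneg (y - y')) (sub_nonneg.2 hb),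
    mul_nonneg (abs_nonneg (y - y')) (sub_nonneg.2 hden)]

theorem measurable_wDens_right (y : ℝ) : Measurable (wDens y) :=
  measurable_wDens.comp (measurable_const.prodMk measurable_id)

theorem integral_wLaw' {y : ℝ} (hy : y ∈ Par) (g : Site → ℝ) :
    ∫ x, g x ∂wLaw y = ∫ x, wDens y x * g x ∂leb := by
  have hm : Measurable fun x : Site => wDens y x :=
    (measurable_wDens_right y).comp measurable_subtype_coe
  unfold wLaw
  rw [integral_withDensity_eq_integral_toReal_smul hm.ennreal_ofReal
    (ae_of_all _ fun x => ENNReal.ofReal_lt_top)]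
  simp only [ENNReal.toReal_ofReal (wDens_nonneg hy), smul_eq_mul]

theorem abs_integral_wLaw_sub_le {y y' : ℝ} (hy : y ∈ Par) (hy' : y' ∈ Par) {g : Site → ℝ} {C : ℝ}
    (hg : Measurable g) (hC : ∀ x, |g x| ≤ C) :
    |∫ x, g x ∂wLaw y - ∫ x, g x ∂wLaw y'| ≤ 36 * C * |y - y'| := by
  have hi : ∀ z ∈ Par, Integrable (fun x : Site => wDens z x * g x) leb := fun z hz => by
    refine Integrable.of_bound (((measurable_wDens_right z).comp
      measurable_subtype_coe).mul hg).aestronglyMeasurable (4 * C) (ae_of_all _ fun x => ?_)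
    rw [norm_mul, Real.norm_eq_abs, Real.norm_eq_abs, abs_of_nonneg (wDens_nonneg hz)]
    exact mul_le_mul (wDens_le x.2 hz) (hC x) (abs_nonneg _) (by norm_num)
  rw [integral_wLaw' hy, integral_wLaw' hy', ← integral_sub (hi y hy) (hi y' hy')]
  have h := norm_integral_le_of_norm_le_const (μ := leb) (C := 36 * C * |y - y'|)
    (f := fun x : Site => wDens y x * g x - wDens y' x * g x) (ae_of_all _ fun x => by
      rw [← sub_mul, norm_mul, Real.norm_eq_abs, Real.norm_eq_abs]
      calc _ ≤ 36 * |y - y'| * C := mul_le_mul (abs_wDens_sub_le x.2 hy hy') (hC x) (abs_nonneg _)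
            (by positivity)
        _ = _ := by ring)
  simpa using h

/-! ### Lifting to probability measures -/

/-- The mixture as a probability measure on `X`. -/
noncomputable def mixP (μ : ProbabilityMeasure Par) : ProbabilityMeasure Site :=
  ⟨mix μ, inferInstance⟩

theorem continuous_integral_wLaw {g : Site → ℝ} (hg : Continuous g) :
    Continuous fun y : Par => ∫ x, g x ∂wLaw y := by
  obtain ⟨C, hC⟩ := (isCompact_range hg).isBounded.exists_norm_le
  have hC' : ∀ x, |g x| ≤ C := fun x => hC _ (mem_range_self x)
  have hC0 : 0 ≤ C := (abs_nonneg _).trans (hC' ⟨0, by norm_num⟩)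
  refine LipschitzWith.continuous (K := ⟨36 * C, by positivity⟩)
    (LipschitzWith.of_dist_le_mul fun y y' => ?_)
  rw [Real.dist_eq, Subtype.dist_eq, Real.dist_eq]
  exact abs_integral_wLaw_sub_le y.2 y'.2 hg.measurable hC'

theorem continuous_integral_pm {α : Type*} [TopologicalSpace α] [CompactSpace α]
    [MeasurableSpace α] [OpensMeasurableSpace α] {f : α → ℝ} (hf : Continuous f) :
    Continuous fun μ : ProbabilityMeasure α => ∫ y, f y ∂(μ : Measure α) :=
  ProbabilityMeasure.continuous_integral_boundedContinuousFunction
    (BoundedContinuousFunction.mkOfCompact ⟨f, hf⟩)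

theorem continuous_mixP : Continuous mixP := by
  rw [continuous_iff_continuousAt]
  intro μ
  rw [ContinuousAt, ProbabilityMeasure.tendsto_iff_forall_integral_tendsto]
  intro g
  have e : ∀ μ : ProbabilityMeasure Par, ∫ x, g x ∂(mixP μ : Measure Site) =
      ∫ y, ∫ x, g x ∂wLaw y ∂(μ : Measure Par) := fun μ => integral_mix g.continuous
  simp only [e]
  exact (continuous_integral_pm (continuous_integral_wLaw g.continuous)).tendsto μ

theorem field_mixP (μ : ProbabilityMeasure Par) :
    field (mixP μ) = ∫ y, fld y ∂(μ : Measure Par) := integral_id_mix _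

/-- Reflection of the parameter interval. -/
def negPar (y : Par) : Par := ⟨-y, by linarith [y.2.2], by linarith [y.2.1]⟩

theorem coe_negPar (y : Par) : (negPar y : ℝ) = -y := rfl

theorem continuous_negPar : Continuous negPar :=
  Continuous.subtype_mk continuous_subtype_val.neg _

/-- The identity or the reflection of representing measures. -/
noncomputable def sgMap (s : Bool) : Par → Par := if s then id else negPar

theorem continuous_sgMap (s : Bool) : Continuous (sgMap s) := by
  cases s
  · exact continuous_negPar
  · exact continuous_id

/-- The sign belonging to `sgMap`. -/
noncomputable def sgn (s : Bool) : ℝ := if s then 1 else -1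

theorem coe_sgMap (s : Bool) (y : Par) : (sgMap s y : ℝ) = sgn s * y := by
  cases s <;> simp [sgMap, sgn, coe_negPar]

theorem abs_sgn_mul (s : Bool) (t : ℝ) : |sgn s * t| = |t| := by
  cases s <;> simp [sgn]

noncomputable def reflP (s : Bool) (μ : ProbabilityMeasure Par) : ProbabilityMeasure Par :=
  μ.map (continuous_sgMap s).measurable.aemeasurable

theorem coe_reflP (s : Bool) (μ : ProbabilityMeasure Par) :
    (reflP s μ : Measure Par) = (μ : Measure Par).map (sgMap s) := rfl

theorem continuous_reflP (s : Bool) : Continuous (reflP s) :=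
  ProbabilityMeasure.continuous_map (continuous_sgMap s)

theorem comb_neg (r y : ℝ) : comb (-r) (-y) = -comb r y := by
  unfold comb; rw [neg_mul_neg, ← neg_add, neg_div]

theorem lowImg_neg (q : ℝ) : lowImg (-q) = -highImg q := by
  unfold lowImg highImg; rw [← neg_div]; ring_nf

theorem highImg_neg (q : ℝ) : highImg (-q) = -lowImg q := by
  unfold lowImg highImg; rw [← neg_div]; ring_nf

theorem stepKer_sgMap {r : ℝ} (hr : |r| ≤ 1 / 2) (s : Bool) (y : Par) :
    stepKer (sgn s * r) (sgMap s y) = (stepKer r y).map (sgMap s) := by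
  have hm := (continuous_sgMap s).measurable
  rw [stepKer_apply, stepKer_apply, Measure.map_add _ _ hm, Measure.map_smul, Measure.map_smul,
    Measure.map_dirac' hm, Measure.map_dirac' hm, coe_sgMap]
  cases s
  · have hr' : |-r| ≤ 1 / 2 := by rwa [abs_neg]
    have e1 : lowPt (-r) (negPar y) = negPar (highPt r y) := by
      apply Subtype.ext
      rw [coe_lowPt hr', coe_negPar, coe_negPar, coe_highPt hr, comb_neg, lowImg_neg]
    have e2 : highPt (-r) (negPar y) = negPar (lowPt r y) := by
      apply Subtype.ext
      rw [coe_highPt hr', coe_negPar, coe_negPar, coe_lowPt hr, comb_neg, highImg_neg]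
    simp only [sgn, sgMap, Bool.false_eq_true, if_false, neg_one_mul, comb_neg, e1, e2]
    rw [add_comm]
    congr 2
    rw [sub_neg_eq_add]
  · simp [sgn, sgMap]

theorem bind_stepKer_reflP {r : ℝ} (hr : |r| ≤ 1 / 2) (s : Bool) (μ : Measure Par) :
    (μ.map (sgMap s)).bind (stepKer (sgn s * r)) = (μ.bind (stepKer r)).map (sgMap s) := by
  have hm := (continuous_sgMap s).measurable
  ext A hA
  rw [Measure.bind_apply hA (Kernel.aemeasurable _), Measure.map_apply hm hA,
    Measure.bind_apply (hm hA) (Kernel.aemeasurable _),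
    lintegral_map (Kernel.measurable_coe _ hA) hm]
  refine lintegral_congr fun y => ?_
  rw [stepKer_sgMap hr, Measure.map_apply hm hA]

/-- The properties of the feedback function that the infinite-size dynamics uses. -/
structure Nice (G : ℝ → ℝ) : Prop where
  cont : Continuous G
  mono : Monotone G
  odd : ∀ x, G (-x) = -G x
  bound : ∀ x, |G x| ≤ 1 / 2

/-- The field of a mixture in terms of the representing measure. -/
noncomputable def phi (μ : ProbabilityMeasure Par) : ℝ := ∫ y, fld y ∂(μ : Measure Par)

theorem phi_reflP (s : Bool) (μ : ProbabilityMeasure Par) : phi (reflP s μ) = sgn s * phi μ := by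
  unfold phi
  rw [coe_reflP, integral_map (continuous_sgMap s).measurable.aemeasurable
    fld_isTest.continuous.measurable.aestronglyMeasurable, ← integral_const_mul]
  refine integral_congr_ae (ae_of_all _ fun y => ?_)
  simp only [coe_sgMap]
  cases s <;> simp [sgn, fld_neg]

/-- `μ'` represents the image of the mixture `μ` under `T_r`. -/
def Steps (r : ℝ) (μ μ' : ProbabilityMeasure Par) : Prop :=
  (μ' : Measure Par) = (μ : Measure Par).bind (stepKer r)

theorem exists_steps {r : ℝ} (hr : |r| ≤ 1 / 2) (μ : ProbabilityMeasure Par) :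
    ∃ μ', Steps r μ μ' := by
  have := isMarkovKernel_stepKer hr
  exact ⟨⟨(μ : Measure Par).bind (stepKer r), inferInstance⟩, rfl⟩

theorem Steps.integral {r : ℝ} (hr : |r| ≤ 1 / 2) {μ μ' : ProbabilityMeasure Par}
    (h : Steps r μ μ') {f : Par → ℝ} (hf : Continuous f) :
    ∫ y, f y ∂(μ' : Measure Par) = ∫ y, dualOp r f y ∂(μ : Measure Par) := by
  rw [h, integral_bind_stepKer hr hf]

theorem noisyStep_mixP {G : ℝ → ℝ} (hG : Nice G) (s : Bool) (μ : ProbabilityMeasure Par) (t : ℝ) :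
    ∃ μ', Steps (G (phi μ + sgn s * t)) μ μ' ∧
      noisyStep G (mixP (reflP s μ)) t = mixP (reflP s μ') := by
  have hr := hG.bound (phi μ + sgn s * t)
  obtain ⟨μ', h⟩ := exists_steps hr μ
  refine ⟨μ', h, ?_⟩
  have e : G (field (mixP (reflP s μ)) + t) = sgn s * G (phi μ + sgn s * t) := by
    rw [field_mixP]
    change G (phi (reflP s μ) + t) = _
    rw [phi_reflP]
    cases s
    · simp only [sgn, Bool.false_eq_true, if_false, neg_one_mul]
      rw [← hG.odd]; congr 1; ring
    · simp [sgn]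
  apply Subtype.ext
  change (mix (reflP s μ : Measure Par)).map (siteMap (G (field (mixP (reflP s μ)) + t))) =
    mix (reflP s μ' : Measure Par)
  rw [e, map_mix (by rwa [abs_sgn_mul]), coe_reflP, coe_reflP, bind_stepKer_reflP hr, h]

/-- The mixtures whose representing measure, up to reflection, lies in `M`. -/
def repSet (M : Set (ProbabilityMeasure Par)) : Set (ProbabilityMeasure Site) :=
  (fun p : Bool × ProbabilityMeasure Par => mixP (reflP p.1 p.2)) '' {p | p.2 ∈ M}

theorem continuous_mixP_reflP :
    Continuous fun p : Bool × ProbabilityMeasure Par => mixP (reflP p.1 p.2) :=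
  continuous_mixP.comp (continuous_prod_of_discrete_left.2 continuous_reflP)

theorem isClosed_repSet {M : Set (ProbabilityMeasure Par)} (hM : IsClosed M) :
    IsClosed (repSet M) :=
  ((hM.preimage continuous_snd).isCompact.image continuous_mixP_reflP).isClosed

theorem mem_repSet_iInter {M : ℕ → Set (ProbabilityMeasure Par)} (hM : ∀ n, IsClosed (M n))
    (hanti : Antitone M) {ν : ProbabilityMeasure Site} (h : ∀ n, ν ∈ repSet (M n)) :
    ν ∈ repSet (⋂ n, M n) := by
  have hcl : ∀ n, IsClosed {p : Bool × ProbabilityMeasure Par |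
      p.2 ∈ M n ∧ mixP (reflP p.1 p.2) = ν} := fun n =>
    ((hM n).preimage continuous_snd).inter (isClosed_eq continuous_mixP_reflP continuous_const)
  obtain ⟨p, hp⟩ := IsCompact.nonempty_iInter_of_sequence_nonempty_isCompact_isClosed
    (fun n => {p : Bool × ProbabilityMeasure Par | p.2 ∈ M n ∧ mixP (reflP p.1 p.2) = ν})
    (fun n p hp => ⟨hanti (Nat.le_succ n) hp.1, hp.2⟩)
    (fun n => by obtain ⟨p, h1, h2⟩ := h n; exact ⟨p, h1, h2⟩) (hcl 0).isCompact hcl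
  rw [mem_iInter] at hp
  exact ⟨p, mem_iInter.2 fun n => (hp n).1, (hp 0).2⟩

/-! ### Stationary measures -/

theorem IsStationary.ae_mem_of_step {S : Type*} [MeasurableSpace S] {Φ : S → ℝ → S} {ϱ : Measure ℝ}
    {m : Measure S} (hm : IsStationary Φ ϱ m) {I : Set ℝ} (hI : ϱ Iᶜ = 0) {C B : Set S}
    (hC : ∀ᵐ s ∂m, s ∈ C) (hB : MeasurableSet B) (h : ∀ s ∈ C, ∀ t ∈ I, Φ s t ∈ B) :
    ∀ᵐ s ∂m, s ∈ B := by
  change m Bᶜ = 0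
  rw [hm _ hB.compl]
  rw [lintegral_eq_zero_of_ae_eq_zero]
  filter_upwards [hC] with s hs
  refine measure_mono_null ?_ hI
  intro t ht hti
  exact ht (h s hs t hti)

/-- If `C` is absorbing and is reached with positive probability from `E`, up to null sets, then
`E` is contained in `C` up to a null set. -/
theorem IsStationary.null_of_reach {S : Type*} [MeasurableSpace S] {Φ : S → ℝ → S} {ϱ : Measure ℝ}
    [IsProbabilityMeasure ϱ] {m : Measure S} [IsProbabilityMeasure m] (hm : IsStationary Φ ϱ m)
    (hΦ : ∀ A, MeasurableSet A → Measurable fun s => ϱ {t | Φ s t ∈ A}) {I J : Set ℝ} (hI : ϱ Iᶜ = 0) (hJ : ϱ J ≠ 0) {C C' E : Set S} (hC : MeasurableSet C)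
    (habs : ∀ s ∈ C, ∀ t ∈ I, Φ s t ∈ C) (hC' : m (C' \ C) = 0)
    (hE : ∀ s ∈ E, ∀ t ∈ J, Φ s t ∈ C') : m (E \ C) = 0 := by
  set Z := C ∪ toMeasurable m (C' \ C) with hZ
  have hZm : MeasurableSet Z := hC.union (measurableSet_toMeasurable _ _)
  have hC'Z : C' ⊆ Z := fun s hs => by
    by_cases h : s ∈ C
    · exact Or.inl h
    · exact Or.inr (subset_toMeasurable _ _ ⟨hs, h⟩)
  have hmZ : m Z = m C := by
    refine le_antisymm ?_ (measure_mono subset_union_left)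
    refine (measure_union_le _ _).trans ?_
    rw [measure_toMeasurable, hC', add_zero]
  have h1 : m C ≤ ∫⁻ s in C, ϱ {t | Φ s t ∈ Z} ∂m := by
    calc m C = ∫⁻ _ in C, 1 ∂m := by simp
      _ ≤ _ := by
        refine setLIntegral_mono' hC fun s hs => ?_
        have : ϱ I ≤ ϱ {t | Φ s t ∈ Z} := measure_mono fun t ht => Or.inl (habs s hs t ht)
        refine le_trans ?_ this
        have h2 := measure_univ_le_add_compl (μ := ϱ) I
        rwa [hI, add_zero, measure_univ] at h2
  have h2 : ∫⁻ s in C, ϱ {t | Φ s t ∈ Z} ∂m + ∫⁻ s in Cᶜ, ϱ {t | Φ s t ∈ Z} ∂m = m C := by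
    rw [lintegral_add_compl _ hC, ← hm _ hZm, hmZ]
  have h3 : ∫⁻ s in Cᶜ, ϱ {t | Φ s t ∈ Z} ∂m = 0 := by
    have hfin : m C ≠ ⊤ := measure_ne_top _ _
    have h4 : m C + ∫⁻ s in Cᶜ, ϱ {t | Φ s t ∈ Z} ∂m ≤ m C + 0 := by
      rw [add_zero]; exact (add_le_add_left h1 _).trans h2.le
    exact le_antisymm ((ENNReal.add_le_add_iff_left hfin).1 h4) bot_le
  by_contra hne
  have h5 : ϱ J * m (E \ C) ≤ ∫⁻ s in Cᶜ, ϱ {t | Φ s t ∈ Z} ∂m := by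
    calc ϱ J * m (E \ C) = ϱ J * (m.restrict Cᶜ) E := by
          rw [Measure.restrict_apply' hC.compl, sdiff_eq]
      _ ≤ ϱ J * (m.restrict Cᶜ) {s | ϱ J ≤ ϱ {t | Φ s t ∈ Z}} := by
          gcongr
          intro s hs
          exact measure_mono fun t ht => hC'Z (hE s hs t ht)
      _ ≤ _ := mul_meas_ge_le_lintegral (hΦ Z hZm) _
  rw [h3] at h5
  exact mul_ne_zero hJ hne (le_antisymm h5 bot_le)

/-! ### Measurability of the infinite-size system -/

theorem measurable_siteMap_uncurry : Measurable fun p : ℝ × Site => siteMap p.1 p.2 := by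
  have h : Measurable fun p : ℝ × ℝ => siteFun p.1 p.2 := by
    unfold siteFun fracMap
    exact Measurable.ite (measurableSet_le measurable_snd (by fun_prop)) (by fun_prop)
      (by fun_prop)
  exact continuous_projIcc.measurable.comp
    (h.comp (measurable_fst.prodMk (measurable_subtype_coe.comp measurable_snd)))

theorem continuous_field : Continuous field := continuous_integral_pm continuous_subtype_val

theorem measurable_noisyStep {G : ℝ → ℝ} (hG : Measurable G) :
    Measurable fun p : ProbabilityMeasure Site × ℝ => noisyStep G p.1 p.2 := by
  refine Measurable.subtype_mk (Measure.measurable_of_measurable_coe _ fun A hA => ?_)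
  let κ : Kernel (ProbabilityMeasure Site × ℝ) Site :=
    ⟨fun p => (p.1 : Measure Site), measurable_subtype_coe.comp measurable_fst⟩
  have : IsMarkovKernel κ := ⟨fun p => by
    change IsProbabilityMeasure (p.1 : Measure Site); infer_instance⟩
  have hm : MeasurableSet {p : (ProbabilityMeasure Site × ℝ) × Site |
      siteMap (G (field p.1.1 + p.1.2)) p.2 ∈ A} := by
    refine measurable_siteMap_uncurry.comp (Measurable.prodMk ?_ measurable_snd) hA
    exact hG.comp (((continuous_field.measurable.comp measurable_fst).add measurable_snd).comp
      measurable_fst)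
  have h := Kernel.measurable_kernel_prodMk_left (κ := κ) hm
  have e : (fun p : ProbabilityMeasure Site × ℝ => (noisyStep G p.1 p.2 : Measure Site) A) =
      fun p => κ p (Prod.mk p ⁻¹' {p : (ProbabilityMeasure Site × ℝ) × Site |
        siteMap (G (field p.1.1 + p.1.2)) p.2 ∈ A}) := by
    funext p
    change (Measure.map (siteMap (G (field p.1 + p.2))) (p.1 : Measure Site)) A = _
    rw [Measure.map_apply (measurable_siteMap _) hA]
    rfl
  exact e ▸ h

theorem measurable_noisyStep_prob {G : ℝ → ℝ} (hG : Measurable G) (ϱ : Measure ℝ) [SFinite ϱ]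
    (A : Set (ProbabilityMeasure Site)) (hA : MeasurableSet A) :
    Measurable fun ν => ϱ {t | noisyStep G ν t ∈ A} :=
  measurable_measure_prodMk_left (measurable_noisyStep hG hA)

/-! ### Order intervals of representing measures -/

theorem IsTest.integral_sub_le {f : Par → ℝ} (hf : IsTest f) (μ ν : Measure Par)
    [IsProbabilityMeasure μ] [IsProbabilityMeasure ν] : ∫ y, f y ∂μ - ∫ y, f y ∂ν ≤ 2 := by
  set z : Par := ⟨-1, by norm_num⟩ with hz
  have hmin : ∀ y, f z ≤ f y := fun y => (hf z y y.2.1).1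
  have hmax : ∀ y, f y ≤ f z + 2 := fun y => by
    have h1 := (hf z y y.2.1).2
    have h2 : (z : ℝ) = -1 := rfl
    linarith [y.2.2]
  have hi : ∀ (κ : Measure Par) [IsProbabilityMeasure κ], Integrable f κ := fun κ _ =>
    integrable_of_continuous hf.continuous κ
  have h1 : ∫ y, f y ∂μ ≤ f z + 2 := by
    simpa using integral_mono (hi μ) (integrable_const (f z + 2)) hmax
  have h2 : f z ≤ ∫ y, f y ∂ν := by
    simpa using integral_mono (integrable_const (f z)) (hi ν) hmin
  linarith

theorem integral_dualOp_le {r r' : ℝ} (hr : |r| ≤ 1 / 2) (hr' : |r'| ≤ 1 / 2) (h : r ≤ r')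
    {f : Par → ℝ} (hf : IsTest f) (μ : Measure Par) [IsProbabilityMeasure μ] :
    ∫ y, dualOp r f y ∂μ ≤ ∫ y, dualOp r' f y ∂μ ∧
      ∫ y, dualOp r' f y ∂μ ≤ ∫ y, dualOp r f y ∂μ + 9 / 10 * (r' - r) := by
  have hc : ∀ s, |s| ≤ 1 / 2 → Integrable (dualOp s f) μ := fun s hs => by
    have h1 := integrable_of_continuous (dualOp_isTest hs hf).continuous μ
    have e : dualOp s f = fun y => 9 / 10 * (10 / 9 * dualOp s f y) := by funext y; ring
    rw [e]
    exact h1.const_mul (9 / 10)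
  constructor
  · exact integral_mono (hc r hr) (hc r' hr') fun y => (dualOp_sub_le hr hr' h hf y).1
  · have := integral_mono (hc r' hr') ((hc r hr).add (integrable_const (9 / 10 * (r' - r))))
      fun y => by
        have := (dualOp_sub_le hr hr' h hf y).2
        simp only [Pi.add_apply]; linarith
    simpa [integral_add (hc r hr) (integrable_const _)] using this

theorem integral_dualOp_eq {r : ℝ} (f : Par → ℝ) (μ : Measure Par) :
    ∫ y, dualOp r f y ∂μ = 9 / 10 * ∫ y, 10 / 9 * dualOp r f y ∂μ := by
  rw [← integral_const_mul]; congr 1; funext y; ring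

theorem abs_le_of_mem {r : ℝ} (h0 : 0 < r) (h1 : r ≤ 1 / 2) : |r| ≤ 1 / 2 :=
  abs_le.2 ⟨by linarith, h1⟩

theorem invRepr_mono {R S : ℝ} (hR : 0 < R) (hRS : R ≤ S) (hS : S ≤ 1 / 2) {f : Par → ℝ}
    (hf : IsTest f) : ∫ y, f y ∂invRepr R ≤ ∫ y, f y ∂invRepr S ∧
      ∫ y, f y ∂invRepr S ≤ ∫ y, f y ∂invRepr R + 9 * (S - R) := by
  have := isProbabilityMeasure_invRepr hR (hRS.trans hS)
  have := isProbabilityMeasure_invRepr (hR.trans_le hRS) hS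
  have hr := abs_le_of_mem hR (hRS.trans hS)
  have hs := abs_le_of_mem (hR.trans_le hRS) hS
  have key : ∀ n : ℕ, ∀ f : Par → ℝ, IsTest f →
      ∫ y, f y ∂invRepr R ≤ ∫ y, f y ∂invRepr S + 2 * (9 / 10 : ℝ) ^ n ∧
      ∫ y, f y ∂invRepr S ≤ ∫ y, f y ∂invRepr R + 9 * (S - R) + 2 * (9 / 10 : ℝ) ^ n := by
    intro n
    induction n with
    | zero =>
      intro f hf
      have h1 := hf.integral_sub_le (invRepr R) (invRepr S)
      have h2 := hf.integral_sub_le (invRepr S) (invRepr R)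
      constructor <;> simp only [pow_zero] <;> linarith
    | succ n ih =>
      intro f hf
      obtain ⟨h1, h2⟩ := ih _ (dualOp_isTest hr hf)
      obtain ⟨h3, h4⟩ := integral_dualOp_le hr hs hRS hf (invRepr S)
      have e1 := integral_dualOp_invRepr hR (hRS.trans hS) hf.continuous
      have e2 := integral_dualOp_invRepr (hR.trans_le hRS) hS hf.continuous
      have e3 := integral_dualOp_eq (r := R) f (invRepr R)
      have e4 := integral_dualOp_eq (r := R) f (invRepr S)
      rw [pow_succ]
      constructor <;> linarith
  have hlim : Tendsto (fun n : ℕ => 2 * (9 / 10 : ℝ) ^ n) atTop (𝓝 0) := by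
    simpa using (tendsto_pow_atTop_nhds_zero_of_lt_one (by norm_num : (0 : ℝ) ≤ 9 / 10)
      (by norm_num)).const_mul 2
  constructor
  · have := hlim.const_add (∫ y, f y ∂invRepr S)
    rw [add_zero] at this
    exact ge_of_tendsto' this fun n => (key n f hf).1
  · have := hlim.const_add (∫ y, f y ∂invRepr R + 9 * (S - R))
    rw [add_zero] at this
    exact ge_of_tendsto' this fun n => (key n f hf).2

/-- The representing measures between `μ_R` and `μ_S`, up to an error `κ`. -/
def between (R S κ : ℝ) : Set (ProbabilityMeasure Par) :=
  {μ | ∀ f : Par → ℝ, IsTest f → ∫ y, f y ∂invRepr R - κ ≤ ∫ y, f y ∂(μ : Measure Par) ∧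
    ∫ y, f y ∂(μ : Measure Par) ≤ ∫ y, f y ∂invRepr S + κ}

theorem isClosed_between (R S κ : ℝ) : IsClosed (between R S κ) := by
  simp only [between, Set.ofPred_forall]
  refine isClosed_iInter fun f => isClosed_iInter fun hf => ?_
  have hc := continuous_integral_pm hf.continuous
  exact (isClosed_le continuous_const hc).inter (isClosed_le hc continuous_const)

theorem between_step {R S κ r : ℝ} (hR : 0 < R) (hRS : R ≤ S) (hS : S ≤ 1 / 2) (hRr : R ≤ r)
    (hrS : r ≤ S) {μ μ' : ProbabilityMeasure Par} (h : μ ∈ between R S κ) (hs : Steps r μ μ') :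
    μ' ∈ between R S (9 / 10 * κ) := by
  intro f hf
  have hR' := abs_le_of_mem hR (hRS.trans hS)
  have hS' := abs_le_of_mem (hR.trans_le hRS) hS
  have hr' := abs_le_of_mem (hR.trans_le hRr) (hrS.trans hS)
  rw [hs.integral hr' hf.continuous]
  have a1 := (integral_dualOp_le hR' hr' hRr hf (μ : Measure Par)).1
  have a2 := (integral_dualOp_le hr' hS' hrS hf (μ : Measure Par)).1
  have b1 := (h _ (dualOp_isTest hR' hf)).1
  have b2 := (h _ (dualOp_isTest hS' hf)).2
  have e1 := integral_dualOp_invRepr hR (hRS.trans hS) hf.continuous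
  have e2 := integral_dualOp_invRepr (hR.trans_le hRS) hS hf.continuous
  have e3 := integral_dualOp_eq (r := R) f (invRepr R)
  have e4 := integral_dualOp_eq (r := R) f (μ : Measure Par)
  have e5 := integral_dualOp_eq (r := S) f (invRepr S)
  have e6 := integral_dualOp_eq (r := S) f (μ : Measure Par)
  constructor <;> linarith

/-- The setting of a stationary measure of the infinite-size system. -/
structure StatSetting (G : ℝ → ℝ) (ϱ : Measure ℝ) (ε : ℝ)
    (Q : Measure (ProbabilityMeasure Site)) : Prop where
  nice : Nice G
  probNoise : IsProbabilityMeasure ϱ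
  prob : IsProbabilityMeasure Q
  bounded : ϱ (Icc (-ε) ε)ᶜ = 0
  stat : IsStationary (noisyStep G) ϱ Q

theorem sgn_mul_mem {ε t : ℝ} (s : Bool) (ht : t ∈ Icc (-ε) ε) : sgn s * t ∈ Icc (-ε) ε := by
  rw [mem_Icc, ← abs_le] at ht ⊢
  rwa [abs_sgn_mul]

theorem StatSetting.ae_repSet_step {G : ℝ → ℝ} {ϱ : Measure ℝ} {ε : ℝ}
    {Q : Measure (ProbabilityMeasure Site)} (h : StatSetting G ϱ ε Q)
    {M M' : Set (ProbabilityMeasure Par)} (hM' : IsClosed M') (hQ : ∀ᵐ ν ∂Q, ν ∈ repSet M)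
    (hstep : ∀ μ ∈ M, ∀ t ∈ Icc (-ε) ε, ∀ μ', Steps (G (phi μ + t)) μ μ' → μ' ∈ M') :
    ∀ᵐ ν ∂Q, ν ∈ repSet M' := by
  refine h.stat.ae_mem_of_step h.bounded hQ (isClosed_repSet hM').measurableSet ?_
  rintro _ ⟨⟨s, μ⟩, hμ, rfl⟩ t ht
  obtain ⟨μ', h1, h2⟩ := noisyStep_mixP h.nice s μ t
  exact ⟨(s, μ'), hstep μ hμ _ (sgn_mul_mem s ht) μ' h1, h2.symm⟩

theorem StatSetting.ae_between {G : ℝ → ℝ} {ϱ : Measure ℝ} {ε : ℝ}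
    {Q : Measure (ProbabilityMeasure Site)} (h : StatSetting G ϱ ε Q)
    {M : Set (ProbabilityMeasure Par)} (hM : IsClosed M) (hQ : ∀ᵐ ν ∂Q, ν ∈ repSet M)
    (habs : ∀ μ ∈ M, ∀ t ∈ Icc (-ε) ε, ∀ μ', Steps (G (phi μ + t)) μ μ' → μ' ∈ M)
    {R S : ℝ} (hR : 0 < R) (hRS : R ≤ S) (hS : S ≤ 1 / 2)
    (hr : ∀ μ ∈ M, ∀ t ∈ Icc (-ε) ε, G (phi μ + t) ∈ Icc R S) :
    ∀ᵐ ν ∂Q, ν ∈ repSet (M ∩ between R S 0) := by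
  have key : ∀ n : ℕ, ∀ᵐ ν ∂Q, ν ∈ repSet (M ∩ between R S (2 * (9 / 10 : ℝ) ^ n)) := by
    intro n
    induction n with
    | zero =>
      have : M ∩ between R S (2 * (9 / 10 : ℝ) ^ 0) = M := by
        refine inter_eq_left.2 fun μ _ f hf => ?_
        have := isProbabilityMeasure_invRepr hR (hRS.trans hS)
        have := isProbabilityMeasure_invRepr (hR.trans_le hRS) hS
        have h1 := hf.integral_sub_le (invRepr R) (μ : Measure Par)
        have h2 := hf.integral_sub_le (μ : Measure Par) (invRepr S)
        constructor <;> simp only [pow_zero] <;> linarith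
      rw [this]; exact hQ
    | succ n ih =>
      refine h.ae_repSet_step (hM.inter (isClosed_between _ _ _)) ih ?_
      rintro μ ⟨hμ, hμb⟩ t ht μ' hs
      refine ⟨habs μ hμ t ht μ' hs, ?_⟩
      have := between_step hR hRS hS (hr μ hμ t ht).1 (hr μ hμ t ht).2 hμb hs
      rwa [show 9 / 10 * (2 * (9 / 10 : ℝ) ^ n) = 2 * (9 / 10 : ℝ) ^ (n + 1) by ring] at this
  filter_upwards [ae_all_iff.2 key] with ν hν
  have hanti : Antitone fun n : ℕ => M ∩ between R S (2 * (9 / 10 : ℝ) ^ n) := by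
    intro m n hmn μ hμ
    refine ⟨hμ.1, fun f hf => ?_⟩
    have h1 := hμ.2 f hf
    have h2 : (9 / 10 : ℝ) ^ n ≤ (9 / 10 : ℝ) ^ m :=
      pow_le_pow_of_le_one (by norm_num) (by norm_num) hmn
    constructor <;> linarith [h1.1, h1.2]
  obtain ⟨p, hp, hpν⟩ := mem_repSet_iInter
    (fun n => hM.inter (isClosed_between R S (2 * (9 / 10 : ℝ) ^ n))) hanti hν
  refine ⟨p, ⟨(mem_iInter.1 hp 0).1, fun f hf => ?_⟩, hpν⟩
  have hp' := fun n => ((mem_iInter.1 hp n).2 f hf)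
  have hlim : Tendsto (fun n : ℕ => 2 * (9 / 10 : ℝ) ^ n) atTop (𝓝 0) := by
    simpa using (tendsto_pow_atTop_nhds_zero_of_lt_one (by norm_num : (0 : ℝ) ≤ 9 / 10)
      (by norm_num)).const_mul 2
  exact ⟨le_of_tendsto' (hlim.const_sub _) fun n => (hp' n).1,
    ge_of_tendsto' (hlim.const_add _) fun n => (hp' n).2⟩

/-- The field of `u_R`. -/
noncomputable def phiInv (R : ℝ) : ℝ := ∫ y, fld y ∂invRepr R

theorem phi_mem_of_between {R S : ℝ} {μ : ProbabilityMeasure Par} (h : μ ∈ between R S 0) :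
    phiInv R ≤ phi μ ∧ phi μ ≤ phiInv S := by
  have := h _ fld_isTest
  rw [sub_zero, add_zero] at this
  exact this

/-- Narrowing an invariant order interval by the noisy one-dimensional map. -/
theorem StatSetting.narrow {G : ℝ → ℝ} {ϱ : Measure ℝ} {ε : ℝ}
    {Q : Measure (ProbabilityMeasure Site)} (h : StatSetting G ϱ ε Q)
    {M : Set (ProbabilityMeasure Par)} (hM : IsClosed M)
    (habs : ∀ μ ∈ M, ∀ t ∈ Icc (-ε) ε, ∀ μ', Steps (G (phi μ + t)) μ μ' → μ' ∈ M)
    {R S R' S' : ℝ}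
    (hR : 0 < R) (hRR : R ≤ R') (hRS : R' ≤ S') (hSS : S' ≤ S) (hS : S ≤ 1 / 2)
    (h1 : R' ≤ G (phiInv R - ε)) (h2 : G (phiInv S + ε) ≤ S')
    (hQ : ∀ᵐ ν ∂Q, ν ∈ repSet (M ∩ between R S 0)) :
    ∀ᵐ ν ∂Q, ν ∈ repSet (M ∩ between R' S' 0) := by
  have hr : ∀ μ ∈ M ∩ between R S 0, ∀ t ∈ Icc (-ε) ε, G (phi μ + t) ∈ Icc R' S' := by
    rintro μ ⟨-, hμ⟩ t ht
    obtain ⟨a, b⟩ := phi_mem_of_between hμ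
    exact ⟨h1.trans (h.nice.mono (by linarith [ht.1])),
      (h.nice.mono (by linarith [ht.2])).trans h2⟩
  refine (h.ae_between (hM.inter (isClosed_between _ _ _)) hQ ?_ (hR.trans_le hRR) hRS
    (hSS.trans hS) hr).mono fun ν => ?_
  · rintro μ hμ t ht μ' hs
    refine ⟨habs μ hμ.1 t ht μ' hs, ?_⟩
    have := between_step hR (hRR.trans (hRS.trans hSS)) hS (hRR.trans (hr μ hμ t ht).1)
      ((hr μ hμ t ht).2.trans hSS) hμ.2 hs
    rwa [mul_zero] at this
  · rintro ⟨p, hp, rfl⟩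
    exact ⟨p, ⟨hp.1.1, hp.2⟩, rfl⟩

/-! ### Entering the absorbing set -/

/-- The lower end of the image under the step with parameter `r` of an interval `[y, _]`. -/
noncomputable def lowEnd (r y : ℝ) : ℝ := lowImg (comb r y)

/-- The upper end of the image under the step with parameter `r` of an interval `[_, y]`. -/
noncomputable def highEnd (r y : ℝ) : ℝ := highImg (comb r y)

theorem lowEnd_mem {r y : ℝ} (hr : |r| ≤ 1 / 2) (hy : y ∈ Par) : lowEnd r y ∈ Par :=
  lowImg_mem (abs_comb_le hr hy)

theorem highEnd_mem {r y : ℝ} (hr : |r| ≤ 1 / 2) (hy : y ∈ Par) : highEnd r y ∈ Par :=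
  highImg_mem (abs_comb_le hr hy)

theorem lowEnd_den_pos {r y : ℝ} (hr : |r| ≤ 1 / 2) (hy : y ∈ Par) : 3 ≤ 4 + r * y + (r + y) := by
  nlinarith [mul_nonneg (by linarith [(abs_le.1 hr).1] : 0 ≤ 1 + r) (by linarith [hy.1] : 0 ≤ 1 + y)]

theorem highEnd_den_pos {r y : ℝ} (hr : |r| ≤ 1 / 2) (hy : y ∈ Par) :
    3 ≤ 4 + r * y - (r + y) := by
  nlinarith [mul_nonneg (by linarith [(abs_le.1 hr).2] : 0 ≤ 1 - r) (by linarith [hy.2] : 0 ≤ 1 - y)]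

theorem lowEnd_eq {r y : ℝ} (hr : |r| ≤ 1 / 2) (hy : y ∈ Par) :
    lowEnd r y = 2 * (r + y) / (4 + r * y + (r + y)) := by
  rw [eq_div_iff (by linarith [lowEnd_den_pos hr hy])]; exact lowImg_mul hr hy

theorem highEnd_eq {r y : ℝ} (hr : |r| ≤ 1 / 2) (hy : y ∈ Par) :
    highEnd r y = 2 * (r + y) / (4 + r * y - (r + y)) := by
  rw [eq_div_iff (by linarith [highEnd_den_pos hr hy])]; exact highImg_mul hr hy

theorem comb_mono_right {r y y' : ℝ} (hr : |r| ≤ 1 / 2) (hy : y ∈ Par) (hy' : y' ∈ Par)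
    (h : y ≤ y') : comb r y ≤ comb r y' :=
  comb_le_comb (by linarith) (abs_le.2 hy) (abs_le.2 hy') h

theorem comb_mono_left {r r' y : ℝ} (hr : |r| ≤ 1 / 2) (hr' : |r'| ≤ 1 / 2) (hy : y ∈ Par)
    (h : r ≤ r') : comb r y ≤ comb r' y := by
  rw [comb_comm r, comb_comm r']
  exact comb_le_comb (abs_le.2 hy) (by linarith) (by linarith) h

theorem lowEnd_mono {r r' y y' : ℝ} (hr : |r| ≤ 1 / 2) (hr' : |r'| ≤ 1 / 2) (hy : y ∈ Par)
    (hy' : y' ∈ Par) (h : r ≤ r') (h' : y ≤ y') : lowEnd r y ≤ lowEnd r' y' :=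
  lowImg_le (abs_comb_le hr hy) (abs_comb_le hr' hy')
    ((comb_mono_right hr hy hy' h').trans (comb_mono_left hr hr' hy' h))

theorem lowEnd_nonneg {r y : ℝ} (hr : |r| ≤ 1 / 2) (hy : y ∈ Par) (h : 0 ≤ r + y) :
    0 ≤ lowEnd r y := by
  rw [lowEnd_eq hr hy]; exact div_nonneg (by linarith) (by linarith [lowEnd_den_pos hr hy])

theorem highEnd_nonpos {r y : ℝ} (hr : |r| ≤ 1 / 2) (hy : y ∈ Par) (h : r + y ≤ 0) :
    highEnd r y ≤ 0 := by
  rw [highEnd_eq hr hy]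
  exact div_nonpos_of_nonpos_of_nonneg (by linarith) (by linarith [highEnd_den_pos hr hy])

theorem le_lowEnd_of_nonpos {r y : ℝ} (hr : |r| ≤ 1 / 2) (hy : y ∈ Par) (h : r + y ≤ 0) :
    2 / 3 * (r + y) ≤ lowEnd r y ∧ lowEnd r y ≤ 0 := by
  have h3 := lowEnd_den_pos hr hy
  rw [lowEnd_eq hr hy]
  refine ⟨?_, div_nonpos_of_nonpos_of_nonneg (by linarith) (by linarith)⟩
  rw [le_div_iff₀ (by linarith)]
  nlinarith

theorem highEnd_le_of_nonneg {r y : ℝ} (hr : |r| ≤ 1 / 2) (hy : y ∈ Par) (h : 0 ≤ r + y) :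
    highEnd r y ≤ 2 / 3 * (r + y) ∧ 0 ≤ highEnd r y := by
  have h3 := highEnd_den_pos hr hy
  rw [highEnd_eq hr hy]
  refine ⟨?_, div_nonneg (by linarith) (by linarith)⟩
  rw [div_le_iff₀ (by linarith)]
  nlinarith

theorem le_lowEnd {r y : ℝ} (hr : |r| ≤ 1 / 2) (hy : y ∈ Icc (0 : ℝ) 1) (h : y / (1 - y) ≤ r)
    (h1 : y < 1) : y ≤ lowEnd r y := by
  have hy' : y ∈ Par := ⟨by linarith [hy.1], hy.2⟩
  have h3 := lowEnd_den_pos hr hy'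
  rw [div_le_iff₀ (by linarith)] at h
  rw [lowEnd_eq hr hy', le_div_iff₀ (by linarith)]
  nlinarith [hy.1, mul_le_mul_of_nonneg_right h (by linarith [hy.1] : 0 ≤ 2 + y)]

theorem lt_lowEnd {r y : ℝ} (hr : |r| ≤ 1 / 2) (hy : y ∈ Icc (0 : ℝ) 1) (h : y / (1 - y) < r)
    (h1 : y < 1) : y < lowEnd r y := by
  have hy' : y ∈ Par := ⟨by linarith [hy.1], hy.2⟩
  have h3 := lowEnd_den_pos hr hy'
  rw [div_lt_iff₀ (by linarith)] at h
  rw [lowEnd_eq hr hy', lt_div_iff₀ (by linarith)]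
  nlinarith [hy.1, mul_lt_mul_of_pos_right h (by linarith [hy.1] : 0 < 2 + y)]

/-- The representing measures supported in `[a, b]`. -/
def suppIn (a b : ℝ) : Set (ProbabilityMeasure Par) :=
  {μ | ∀ᵐ y : Par ∂(μ : Measure Par), (y : ℝ) ∈ Icc a b}

theorem mem_suppIn {a b : ℝ} {μ : ProbabilityMeasure Par} :
    μ ∈ suppIn a b ↔ ∀ᵐ y : Par ∂(μ : Measure Par), (y : ℝ) ∈ Icc a b := Iff.rfl

theorem suppIn_univ : suppIn (-1) 1 = univ :=
  eq_univ_of_forall fun _ => ae_of_all _ fun y => y.2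

theorem suppIn_mono {a b a' b' : ℝ} (ha : a' ≤ a) (hb : b ≤ b') : suppIn a b ⊆ suppIn a' b' :=
  fun _ hμ => (mem_suppIn.1 hμ).mono fun _ hy => ⟨ha.trans hy.1, hy.2.trans hb⟩

theorem isClosed_suppIn (a b : ℝ) : IsClosed (suppIn a b) := by
  have hF : IsClosed {y : Par | (y : ℝ) ∈ Icc a b} := isClosed_Icc.preimage continuous_subtype_val
  have e : suppIn a b = {μ : ProbabilityMeasure Par |
      1 ≤ (μ : Measure Par) {y : Par | (y : ℝ) ∈ Icc a b}} := by
    ext μ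
    have h1 : μ ∈ suppIn a b ↔ (μ : Measure Par) {y : Par | (y : ℝ) ∈ Icc a b}ᶜ = 0 := Iff.rfl
    rw [h1, prob_compl_eq_zero_iff hF.measurableSet]
    exact ⟨fun h => h.ge, fun h => le_antisymm prob_le_one h⟩
  rw [e]
  refine isClosed_of_closure_subset fun μ hμ => ?_
  obtain ⟨u, hu, hlim⟩ := mem_closure_iff_seq_limit.1 hμ
  have := ProbabilityMeasure.limsup_measure_closed_le_of_tendsto hlim hF
  refine le_trans ?_ this
  exact le_limsup_of_frequently_le (Frequently.of_forall hu) (by isBoundedDefault)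

theorem phi_mem_of_suppIn {a b : ℝ} (ha : a ∈ Par) (hb : b ∈ Par) {μ : ProbabilityMeasure Par}
    (h : μ ∈ suppIn a b) : fld a ≤ phi μ ∧ phi μ ≤ fld b := by
  have hi := integrable_of_continuous fld_isTest.continuous (μ : Measure Par)
  constructor
  · have := integral_mono_ae (integrable_const (fld a)) hi ((mem_suppIn.1 h).mono fun y hy => (fld_mono_lip ha y.2 hy.1).1)
    simpa [phi] using this
  · have := integral_mono_ae hi (integrable_const (fld b)) ((mem_suppIn.1 h).mono fun y hy => (fld_mono_lip y.2 hb hy.2).1)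
    simpa [phi] using this

theorem suppIn_step {a b r : ℝ} (ha : a ∈ Par) (hb : b ∈ Par) (hr : |r| ≤ 1 / 2)
    {μ μ' : ProbabilityMeasure Par} (h : μ ∈ suppIn a b) (hs : Steps r μ μ') :
    μ' ∈ suppIn (lowEnd r a) (highEnd r b) := by
  have hF : MeasurableSet {y : Par | (y : ℝ) ∈ Icc (lowEnd r a) (highEnd r b)} :=
    measurable_subtype_coe measurableSet_Icc
  change (μ' : Measure Par) {y : Par | (y : ℝ) ∈ Icc (lowEnd r a) (highEnd r b)}ᶜ = 0
  rw [hs, Measure.bind_apply hF.compl (Kernel.aemeasurable _), lintegral_eq_zero_of_ae_eq_zero]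
  filter_upwards [mem_suppIn.1 h] with y hy
  have q1 := abs_comb_le hr ha
  have q2 := abs_comb_le hr y.2
  have q3 := abs_comb_le hr hb
  have c1 := comb_mono_right hr ha y.2 hy.1
  have c2 := comb_mono_right hr y.2 hb hy.2
  have m1 : lowPt r y ∈ {y : Par | (y : ℝ) ∈ Icc (lowEnd r a) (highEnd r b)} := by
    change (lowPt r y : ℝ) ∈ Icc (lowEnd r a) (highEnd r b)
    rw [coe_lowPt hr]
    exact ⟨lowImg_le q1 q2 c1, (lowImg_le_highImg q2).trans (highImg_le q2 q3 c2)⟩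
  have m2 : highPt r y ∈ {y : Par | (y : ℝ) ∈ Icc (lowEnd r a) (highEnd r b)} := by
    change (highPt r y : ℝ) ∈ Icc (lowEnd r a) (highEnd r b)
    rw [coe_highPt hr]
    exact ⟨(lowImg_le q1 q2 c1).trans (lowImg_le_highImg q2), highImg_le q2 q3 c2⟩
  rw [stepKer_apply, Measure.add_apply, Measure.smul_apply, Measure.smul_apply,
    Measure.dirac_apply' _ hF.compl, Measure.dirac_apply' _ hF.compl]
  simp only [indicator_of_notMem (not_not_intro m1 : _ ∉ _ᶜ),
    indicator_of_notMem (not_not_intro m2 : _ ∉ _ᶜ)]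
  simp

theorem reflP_mem_suppIn {a b : ℝ} {μ : ProbabilityMeasure Par} (h : μ ∈ suppIn a b) :
    reflP false μ ∈ suppIn (-b) (-a) := by
  have hF : MeasurableSet {y : Par | (y : ℝ) ∈ Icc (-b) (-a)} :=
    measurable_subtype_coe measurableSet_Icc
  rw [mem_suppIn, coe_reflP, ae_map_iff (continuous_sgMap false).measurable.aemeasurable hF]
  filter_upwards [mem_suppIn.1 h] with y hy
  rw [coe_sgMap]
  simp only [sgn, Bool.false_eq_true, if_false, neg_one_mul]
  exact ⟨neg_le_neg hy.2, neg_le_neg hy.1⟩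

theorem reflP_reflP (s : Bool) (μ : ProbabilityMeasure Par) :
    reflP s μ = reflP (!s) (reflP false μ) := by
  apply Subtype.ext
  change (μ : Measure Par).map (sgMap s) =
    ((μ : Measure Par).map (sgMap false)).map (sgMap (!s))
  rw [Measure.map_map (continuous_sgMap _).measurable (continuous_sgMap _).measurable]
  congr 1
  funext y
  apply Subtype.ext
  cases s <;> simp [coe_sgMap, sgn]

theorem StatSetting.reach {G : ℝ → ℝ} {ϱ : Measure ℝ} {ε : ℝ}
    {Q : Measure (ProbabilityMeasure Site)} (h : StatSetting G ϱ ε Q) {J : Set ℝ}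
    (hJ : ∀ s, ϱ {t | sgn s * t ∈ J} ≠ 0) {C : Set (ProbabilityMeasure Site)} (hC : MeasurableSet C)
    (habs : ∀ ν ∈ C, ∀ t ∈ Icc (-ε) ε, noisyStep G ν t ∈ C)
    {M M' : Set (ProbabilityMeasure Par)} (hM' : Q (repSet M' \ C) = 0)
    (hstep : ∀ μ ∈ M, ∀ t ∈ J, ∀ μ', Steps (G (phi μ + t)) μ μ' → μ' ∈ M' ∨ reflP false μ' ∈ M') :
    Q (repSet M \ C) = 0 := by
  have := h.probNoise
  have := h.prob
  have key : ∀ s, Q ((fun μ => mixP (reflP s μ)) '' M \ C) = 0 := fun s => by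
    refine h.stat.null_of_reach (measurable_noisyStep_prob h.nice.cont.measurable ϱ) h.bounded (hJ s)
      hC habs hM' ?_
    rintro _ ⟨μ, hμ, rfl⟩ t ht
    obtain ⟨μ', h1, h2⟩ := noisyStep_mixP h.nice s μ t
    change noisyStep G (mixP (reflP s μ)) t ∈ repSet M'
    rw [h2]
    rcases hstep μ hμ _ ht μ' h1 with h3 | h3
    · exact ⟨(s, μ'), h3, rfl⟩
    · exact ⟨(!s, reflP false μ'), h3, by simp only [← reflP_reflP]⟩
  refine measure_mono_null ?_ (measure_union_null (key true) (key false))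
  rintro _ ⟨⟨⟨s, μ⟩, hμ, rfl⟩, hn⟩
  cases s
  · exact Or.inr ⟨⟨μ, hμ, rfl⟩, hn⟩
  · exact Or.inl ⟨⟨μ, hμ, rfl⟩, hn⟩

theorem repSet_union (M M' : Set (ProbabilityMeasure Par)) :
    repSet (M ∪ M') = repSet M ∪ repSet M' := by
  unfold repSet; rw [← image_union]; rfl

theorem repSet_mono {M M' : Set (ProbabilityMeasure Par)} (h : M ⊆ M') : repSet M ⊆ repSet M' :=
  image_mono fun _ hp => h hp

/-- The representing measures whose support lies, together with `0`, in an interval of length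
at most `l`. -/
def shortSupp (l : ℝ) : Set (ProbabilityMeasure Par) :=
  {μ | ∃ a b : ℝ, a ∈ Icc (-1 : ℝ) 0 ∧ b ∈ Icc (0 : ℝ) 1 ∧ b - a ≤ l ∧ μ ∈ suppIn a b}

theorem continuousOn_lowEnd {G : ℝ → ℝ} (hG : Nice G) (a : ℝ) :
    ContinuousOn (fun y => lowEnd (G (fld y + a)) y) Par := by
  have hf : ContinuousOn fld Par := by
    rw [continuousOn_iff_continuous_domRestrict]; exact fld_isTest.continuous
  have hg : ContinuousOn (fun y => G (fld y + a)) Par :=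
    hG.cont.comp_continuousOn (hf.add continuousOn_const)
  refine ContinuousOn.congr (f := fun y => 2 * (G (fld y + a) + y) /
    (4 + G (fld y + a) * y + (G (fld y + a) + y))) ?_ fun y hy => lowEnd_eq (hG.bound _) hy
  have hs := hg.add continuousOn_id
  refine ContinuousOn.div (continuousOn_const.mul hs)
    ((continuousOn_const.add (hg.mul continuousOn_id)).add hs) fun y hy => ?_
  linarith [lowEnd_den_pos (hG.bound (fld y + a)) hy]

/-- Almost every state is represented, up to reflection, by a measure on `[y₀, 1]`. -/
theorem StatSetting.entry {G : ℝ → ℝ} {ϱ : Measure ℝ} {ε : ℝ}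
    {Q : Measure (ProbabilityMeasure Site)} (h : StatSetting G ϱ ε Q)
    (hrep : ∀ᵐ ν ∂Q, ν ∈ repSet univ) (hpos : ∀ x, 0 < x → 0 < G x) {a : ℝ} (ha : 0 < a)
    (hJ : ∀ s, ϱ {t | sgn s * t ∈ Icc a ε} ≠ 0) {y₀ : ℝ} (hy₀ : 0 < y₀) (hy₁ : y₀ < 1)
    (hy : ∀ y ∈ Ioc 0 y₀, y / (1 - y) < G (fld y)) (hε : y₀ / (1 - y₀) ≤ G (fld y₀ - ε)) :
    (∀ μ ∈ suppIn y₀ 1, ∀ t ∈ Icc (-ε) ε, ∀ μ', Steps (G (phi μ + t)) μ μ' → μ' ∈ suppIn y₀ 1) ∧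
    ∀ᵐ ν ∂Q, ν ∈ repSet (suppIn y₀ 1) := by
  have := h.probNoise
  have := h.prob
  have h1P : (1 : ℝ) ∈ Par := by norm_num
  have hPar : ∀ y ∈ Icc (0 : ℝ) 1, y ∈ Par := fun y hy => ⟨by linarith [hy.1], hy.2⟩
  have habs : ∀ μ ∈ suppIn y₀ 1, ∀ t ∈ Icc (-ε) ε, ∀ μ', Steps (G (phi μ + t)) μ μ' →
      μ' ∈ suppIn y₀ 1 := by
    intro μ hμ t ht μ' hs
    have hb := h.nice.bound (phi μ + t)
    refine suppIn_mono ?_ (highEnd_mem hb h1P).2 (suppIn_step (hPar _ ⟨hy₀.le, hy₁.le⟩) h1P hb hμ hs)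
    refine le_lowEnd hb ⟨hy₀.le, hy₁.le⟩ (hε.trans (h.nice.mono ?_)) hy₁
    linarith [(phi_mem_of_suppIn (hPar _ ⟨hy₀.le, hy₁.le⟩) h1P hμ).1, ht.1]
  refine ⟨habs, ?_⟩
  set C := repSet (suppIn y₀ 1) with hCdef
  have hC : MeasurableSet C := (isClosed_repSet (isClosed_suppIn _ _)).measurableSet
  have habsC : ∀ ν ∈ C, ∀ t ∈ Icc (-ε) ε, noisyStep G ν t ∈ C := by
    rintro _ ⟨⟨s, μ⟩, hμ, rfl⟩ t ht
    obtain ⟨μ', h1, h2⟩ := noisyStep_mixP h.nice s μ t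
    exact ⟨(s, μ'), habs μ hμ _ (sgn_mul_mem s ht) μ' h1, h2.symm⟩
  have hchain : Q (repSet (suppIn 0 1) \ C) = 0 := by
    have hcomp : IsCompact (Icc 0 y₀) := isCompact_Icc
    have hcont : ContinuousOn (fun y => lowEnd (G (fld y + a)) y - y) (Icc 0 y₀) :=
      ((continuousOn_lowEnd h.nice a).mono fun y hy => hPar y ⟨hy.1, hy.2.trans hy₁.le⟩).sub
        continuousOn_id
    obtain ⟨z, hz, hmin⟩ := hcomp.exists_isMinOn ⟨0, le_rfl, hy₀.le⟩ hcont
    set c := lowEnd (G (fld z + a)) z - z with hc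
    have hgap : ∀ y ∈ Icc 0 y₀, y / (1 - y) < G (fld y + a) := by
      intro y hyy
      rcases hyy.1.eq_or_lt with h0 | h0
      · rw [← h0, fld_zero]; simpa using hpos a ha
      · exact (hy y ⟨h0, hyy.2⟩).trans_le (h.nice.mono (by linarith))
    have hc0 : 0 < c := by
      have := lt_lowEnd (h.nice.bound (fld z + a)) ⟨hz.1, hz.2.trans hy₁.le⟩ (hgap z hz)
        (hz.2.trans_lt hy₁)
      linarith
    have hind : ∀ n : ℕ, Q (repSet (suppIn (max (y₀ - n * c) 0) 1) \ C) = 0 := by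
      intro n
      induction n with
      | zero =>
        have : max (y₀ - (0 : ℕ) * c) 0 = y₀ := by simp [hy₀.le]
        rw [this, sdiff_self]; exact measure_empty
      | succ n ih =>
        set x := max (y₀ - (n + 1 : ℕ) * c) 0 with hx
        have hxn : max (y₀ - n * c) 0 ≤ x + c := by
          refine max_le ?_ (by have := le_max_right (y₀ - (n + 1 : ℕ) * c) 0; linarith)
          have := le_max_left (y₀ - (n + 1 : ℕ) * c) 0
          push_cast at this hx
          rw [← hx] at this
          linarith
        have hx0 : x ∈ Icc 0 y₀ := by
          refine ⟨le_max_right _ _, max_le ?_ hy₀.le⟩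
          have : 0 ≤ (n + 1 : ℕ) * c := by positivity
          linarith
        have hxP := hPar x ⟨hx0.1, hx0.2.trans hy₁.le⟩
        refine h.reach (J := Icc a ε) hJ hC habsC ih fun μ hμ t ht μ' hs => Or.inl ?_
        have hb := h.nice.bound (phi μ + t)
        refine suppIn_mono ?_ (highEnd_mem hb h1P).2 (suppIn_step hxP h1P hb hμ hs)
        have h3 : c ≤ lowEnd (G (fld x + a)) x - x := hmin hx0
        have h4 : lowEnd (G (fld x + a)) x ≤ lowEnd (G (phi μ + t)) x :=
          lowEnd_mono (h.nice.bound _) hb hxP hxP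
            (h.nice.mono (by linarith [(phi_mem_of_suppIn hxP h1P hμ).1, ht.1])) le_rfl
        linarith
    obtain ⟨n, hn⟩ := exists_nat_gt (y₀ / c)
    rw [div_lt_iff₀ hc0] at hn
    have := hind n
    rwa [max_eq_right (by linarith)] at this
  have hJfull : ∀ s, ϱ {t | sgn s * t ∈ Icc (-ε) ε} ≠ 0 := by
    intro s h0
    have e : {t | sgn s * t ∈ Icc (-ε) ε} = Icc (-ε) ε := by
      ext t
      change sgn s * t ∈ Icc (-ε) ε ↔ _
      rw [mem_Icc, mem_Icc, ← abs_le, ← abs_le, abs_sgn_mul]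
    rw [e] at h0
    have h1 := measure_univ_le_add_compl (μ := ϱ) (Icc (-ε) ε)
    rw [h0, h.bounded, measure_univ] at h1
    simp at h1
  set l₀ := min (a / 2) (G (a / 2)) with hl₀
  have hl₀pos : 0 < l₀ := lt_min (by linarith) (hpos _ (by linarith))
  have hshort : ∀ n : ℕ, Q (repSet (shortSupp ((3 / 2) ^ n * l₀)) \ C) = 0 := by
    intro n
    induction n with
    | zero =>
      refine h.reach (J := Icc a ε) hJ hC habsC hchain ?_
      rintro μ ⟨α, β, hα, hβ, hlen, hμ⟩ t ht μ' hs
      left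
      have hb := h.nice.bound (phi μ + t)
      have hαP : α ∈ Par := ⟨hα.1, by linarith [hα.2]⟩
      have hβP := hPar β hβ
      refine suppIn_mono ?_ (highEnd_mem hb hβP).2 (suppIn_step hαP hβP hb hμ hs)
      refine lowEnd_nonneg hb hαP ?_
      rw [pow_zero, one_mul] at hlen
      have h1 := min_le_left (a / 2) (G (a / 2))
      have h2 := min_le_right (a / 2) (G (a / 2))
      have h3 := (phi_mem_of_suppIn hαP hβP hμ).1
      have h4 := (abs_le.1 (abs_fld_le hαP)).1
      rw [abs_of_nonpos hα.2] at h4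
      have h5 : G (a / 2) ≤ G (phi μ + t) := h.nice.mono (by linarith [ht.1, hβ.1])
      linarith [hβ.1]
    | succ n ih =>
      refine h.reach (J := Icc (-ε) ε) hJfull hC habsC
        (M' := suppIn 0 1 ∪ shortSupp ((3 / 2) ^ n * l₀)) ?_ ?_
      · rw [repSet_union, union_sdiff_distrib]; exact measure_union_null hchain ih
      rintro μ ⟨α, β, hα, hβ, hlen, hμ⟩ t ht μ' hs
      have hb := h.nice.bound (phi μ + t)
      set r := G (phi μ + t)
      have hαP : α ∈ Par := ⟨hα.1, by linarith [hα.2]⟩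
      have hβP := hPar β hβ
      have hstep := suppIn_step hαP hβP hb hμ hs
      rcases le_total 0 (r + α) with h1 | h1
      · exact Or.inl (Or.inl (suppIn_mono (lowEnd_nonneg hb hαP h1) (highEnd_mem hb hβP).2 hstep))
      rcases le_total (r + β) 0 with h2 | h2
      · right; left
        have := reflP_mem_suppIn (suppIn_mono (lowEnd_mem hb hαP).1 (highEnd_nonpos hb hβP h2) hstep)
        simpa using this
      · left; right
        have h3 := le_lowEnd_of_nonpos hb hαP h1
        have h4 := highEnd_le_of_nonneg hb hβP h2
        refine ⟨_, _, ⟨(lowEnd_mem hb hαP).1, h3.2⟩, ⟨h4.2, (highEnd_mem hb hβP).2⟩, ?_, hstep⟩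
        rw [pow_succ] at hlen
        linarith [h3.1, h4.1]
  obtain ⟨n, hn⟩ := pow_unbounded_of_one_lt (2 / l₀) (by norm_num : (1 : ℝ) < 3 / 2)
  rw [div_lt_iff₀ hl₀pos] at hn
  have huniv : (univ : Set (ProbabilityMeasure Par)) ⊆ shortSupp ((3 / 2) ^ n * l₀) := by
    intro μ _
    exact ⟨-1, 1, by norm_num, by norm_num, by linarith, by rw [suppIn_univ]; trivial⟩
  have hfin : Q (repSet univ \ C) = 0 :=
    measure_mono_null (sdiff_subset_sdiff_left (repSet_mono huniv)) (hshort n)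
  filter_upwards [hrep, measure_eq_zero_iff_ae_notMem.1 hfin] with ν h1 h2
  by_contra h3
  exact h2 ⟨h1, h3⟩

/-- A symmetric law other than the point mass at `0` charges both sides of `0`. -/
theorem IsNoise.exists_pos {ϱ : Measure ℝ} {ε : ℝ} (h : IsNoise ϱ ε) :
    ∃ a, 0 < a ∧ ∀ s, ϱ {t | sgn s * t ∈ Icc a ε} ≠ 0 := by
  have := h.prob
  have hneg : ∀ A : Set ℝ, MeasurableSet A → ϱ {t | -t ∈ A} = ϱ A := fun A hA => by
    conv_rhs => rw [← h.symm, Measure.map_apply measurable_neg hA]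
    rfl
  have hIoi : ϱ (Ioi 0) ≠ 0 := by
    intro h0
    have h1 : ϱ (Iio 0) = 0 := by
      rw [← h0, ← hneg _ measurableSet_Ioi]; congr 1; ext t; simp
    refine h.nontrivial ?_
    have h2 : ∀ᵐ t ∂ϱ, t = 0 := by
      have h3 : ∀ᵐ t ∂ϱ, t ∉ Ioi (0 : ℝ) := measure_eq_zero_iff_ae_notMem.1 h0
      have h4 : ∀ᵐ t ∂ϱ, t ∉ Iio (0 : ℝ) := measure_eq_zero_iff_ae_notMem.1 h1
      filter_upwards [h3, h4] with t a b
      exact le_antisymm (not_lt.1 a) (not_lt.1 b)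
    ext A hA
    rw [Measure.dirac_apply' _ hA]
    by_cases h0A : (0 : ℝ) ∈ A
    · rw [indicator_of_mem h0A, Pi.one_apply, ← prob_compl_eq_zero_iff hA]
      exact (measure_eq_zero_iff_ae_notMem.2 (h2.mono fun t ht => by rw [ht]; simpa using h0A))
    · rw [indicator_of_notMem h0A]
      exact (measure_eq_zero_iff_ae_notMem.2 (h2.mono fun t ht => by rw [ht]; exact h0A))
  obtain ⟨n, hn⟩ : ∃ n : ℕ, ϱ (Ici (1 / ((n : ℝ) + 1))) ≠ 0 := by
    by_contra! hall
    refine hIoi (measure_mono_null ?_ (measure_iUnion_null hall))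
    intro t ht
    obtain ⟨n, hn⟩ := exists_nat_one_div_lt (mem_Ioi.1 ht)
    exact mem_iUnion.2 ⟨n, hn.le⟩
  have hIcc : ϱ (Icc (1 / ((n : ℝ) + 1)) ε) ≠ 0 := by
    intro h0
    refine hn (measure_mono_null (fun t ht => ?_) (measure_union_null h0 h.bounded))
    by_cases hte : t ∈ Icc (-ε) ε
    · exact Or.inl ⟨ht, hte.2⟩
    · exact Or.inr hte
  refine ⟨1 / ((n : ℝ) + 1), by positivity, fun s => ?_⟩
  cases s
  · simp only [sgn, Bool.false_eq_true, if_false, neg_one_mul]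
    rwa [hneg _ measurableSet_Icc]
  · simp only [sgn, if_true, one_mul]
    exact hIcc

/-! ### Absolutely continuous states are attracted by the mixtures -/

theorem IsStationary.measure_le_of_step {S : Type*} [MeasurableSpace S] {Φ : S → ℝ → S}
    {ϱ : Measure ℝ} [IsProbabilityMeasure ϱ] {m : Measure S} (hm : IsStationary Φ ϱ m)
    (hΦ : ∀ A, MeasurableSet A → Measurable fun s => ϱ {t | Φ s t ∈ A}) {I : Set ℝ}
    (hI : ϱ Iᶜ = 0) {A B : Set S} (h : ∀ s ∈ A, ∀ t ∈ I, Φ s t ∈ B) : m A ≤ m B := by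
  have hZ := measurableSet_toMeasurable m B
  rw [← measure_toMeasurable B, hm _ hZ]
  refine le_trans ?_ (mul_meas_ge_le_lintegral (hΦ _ hZ) 1)
  rw [one_mul]
  refine measure_mono fun s hs => ?_
  have h1 : ϱ I ≤ ϱ {t | Φ s t ∈ toMeasurable m B} :=
    measure_mono fun t ht => subset_toMeasurable _ _ (h s hs t ht)
  have h2 := measure_univ_le_add_compl (μ := ϱ) I
  rw [hI, add_zero, measure_univ] at h2
  exact h2.trans h1

/-- The preimage of a set under a composition of single-site maps. -/
def pull : List ℝ → Set Site → Set Site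
  | [], B => B
  | r :: rs, B => siteMap r ⁻¹' pull rs B

theorem measurableSet_pull (rs : List ℝ) {B : Set Site} (hB : MeasurableSet B) :
    MeasurableSet (pull rs B) := by
  induction rs with
  | nil => exact hB
  | cons r rs ih => exact measurable_siteMap r ih

theorem wLaw_real_preimage {r : ℝ} (hr : |r| ≤ 1 / 2) (y : Par) {A : Set Site}
    (hA : MeasurableSet A) : (wLaw y).real (siteMap r ⁻¹' A) =
      dualOp r (fun z => (wLaw z).real A) y := by
  have hq := abs_le.1 (abs_comb_le hr y.2)
  have h1 := isProbabilityMeasure_wLaw (lowPt r y).2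
  have h2 := isProbabilityMeasure_wLaw (highPt r y).2
  unfold Measure.real
  rw [← Measure.map_apply (measurable_siteMap r) hA, map_wLaw hr, stepKer_bind_apply _ _ hA,
    ENNReal.toReal_add (by finiteness) (by finiteness), ENNReal.toReal_mul, ENNReal.toReal_mul,
    ENNReal.toReal_ofReal (by linarith), ENNReal.toReal_ofReal (by linarith)]
  rfl

theorem wLaw_real_pull (rs : List ℝ) (hrs : ∀ r ∈ rs, |r| ≤ 1 / 2) {B : Set Site}
    (hB : MeasurableSet B) : ∃ f g : Par → ℝ, IsTest f ∧ IsTest g ∧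
      ∀ y : Par, (wLaw y).real (pull rs B) = 72 * (9 / 10 : ℝ) ^ rs.length * (f y - g y) := by
  induction rs with
  | nil =>
    refine ⟨fun y => ((wLaw y).real B + 36 * y) / 72, fun y => y / 2, ?_, ?_, ?_⟩
    · intro x y hxy
      have hxy' := Subtype.coe_le_coe.2 hxy
      have h := abs_integral_wLaw_sub_le (C := 1) y.2 x.2 (g := B.indicator 1)
        (measurable_one.indicator hB) fun z => by
          by_cases hz : z ∈ B <;> simp [hz]
      rw [integral_indicator_one hB, integral_indicator_one hB, abs_of_nonneg (sub_nonneg.2 hxy'),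
        abs_le] at h
      constructor <;> linarith
    · intro x y hxy
      have hxy' := Subtype.coe_le_coe.2 hxy
      constructor <;> linarith
    · intro y
      change (wLaw y).real B = _
      rw [List.length_nil]; ring
  | cons r rs ih =>
    obtain ⟨f, g, hf, hg, h⟩ := ih fun r' hr' => hrs r' (List.mem_cons_of_mem _ hr')
    have hr := hrs r List.mem_cons_self
    refine ⟨_, _, dualOp_isTest hr hf, dualOp_isTest hr hg, fun y => ?_⟩
    change (wLaw y).real (siteMap r ⁻¹' pull rs B) = _
    rw [wLaw_real_preimage hr y (measurableSet_pull rs hB)]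
    simp only [dualOp, h, List.length_cons, pow_succ]
    ring

theorem wLaw_zero : wLaw 0 = leb := by
  unfold wLaw wDens; simp

/-- The functions whose images under long compositions of single-site maps forget everything
but the total mass. -/
def Mixes (u : Site → ℝ) : Prop :=
  Integrable u leb ∧ ∀ η : ℝ, 0 < η → ∃ n : ℕ, ∀ rs : List ℝ, n ≤ rs.length →
    (∀ r ∈ rs, |r| ≤ 1 / 2) → ∀ B : Set Site, MeasurableSet B →
      |∫ x in pull rs B, u x ∂leb - (∫ x, u x ∂leb) * leb.real (pull rs B)| ≤ η

theorem integrable_wDens {y : ℝ} (hy : y ∈ Par) : Integrable (fun x : Site => wDens y x) leb :=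
  Integrable.of_bound ((measurable_wDens_right y).comp measurable_subtype_coe).aestronglyMeasurable
    4 (ae_of_all _ fun x => by
      rw [Real.norm_eq_abs, abs_of_nonneg (wDens_nonneg hy)]; exact wDens_le x.2 hy)

theorem setIntegral_wDens {y : ℝ} (hy : y ∈ Par) {A : Set Site} (hA : MeasurableSet A) :
    ∫ x in A, wDens y x ∂leb = (wLaw y).real A := by
  unfold wLaw Measure.real
  rw [withDensity_apply _ hA, ← ofReal_integral_eq_lintegral_ofReal
    (integrable_wDens hy).integrableOn (ae_of_all _ fun x => wDens_nonneg hy),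
    ENNReal.toReal_ofReal (integral_nonneg fun x => wDens_nonneg hy)]

theorem mixes_wDens {y : ℝ} (hy : y ∈ Par) : Mixes fun x => wDens y x := by
  refine ⟨integrable_wDens hy, fun η hη => ?_⟩
  obtain ⟨n, hn⟩ := exists_pow_lt_of_lt_one (by positivity : 0 < η / 288)
    (by norm_num : (9 / 10 : ℝ) < 1)
  refine ⟨n, fun rs hlen hrs B hB => ?_⟩
  have h0P : (0 : ℝ) ∈ Par := by norm_num
  have := isProbabilityMeasure_wLaw hy
  have e : ∫ x : Site, wDens y x ∂leb = 1 := by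
    have := setIntegral_wDens hy MeasurableSet.univ
    rwa [setIntegral_univ, probReal_univ] at this
  obtain ⟨f, g, hf, hg, h⟩ := wLaw_real_pull rs hrs hB
  have h1 := h ⟨y, hy⟩
  have h2 := h ⟨0, h0P⟩
  simp only [wLaw_zero] at h1 h2
  rw [e, one_mul, setIntegral_wDens hy (measurableSet_pull rs hB), h1, h2]
  have h3 := abs_le.1 (hf.abs_sub_le ⟨y, hy⟩ ⟨0, h0P⟩)
  have h4 := abs_le.1 (hg.abs_sub_le ⟨y, hy⟩ ⟨0, h0P⟩)
  have h5 : (9 / 10 : ℝ) ^ rs.length ≤ η / 288 :=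
    (pow_le_pow_of_le_one (by norm_num) (by norm_num) hlen).trans hn.le
  have h6 : (0 : ℝ) ≤ (9 / 10 : ℝ) ^ rs.length := by positivity
  rw [← mul_sub, abs_mul, abs_of_nonneg (by positivity)]
  have h7 : |f ⟨y, hy⟩ - g ⟨y, hy⟩ - (f ⟨0, h0P⟩ - g ⟨0, h0P⟩)| ≤ 4 :=
    abs_le.2 ⟨by linarith, by linarith⟩
  nlinarith [abs_nonneg (f ⟨y, hy⟩ - g ⟨y, hy⟩ - (f ⟨0, h0P⟩ - g ⟨0, h0P⟩))]

theorem Mixes.add {u v : Site → ℝ} (hu : Mixes u) (hv : Mixes v) : Mixes fun x => u x + v x := by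
  refine ⟨hu.1.add hv.1, fun η hη => ?_⟩
  obtain ⟨n, hn⟩ := hu.2 (η / 2) (by positivity)
  obtain ⟨m, hm⟩ := hv.2 (η / 2) (by positivity)
  refine ⟨max n m, fun rs hlen hrs B hB => ?_⟩
  have h1 := abs_le.1 (hn rs ((le_max_left _ _).trans hlen) hrs B hB)
  have h2 := abs_le.1 (hm rs ((le_max_right _ _).trans hlen) hrs B hB)
  rw [integral_add hu.1.integrableOn hv.1.integrableOn, integral_add hu.1 hv.1, abs_le]
  constructor <;> linarith

theorem Mixes.const_mul {u : Site → ℝ} (hu : Mixes u) (c : ℝ) : Mixes fun x => c * u x := by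
  refine ⟨hu.1.const_mul c, fun η hη => ?_⟩
  obtain ⟨n, hn⟩ := hu.2 (η / (|c| + 1)) (by positivity)
  refine ⟨n, fun rs hlen hrs B hB => ?_⟩
  have h1 := hn rs hlen hrs B hB
  rw [integral_const_mul, integral_const_mul, mul_assoc, ← mul_sub, abs_mul]
  rw [le_div_iff₀ (by positivity)] at h1
  nlinarith [abs_nonneg c, abs_nonneg (∫ x in pull rs B, u x ∂leb -
    (∫ x, u x ∂leb) * leb.real (pull rs B))]

theorem Mixes.of_close {u : Site → ℝ} (hu : Integrable u leb)
    (h : ∀ η : ℝ, 0 < η → ∃ v, Mixes v ∧ ∫ x, |u x - v x| ∂leb ≤ η) : Mixes u := by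
  refine ⟨hu, fun η hη => ?_⟩
  obtain ⟨v, hv, hd⟩ := h (η / 3) (by positivity)
  obtain ⟨n, hn⟩ := hv.2 (η / 3) (by positivity)
  refine ⟨n, fun rs hlen hrs B hB => ?_⟩
  have h1 := abs_le.1 (hn rs hlen hrs B hB)
  have key : ∀ A : Set Site, |∫ x in A, u x ∂leb - ∫ x in A, v x ∂leb| ≤ η / 3 := fun A => by
    rw [← integral_sub hu.integrableOn hv.1.integrableOn]
    refine (abs_integral_le_integral_abs).trans (le_trans ?_ hd)
    exact setIntegral_le_integral (hu.sub hv.1).abs (ae_of_all _ fun x => abs_nonneg _)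
  have h2 := abs_le.1 (key (pull rs B))
  have h3 := key univ
  rw [setIntegral_univ, setIntegral_univ] at h3
  have h4 : leb.real (pull rs B) ≤ 1 := measureReal_le_one
  have h5 : |(∫ x, u x ∂leb - ∫ x, v x ∂leb) * leb.real (pull rs B)| ≤ η / 3 := by
    rw [abs_mul, abs_of_nonneg measureReal_nonneg]
    nlinarith [abs_nonneg (∫ x, u x ∂leb - ∫ x, v x ∂leb),
      measureReal_nonneg (μ := leb) (s := pull rs B)]
  rw [sub_mul] at h5
  have h6 := abs_le.1 h5
  rw [abs_le]
  constructor <;> linarith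

theorem Mixes.of_uniformly_close {u : Site → ℝ} (hu : Integrable u leb)
    (h : ∀ η : ℝ, 0 < η → ∃ v, Mixes v ∧ ∀ x, |u x - v x| ≤ η) : Mixes u := by
  refine Mixes.of_close hu fun η hη => ?_
  obtain ⟨v, hv, hd⟩ := h η hη
  refine ⟨v, hv, ?_⟩
  simpa using integral_mono (hu.sub hv.1).abs (integrable_const η) hd

/-- The tail from `x ^ k` on of the expansion of `(1 - x * y)⁻²`, divided by `y ^ k`. -/
noncomputable def tailFun (k : ℕ) (y x : ℝ) : ℝ := x ^ k * (1 / (1 - x * y) ^ 2 + k / (1 - x * y))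

theorem tailFun_sub {x y : ℝ} (h : 1 - x * y ≠ 0) (k : ℕ) :
    tailFun k y x - (k + 1) * x ^ k = y * tailFun (k + 1) y x := by
  unfold tailFun
  push_cast
  field_simp
  ring

theorem abs_tailFun_le {x y : ℝ} (hx : x ∈ Site) (hy : y ∈ Par) (k : ℕ) :
    |tailFun k y x| ≤ 4 + 2 * k := by
  have h := one_sub_mul_pos hx hy
  have hx1 : |x| ≤ 1 := abs_le.2 ⟨by linarith [hx.1], by linarith [hx.2]⟩
  have h1 : 1 / (1 - x * y) ^ 2 ≤ 4 := by
    rw [div_le_iff₀ (by positivity)]; nlinarith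
  have h2 : k / (1 - x * y) ≤ 2 * k := by
    rw [div_le_iff₀ (by linarith)]; nlinarith [Nat.cast_nonneg (α := ℝ) k]
  have h3 : 0 ≤ 1 / (1 - x * y) ^ 2 + k / (1 - x * y) := by positivity
  unfold tailFun
  rw [abs_mul, abs_pow, abs_of_nonneg h3]
  have h4 : |x| ^ k ≤ 1 := pow_le_one₀ (abs_nonneg _) hx1
  nlinarith [pow_nonneg (abs_nonneg x) k]

theorem integrable_pow_site (k : ℕ) : Integrable (fun x : Site => (x : ℝ) ^ k) leb :=
  integrable_of_continuous (by fun_prop) _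

theorem mixes_tailFun (k : ℕ) : (∀ y ∈ Ioc (0 : ℝ) 1, Mixes fun x => tailFun k y x) ∧
    Mixes fun x => (x : ℝ) ^ k := by
  have hP : ∀ y ∈ Ioc (0 : ℝ) 1, y ∈ Par := fun y hy => ⟨by linarith [hy.1], hy.2⟩
  have hne : ∀ (x : Site), ∀ y ∈ Ioc (0 : ℝ) 1, 1 - x * y ≠ 0 := fun x y hy => by
    have := one_sub_mul_pos x.2 (hP y hy); positivity
  have step : ∀ k : ℕ, (∀ y ∈ Ioc (0 : ℝ) 1, Mixes fun x => tailFun k y x) →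
      Mixes fun x => (x : ℝ) ^ k := by
    intro k h
    refine Mixes.of_uniformly_close (integrable_pow_site k) fun η hη => ?_
    set y := min 1 (η / (4 + 2 * (k + 1))) with hy
    have hy1 : y ∈ Ioc (0 : ℝ) 1 := ⟨lt_min one_pos (by positivity), min_le_left _ _⟩
    refine ⟨_, (h y hy1).const_mul ((k : ℝ) + 1)⁻¹, fun x => ?_⟩
    have h1 := tailFun_sub (hne x y hy1) k
    have h2 := abs_tailFun_le x.2 (hP y hy1) (k + 1)
    push_cast at h2
    have h3 : y * (4 + 2 * (k + 1)) ≤ η := by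
      rw [← le_div_iff₀ (by positivity)]; exact min_le_right _ _
    have e : (x : ℝ) ^ k - ((k : ℝ) + 1)⁻¹ * tailFun k y x =
        -(((k : ℝ) + 1)⁻¹ * (y * tailFun (k + 1) y x)) := by
      rw [← h1]; field_simp; ring
    rw [e, abs_neg, abs_mul, abs_mul, abs_of_pos hy1.1, abs_of_pos (by positivity)]
    have h4 : ((k : ℝ) + 1)⁻¹ ≤ 1 := inv_le_one_of_one_le₀ (by linarith [Nat.cast_nonneg (α := ℝ) k])
    have h5 : y * |tailFun (k + 1) y x| ≤ η :=
      (mul_le_mul_of_nonneg_left h2 hy1.1.le).trans h3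
    have h6 : 0 ≤ y * |tailFun (k + 1) y x| := mul_nonneg hy1.1.le (abs_nonneg _)
    nlinarith
  induction k with
  | zero =>
    refine ⟨?_, step 0 ?_⟩ <;>
    · intro y hy
      have h := (mixes_wDens (hP y hy)).const_mul (1 - y ^ 2 / 4)⁻¹
      have h1 : 1 - y ^ 2 / 4 ≠ 0 := by nlinarith [hy.1, hy.2]
      convert h using 2 with x
      unfold tailFun wDens
      rw [div_eq_mul_inv (1 - y ^ 2 / 4), ← mul_assoc, inv_mul_cancel₀ h1]
      simp
  | succ k ih =>
    have h : ∀ y ∈ Ioc (0 : ℝ) 1, Mixes fun x => tailFun (k + 1) y x := by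
      intro y hy
      have h1 := ((ih.1 y hy).add (ih.2.const_mul (-((k : ℝ) + 1)))).const_mul y⁻¹
      convert h1 using 2 with x
      have h2 := tailFun_sub (hne x y hy) k
      rw [neg_mul, ← sub_eq_add_neg, h2, inv_mul_cancel_left₀ hy.1.ne']
    exact ⟨h, step _ h⟩

theorem mixes_polynomial (p : Polynomial ℝ) : Mixes fun x => p.eval (x : ℝ) := by
  induction p using Polynomial.induction_on' with
  | add p q hp hq => simpa only [Polynomial.eval_add] using hp.add hq
  | monomial n a =>
    simpa only [Polynomial.eval_monomial] using (mixes_tailFun n).2.const_mul a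

theorem mixes_continuous {u : Site → ℝ} (hu : Continuous u) : Mixes u := by
  refine Mixes.of_uniformly_close (integrable_of_continuous hu _) fun η hη => ?_
  have h : (⟨u, hu⟩ : C(Site, ℝ)) ∈ (polynomialFunctions Site).topologicalClosure := by
    rw [polynomialFunctions_closure_eq_top]; trivial
  rw [← SetLike.mem_coe, Subalgebra.topologicalClosure_coe, Metric.mem_closure_iff] at h
  obtain ⟨g, hg, hd⟩ := h η hη
  rw [polynomialFunctions_coe] at hg
  obtain ⟨p, rfl⟩ := hg
  refine ⟨_, mixes_polynomial p, fun x => ?_⟩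
  have := (ContinuousMap.dist_le hη.le).1 hd.le x
  rwa [Real.dist_eq] at this

theorem mixes_of_integrable {u : Site → ℝ} (hu : Integrable u leb) : Mixes u := by
  refine Mixes.of_close hu fun η hη => ?_
  obtain ⟨g, hg, -⟩ := hu.exists_boundedContinuous_integral_sub_le hη
  exact ⟨g, mixes_continuous g.continuous, hg⟩

theorem exists_mixP_map {r : ℝ} (hr : |r| ≤ 1 / 2) (μ : ProbabilityMeasure Par) :
    ∃ μ', (mixP μ).map (measurable_siteMap r).aemeasurable = mixP μ' := by
  obtain ⟨μ', h⟩ := exists_steps hr μ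
  refine ⟨μ', Subtype.ext ?_⟩
  change (mix (μ : Measure Par)).map (siteMap r) = mix (μ' : Measure Par)
  rw [map_mix hr, h]

/-- The states within total variation distance `η` of a mixture. -/
def nearMix (η : ENNReal) : Set (ProbabilityMeasure Site) :=
  {ν | ∃ μ, ∀ B, MeasurableSet B → (ν : Measure Site) B ≤ (mixP μ : Measure Site) B + η ∧
    (mixP μ : Measure Site) B ≤ (ν : Measure Site) B + η}

theorem noisyStep_mem_nearMix {G : ℝ → ℝ} (hG : Nice G) {η : ENNReal} {ν : ProbabilityMeasure Site}
    (h : ν ∈ nearMix η) (t : ℝ) : noisyStep G ν t ∈ nearMix η := by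
  obtain ⟨μ, hμ⟩ := h
  obtain ⟨μ', h'⟩ := exists_mixP_map (hG.bound (field ν + t)) μ
  refine ⟨μ', fun B hB => ?_⟩
  have hB' := measurable_siteMap (G (field ν + t)) hB
  rw [← h']
  change (Measure.map (siteMap (G (field ν + t))) (ν : Measure Site)) B ≤
    (Measure.map (siteMap (G (field ν + t))) (mixP μ : Measure Site)) B + η ∧
    (Measure.map (siteMap (G (field ν + t))) (mixP μ : Measure Site)) B ≤
    (Measure.map (siteMap (G (field ν + t))) (ν : Measure Site)) B + η
  rw [Measure.map_apply (measurable_siteMap _) hB, Measure.map_apply (measurable_siteMap _) hB]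
  exact hμ _ hB'

/-- The states all of whose `n`-th images are near a mixture. -/
def reachMix (G : ℝ → ℝ) (η : ENNReal) : ℕ → Set (ProbabilityMeasure Site)
  | 0 => nearMix η
  | n + 1 => {ν | ∀ t, noisyStep G ν t ∈ reachMix G η n}

theorem reachMix_mono {G : ℝ → ℝ} (hG : Nice G) (η : ENNReal) : Monotone (reachMix G η) := by
  refine monotone_nat_of_le_succ fun n => ?_
  induction n with
  | zero => exact fun ν hν t => noisyStep_mem_nearMix hG hν t
  | succ n ih => exact fun ν hν t => ih (hν t)

theorem mem_reachMix {G : ℝ → ℝ} (hG : Nice G) {η : ENNReal} (n : ℕ) {ν : ProbabilityMeasure Site}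
    {μ : ProbabilityMeasure Par} (h : ∀ rs : List ℝ, rs.length = n → (∀ r ∈ rs, |r| ≤ 1 / 2) →
      ∀ B, MeasurableSet B →
        (ν : Measure Site) (pull rs B) ≤ (mixP μ : Measure Site) (pull rs B) + η ∧
        (mixP μ : Measure Site) (pull rs B) ≤ (ν : Measure Site) (pull rs B) + η) :
    ν ∈ reachMix G η n := by
  induction n generalizing ν μ with
  | zero => exact ⟨μ, fun B hB => h [] rfl (by simp) B hB⟩
  | succ n ih =>
    intro t
    have hr := hG.bound (field ν + t)
    obtain ⟨μ', h'⟩ := exists_mixP_map hr μ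
    refine ih (μ := μ') fun rs hlen hrs B hB => ?_
    have hp := measurableSet_pull rs hB
    rw [← h']
    change (Measure.map (siteMap (G (field ν + t))) (ν : Measure Site)) _ ≤
      (Measure.map (siteMap (G (field ν + t))) (mixP μ : Measure Site)) _ + η ∧
      (Measure.map (siteMap (G (field ν + t))) (mixP μ : Measure Site)) _ ≤
      (Measure.map (siteMap (G (field ν + t))) (ν : Measure Site)) _ + η
    rw [Measure.map_apply (measurable_siteMap _) hp, Measure.map_apply (measurable_siteMap _) hp]
    refine h (G (field ν + t) :: rs) (by rw [List.length_cons, hlen]) ?_ B hB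
    intro r hr'
    rcases List.mem_cons.1 hr' with rfl | hr'
    · exact hr
    · exact hrs r hr'

theorem exists_mixP_eq_leb : ∃ μ, (mixP μ : Measure Site) = leb := by
  refine ⟨⟨Measure.dirac ⟨0, by norm_num⟩, inferInstance⟩, ?_⟩
  change (Measure.dirac _).bind wKer = leb
  rw [Measure.dirac_bind wKer.measurable, wKer_apply]
  exact wLaw_zero

theorem exists_mem_reachMix {G : ℝ → ℝ} (hG : Nice G) {ν : ProbabilityMeasure Site}
    (hν : (ν : Measure Site) ≪ leb) {η : ℝ} (hη : 0 < η) :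
    ∃ n, ν ∈ reachMix G (ENNReal.ofReal η) n := by
  have hu : Integrable (fun x => ((ν : Measure Site).rnDeriv leb x).toReal) leb :=
    Measure.integrable_toReal_rnDeriv
  obtain ⟨n, hn⟩ := (mixes_of_integrable hu).2 η hη
  obtain ⟨μ, hμ⟩ := exists_mixP_eq_leb
  refine ⟨n, mem_reachMix hG n (μ := μ) fun rs hlen hrs B hB => ?_⟩
  have h := hn rs hlen.ge hrs B hB
  rw [Measure.setIntegral_toReal_rnDeriv hν, Measure.integral_toReal_rnDeriv hν, probReal_univ,
    one_mul, abs_le] at h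
  rw [hμ]
  have e : ∀ (κ : Measure Site) [IsFiniteMeasure κ] (A : Set Site), κ A = ENNReal.ofReal (κ.real A) :=
    fun κ _ A => (ofReal_measureReal).symm
  rw [e _ (pull rs B), e leb (pull rs B), ← ENNReal.ofReal_add measureReal_nonneg hη.le,
    ← ENNReal.ofReal_add measureReal_nonneg hη.le]
  constructor <;> apply ENNReal.ofReal_le_ofReal <;> linarith

theorem mem_range_mixP_of_closure {ν : ProbabilityMeasure Site}
    (h : ∀ n : ℕ, ν ∈ closure (nearMix (ENNReal.ofReal (1 / ((n : ℝ) + 1))))) :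
    ν ∈ range mixP := by
  let := TopologicalSpace.metrizableSpaceMetric (ProbabilityMeasure Site)
  have hcl : IsClosed (range mixP) := (isCompact_range continuous_mixP).isClosed
  have h1 : ∀ n : ℕ, ∃ ν' ∈ nearMix (ENNReal.ofReal (1 / ((n : ℝ) + 1))),
      dist ν ν' < 1 / ((n : ℝ) + 1) := fun n => Metric.mem_closure_iff.1 (h n) _ (by positivity)
  choose u hu hd using h1
  choose μ hμ using hu
  have hlim : Tendsto u atTop (𝓝 ν) := by
    rw [tendsto_iff_dist_tendsto_zero]
    refine squeeze_zero (fun _ => dist_nonneg) (fun n => ?_) tendsto_one_div_add_atTop_nhds_zero_nat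
    rw [dist_comm]; exact (hd n).le
  refine hcl.mem_of_tendsto (f := fun n => mixP (μ n)) (b := atTop) ?_
    (Eventually.of_forall fun n => mem_range_self _)
  refine tendsto_of_forall_isClosed_limsup_le' fun F hF => ?_
  have h2 := ProbabilityMeasure.limsup_measure_closed_le_of_tendsto hlim hF
  refine ENNReal.le_of_forall_pos_le_add fun η hη _ => ?_
  have h3 : ∀ᶠ n : ℕ in atTop, ENNReal.ofReal (1 / ((n : ℝ) + 1)) ≤ η := by
    have h4 : Tendsto (fun n : ℕ => 1 / ((n : ℝ) + 1)) atTop (𝓝 0) :=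
      tendsto_one_div_add_atTop_nhds_zero_nat
    filter_upwards [h4.eventually_lt_const (NNReal.coe_pos.2 hη)] with n hn
    rw [← ENNReal.ofReal_coe_nnreal]
    exact ENNReal.ofReal_le_ofReal hn.le
  refine le_trans ?_ (add_le_add_left h2 (η : ENNReal))
  rw [← limsup_add_const _ _ _ (by isBoundedDefault) (by isBoundedDefault)]
  refine limsup_le_limsup ?_
  filter_upwards [h3] with n hn
  exact ((hμ n F hF.measurableSet).2).trans (add_le_add_right hn _)

theorem reflP_true (μ : ProbabilityMeasure Par) : reflP true μ = μ := by
  apply Subtype.ext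
  change (μ : Measure Par).map id = μ
  exact Measure.map_id

/-- An absolutely continuous stationary measure is concentrated on the mixtures. -/
theorem StatSetting.ae_repSet_univ {G : ℝ → ℝ} {ϱ : Measure ℝ} {ε : ℝ}
    {Q : Measure (ProbabilityMeasure Site)} (h : StatSetting G ϱ ε Q)
    (hac : ∀ᵐ ν : ProbabilityMeasure Site ∂Q, (ν : Measure Site) ≪ leb) : ∀ᵐ ν ∂Q, ν ∈ repSet univ := by
  have := h.probNoise
  have := h.prob
  have hA : ∀ η : ℝ, 0 < η → Q (nearMix (ENNReal.ofReal η)) = 1 := by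
    intro η hη
    refine le_antisymm prob_le_one ?_
    have hle : ∀ n, Q (reachMix G (ENNReal.ofReal η) n) ≤ Q (nearMix (ENNReal.ofReal η)) := by
      intro n
      induction n with
      | zero => exact le_rfl
      | succ n ih =>
        refine le_trans ?_ ih
        exact h.stat.measure_le_of_step (measurable_noisyStep_prob h.nice.cont.measurable ϱ)
          h.bounded fun ν hν t _ => hν t
    calc (1 : ENNReal) = Q univ := measure_univ.symm
      _ ≤ Q (⋃ n, reachMix G (ENNReal.ofReal η) n) := by
          refine measure_mono_ae ?_
          filter_upwards [hac] with ν hν _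
          exact mem_iUnion.2 (exists_mem_reachMix h.nice hν hη)
      _ = ⨆ n, Q (reachMix G (ENNReal.ofReal η) n) := (reachMix_mono h.nice _).measure_iUnion
      _ ≤ _ := iSup_le hle
  have hcl : ∀ n : ℕ, ∀ᵐ ν ∂Q, ν ∈ closure (nearMix (ENNReal.ofReal (1 / ((n : ℝ) + 1)))) := by
    intro n
    refine (prob_compl_eq_zero_iff isClosed_closure.measurableSet).2 (le_antisymm prob_le_one ?_)
    rw [← hA (1 / ((n : ℝ) + 1)) (by positivity)]
    exact measure_mono subset_closure
  filter_upwards [ae_all_iff.2 hcl] with ν hν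
  obtain ⟨μ, rfl⟩ := mem_range_mixP_of_closure hν
  exact ⟨(true, μ), trivial, by simp only [reflP_true]⟩

/-! ### The Wasserstein distance and test functions -/

theorem lintegral_Iio_eq (μ : Measure ℝ) [IsFiniteMeasure μ] (E : Set ℝ)
    [IsFiniteMeasure (volume.restrict E)] :
    ∫⁻ y, (volume.restrict E) (Iio y) ∂μ = ∫⁻ z in E, μ (Ioi z) := by
  have hA : MeasurableSet {p : ℝ × ℝ | p.2 < p.1} := measurableSet_lt measurable_snd measurable_fst
  have h1 := Measure.prod_apply (μ := μ) (ν := volume.restrict E) hA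
  rw [Measure.prod_apply_symm hA] at h1
  exact h1.symm

/-- The test function with derivative the indicator of `E`. -/
noncomputable def testOf (E : Set ℝ) (y : Par) : ℝ := (volume.restrict (E ∩ Par)).real (Iio (y : ℝ))

instance isFiniteMeasure_restrict_inter_Par (E : Set ℝ) :
    IsFiniteMeasure ((volume : Measure ℝ).restrict (E ∩ Par)) :=
  ⟨by
    rw [Measure.restrict_apply_univ]
    exact (measure_mono inter_subset_right).trans_lt (by simp)⟩

theorem isTest_testOf (E : Set ℝ) : IsTest (testOf E) := by
  intro x y hxy
  have hxy' := Subtype.coe_le_coe.2 hxy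
  unfold testOf
  have h1 : Iio (y : ℝ) = Iio (x : ℝ) ∪ Ico (x : ℝ) y := (Iio_union_Ico_eq_Iio hxy').symm
  constructor
  · exact measureReal_mono (Iio_subset_Iio hxy')
  · have h2 : (volume.restrict (E ∩ Par)).real (Ico (x : ℝ) y) ≤ y - x := by
      have h3 : (volume.restrict (E ∩ Par)) (Ico (x : ℝ) y) ≤ volume (Ico (x : ℝ) y) :=
        Measure.restrict_apply_le _ _
      rw [Real.volume_Ico] at h3
      exact ENNReal.toReal_le_of_le_ofReal (sub_nonneg.2 hxy') h3
    have h4 := measureReal_union_le (μ := volume.restrict (E ∩ Par)) (Iio (x : ℝ)) (Ico (x : ℝ) y)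
    rw [← h1] at h4
    linarith

theorem integral_testOf (E : Set ℝ) (μ : Measure Par) [IsProbabilityMeasure μ] :
    ∫ y, testOf E y ∂μ = ∫ z in E ∩ Par, (μ.map Subtype.val).real (Ioi z) := by
  have hp := Measure.isProbabilityMeasure_map (μ := μ) measurable_subtype_coe.aemeasurable
  have hm : Measurable fun y : ℝ => (volume.restrict (E ∩ Par)) (Iio y) :=
    (Monotone.measurable fun x y h => measure_mono (Iio_subset_Iio h))
  have hm' : Measurable fun z : ℝ => (μ.map Subtype.val) (Ioi z) :=
    (Antitone.measurable fun x y h => measure_mono (Ioi_subset_Ioi h))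
  have h1 : ∫ y, testOf E y ∂μ = ∫ y, (volume.restrict (E ∩ Par)).real (Iio y) ∂(μ.map Subtype.val) := by
    rw [(MeasurableEmbedding.subtype_coe measurableSet_Icc).integral_map]; rfl
  rw [h1]
  unfold Measure.real
  rw [integral_toReal hm.aemeasurable (ae_of_all _ fun _ => measure_lt_top _ _),
    integral_toReal hm'.aemeasurable (ae_of_all _ fun _ => measure_lt_top _ _), lintegral_Iio_eq]

theorem real_Iic_eq (μ : Measure ℝ) [IsProbabilityMeasure μ] (z : ℝ) :
    μ.real (Iic z) = 1 - μ.real (Ioi z) := by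
  rw [← compl_Ioi, probReal_compl_eq_one_sub measurableSet_Ioi]

theorem real_Iic_of_notMem_Par (μ : Measure Par) [IsProbabilityMeasure μ] {z : ℝ} (hz : z ∉ Par) :
    (μ.map Subtype.val).real (Iic z) = if z < -1 then 0 else 1 := by
  unfold Measure.real
  rw [Measure.map_apply measurable_subtype_coe measurableSet_Iic]
  split_ifs with h
  · have : (Subtype.val : Par → ℝ) ⁻¹' Iic z = ∅ := by
      ext y; simp only [mem_preimage, mem_Iic, mem_empty_iff_false, iff_false, not_le]
      exact h.trans_le y.2.1
    rw [this]; simp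
  · have h1 : 1 < z := by
      by_contra h2
      exact hz ⟨not_lt.1 h, not_lt.1 h2⟩
    have : (Subtype.val : Par → ℝ) ⁻¹' Iic z = univ := by
      ext y; simp only [mem_preimage, mem_Iic, mem_univ, iff_true]
      exact y.2.2.trans h1.le
    rw [this]; simp

/-- The Wasserstein distance is at most twice the supremum of the differences over test
functions. -/
theorem wasserstein_le {μ ν : Measure Par} [IsProbabilityMeasure μ] [IsProbabilityMeasure ν] {c : ℝ}
    (h : ∀ f : Par → ℝ, IsTest f → |∫ y, f y ∂μ - ∫ y, f y ∂ν| ≤ c) :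
    wasserstein (μ.map Subtype.val) (ν.map Subtype.val) ≤ 2 * c := by
  have hp := Measure.isProbabilityMeasure_map (μ := μ) measurable_subtype_coe.aemeasurable
  have hp' := Measure.isProbabilityMeasure_map (μ := ν) measurable_subtype_coe.aemeasurable
  set F := fun z : ℝ => (μ.map Subtype.val).real (Ioi z) with hF
  set F' := fun z : ℝ => (ν.map Subtype.val).real (Ioi z) with hF'
  have hmono : ∀ (κ : Measure ℝ) [IsProbabilityMeasure κ], Measurable fun z : ℝ => κ.real (Ioi z) :=
    fun κ _ => Antitone.measurable fun x y h => measureReal_mono (Ioi_subset_Ioi h)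
  have hFm : Measurable F := hmono _
  have hFm' : Measurable F' := hmono _
  have hi : ∀ (κ : Measure ℝ) [IsProbabilityMeasure κ] (E : Set ℝ),
      IntegrableOn (fun z : ℝ => κ.real (Ioi z)) (E ∩ Par) := fun κ _ E =>
    Integrable.of_bound (hmono κ).aestronglyMeasurable 1 (ae_of_all _ fun z => by
      rw [Real.norm_eq_abs, abs_of_nonneg measureReal_nonneg]; exact measureReal_le_one)
  set E := {z | F' z ≤ F z} with hE
  have hEm : MeasurableSet E := measurableSet_le hFm' hFm
  have key : ∀ E : Set ℝ, ∫ z in E ∩ Par, (F z - F' z) = ∫ y, testOf E y ∂μ - ∫ y, testOf E y ∂ν := by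
    intro E
    rw [integral_testOf, integral_testOf, ← integral_sub (hi _ E) (hi _ E)]
  have h1 : wasserstein (μ.map Subtype.val) (ν.map Subtype.val) = ∫ z in Par, |F z - F' z| := by
    unfold wasserstein
    rw [← setIntegral_eq_integral_of_forall_compl_eq_zero (s := Par)]
    · refine integral_congr_ae (ae_of_all _ fun z => ?_)
      simp only [real_Iic_eq]
      rw [← abs_neg]; congr 1; ring
    · intro z hz
      rw [real_Iic_of_notMem_Par _ hz, real_Iic_of_notMem_Par _ hz, sub_self, abs_zero]
  have hab : IntegrableOn (fun z => |F z - F' z|) Par := by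
    have := (hi (μ.map Subtype.val) univ).sub (hi (ν.map Subtype.val) univ)
    rw [univ_inter] at this
    exact this.abs
  have h2 := integral_inter_add_sdiff (s := Par) hEm hab
  have h3 : ∫ z in Par ∩ E, |F z - F' z| = ∫ z in E ∩ Par, (F z - F' z) := by
    rw [inter_comm]
    refine setIntegral_congr_fun (hEm.inter measurableSet_Icc) fun z hz => ?_
    exact abs_of_nonneg (sub_nonneg.2 hz.1)
  have h4 : ∫ z in Par \ E, |F z - F' z| = -∫ z in Eᶜ ∩ Par, (F z - F' z) := by
    rw [sdiff_eq, inter_comm, ← integral_neg]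
    refine setIntegral_congr_fun (hEm.compl.inter measurableSet_Icc) fun z hz => ?_
    have hz' : ¬ F' z ≤ F z := hz.1
    exact abs_of_nonpos (sub_nonpos.2 (not_le.1 hz').le)
  have h5 := abs_le.1 (h _ (isTest_testOf E))
  have h6 := abs_le.1 (h _ (isTest_testOf Eᶜ))
  rw [h1, ← h2, h3, h4, key, key]
  linarith

theorem isTest_neg_comp_negPar {f : Par → ℝ} (hf : IsTest f) : IsTest fun y => -f (negPar y) := by
  intro x y hxy
  have h := hf (negPar y) (negPar x) (neg_le_neg (Subtype.coe_le_coe.2 hxy))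
  rw [coe_negPar, coe_negPar] at h
  constructor <;> linarith [h.1, h.2]

theorem abs_integral_sgMap_sub_le {μ ν : Measure Par} [IsProbabilityMeasure μ]
    [IsProbabilityMeasure ν] {c : ℝ} (h : ∀ f : Par → ℝ, IsTest f → |∫ y, f y ∂μ - ∫ y, f y ∂ν| ≤ c)
    (s : Bool) {f : Par → ℝ} (hf : IsTest f) :
    |∫ y, f y ∂(μ.map (sgMap s)) - ∫ y, f y ∂(ν.map (sgMap s))| ≤ c := by
  have hm := (continuous_sgMap s).measurable
  have hfm := hf.continuous.measurable
  rw [integral_map hm.aemeasurable hfm.aestronglyMeasurable, integral_map hm.aemeasurable hfm.aestronglyMeasurable]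
  cases s
  · have h1 := h _ (isTest_neg_comp_negPar hf)
    rw [integral_neg, integral_neg, ← abs_neg] at h1
    refine le_trans (le_of_eq ?_) h1
    simp only [sgMap, Bool.false_eq_true, if_false]
    congr 1; ring
  · exact h f hf

theorem reprMeasure_neg {r : ℝ} (hr : r ≠ 0) :
    reprMeasure (-r) = (reprMeasure r).map (fun y => -y) := by
  unfold reprMeasure
  rw [if_neg hr, if_neg (neg_ne_zero.2 hr)]
  have hlog : logConst (-r) = logConst r := by unfold logConst; rw [neg_sq]
  have hs : MeasurableSet (Icc (r / (1 + r)) (r / (1 - r))) := measurableSet_Icc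
  ext A hA
  have hA' : MeasurableSet ((fun y : ℝ => -y) ⁻¹' A) := measurable_neg hA
  rw [Measure.map_apply measurable_neg hA, withDensity_apply _ hA, withDensity_apply _ hA',
    Measure.restrict_restrict hA, Measure.restrict_restrict hA',
    ← lintegral_indicator (hA.inter measurableSet_Icc), ← lintegral_indicator (hA'.inter hs),
    ← lintegral_neg_eq_self]
  refine lintegral_congr fun y => ?_
  have e1 : -y ∈ A ∩ Icc (-r / (1 + -r)) (-r / (1 - -r)) ↔
      y ∈ (fun y : ℝ => -y) ⁻¹' A ∩ Icc (r / (1 + r)) (r / (1 - r)) := by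
    have a1 : -r / (1 + -r) = -(r / (1 - r)) := by rw [neg_div]; ring_nf
    have a2 : -r / (1 - -r) = -(r / (1 + r)) := by rw [neg_div]; ring_nf
    rw [a1, a2, mem_inter_iff, mem_inter_iff, mem_preimage, mem_Icc, mem_Icc, neg_le_neg_iff,
      neg_le_neg_iff]
    tauto
  by_cases h : y ∈ (fun y : ℝ => -y) ⁻¹' A ∩ Icc (r / (1 + r)) (r / (1 - r))
  · rw [indicator_of_mem h, indicator_of_mem (e1.2 h), hlog, neg_sq]
  · rw [indicator_of_notMem h, indicator_of_notMem (fun h' => h (e1.1 h'))]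

theorem map_sgMap_invRepr {r : ℝ} (h0 : 0 < r) (h1 : r ≤ 1 / 2) (s : Bool) :
    ((invRepr r).map (sgMap s)).map Subtype.val = reprMeasure (sgn s * r) := by
  rw [Measure.map_map measurable_subtype_coe (continuous_sgMap s).measurable]
  cases s
  · have e : (Subtype.val ∘ sgMap false : Par → ℝ) = (fun y => -y) ∘ Subtype.val := by
      funext y; simp [coe_sgMap, sgn]
    rw [e, ← Measure.map_map measurable_neg measurable_subtype_coe, map_invRepr h0 h1]
    simp only [sgn, Bool.false_eq_true, if_false, neg_one_mul]
    exact (reprMeasure_neg h0.ne').symm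
  · simp only [sgMap, sgn, if_true, one_mul]
    exact map_invRepr h0 h1

theorem mixP_mem_nearSet {r δ : ℝ} (h0 : 0 < r) (h1 : r ≤ 1 / 2) (s : Bool)
    {μ : ProbabilityMeasure Par} (hs : μ ∈ suppIn (-2 / 3) (2 / 3))
    (h : ∀ f : Par → ℝ, IsTest f → |∫ y, f y ∂(μ : Measure Par) - ∫ y, f y ∂invRepr r| ≤ δ / 2) :
    mixP (reflP s μ) ∈ nearSet (sgn s * r) δ := by
  have := isProbabilityMeasure_invRepr h0 h1
  have hsm := (continuous_sgMap s).measurable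
  have := Measure.isProbabilityMeasure_map (μ := (μ : Measure Par)) hsm.aemeasurable
  have := Measure.isProbabilityMeasure_map (μ := invRepr r) hsm.aemeasurable
  refine ⟨(reflP s μ : Measure Par).map Subtype.val, ⟨?_, ?_⟩, mix_eq_withDensity _, ?_⟩
  · exact Measure.isProbabilityMeasure_map measurable_subtype_coe.aemeasurable
  · rw [coe_reflP, Measure.map_apply measurable_subtype_coe measurableSet_Icc.compl,
      Measure.map_apply hsm (measurable_subtype_coe measurableSet_Icc.compl)]
    refine measure_mono_null ?_ (mem_suppIn.1 hs)
    intro y hy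
    change ¬ (y : ℝ) ∈ Icc (-2 / 3) (2 / 3)
    intro hy'
    refine hy ?_
    rw [coe_sgMap]
    have := sgn_mul_mem (ε := 2 / 3) s (t := y) (by rwa [← neg_div])
    rwa [← neg_div] at this
  · rw [← map_sgMap_invRepr h0 h1 s, coe_reflP]
    have := wasserstein_le (fun f hf => abs_integral_sgMap_sub_le h s hf)
    linarith

theorem abs_integral_sub_invRepr_le {R S r : ℝ} (hR : 0 < R) (hRr : R ≤ r) (hrS : r ≤ S)
    (hS : S ≤ 1 / 2) {μ : ProbabilityMeasure Par} (h : μ ∈ between R S 0) {f : Par → ℝ}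
    (hf : IsTest f) : |∫ y, f y ∂(μ : Measure Par) - ∫ y, f y ∂invRepr r| ≤ 9 * (S - R) := by
  have h1 := h f hf
  have h2 := invRepr_mono hR hRr (hrS.trans hS) hf
  have h3 := invRepr_mono (hR.trans_le hRr) hrS hS hf
  rw [abs_le]
  constructor <;> linarith [h1.1, h1.2, h2.1, h2.2, h3.1, h3.2]

theorem fld_one_le : fld 1 ≤ 1 / 3 := by
  have h1 : (1 : ℝ) ∈ Par := by norm_num
  unfold fld
  calc _ ≤ ∫ x in (-1 / 2 : ℝ)..(1 / 2), 2 * (1 / 4 - x ^ 2) := by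
        refine intervalIntegral.integral_mono_on (by norm_num)
          (intervalIntegrable_of_continuousOn_site (continuousOn_fld_integrand h1))
          (Continuous.intervalIntegrable (by fun_prop) _ _) fun x hx => ?_
        have h2 := one_sub_mul_pos hx h1
        rw [mul_comm]
        refine mul_le_mul_of_nonneg_right ?_ (by nlinarith [hx.1, hx.2])
        rw [div_le_iff₀ (by linarith)]; linarith
    _ = _ := by rw [intervalIntegral.integral_const_mul, integral_quarter_sub_sq]; norm_num

theorem abs_phi_le (μ : ProbabilityMeasure Par) : |phi μ| ≤ 1 / 3 := by
  have h1 : (1 : ℝ) ∈ Par := by norm_num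
  have h2 : (-1 : ℝ) ∈ Par := by norm_num
  have h := phi_mem_of_suppIn h2 h1 (μ := μ) (by rw [suppIn_univ]; trivial)
  rw [fld_neg] at h
  rw [abs_le]
  constructor <;> linarith [fld_one_le, h.1, h.2]

theorem phiInv_le {r : ℝ} (h0 : 0 < r) (h1 : r ≤ 1 / 2) : phiInv r ≤ 1 / 3 := by
  have := isProbabilityMeasure_invRepr h0 h1
  exact (abs_le.1 (abs_phi_le ⟨invRepr r, this⟩)).2

/-! ### Concentration of stationary measures of the infinite-size system -/

theorem highEnd_two_fifths {r b : ℝ} (hr : |r| ≤ 1 / 2) (hr' : r ≤ 2 / 5) (hb : b ∈ Icc (2 / 3 : ℝ) 1) :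
    highEnd r b - 2 / 3 ≤ 4 / 5 * (b - 2 / 3) := by
  have hbP : b ∈ Par := ⟨by linarith [hb.1], hb.2⟩
  have h25 : |(2 / 5 : ℝ)| ≤ 1 / 2 := by rw [abs_of_pos] <;> norm_num
  have h1 : highEnd r b ≤ highEnd (2 / 5) b :=
    highImg_le (abs_comb_le hr hbP) (abs_comb_le h25 hbP) (comb_mono_left hr h25 hbP hr')
  refine (sub_le_sub_right h1 _).trans ?_
  have h3 := highEnd_den_pos h25 hbP
  rw [highEnd_eq h25 hbP, sub_le_iff_le_add, div_le_iff₀ (by linarith)]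
  nlinarith [hb.1, hb.2, mul_nonneg (sub_nonneg.2 hb.1) (sub_nonneg.2 hb.2)]

/-- If all parameters are at most `2 / 5`, the representing measures end up on `[_, 2 / 3]`. -/
theorem StatSetting.ae_suppIn {G : ℝ → ℝ} {ϱ : Measure ℝ} {ε : ℝ}
    {Q : Measure (ProbabilityMeasure Site)} (h : StatSetting G ϱ ε Q) {y₀ : ℝ} (hy₀ : y₀ ∈ Ioc (0 : ℝ) 1)
    (habs : ∀ μ ∈ suppIn y₀ 1, ∀ t ∈ Icc (-ε) ε, ∀ μ', Steps (G (phi μ + t)) μ μ' →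
      μ' ∈ suppIn y₀ 1)
    (hQ : ∀ᵐ ν ∂Q, ν ∈ repSet (suppIn y₀ 1))
    (hr : ∀ μ : ProbabilityMeasure Par, ∀ t ∈ Icc (-ε) ε, G (phi μ + t) ≤ 2 / 5) :
    ∀ᵐ ν ∂Q, ν ∈ repSet (suppIn y₀ (2 / 3)) := by
  set b : ℕ → ℝ := fun n => 2 / 3 + 1 / 3 * (4 / 5 : ℝ) ^ n with hbdef
  have hb : ∀ n, b n ∈ Icc (2 / 3 : ℝ) 1 := fun n => by
    have h1 : (4 / 5 : ℝ) ^ n ≤ 1 := pow_le_one₀ (by norm_num) (by norm_num)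
    have h2 : (0 : ℝ) ≤ (4 / 5 : ℝ) ^ n := by positivity
    constructor <;> simp only [hbdef] <;> linarith
  have hinter : ∀ {a b c : ℝ} {μ : ProbabilityMeasure Par}, c ≤ 1 → μ ∈ suppIn a 1 →
      μ ∈ suppIn b c → μ ∈ suppIn a c := fun _ h1 h2 => by
    rw [mem_suppIn] at *
    filter_upwards [h1, h2] with y a b
    exact ⟨a.1, b.2⟩
  have key : ∀ n, ∀ᵐ ν ∂Q, ν ∈ repSet (suppIn y₀ (b n)) := by
    intro n
    induction n with
    | zero =>
      have : b 0 = 1 := by simp only [hbdef]; norm_num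
      rw [this]; exact hQ
    | succ n ih =>
      refine h.ae_repSet_step (isClosed_suppIn _ _) ih fun μ hμ t ht μ' hs => ?_
      have hG := h.nice.bound (phi μ + t)
      have h1 := habs μ (suppIn_mono le_rfl (hb n).2 hμ) t ht μ' hs
      have hbP : b n ∈ Par := ⟨by linarith [(hb n).1], (hb n).2⟩
      have h2 := suppIn_step (a := y₀) ⟨by linarith [hy₀.1], hy₀.2⟩ hbP hG hμ hs
      refine hinter (hb _).2 h1 (suppIn_mono le_rfl ?_ h2)
      have := highEnd_two_fifths hG (hr μ t ht) (hb n)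
      simp only [hbdef, pow_succ] at this ⊢
      linarith
  filter_upwards [ae_all_iff.2 key] with ν hν
  obtain ⟨p, hp, rfl⟩ := mem_repSet_iInter (fun n => isClosed_suppIn y₀ (b n)) (fun m n hmn =>
    suppIn_mono le_rfl (by
      have : (4 / 5 : ℝ) ^ n ≤ (4 / 5 : ℝ) ^ m :=
        pow_le_pow_of_le_one (by norm_num) (by norm_num) hmn
      simp only [hbdef]; linarith)) hν
  refine ⟨p, ?_, rfl⟩
  change p.2 ∈ suppIn y₀ (2 / 3)
  have h1 : ∀ n, p.2 ∈ suppIn y₀ (b n) := fun n => mem_iInter.1 hp n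
  simp only [mem_suppIn] at h1 ⊢
  filter_upwards [ae_all_iff.2 h1] with y hy
  refine ⟨(hy 0).1, ?_⟩
  have hlim : Tendsto b atTop (𝓝 (2 / 3)) := by
    have := ((tendsto_pow_atTop_nhds_zero_of_lt_one (by norm_num : (0 : ℝ) ≤ 4 / 5)
      (by norm_num)).const_mul (1 / 3)).const_add (2 / 3)
    simpa [hbdef] using this
  exact ge_of_tendsto' hlim fun n => (hy n).2

/-- The concentration statement, in terms of the one-dimensional map `r ↦ G (phiInv r)`. -/
theorem StatSetting.concentrate {G : ℝ → ℝ} {ϱ : Measure ℝ} {ε : ℝ}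
    {Q : Measure (ProbabilityMeasure Site)} (h : StatSetting G ϱ ε Q) {y₀ : ℝ} (hy₀ : y₀ ∈ Ioc (0 : ℝ) 1)
    (habs : ∀ μ ∈ suppIn y₀ 1, ∀ t ∈ Icc (-ε) ε, ∀ μ', Steps (G (phi μ + t)) μ μ' →
      μ' ∈ suppIn y₀ 1)
    (hQ : ∀ᵐ ν ∂Q, ν ∈ repSet (suppIn y₀ 1))
    (hr : ∀ μ : ProbabilityMeasure Par, ∀ t ∈ Icc (-ε) ε, G (phi μ + t) ≤ 2 / 5)
    {R₀ η rs κ : ℝ} (hR₀ : 0 < R₀) (hr0 : R₀ ≤ G (fld y₀ - ε)) (hη : 0 < η) (hκ : 0 < κ)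
    (hR₀' : R₀ ≤ rs - η) (hrs : rs + η ≤ 2 / 5)
    (hlow : ∀ r ∈ Icc R₀ (rs - η), r + κ ≤ G (phiInv r - ε))
    (hhigh : ∀ r ∈ Icc (rs + η) (2 / 5), G (phiInv r + ε) ≤ r - κ) :
    ∀ᵐ ν ∂Q, ν ∈ repSet (suppIn y₀ (2 / 3) ∩ between (rs - η) (rs + η) 0) := by
  have h1 := h.ae_suppIn hy₀ habs hQ hr
  have hyP : y₀ ∈ Par := ⟨by linarith [hy₀.1], hy₀.2⟩
  have h1P : (1 : ℝ) ∈ Par := by norm_num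
  have h23 : (2 / 3 : ℝ) ∈ Icc (2 / 3 : ℝ) 1 := by norm_num
  have h23P : (2 / 3 : ℝ) ∈ Par := by norm_num
  have habs' : ∀ μ ∈ suppIn y₀ (2 / 3), ∀ t ∈ Icc (-ε) ε, ∀ μ', Steps (G (phi μ + t)) μ μ' →
      μ' ∈ suppIn y₀ (2 / 3) := by
    intro μ hμ t ht μ' hs
    have hG := h.nice.bound (phi μ + t)
    have h2 := mem_suppIn.1 (habs μ (suppIn_mono le_rfl (by norm_num) hμ) t ht μ' hs)
    have h3 := mem_suppIn.1 (suppIn_step hyP h23P hG hμ hs)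
    have h4 := highEnd_two_fifths hG (hr μ t ht) h23
    rw [mem_suppIn]
    filter_upwards [h2, h3] with y a b
    exact ⟨a.1, b.2.trans (by linarith)⟩
  have hM := isClosed_suppIn y₀ (2 / 3)
  have h2 := h.ae_between hM h1 habs' hR₀ (by linarith : R₀ ≤ 2 / 5) (by norm_num)
    fun μ hμ t ht => ⟨hr0.trans (h.nice.mono (by
      linarith [(phi_mem_of_suppIn hyP h23P hμ).1, ht.1])), hr μ t ht⟩
  have key : ∀ n : ℕ, ∀ᵐ ν ∂Q, ν ∈ repSet (suppIn y₀ (2 / 3) ∩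
      between (min (rs - η) (R₀ + n * κ)) (max (rs + η) (2 / 5 - n * κ)) 0) := by
    intro n
    induction n with
    | zero =>
      rw [Nat.cast_zero, zero_mul, add_zero, sub_zero, min_eq_right hR₀', max_eq_right hrs]
      exact h2
    | succ n ih =>
      have hn : 0 ≤ (n : ℝ) * κ := by positivity
      set R := min (rs - η) (R₀ + n * κ)
      set S := max (rs + η) (2 / 5 - n * κ)
      have hR : R ∈ Icc R₀ (rs - η) := ⟨le_min hR₀' (by linarith), min_le_left _ _⟩
      have hS : S ∈ Icc (rs + η) (2 / 5) := ⟨le_max_left _ _, max_le hrs (by linarith)⟩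
      refine h.narrow hM habs' (R := R) (S := S) (hR₀.trans_le hR.1)
        (min_le_min le_rfl (by push_cast; linarith)) ?_ (max_le_max le_rfl (by push_cast; linarith))
        (by linarith [hS.2]) ?_ ?_ ih
      · exact (min_le_left _ _).trans ((by linarith : rs - η ≤ rs + η).trans (le_max_left _ _))
      · refine le_trans ?_ (hlow R hR)
        rcases min_choice (rs - η) (R₀ + n * κ) with e | e
        · exact (min_le_left _ _).trans (by simp only [R]; rw [e]; linarith)
        · refine (min_le_right _ _).trans ?_
          simp only [R]; rw [e]; push_cast; linarith
      · refine (hhigh S hS).trans ?_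
        rcases max_choice (rs + η) (2 / 5 - n * κ) with e | e
        · refine le_trans ?_ (le_max_left _ _)
          simp only [S]; rw [e]; linarith
        · refine le_trans ?_ (le_max_right _ _)
          simp only [S]; rw [e]; push_cast; linarith
  obtain ⟨n, hn⟩ := exists_nat_gt (1 / κ)
  rw [div_lt_iff₀ hκ] at hn
  have := key n
  rwa [min_eq_left (by linarith), max_eq_left (by linarith)] at this

/-! ### The extension of the feedback function -/

/-- The properties of the feedback function on a slightly larger interval `[-b, b]`. -/
structure FeedbackOn (G : ℝ → ℝ) (b : ℝ) : Prop where
  half_lt : 1 / 2 < b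
  analytic : ∀ x ∈ Icc (-b) b, AnalyticAt ℝ G x
  deriv_pos : ∀ x ∈ Icc (-b) b, 0 < deriv G x
  deriv_le : ∀ x ∈ Icc (-b) b, deriv G x ≤ 51 / 2 - 50 * |G x|
  bound : ∀ x ∈ Icc (-b) b, |G x| ≤ 41 / 100
  odd : ∀ x ∈ Icc (-b) b, G (-x) = -G x

theorem IsFeedback.abs_le {G : ℝ → ℝ} (hG : IsFeedback G) {x : ℝ} (hx : x ∈ Site) :
    |G x| ≤ 2 / 5 := by
  have := hG.mapsTo hx
  exact _root_.abs_le.2 ⟨by linarith [this.1], this.2⟩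

theorem IsFeedback.exists_feedbackOn {G : ℝ → ℝ} (hG : IsFeedback G)
    (hI : ∀ x ∈ Site, deriv G x ≤ 25 - 50 * |G x|) : ∃ b, FeedbackOn G b := by
  have hev : ∀ x ∈ Site, ∀ᶠ y in 𝓝 x, AnalyticAt ℝ G y ∧ 0 < deriv G y ∧
      deriv G y < 51 / 2 - 50 * |G y| ∧ |G y| < 41 / 100 := by
    intro x hx
    have ha := hG.analytic x hx
    have hd : ContinuousAt (deriv G) x := ha.deriv.continuousAt
    have hc := ha.continuousAt
    have h1 := ha.eventually_analyticAt
    have h2 := hd.eventually_const_lt (hG.sShaped.1 x hx)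
    have h3 : ∀ᶠ y in 𝓝 x, deriv G y < 51 / 2 - 50 * |G y| :=
      hd.eventually_lt (continuousAt_const.sub (continuousAt_const.mul hc.abs))
        (by linarith [hI x hx])
    have h4 := hc.abs.eventually_lt_const (by linarith [hG.abs_le hx] : |G x| < 41 / 100)
    filter_upwards [h1, h2, h3, h4] with y a b c d
    exact ⟨a, b, c, d⟩
  obtain ⟨e1, he1, h1⟩ := Metric.eventually_nhds_iff.1 (hev (1 / 2) (by norm_num))
  obtain ⟨e2, he2, h2⟩ := Metric.eventually_nhds_iff.1 (hev (-1 / 2) (by norm_num))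
  set b := 1 / 2 + min e1 e2 / 2 with hb
  have hm : 0 < min e1 e2 := lt_min he1 he2
  have hm1 := min_le_left e1 e2
  have hm2 := min_le_right e1 e2
  have key : ∀ x ∈ Icc (-b) b, AnalyticAt ℝ G x ∧ 0 < deriv G x ∧
      deriv G x < 51 / 2 - 50 * |G x| ∧ |G x| < 41 / 100 := by
    intro x hx
    rcases lt_or_ge (1 / 2) x with h | h
    · refine h1 ?_
      rw [Real.dist_eq, abs_of_pos (by linarith)]
      linarith [hx.2]
    rcases lt_or_ge x (-1 / 2) with h' | h'
    · refine h2 ?_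
      rw [Real.dist_eq, abs_of_neg (by linarith)]
      linarith [hx.1]
    · exact (hev x ⟨h', h⟩).self_of_nhds
  refine ⟨b, by linarith, fun x hx => (key x hx).1, fun x hx => (key x hx).2.1,
    fun x hx => (key x hx).2.2.1.le, fun x hx => (key x hx).2.2.2.le, fun x hx => ?_⟩
  have hneg : ∀ x ∈ Icc (-b) b, -x ∈ Icc (-b) b := fun x hx =>
    ⟨by linarith [hx.2], by linarith [hx.1]⟩
  have han : AnalyticOnNhd ℝ (fun x => G (-x) + G x) (Icc (-b) b) := fun x hx =>
    ((key (-x) (hneg x hx)).1.comp_of_eq (analyticAt_id.neg) rfl).add (key x hx).1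
  have hz : (fun x => G (-x) + G x) =ᶠ[𝓝 0] 0 := by
    filter_upwards [Icc_mem_nhds (by norm_num : (-1 / 2 : ℝ) < 0) (by norm_num : (0 : ℝ) < 1 / 2)]
      with x hx
    simp only [Pi.zero_apply]
    rw [hG.sShaped.2.1 x hx]; ring
  have := han.eqOn_zero_of_preconnected_of_eventuallyEq_zero isPreconnected_Icc
    (⟨by linarith, by linarith⟩ : (0 : ℝ) ∈ Icc (-b) b) hz hx
  simp only [Pi.zero_apply] at this
  linarith

/-- The feedback function, made constant outside `[-b, b]`. -/
noncomputable def clipG (G : ℝ → ℝ) (b x : ℝ) : ℝ := G (max (-b) (min b x))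

theorem clipG_of_mem {G : ℝ → ℝ} {b x : ℝ} (hx : x ∈ Icc (-b) b) : clipG G b x = G x := by
  unfold clipG; rw [min_eq_right hx.2, max_eq_right hx.1]

theorem FeedbackOn.clip_mem {G : ℝ → ℝ} {b : ℝ} (h : FeedbackOn G b) (x : ℝ) :
    max (-b) (min b x) ∈ Icc (-b) b :=
  ⟨le_max_left _ _, max_le (by linarith [h.half_lt]) (min_le_left _ _)⟩

theorem FeedbackOn.continuousOn {G : ℝ → ℝ} {b : ℝ} (h : FeedbackOn G b) :
    ContinuousOn G (Icc (-b) b) := fun x hx => (h.analytic x hx).continuousAt.continuousWithinAt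

theorem FeedbackOn.strictMonoOn {G : ℝ → ℝ} {b : ℝ} (h : FeedbackOn G b) :
    StrictMonoOn G (Icc (-b) b) :=
  strictMonoOn_of_deriv_pos (convex_Icc _ _) h.continuousOn fun x hx =>
    h.deriv_pos x (interior_subset hx)

theorem FeedbackOn.nice {G : ℝ → ℝ} {b : ℝ} (h : FeedbackOn G b) : Nice (clipG G b) where
  cont := h.continuousOn.comp_continuous (by fun_prop) h.clip_mem
  mono := fun x y hxy => h.strictMonoOn.monotoneOn (h.clip_mem x) (h.clip_mem y)
    (max_le_max le_rfl (min_le_min le_rfl hxy))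
  odd := fun x => by
    unfold clipG
    rw [← h.odd _ (h.clip_mem x)]
    congr 1
    have hb := h.half_lt
    rcases le_total x b with h1 | h1 <;> rcases le_total (-b) x with h2 | h2
    · rw [min_eq_right h1, max_eq_right h2, min_eq_right (by linarith), max_eq_right (by linarith)]
    · rw [min_eq_right h1, max_eq_left h2, min_eq_left (by linarith), max_eq_right (by linarith)]
      ring
    · rw [min_eq_left h1, max_eq_right (by linarith : -b ≤ b), min_eq_right (by linarith),
        max_eq_left (by linarith)]
    · linarith
  bound := fun x => (h.bound _ (h.clip_mem x)).trans (by norm_num)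

theorem FeedbackOn.lipschitz {G : ℝ → ℝ} {b : ℝ} (h : FeedbackOn G b) (x y : ℝ) :
    |clipG G b x - clipG G b y| ≤ 26 * |x - y| := by
  have h1 := (convex_Icc (-b) b).norm_image_sub_le_of_norm_deriv_le (f := G) (C := 26)
    (fun x hx => (h.analytic x hx).differentiableAt) (fun x hx => by
      rw [Real.norm_eq_abs, abs_of_pos (h.deriv_pos x hx)]
      linarith [h.deriv_le x hx, abs_nonneg (G x)]) (h.clip_mem y) (h.clip_mem x)
  refine h1.trans ?_
  refine mul_le_mul_of_nonneg_left ?_ (by norm_num)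
  refine (abs_max_sub_max_le_max _ _ _ _).trans ?_
  rw [sub_self, abs_zero]
  refine max_le (abs_nonneg _) ((abs_min_sub_min_le_max _ _ _ _).trans ?_)
  rw [sub_self, abs_zero]
  exact max_le (abs_nonneg _) le_rfl

/-! ### The one-dimensional map -/

theorem fieldOfDensity_mem {r : ℝ} (h0 : 0 < r) (h1 : r < 2 / 3) :
    fieldOfDensity (invDensity r) ∈ Site := by
  have hc := logConst_pos h0 h1
  have hA : ∀ x ∈ uIcc (-1 / 2 : ℝ) (1 / 2), 0 < 1 - r - r * x ∧ 0 < 1 + r - r * x := by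
    intro x hx
    rw [site_eq_uIcc] at hx
    constructor <;> nlinarith [hx.1, hx.2]
  have hu : ∀ x ∈ uIcc (-1 / 2 : ℝ) (1 / 2), invDensity r x =
      (logConst r)⁻¹ * (r / (1 - r - r * x) - r / (1 + r - r * x)) := by
    intro x hx
    obtain ⟨a, b⟩ := hA x hx
    unfold invDensity
    rw [if_neg h0.ne', div_sub_div _ _ a.ne' b.ne']
    congr 1
    rw [show (r * x - (1 - r)) * (r * x - (1 + r)) = (1 - r - r * x) * (1 + r - r * x) by ring]
    congr 1; ring
  have hcont : ContinuousOn (invDensity r) (uIcc (-1 / 2 : ℝ) (1 / 2)) := by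
    refine ContinuousOn.congr ?_ hu
    refine continuousOn_const.mul (ContinuousOn.sub ?_ ?_)
    · exact ContinuousOn.div continuousOn_const (by fun_prop) fun x hx => (hA x hx).1.ne'
    · exact ContinuousOn.div continuousOn_const (by fun_prop) fun x hx => (hA x hx).2.ne'
  have hpos : ∀ x ∈ uIcc (-1 / 2 : ℝ) (1 / 2), 0 ≤ invDensity r x := by
    intro x hx
    obtain ⟨a, b⟩ := hA x hx
    rw [hu x hx]
    refine mul_nonneg (inv_nonneg.2 hc.le) (sub_nonneg.2 ?_)
    exact div_le_div_of_nonneg_left h0.le a (by linarith)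
  have hint : ∫ x in (-1 / 2 : ℝ)..(1 / 2), invDensity r x = 1 := by
    have hd : ∀ x ∈ uIcc (-1 / 2 : ℝ) (1 / 2), HasDerivAt (fun x =>
        (logConst r)⁻¹ * (Real.log (1 + r - r * x) - Real.log (1 - r - r * x)))
        (invDensity r x) x := by
      intro x hx
      obtain ⟨a, b⟩ := hA x hx
      rw [hu x hx]
      have d1 := (((hasDerivAt_id x).const_mul r).const_sub (1 + r)).log b.ne'
      have d2 := (((hasDerivAt_id x).const_mul r).const_sub (1 - r)).log a.ne'
      refine ((d1.sub d2).const_mul (logConst r)⁻¹).congr_deriv ?_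
      simp only [id]; ring
    rw [intervalIntegral.integral_eq_sub_of_hasDerivAt hd hcont.intervalIntegrable, ← mul_sub]
    have e : Real.log (1 + r - r * (1 / 2)) - Real.log (1 - r - r * (1 / 2)) -
        (Real.log (1 + r - r * (-1 / 2)) - Real.log (1 - r - r * (-1 / 2))) = logConst r := by
      obtain ⟨a1, b1⟩ := hA (1 / 2) right_mem_uIcc
      obtain ⟨a2, b2⟩ := hA (-1 / 2) left_mem_uIcc
      rw [← Real.log_div b1.ne' a1.ne', ← Real.log_div b2.ne' a2.ne',
        ← Real.log_div (div_pos b1 a1).ne' (div_pos b2 a2).ne']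
      unfold logConst
      rw [logConst_arg, div_div_div_eq]
      congr 1
      rw [div_eq_div_iff (mul_pos a1 b2).ne' (by nlinarith)]
      ring
    rw [e, inv_mul_cancel₀ hc.ne']
  have hi := hcont.intervalIntegrable (μ := volume)
  have hix : IntervalIntegrable (fun x => x * invDensity r x) volume (-1 / 2) (1 / 2) :=
    (continuousOn_id.mul hcont).intervalIntegrable
  unfold fieldOfDensity
  rw [setIntegral_site]
  constructor
  · have := intervalIntegral.integral_mono_on (by norm_num : (-1 / 2 : ℝ) ≤ 1 / 2)
      (hi.const_mul (-1 / 2)) hix fun x hx =>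
        mul_le_mul_of_nonneg_right hx.1 (hpos x (by rwa [site_eq_uIcc]))
    rwa [intervalIntegral.integral_const_mul, hint, mul_one] at this
  · have := intervalIntegral.integral_mono_on (by norm_num : (-1 / 2 : ℝ) ≤ 1 / 2)
      hix (hi.const_mul (1 / 2)) fun x hx =>
        mul_le_mul_of_nonneg_right hx.2 (hpos x (by rwa [site_eq_uIcc]))
    rwa [intervalIntegral.integral_const_mul, hint, mul_one] at this

theorem SShapedOn.continuousOn {f : ℝ → ℝ} {s : Set ℝ} (h : SShapedOn f s) : ContinuousOn f s :=
  fun x hx => (differentiableAt_of_deriv_ne_zero (h.1 x hx).ne').continuousAt.continuousWithinAt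

theorem SShapedOn.strictConcaveOn {f : ℝ → ℝ} {c : ℝ} (hc : 0 < c) (h : SShapedOn f (Icc (-c) c)) :
    StrictConcaveOn ℝ (Icc 0 c) f := by
  have hsub : Icc 0 c ⊆ Icc (-c) c := Icc_subset_Icc_left (by linarith)
  refine strictConcaveOn_of_deriv2_neg (convex_Icc _ _) (h.continuousOn.mono hsub) fun x hx => ?_
  rw [interior_Icc] at hx
  exact h.2.2 x (hsub (Ioo_subset_Icc_self hx)) hx.1

/-- An S-shaped function lies above the diagonal to the left of a positive fixed point and below it
to the right. -/
theorem SShapedOn.compare {f : ℝ → ℝ} {c p : ℝ} (h : SShapedOn f (Icc (-c) c)) (hp : 0 < p)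
    (hpc : p ≤ c) (hf : f p = p) : (∀ r ∈ Ioo 0 p, r < f r) ∧ ∀ r ∈ Ioc p c, f r < r := by
  have hc := hp.trans_le hpc
  have hconc := h.strictConcaveOn hc
  have h0 : f 0 = 0 := by
    have := h.2.1 0 ⟨by linarith, hc.le⟩
    rw [neg_zero] at this; linarith
  have key : ∀ r s, 0 < r → r < s → s ≤ c → r / s * f s < f r := by
    intro r s hr hrs hs
    have hs0 := hr.trans hrs
    have := hconc.2 (⟨le_rfl, hc.le⟩ : (0 : ℝ) ∈ Icc 0 c) (⟨hs0.le, hs⟩ : s ∈ Icc 0 c) hs0.ne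
      (sub_pos.2 ((div_lt_one hs0).2 hrs)) (div_pos hr hs0) (sub_add_cancel _ _)
    simp only [smul_eq_mul, h0, mul_zero, zero_add] at this
    rwa [div_mul_cancel₀ _ hs0.ne'] at this
  constructor
  · intro r hr
    have := key r p hr.1 hr.2 hpc
    rwa [hf, div_mul_cancel₀ _ hp.ne'] at this
  · intro r hr
    have h1 := key p r hp hr.1 hr.2
    have hr0 := hp.trans hr.1
    rw [hf, div_mul_eq_mul_div, div_lt_iff₀ hr0] at h1
    exact lt_of_mul_lt_mul_left h1 hp.le

theorem field_mem (ν : ProbabilityMeasure Site) : field ν ∈ Site := by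
  have hi := integrable_of_continuous (f := fun x : Site => (x : ℝ)) continuous_subtype_val
    (ν : Measure Site)
  unfold field
  constructor
  · simpa using integral_mono (integrable_const (-1 / 2 : ℝ)) hi fun x => x.2.1
  · simpa using integral_mono hi (integrable_const (1 / 2 : ℝ)) fun x => x.2.2

theorem isStationary_noisyStep_clip {G : ℝ → ℝ} {b ε : ℝ}
    (hε : ε ≤ b - 1 / 2) {ϱ : Measure ℝ} (hϱ : ϱ (Icc (-ε) ε)ᶜ = 0)
    {Q : Measure (ProbabilityMeasure Site)} :
    IsStationary (noisyStep (clipG G b)) ϱ Q ↔ IsStationary (noisyStep G) ϱ Q := by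
  have key : ∀ A : Set (ProbabilityMeasure Site), ∀ ν,
      ϱ {t | noisyStep (clipG G b) ν t ∈ A} = ϱ {t | noisyStep G ν t ∈ A} := by
    intro A ν
    refine measure_congr ?_
    have h1 : ∀ᵐ t ∂ϱ, t ∈ Icc (-ε) ε := hϱ
    filter_upwards [h1] with t ht
    have h2 := field_mem ν
    have h3 : field ν + t ∈ Icc (-b) b := ⟨by linarith [h2.1, ht.1], by linarith [h2.2, ht.2]⟩
    change (noisyStep (clipG G b) ν t ∈ A) = (noisyStep G ν t ∈ A)
    have h4 : noisyStep (clipG G b) ν t = noisyStep G ν t := by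
      apply Subtype.ext
      change Measure.map (siteMap (clipG G b (field ν + t))) _ =
        Measure.map (siteMap (G (field ν + t))) _
      rw [clipG_of_mem h3]
    rw [h4]
  unfold IsStationary
  simp only [key]

theorem exists_entry_slope {G : ℝ → ℝ} (hd : DifferentiableAt ℝ G 0) (h0 : G 0 = 0)
    (hB : 6 < deriv G 0) {b : ℝ} (hmono : StrictMonoOn G (Icc (-b) b)) (hb : 1 / 2 < b) :
    ∃ y₁ ∈ Ioo (0 : ℝ) (1 / 2), ∀ y ∈ Ioc 0 y₁, y / (1 - y) < G (fld y) := by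
  set k := (6 + deriv G 0) / 2 with hk
  have hk6 : 6 < k := by rw [hk]; linarith
  have hslope := (hasDerivAt_iff_tendsto_slope.1 hd.hasDerivAt).eventually_const_lt
    (show k < deriv G 0 by rw [hk]; linarith)
  obtain ⟨e, he, hes⟩ := Metric.eventually_nhds_iff.1 (eventually_nhdsWithin_iff.1 hslope)
  have hsmall : 0 < 1 - 6 / k := by rw [sub_pos, div_lt_one (by linarith)]; exact hk6
  set y₁ := min (min e (1 / 4)) ((1 - 6 / k) / 2) with hy₁
  have hy1 : 0 < y₁ := lt_min (lt_min he (by norm_num)) (by linarith)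
  have l1 : y₁ ≤ e := (min_le_left _ _).trans (min_le_left _ _)
  have l2 : y₁ ≤ 1 / 4 := (min_le_left _ _).trans (min_le_right _ _)
  have l3 : y₁ ≤ (1 - 6 / k) / 2 := min_le_right _ _
  refine ⟨y₁, ⟨hy1, by linarith⟩, fun y hy => ?_⟩
  have hyI : y ∈ Icc (0 : ℝ) 1 := ⟨hy.1.le, by linarith [hy.2]⟩
  have hyP : y ∈ Par := ⟨by linarith [hy.1], hyI.2⟩
  have h1 : k < slope G 0 (y / 6) := hes (by
    rw [Real.dist_eq, sub_zero, abs_of_pos (by linarith [hy.1])]; linarith [hy.1, hy.2]) (by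
      simp only [mem_compl_iff, mem_singleton_iff]; linarith [hy.1])
  rw [slope_def_field, h0, sub_zero, sub_zero, lt_div_iff₀ (by linarith [hy.1])] at h1
  have h2 := le_fld hyI
  have h3 := (abs_le.1 (abs_fld_le hyP)).2
  rw [abs_of_pos hy.1] at h3
  have h4 : G (y / 6) ≤ G (fld y) := hmono.monotoneOn
    ⟨by linarith [hy.1], by linarith [hy.2]⟩ ⟨by linarith [hy.1], by linarith [hy.2]⟩ h2
  refine lt_of_lt_of_le ?_ (h1.le.trans h4)
  rw [div_lt_iff₀ (by linarith [hy.2])]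
  have h5 : 6 / k < 1 - y := by linarith [hy.2]
  rw [div_lt_iff₀ (by linarith)] at h5
  nlinarith [hy.1]

/-- Concentration of the absolutely continuous stationary measures of the infinite-size system near
the two states `u_{±r}`, `r` the positive fixed point of `feedbackH G`, for small noise. -/
theorem exists_noise_bound {G : ℝ → ℝ} (hG : IsFeedback G) {b : ℝ} (hb : FeedbackOn G b)
    (hII : SShapedOn (feedbackH G) (Icc (-2 / 5) (2 / 5))) (hB : 6 < deriv G 0) {rs : ℝ}
    (hrs_pos : 0 < rs) (hrs_lt : rs < 2 / 3) (hrs : feedbackH G rs = rs) {δ : ℝ} (hδ : 0 < δ) :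
    ∃ ε₀ : ℝ, 0 < ε₀ ∧ ε₀ ≤ b - 1 / 2 ∧ ∀ ε : ℝ, 0 < ε → ε < ε₀ → ∀ ϱ : Measure ℝ, IsNoise ϱ ε →
      ∀ Q : Measure (ProbabilityMeasure Site), IsProbabilityMeasure Q →
        IsStationary (noisyStep G) ϱ Q → (∀ᵐ ν : ProbabilityMeasure Site ∂Q, (ν : Measure Site) ≪ leb) →
        ∀ᵐ ν ∂Q, (field ν < 0 ∧ ν ∈ nearSet (-rs) δ) ∨ (0 < field ν ∧ ν ∈ nearSet rs δ) := by
  have hb2 := hb.half_lt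
  have hnice := hb.nice
  have hclip : ∀ x ∈ Icc (-1 / 2 : ℝ) (1 / 2), clipG G b x = G x := fun x hx =>
    clipG_of_mem ⟨by linarith [hx.1], by linarith [hx.2]⟩
  have hI : ∀ {x}, x ∈ Site → x ∈ Icc (-b) b := fun hx => ⟨by linarith [hx.1], by linarith [hx.2]⟩
  have hG0 : G 0 = 0 := by
    have := hb.odd 0 ⟨by linarith, by linarith⟩
    rw [neg_zero] at this; linarith
  have hrs25 : rs < 2 / 5 := by
    have h1 : rs ≤ 2 / 5 := by
      rw [← hrs]
      exact (abs_le.1 (hG.abs_le (fieldOfDensity_mem hrs_pos hrs_lt))).2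
    have h2 : phiInv rs ≤ 1 / 3 := phiInv_le hrs_pos (by linarith)
    have h3 : fieldOfDensity (invDensity rs) = phiInv rs :=
      fieldOfDensity_invDensity hrs_pos (by linarith)
    have h4 := fieldOfDensity_mem hrs_pos hrs_lt
    rw [← hrs]
    refine lt_of_lt_of_le (hb.strictMonoOn (hI h4) (hI ⟨by norm_num, le_rfl⟩) ?_)
      (abs_le.1 (hG.abs_le (x := 1 / 2) ⟨by norm_num, le_rfl⟩)).2
    rw [h3]; linarith
  rw [show (-2 / 5 : ℝ) = -(2 / 5) by norm_num] at hII
  obtain ⟨hbelow, habove⟩ := hII.compare hrs_pos hrs25.le hrs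
  have hH : ∀ r ∈ Ioc (0 : ℝ) (2 / 5), clipG G b (phiInv r) = feedbackH G r := by
    intro r hr
    have h3 : fieldOfDensity (invDensity r) = phiInv r :=
      fieldOfDensity_invDensity hr.1 (by linarith [hr.2])
    have h4 := fieldOfDensity_mem hr.1 (by linarith [hr.2])
    unfold feedbackH
    rw [h3] at h4 ⊢
    exact hclip _ h4
  set η := min (δ / 36) (min (rs / 2) (2 / 5 - rs)) with hη
  have hηpos : 0 < η := lt_min (by positivity) (lt_min (by linarith) (by linarith))
  have η1 : η ≤ δ / 36 := min_le_left _ _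
  have η2 : η ≤ rs / 2 := (min_le_right _ _).trans (min_le_left _ _)
  have η3 : η ≤ 2 / 5 - rs := (min_le_right _ _).trans (min_le_right _ _)
  obtain ⟨y₁, hy₁, hy⟩ := exists_entry_slope (hb.analytic 0 ⟨by linarith, by linarith⟩).differentiableAt
    hG0 hB hb.strictMonoOn hb2
  set y₀ := min y₁ (rs / 4) with hy₀
  have hy0 : 0 < y₀ := lt_min hy₁.1 (by linarith)
  have y1 : y₀ ≤ y₁ := min_le_left _ _
  have y2 : y₀ ≤ rs / 4 := min_le_right _ _
  have hfldS : ∀ y ∈ Ioc 0 y₀, fld y ∈ Site := fun y hyy => by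
    have h1 := abs_le.1 (abs_fld_le (y := y) ⟨by linarith [hyy.1], by linarith [hyy.2, hy₁.2]⟩)
    rw [abs_of_pos hyy.1] at h1
    constructor <;> linarith [h1.1, h1.2, hyy.2, hy₁.2]
  have hy' : ∀ y ∈ Ioc 0 y₀, y / (1 - y) < clipG G b (fld y) := fun y hyy => by
    rw [hclip _ (hfldS y hyy)]; exact hy y ⟨hyy.1, hyy.2.trans y1⟩
  set R₀ := y₀ / (1 - y₀) with hR₀
  have hR0 : 0 < R₀ := div_pos hy0 (by linarith [hy₁.2])
  have hR0' : R₀ ≤ rs - η := by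
    rw [hR₀, div_le_iff₀ (by linarith [hy₁.2])]; nlinarith [hy₁.2]
  have hcH : ContinuousOn (feedbackH G) (Icc (-(2 / 5)) (2 / 5)) := hII.continuousOn
  obtain ⟨z₁, hz₁, hmin₁⟩ := (isCompact_Icc (a := R₀) (b := rs - η)).exists_isMinOn ⟨R₀, le_rfl, hR0'⟩
    ((hcH.mono (Icc_subset_Icc (by linarith) (by linarith))).sub continuousOn_id)
  obtain ⟨z₂, hz₂, hmin₂⟩ := (isCompact_Icc (a := rs + η) (b := 2 / 5)).exists_isMinOn
    ⟨rs + η, le_rfl, by linarith⟩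
    (continuousOn_id.sub (hcH.mono (Icc_subset_Icc (by linarith) le_rfl)))
  have m1 : 0 < feedbackH G z₁ - z₁ :=
    sub_pos.2 (hbelow z₁ ⟨hR0.trans_le hz₁.1, by linarith [hz₁.2]⟩)
  have m2 : 0 < z₂ - feedbackH G z₂ := sub_pos.2 (habove z₂ ⟨by linarith [hz₂.1], hz₂.2⟩)
  set κ := min (feedbackH G z₁ - z₁) (z₂ - feedbackH G z₂) / 2 with hκ
  have hκpos : 0 < κ := half_pos (lt_min m1 m2)
  have κ1 : 2 * κ ≤ feedbackH G z₁ - z₁ := by rw [hκ]; linarith [min_le_left (feedbackH G z₁ - z₁) (z₂ - feedbackH G z₂)]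
  have κ2 : 2 * κ ≤ z₂ - feedbackH G z₂ := by rw [hκ]; linarith [min_le_right (feedbackH G z₁ - z₁) (z₂ - feedbackH G z₂)]
  set c := clipG G b (fld y₀) - R₀ with hc
  have hcpos : 0 < c := sub_pos.2 (hy' y₀ ⟨hy0, le_rfl⟩)
  set ε₀ := min (min (κ / 26) (c / 26)) (min (1 / 6) (b - 1 / 2)) with hε₀
  refine ⟨ε₀, lt_min (lt_min (by positivity) (by positivity)) (lt_min (by norm_num) (by linarith)),
    (min_le_right _ _).trans (min_le_right _ _), ?_⟩
  intro ε hε hεlt ϱ hϱ Q hQ hstat hac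
  have e1 : ε ≤ κ / 26 := hεlt.le.trans ((min_le_left _ _).trans (min_le_left _ _))
  have e2 : ε ≤ c / 26 := hεlt.le.trans ((min_le_left _ _).trans (min_le_right _ _))
  have e3 : ε ≤ 1 / 6 := hεlt.le.trans ((min_le_right _ _).trans (min_le_left _ _))
  have e4 : ε ≤ b - 1 / 2 := hεlt.le.trans ((min_le_right _ _).trans (min_le_right _ _))
  have hlip : ∀ x, |clipG G b (x - ε) - clipG G b x| ≤ 26 * ε ∧
      |clipG G b (x + ε) - clipG G b x| ≤ 26 * ε := fun x => by
    have h1 := hb.lipschitz (x - ε) x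
    have h2 := hb.lipschitz (x + ε) x
    rw [sub_sub_cancel_left, abs_neg, abs_of_pos hε] at h1
    rw [add_sub_cancel_left, abs_of_pos hε] at h2
    exact ⟨h1, h2⟩
  have hS : StatSetting (clipG G b) ϱ ε Q :=
    ⟨hnice, hϱ.prob, hQ, hϱ.bounded, (isStationary_noisyStep_clip e4 hϱ.bounded).2 hstat⟩
  obtain ⟨a, ha, hJ⟩ := hϱ.exists_pos
  have hpos : ∀ x, 0 < x → 0 < clipG G b x := by
    intro x hx
    have h0 : (0 : ℝ) ∈ Icc (-b) b := ⟨by linarith, by linarith⟩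
    rw [← hG0]
    refine hb.strictMonoOn h0 (hb.clip_mem x) ?_
    exact lt_max_of_lt_right (lt_min (by linarith) hx)
  have hentry0 : R₀ ≤ clipG G b (fld y₀ - ε) := by
    have := (abs_le.1 (hlip (fld y₀)).1).1
    linarith
  obtain ⟨habs, hrep⟩ := hS.entry (hS.ae_repSet_univ hac) hpos ha hJ hy0 (by linarith [hy₁.2]) hy' hentry0
  have hr : ∀ μ : ProbabilityMeasure Par, ∀ t ∈ Icc (-ε) ε, clipG G b (phi μ + t) ≤ 2 / 5 := by
    intro μ t ht
    have h1 := (abs_le.1 (abs_phi_le μ)).2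
    refine (hnice.mono (by linarith [ht.2] : phi μ + t ≤ 1 / 2)).trans ?_
    rw [hclip _ ⟨by norm_num, le_rfl⟩]
    exact (abs_le.1 (hG.abs_le (x := 1 / 2) ⟨by norm_num, le_rfl⟩)).2
  have hfin := hS.concentrate ⟨hy0, by linarith [hy₁.2]⟩ habs hrep hr hR0 hentry0 hηpos hκpos hR0'
    (by linarith)
    (fun r hr' => by
      have h1 : feedbackH G z₁ - z₁ ≤ feedbackH G r - r := hmin₁ hr'
      have h2 := (abs_le.1 (hlip (phiInv r)).1).1
      rw [hH r ⟨hR0.trans_le hr'.1, by linarith [hr'.2]⟩] at h2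
      linarith)
    (fun r hr' => by
      have h1 : z₂ - feedbackH G z₂ ≤ r - feedbackH G r := hmin₂ hr'
      have h2 := (abs_le.1 (hlip (phiInv r)).2).2
      rw [hH r ⟨by linarith [hr'.1], hr'.2⟩] at h2
      linarith)
  filter_upwards [hfin] with ν hν
  obtain ⟨⟨s, μ⟩, ⟨hμ1, hμ2⟩, rfl⟩ := hν
  have hyP : y₀ ∈ Icc (0 : ℝ) 1 := ⟨hy0.le, by linarith [hy₁.2]⟩
  have hφ : 0 < phi μ := by
    have := (phi_mem_of_suppIn (a := y₀) ⟨by linarith, hyP.2⟩ (by norm_num) hμ1).1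
    linarith [le_fld hyP]
  have hmem := mixP_mem_nearSet (δ := δ) hrs_pos (by linarith) s
    (suppIn_mono (by linarith) le_rfl hμ1) fun f hf =>
      (abs_integral_sub_invRepr_le (by linarith) (by linarith) (by linarith) (by linarith) hμ2 hf).trans
        (by linarith)
  have hfield : field (mixP (reflP s μ)) = sgn s * phi μ := by
    rw [field_mixP]; exact phi_reflP s μ
  change (field (mixP (reflP s μ)) < 0 ∧ _) ∨ (0 < field (mixP (reflP s μ)) ∧ _)
  rw [hfield]
  cases s
  · left
    simp only [sgn, Bool.false_eq_true, if_false, neg_one_mul] at hmem ⊢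
    exact ⟨by linarith, hmem⟩
  · right
    simp only [sgn, if_true, one_mul] at hmem ⊢
    exact ⟨hφ, hmem⟩

/-! ### Expansion of the finite-size system -/

/-- A feedback function with derivative `g'` on `[-c, c]` that satisfies the slope condition. -/
structure SlopeOn (g g' : ℝ → ℝ) (c K : ℝ) : Prop where
  deriv : ∀ u ∈ Icc (-c) c, HasDerivAt g (g' u) u
  nonneg : ∀ u ∈ Icc (-c) c, 0 ≤ g' u
  le : ∀ u ∈ Icc (-c) c, g' u ≤ 51 / 2 - 50 * |g u|
  bound : ∀ u ∈ Icc (-c) c, |g u| ≤ 41 / 100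
  lip : ∀ u ∈ Icc (-c) c, ∀ v ∈ Icc (-c) c, |g' u - g' v| ≤ K * |u - v|

theorem SlopeOn.exists_slope {g g' : ℝ → ℝ} {c K : ℝ} (h : SlopeOn g g' c K) {u v : ℝ}
    (hu : u ∈ Icc (-c) c) (hv : v ∈ Icc (-c) c) : ∃ γ : ℝ, g u - g v = γ * (u - v) ∧ 0 ≤ γ ∧
      γ ≤ 51 / 2 ∧ (0 ≤ g u * g v → |g v| ≤ |g u| → γ ≤ 51 / 2 - 50 * |g v|) := by
  have hmono : MonotoneOn g (Icc (-c) c) := by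
    refine monotoneOn_of_deriv_nonneg (convex_Icc _ _)
      (fun x hx => (h.deriv x hx).continuousAt.continuousWithinAt)
      (fun x hx => (h.deriv x (interior_subset hx)).differentiableAt.differentiableWithinAt)
      fun x hx => ?_
    rw [(h.deriv x (interior_subset hx)).deriv]
    exact h.nonneg x (interior_subset hx)
  have main : ∀ u v, u ∈ Icc (-c) c → v ∈ Icc (-c) c → v < u → ∃ γ : ℝ, g u - g v = γ * (u - v) ∧
      0 ≤ γ ∧ γ ≤ 51 / 2 ∧ (0 ≤ g u * g v → γ ≤ 51 / 2 - 50 * min (|g u|) (|g v|)) := by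
    intro u v hu hv huv
    have hsub : Icc v u ⊆ Icc (-c) c := Icc_subset_Icc hv.1 hu.2
    obtain ⟨ξ, hξ, he⟩ := exists_hasDerivAt_eq_slope g g' huv
      (fun x hx => (h.deriv x (hsub hx)).continuousAt.continuousWithinAt)
      (fun x hx => h.deriv x (hsub (Ioo_subset_Icc_self hx)))
    have hξ' := hsub (Ioo_subset_Icc_self hξ)
    have hle := h.le ξ hξ'
    have h1 := hmono hv hξ' hξ.1.le
    have h2 := hmono hξ' hu hξ.2.le
    refine ⟨g' ξ, ?_, h.nonneg ξ hξ', by linarith [abs_nonneg (g ξ)], fun hs => ?_⟩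
    · rw [he, div_mul_cancel₀ _ (by linarith)]
    · refine hle.trans ?_
      have : min (|g u|) (|g v|) ≤ |g ξ| := by
        rcases le_total 0 (g v) with h3 | h3
        · refine (min_le_right _ _).trans ?_
          rw [abs_of_nonneg h3, abs_of_nonneg (h3.trans h1)]; exact h1
        · rcases h3.eq_or_lt with h4 | h4
          · refine (min_le_right _ _).trans ?_
            rw [h4, abs_zero]; exact abs_nonneg _
          · have h5 : g u ≤ 0 := by
              by_contra h6
              exact absurd hs (not_le.2 (mul_neg_of_pos_of_neg (not_le.1 h6) h4))
            refine (min_le_left _ _).trans ?_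
            rw [abs_of_nonpos h5, abs_of_nonpos (h2.trans h5)]; linarith
      linarith
  rcases lt_trichotomy v u with huv | huv | huv
  · obtain ⟨γ, a, b, c, d⟩ := main u v hu hv huv
    exact ⟨γ, a, b, c, fun h1 h2 => by have := d h1; rwa [min_eq_right h2] at this⟩
  · refine ⟨0, by rw [huv]; ring, le_rfl, by norm_num, fun _ _ => ?_⟩
    linarith [h.bound v hv]
  · obtain ⟨γ, a, b, c, d⟩ := main v u hv hu huv
    refine ⟨γ, by linarith, b, c, fun h1 h2 => ?_⟩
    rw [mul_comm] at h1
    have := d h1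
    rwa [min_eq_left h2] at this

theorem expand_aux {A b c y m : ℝ} (hc : 0 < c) (hA : c ≤ A) (hb : 0 ≤ b)
    (h : 10 / 9 * b ≤ 4 * (c ^ 2 - 10 / 9)) :
    10 / 9 * y ^ 2 + 4 * (c ^ 2 - 10 / 9) * (m * (y - m)) ≤ (A * (y + b * m)) ^ 2 := by
  set s := c ^ 2 - 10 / 9 with hs
  have hs0 : 0 ≤ s := by linarith
  have hA2 : c ^ 2 ≤ A ^ 2 := by nlinarith
  have h1 : c ^ 2 * (y + b * m) ^ 2 ≤ (A * (y + b * m)) ^ 2 := by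
    rw [mul_pow]; exact mul_le_mul_of_nonneg_right hA2 (sq_nonneg _)
  refine le_trans ?_ h1
  have hc2 : c ^ 2 = s + 10 / 9 := by rw [hs]; ring
  rw [hc2]
  rcases hs0.eq_or_lt with h0 | h0
  · have : b = 0 := by nlinarith
    rw [this, ← h0]; nlinarith
  · have key : 0 ≤ s * ((s + 10 / 9) * (y + b * m) ^ 2 - (10 / 9 * y ^ 2 + 4 * s * (m * (y - m)))) := by
      have e : s * ((s + 10 / 9) * (y + b * m) ^ 2 - (10 / 9 * y ^ 2 + 4 * s * (m * (y - m)))) =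
          (s * y + (b * (s + 10 / 9) - 2 * s) * m) ^ 2 +
          m ^ 2 * (b * (s + 10 / 9) * (4 * s - 10 / 9 * b)) := by ring
      rw [e]
      have : 0 ≤ b * (s + 10 / 9) * (4 * s - 10 / 9 * b) :=
        mul_nonneg (mul_nonneg hb (by linarith)) (by linarith)
      positivity
    have := nonneg_of_mul_nonneg_right key h0
    linarith

theorem den_bounds {r x : ℝ} (hr : |r| ≤ 41 / 100) (hx : x ∈ Site) :
    0 < 1 + r * x ∧ 1 + r * x ≤ 1 + |r| / 2 ∧ 1 - 4 * x ^ 2 ≤ 21 / 20 * (1 + r * x) ∧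
      0 ≤ 1 - 4 * x ^ 2 := by
  have hx2 : |x| ≤ 1 / 2 := abs_le.2 ⟨by linarith [hx.1], hx.2⟩
  have h1 : |r * x| ≤ |r| / 2 := by
    rw [abs_mul]; nlinarith [abs_nonneg r, abs_nonneg x]
  have h2 := abs_le.1 h1
  have hr' := abs_le.1 hr
  refine ⟨by linarith, by linarith, ?_, by nlinarith [hx.1, hx.2]⟩
  nlinarith [sq_nonneg (x + r / 8), sq_nonneg (x - r / 8), sq_nonneg (2 * x + 21 / 80 * r)]

theorem fracMap_sub_left {r x x' : ℝ} (hx : 1 + r * x ≠ 0) (hx' : 1 + r * x' ≠ 0) :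
    fracMap r x - fracMap r x' =
      (4 - r ^ 2) / (2 * ((1 + r * x) * (1 + r * x'))) * (x - x') := by
  unfold fracMap
  have h1 : 2 * r * x + 2 ≠ 0 := by
    rw [show 2 * r * x + 2 = 2 * (1 + r * x) by ring]; exact mul_ne_zero two_ne_zero hx
  have h2 : 2 * r * x' + 2 ≠ 0 := by
    rw [show 2 * r * x' + 2 = 2 * (1 + r * x') by ring]; exact mul_ne_zero two_ne_zero hx'
  rw [div_sub_div _ _ h1 h2, div_mul_eq_mul_div, div_eq_div_iff (mul_ne_zero h1 h2)
    (mul_ne_zero two_ne_zero (mul_ne_zero hx hx'))]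
  ring

theorem fracMap_sub_right {r r' x : ℝ} (hx : 1 + r * x ≠ 0) (hx' : 1 + r' * x ≠ 0) :
    fracMap r x - fracMap r' x =
      (1 - 4 * x ^ 2) / (2 * ((1 + r * x) * (1 + r' * x))) * (r - r') := by
  unfold fracMap
  have h1 : 2 * r * x + 2 ≠ 0 := by
    rw [show 2 * r * x + 2 = 2 * (1 + r * x) by ring]; exact mul_ne_zero two_ne_zero hx
  have h2 : 2 * r' * x + 2 ≠ 0 := by
    rw [show 2 * r' * x + 2 = 2 * (1 + r' * x) by ring]; exact mul_ne_zero two_ne_zero hx'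
  rw [div_sub_div _ _ h1 h2, div_mul_eq_mul_div, div_eq_div_iff (mul_ne_zero h1 h2)
    (mul_ne_zero two_ne_zero (mul_ne_zero hx hx'))]
  ring

theorem expand_same {r r' γ m x x' : ℝ} (hr : |r| ≤ 41 / 100) (hle : |r'| ≤ |r|)
    (hγ : r - r' = γ * m) (hγ0 : 0 ≤ γ) (hγ1 : γ ≤ 51 / 2 - 50 * |r'|) (hx : x ∈ Site)
    (hx' : x' ∈ Site) : 10 / 9 * (x - x') ^ 2 +
      4 * ((2 * (2 - |r'|) / (2 + |r'|)) ^ 2 - 10 / 9) * (m * ((x - x') - m)) ≤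
      (fracMap r x - fracMap r' x') ^ 2 := by
  set p := |r'| with hp
  have hp0 : 0 ≤ p := abs_nonneg _
  have hp1 : p ≤ 41 / 100 := hle.trans hr
  obtain ⟨a1, a2, a3, a4⟩ := den_bounds hr hx
  obtain ⟨b1, b2, -, -⟩ := den_bounds hp1 hx
  obtain ⟨c1, c2, -, -⟩ := den_bounds hp1 hx'
  rw [← hp] at b2 c2
  have hr2 : r' ^ 2 = p ^ 2 := (sq_abs r').symm
  have h4 : 0 < 4 - r' ^ 2 := by rw [hr2]; nlinarith
  set A := (4 - r' ^ 2) / (2 * ((1 + r' * x) * (1 + r' * x'))) with hA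
  set b := γ * ((1 - 4 * x ^ 2) * (1 + r' * x') / ((1 + r * x) * (4 - r' ^ 2))) with hb
  have e : fracMap r x - fracMap r' x' = A * ((x - x') + b * m) := by
    have e1 := fracMap_sub_left b1.ne' c1.ne'
    have e2 := fracMap_sub_right a1.ne' b1.ne'
    have e3 : A * (b * m) = (1 - 4 * x ^ 2) / (2 * ((1 + r * x) * (1 + r' * x))) * (r - r') := by
      rw [hγ, hA, hb]
      have := a1.ne'; have := b1.ne'; have := c1.ne'; have := h4.ne'
      field_simp
    rw [mul_add, e3]
    linarith
  rw [e]
  have hcpos : 0 < 2 * (2 - p) / (2 + p) := div_pos (by linarith) (by linarith)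
  refine expand_aux hcpos ?_ ?_ ?_
  · rw [hA, div_le_div_iff₀ (by linarith) (by positivity), hr2]
    have h1 : (1 + r' * x) * (1 + r' * x') ≤ (1 + p / 2) * (1 + p / 2) :=
      mul_le_mul b2 c2 c1.le (by linarith)
    nlinarith [mul_le_mul_of_nonneg_left h1 (by linarith : 0 ≤ 2 * (2 - p))]
  · exact mul_nonneg hγ0 (div_nonneg (mul_nonneg a4 c1.le) (mul_nonneg a1.le h4.le))
  · have hb1 : b ≤ (51 / 2 - 50 * p) * (21 / 40 / (2 - p)) := by
      refine mul_le_mul hγ1 ?_ (div_nonneg (mul_nonneg a4 c1.le) (mul_nonneg a1.le h4.le)) (by linarith)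
      rw [div_le_div_iff₀ (mul_pos a1 h4) (by linarith), hr2]
      have h1 : (1 - 4 * x ^ 2) * (1 + r' * x') ≤ 21 / 20 * (1 + r * x) * (1 + p / 2) :=
        mul_le_mul a3 c2 c1.le (by positivity)
      nlinarith [mul_le_mul_of_nonneg_right h1 (by linarith : 0 ≤ 2 - p)]
    have h2 : 10 / 9 * ((51 / 2 - 50 * p) * (21 / 40 / (2 - p))) ≤
        4 * ((2 * (2 - p) / (2 + p)) ^ 2 - 10 / 9) := by
      have e1 : 10 / 9 * ((51 / 2 - 50 * p) * (21 / 40 / (2 - p))) =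
          (10 / 9 * (51 / 2 - 50 * p) * (21 / 40)) / (2 - p) := by ring
      have e2 : 4 * ((2 * (2 - p) / (2 + p)) ^ 2 - 10 / 9) =
          4 * (4 * (2 - p) ^ 2 - 10 / 9 * (2 + p) ^ 2) / (2 + p) ^ 2 := by
        have : 2 + p ≠ 0 := by linarith
        field_simp
        ring
      rw [e1, e2, div_le_div_iff₀ (by linarith) (by positivity)]
      nlinarith [mul_nonneg hp0 (sub_nonneg.2 hp1), mul_nonneg (mul_nonneg hp0 hp0) (sub_nonneg.2 hp1),
        mul_nonneg hp0 (mul_nonneg hp0 hp0)]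
    linarith

theorem exists_weight {q q' c a b : ℝ} (hq : 0 ≤ q) (hq' : 0 ≤ q') (hqc : q ≤ c) (hqc' : q' ≤ c)
    (ha : 0 ≤ a) (hb : 0 ≤ b) : ∃ w : ℝ, 0 ≤ w ∧ w ≤ c ∧ q * a + q' * b = w * (a + b) := by
  rcases (add_nonneg ha hb).eq_or_lt with h | h
  · have h1 : a = 0 := by linarith
    have h2 : b = 0 := by linarith
    exact ⟨q, hq, hqc, by rw [h1, h2]; ring⟩
  · refine ⟨(q * a + q' * b) / (a + b), by positivity, ?_, (div_mul_cancel₀ _ h.ne').symm⟩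
    rw [div_le_iff₀ h]
    nlinarith [mul_nonneg (sub_nonneg.2 hqc) ha, mul_nonneg (sub_nonneg.2 hqc') hb]

theorem expand_opposite {r r' γ m x x' : ℝ} (hr : |r| ≤ 41 / 100) (hr' : |r'| ≤ 41 / 100)
    (hs : r * r' ≤ 0) (hγ : r - r' = γ * m) (hγ0 : 0 ≤ γ) (hγ1 : γ ≤ 51 / 2) (hx : x ∈ Site)
    (hx' : x' ∈ Site) : 10 / 9 * (x - x') ^ 2 + 4 * (2 ^ 2 - 10 / 9) * (m * ((x - x') - m)) ≤
      (fracMap r x - fracMap r' x') ^ 2 := by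
  obtain ⟨a1, -, a3, a4⟩ := den_bounds hr hx
  obtain ⟨c1, -, c3, c4⟩ := den_bounds hr' hx'
  set q := (1 - 4 * x ^ 2) / (1 + r * x) with hq
  set q' := (1 - 4 * x' ^ 2) / (1 + r' * x') with hq'
  have hq0 : 0 ≤ q := div_nonneg a4 a1.le
  have hq0' : 0 ≤ q' := div_nonneg c4 c1.le
  have hq1 : q ≤ 21 / 20 := by rw [hq, div_le_iff₀ a1]; exact a3
  have hq1' : q' ≤ 21 / 20 := by rw [hq', div_le_iff₀ c1]; exact c3
  have e1 : fracMap r x - fracMap 0 x = q / 2 * r := by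
    rw [fracMap_sub_right a1.ne' (by norm_num), hq]
    have := a1.ne'
    rw [zero_mul, add_zero, mul_one, sub_zero, div_div, mul_comm 2]
  have e2 : fracMap r' x' - fracMap 0 x' = q' / 2 * r' := by
    rw [fracMap_sub_right c1.ne' (by norm_num), hq']
    have := c1.ne'
    rw [zero_mul, add_zero, mul_one, sub_zero, div_div, mul_comm 2]
  have e3 : fracMap 0 x - fracMap 0 x' = 2 * (x - x') := by unfold fracMap; ring
  set s := q / 2 * r - q' / 2 * r' with hsdef
  obtain ⟨w, hw0, hw1, hw⟩ : ∃ w : ℝ, 0 ≤ w ∧ w ≤ 21 / 40 ∧ s = w * (r - r') := by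
    rcases mul_nonpos_iff.1 hs with h | h
    · obtain ⟨w, h0, h1, h2⟩ := exists_weight (by positivity : 0 ≤ q / 2) (by positivity : 0 ≤ q' / 2)
        (by linarith : q / 2 ≤ 21 / 40) (by linarith : q' / 2 ≤ 21 / 40) h.1 (neg_nonneg.2 h.2)
      exact ⟨w, h0, h1, by linarith⟩
    · obtain ⟨w, h0, h1, h2⟩ := exists_weight (by positivity : 0 ≤ q / 2) (by positivity : 0 ≤ q' / 2)
        (by linarith : q / 2 ≤ 21 / 40) (by linarith : q' / 2 ≤ 21 / 40) (neg_nonneg.2 h.1) h.2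
      exact ⟨w, h0, h1, by linarith⟩
  have e : fracMap r x - fracMap r' x' = 2 * ((x - x') + w * γ / 2 * m) := by
    have : s = w * γ * m := by rw [hw, hγ]; ring
    linarith
  rw [e]
  refine expand_aux two_pos le_rfl (by positivity) ?_
  have : w * γ ≤ 21 / 40 * (51 / 2) := mul_le_mul hw1 hγ1 hγ0 (by norm_num)
  linarith

/-- The average of the coordinates. -/
noncomputable def avg {N : ℕ} (x : Fin (N + 1) → ℝ) : ℝ := (∑ j, x j) / (N + 1)

theorem avg_sub {N : ℕ} (x y : Fin (N + 1) → ℝ) : avg (x - y) = avg x - avg y := by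
  unfold avg; rw [← sub_div, ← Finset.sum_sub_distrib]; rfl

theorem sum_sub_avg {N : ℕ} (x : Fin (N + 1) → ℝ) : ∑ j, (x j - avg x) = 0 := by
  have h : (N : ℝ) + 1 ≠ 0 := by positivity
  rw [Finset.sum_sub_distrib, Finset.sum_const, Finset.card_univ, Fintype.card_fin, nsmul_eq_mul]
  unfold avg
  push_cast
  field_simp
  ring

theorem abs_avg_le {N : ℕ} (x : Fin (N + 1) → ℝ) : |avg x| ≤ (∑ j, |x j|) / (N + 1) := by
  unfold avg
  rw [abs_div, abs_of_pos (by positivity : (0 : ℝ) < N + 1)]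
  exact div_le_div_of_nonneg_right (Finset.abs_sum_le_sum_abs _ _) (by positivity)

/-- The cube `X^{N+1}`. -/
def cube (N : ℕ) : Set (Fin (N + 1) → ℝ) := {x | ∀ i, x i ∈ Site}

theorem avg_mem {N : ℕ} {x : Fin (N + 1) → ℝ} (hx : x ∈ cube N) : avg x ∈ Site := by
  have hpos : (0 : ℝ) < N + 1 := by positivity
  unfold avg
  constructor
  · rw [le_div_iff₀ hpos]
    have := Finset.card_nsmul_le_sum Finset.univ x (-1 / 2) fun i _ => (hx i).1
    simp only [Finset.card_univ, Fintype.card_fin, nsmul_eq_mul] at this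
    push_cast at this; linarith
  · rw [div_le_iff₀ hpos]
    have := Finset.sum_le_card_nsmul Finset.univ x (1 / 2) fun i _ => (hx i).2
    simp only [Finset.card_univ, Fintype.card_fin, nsmul_eq_mul] at this
    push_cast at this; linarith

/-- The coupled map before reduction modulo `1`. -/
noncomputable def liftMap {N : ℕ} (g : ℝ → ℝ) (t : ℝ) (x : Fin (N + 1) → ℝ) (i : Fin (N + 1)) : ℝ :=
  fracMap (g (avg x + t)) (x i)

theorem SlopeOn.avg_add_mem {g g' : ℝ → ℝ} {c K : ℝ} (_h : SlopeOn g g' c K) {N : ℕ} {t : ℝ}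
    (ht : |t| ≤ c - 1 / 2) {x : Fin (N + 1) → ℝ} (hx : x ∈ cube N) : avg x + t ∈ Icc (-c) c := by
  have h1 := avg_mem hx
  have h2 := abs_le.1 ht
  constructor <;> linarith [h1.1, h1.2]

theorem SlopeOn.expand {g g' : ℝ → ℝ} {c K : ℝ} (h : SlopeOn g g' c K) {N : ℕ} {t : ℝ}
    (ht : |t| ≤ c - 1 / 2) {x x' : Fin (N + 1) → ℝ} (hx : x ∈ cube N) (hx' : x' ∈ cube N) :
    ∑ i, (x i - x' i) ^ 2 ≤ 9 / 10 * ∑ i, (liftMap g t x i - liftMap g t x' i) ^ 2 := by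
  have main : ∀ x x' : Fin (N + 1) → ℝ, x ∈ cube N → x' ∈ cube N →
      |g (avg x' + t)| ≤ |g (avg x + t)| →
      ∑ i, (x i - x' i) ^ 2 ≤ 9 / 10 * ∑ i, (liftMap g t x i - liftMap g t x' i) ^ 2 := by
    intro x x' hx hx' hle
    have hu := h.avg_add_mem ht hx
    have hu' := h.avg_add_mem ht hx'
    obtain ⟨γ, hγ, hγ0, hγ1, hγ2⟩ := h.exists_slope hu hu'
    have em : avg x + t - (avg x' + t) = avg (x - x') := by rw [avg_sub]; ring
    rw [em] at hγ
    obtain ⟨e, he⟩ : ∃ e : ℝ, ∀ i, 10 / 9 * (x i - x' i) ^ 2 +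
        e * (avg (x - x') * ((x i - x' i) - avg (x - x'))) ≤
        (liftMap g t x i - liftMap g t x' i) ^ 2 := by
      rcases le_total 0 (g (avg x + t) * g (avg x' + t)) with hs | hs
      · exact ⟨_, fun i => expand_same (h.bound _ hu) hle hγ hγ0 (hγ2 hs hle) (hx i) (hx' i)⟩
      · exact ⟨_, fun i => expand_opposite (h.bound _ hu) (h.bound _ hu') hs hγ hγ0 hγ1 (hx i)
          (hx' i)⟩
    have hsum := Finset.sum_le_sum fun i (_ : i ∈ Finset.univ) => he i
    rw [Finset.sum_add_distrib, ← Finset.mul_sum, ← Finset.mul_sum, ← Finset.mul_sum] at hsum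
    have h0 : ∑ i, ((x i - x' i) - avg (x - x')) = 0 := sum_sub_avg (x - x')
    rw [h0, mul_zero, mul_zero, add_zero] at hsum
    linarith
  rcases le_total (|g (avg x' + t)|) (|g (avg x + t)|) with h1 | h1
  · exact main x x' hx hx' h1
  · have := main x' x hx' hx h1
    simp only [sub_sq_comm (x' _), sub_sq_comm (liftMap g t x' _)] at this
    exact this

theorem SlopeOn.injOn {g g' : ℝ → ℝ} {c K : ℝ} (h : SlopeOn g g' c K) {N : ℕ} {t : ℝ}
    (ht : |t| ≤ c - 1 / 2) : InjOn (liftMap (N := N) g t) (cube N) := by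
  intro x hx x' hx' he
  have h1 := h.expand ht hx hx'
  rw [he] at h1
  simp only [sub_self, ne_eq, OfNat.ofNat_ne_zero, not_false_eq_true, zero_pow, Finset.sum_const_zero,
    mul_zero] at h1
  have h2 := (Finset.sum_eq_zero_iff_of_nonneg fun i _ => sq_nonneg (x i - x' i)).1
    (le_antisymm h1 (Finset.sum_nonneg fun i _ => sq_nonneg _))
  funext i
  have := h2 i (Finset.mem_univ i)
  exact sub_eq_zero.1 (pow_eq_zero_iff two_ne_zero |>.1 this)

/-- The lift maps the cube onto `[-1/2, 3/2]^{N+1}`. -/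
theorem SlopeOn.surjOn {g g' : ℝ → ℝ} {c K : ℝ} (h : SlopeOn g g' c K) {N : ℕ} {t : ℝ}
    (ht : |t| ≤ c - 1 / 2) {y : Fin (N + 1) → ℝ} (hy : ∀ i, y i ∈ Icc (-1 / 2 : ℝ) (3 / 2)) :
    ∃ x ∈ cube N, liftMap g t x = y := by
  have hr2 : ∀ r ∈ Icc (-(41 / 100) : ℝ) (41 / 100), |r| ≤ 1 / 2 := fun r hr =>
    (abs_le.2 hr).trans (by norm_num)
  have hcube : ∀ r ∈ Icc (-(41 / 100) : ℝ) (41 / 100), (fun i => fracInv r (y i)) ∈ cube N :=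
    fun r hr i => fracInv_mem (hr2 r hr) (hy i)
  have hcont : ContinuousOn (fun r => r - g (avg (fun i => fracInv r (y i)) + t))
      (Icc (-(41 / 100) : ℝ) (41 / 100)) := by
    have h1 : ContinuousOn (fun r => avg (fun i => fracInv r (y i)) + t)
        (Icc (-(41 / 100) : ℝ) (41 / 100)) := by
      unfold avg fracInv
      refine ContinuousOn.add (ContinuousOn.div_const (continuousOn_finsetSum _ fun i _ => ?_) _)
        continuousOn_const
      refine ContinuousOn.div (by fun_prop) (by fun_prop) fun r hr => ?_
      exact (fracInv_den_pos (hr2 r hr) (hy i)).ne'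
    have h2 : ContinuousOn g (Icc (-c) c) := fun u hu => (h.deriv u hu).continuousAt.continuousWithinAt
    exact continuousOn_id.sub (h2.comp h1 fun r hr => h.avg_add_mem ht (hcube r hr))
  have hends : (0 : ℝ) ∈ Icc (-(41 / 100) - g (avg (fun i => fracInv (-(41 / 100)) (y i)) + t))
      (41 / 100 - g (avg (fun i => fracInv (41 / 100) (y i)) + t)) := by
    have h1 := h.bound _ (h.avg_add_mem ht (hcube (-(41 / 100)) (by norm_num)))
    have h2 := h.bound _ (h.avg_add_mem ht (hcube (41 / 100) (by norm_num)))
    constructor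
    · linarith [(abs_le.1 h1).1]
    · linarith [(abs_le.1 h2).2]
  obtain ⟨r, hr, he⟩ := intermediate_value_Icc (by norm_num) hcont hends
  refine ⟨_, hcube r hr, ?_⟩
  funext i
  unfold liftMap
  have : g (avg (fun i => fracInv r (y i)) + t) = r := by
    simp only at he; linarith
  rw [this]
  exact fracMap_fracInv (hr2 r hr) (hy i)

/-! ### The Jacobian of the finite-size system -/

/-- The derivative of a single coordinate in its own direction. -/
noncomputable def diagCoef (r x : ℝ) : ℝ := (4 - r ^ 2) / (2 * (1 + r * x) ^ 2)

/-- The relative strength of the coupling. -/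
noncomputable def coupCoef (γ r x : ℝ) : ℝ := γ * ((1 - 4 * x ^ 2) / (4 - r ^ 2))

/-- The Jacobian determinant of the lift. -/
noncomputable def jac {N : ℕ} (g g' : ℝ → ℝ) (t : ℝ) (x : Fin (N + 1) → ℝ) : ℝ :=
  (∏ i, diagCoef (g (avg x + t)) (x i)) *
    (1 + avg fun i => coupCoef (g' (avg x + t)) (g (avg x + t)) (x i))

/-- The Jacobian matrix of the lift. -/
noncomputable def jacMatrix {N : ℕ} (g g' : ℝ → ℝ) (t : ℝ) (x : Fin (N + 1) → ℝ) :
    Matrix (Fin (N + 1)) (Fin (N + 1)) ℝ :=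
  Matrix.diagonal (fun i => diagCoef (g (avg x + t)) (x i)) *
    (1 + Matrix.replicateCol Unit (fun i => coupCoef (g' (avg x + t)) (g (avg x + t)) (x i)) *
      Matrix.replicateRow Unit (fun _ => 1 / ((N : ℝ) + 1)))

theorem det_jacMatrix {N : ℕ} (g g' : ℝ → ℝ) (t : ℝ) (x : Fin (N + 1) → ℝ) :
    (jacMatrix g g' t x).det = jac g g' t x := by
  unfold jacMatrix jac
  rw [Matrix.det_mul, Matrix.det_diagonal, Matrix.det_one_add_replicateCol_mul_replicateRow]
  congr 2
  simp only [dotProduct, avg, Finset.sum_div]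
  refine Finset.sum_congr rfl fun i _ => ?_
  ring

/-- The averaging functional. -/
noncomputable def avgL (N : ℕ) : (Fin (N + 1) → ℝ) →L[ℝ] ℝ :=
  (1 / ((N : ℝ) + 1)) • ∑ j, ContinuousLinearMap.proj j

theorem avgL_apply {N : ℕ} (x : Fin (N + 1) → ℝ) : avgL N x = avg x := by
  simp only [avgL, avg, _root_.smul_apply, _root_.sum_apply,
    ContinuousLinearMap.proj_apply, smul_eq_mul]
  ring

theorem SlopeOn.hasFDerivAt_liftMap {g g' : ℝ → ℝ} {c K : ℝ} (h : SlopeOn g g' c K) {N : ℕ} {t : ℝ}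
    (ht : |t| ≤ c - 1 / 2) {x : Fin (N + 1) → ℝ} (hx : x ∈ cube N) :
    HasFDerivAt (liftMap g t) (Matrix.toLin' (jacMatrix g g' t x)).toContinuousLinearMap x := by
  have hu := h.avg_add_mem ht hx
  rw [hasFDerivAt_pi']
  intro i
  have havg : HasFDerivAt (fun x : Fin (N + 1) → ℝ => avg x + t) (avgL N) x := by
    have e : (fun x : Fin (N + 1) → ℝ => avg x + t) = fun x => avgL N x + t :=
      funext fun x => by rw [avgL_apply]
    rw [e]
    exact (avgL N).hasFDerivAt.add_const t
  have hr : HasFDerivAt (fun x : Fin (N + 1) → ℝ => g (avg x + t)) (g' (avg x + t) • avgL N) x :=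
    (h.deriv _ hu).comp_hasFDerivAt x havg
  have hp : HasFDerivAt (fun x : Fin (N + 1) → ℝ => x i) (ContinuousLinearMap.proj i) x :=
    (ContinuousLinearMap.proj (R := ℝ) (φ := fun _ : Fin (N + 1) => ℝ) i).hasFDerivAt
  set r := g (avg x + t) with hrdef
  obtain ⟨a1, -, -, -⟩ := den_bounds (h.bound _ hu) (hx i)
  rw [← hrdef] at a1
  have hden : 2 * r * x i + 2 ≠ 0 := by nlinarith
  have hnum := ((hr.add_const 4).mul hp).add (hr.add_const 1)
  have hd := ((hr.const_mul 2).mul hp).add_const 2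
  have hinv : HasFDerivAt (fun x : Fin (N + 1) → ℝ => (2 * g (avg x + t) * x i + 2)⁻¹) _ x :=
    (hasDerivAt_inv hden).comp_hasFDerivAt x hd
  have hall := hnum.mul hinv
  refine (hall.congr_fderiv ?_).congr_of_eventuallyEq (Eventually.of_forall fun z => ?_)
  rotate_left
  · simp only [liftMap, fracMap, div_eq_mul_inv]; rfl
  · ext v
    have e1 : (jacMatrix g g' t x).mulVec v i =
        diagCoef r (x i) * (v i + coupCoef (g' (avg x + t)) r (x i) * avg v) := by
      unfold jacMatrix
      rw [← Matrix.mulVec_mulVec, Matrix.mulVec_diagonal, Matrix.add_mulVec, Matrix.one_mulVec,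
        ← Matrix.mulVec_mulVec]
      congr 1
      simp only [Pi.add_apply, Matrix.mulVec, dotProduct, Matrix.replicateCol_apply,
        Matrix.replicateRow_apply, Finset.univ_unique, Finset.sum_singleton, ← hrdef]
      rw [← Finset.mul_sum, one_div, inv_mul_eq_div]; rfl
    simp only [ContinuousLinearMap.comp_apply, ContinuousLinearMap.proj_apply,
      LinearMap.coe_toContinuousLinearMap', Matrix.toLin'_apply, e1,
      _root_.add_apply, _root_.smul_apply, smul_eq_mul, avgL_apply,
      diagCoef, coupCoef, Pi.add_apply, Pi.mul_apply, ← hrdef]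
    have h4 : 4 - r ^ 2 ≠ 0 := by
      have := abs_le.1 (h.bound _ hu)
      rw [← hrdef] at this
      nlinarith [this.1, this.2]
    have h5 : 1 + r * x i ≠ 0 := a1.ne'
    have h6 : 2 * r * x i + 2 = 2 * (1 + r * x i) := by ring
    rw [h6]
    field_simp
    ring

theorem le_exp_mul {u v c : ℝ} (hv : 0 ≤ v) (h : |u - v| ≤ c * v) : u ≤ Real.exp c * v := by
  have h1 := (abs_le.1 h).2
  nlinarith [Real.add_one_le_exp c]

theorem diagCoef_pos {r x : ℝ} (hr : |r| ≤ 41 / 100) (hx : x ∈ Site) : 0 < diagCoef r x := by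
  have h1 := (den_bounds hr hx).1
  have h2 : 0 < 4 - r ^ 2 := by nlinarith [(abs_le.1 hr).1, (abs_le.1 hr).2]
  unfold diagCoef; positivity

theorem diagCoef_le {r r' x x' : ℝ} (hr : |r| ≤ 41 / 100) (hr' : |r'| ≤ 41 / 100) (hx : x ∈ Site)
    (hx' : x' ∈ Site) :
    diagCoef r x ≤ Real.exp (3 * |r - r'| + 2 * |x - x'|) * diagCoef r' x' := by
  have a := (den_bounds hr hx).1
  have a' := (den_bounds hr' hx').1
  have b := abs_le.1 hr
  have b' := abs_le.1 hr'
  have ax : |x'| ≤ 1 / 2 := abs_le.2 ⟨by linarith [hx'.1], hx'.2⟩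
  have ar : 79 / 100 ≤ 1 + r * x := by nlinarith [hx.1, hx.2]
  have h4 : 19 / 5 ≤ 4 - r' ^ 2 := by nlinarith
  have h1 : 4 - r ^ 2 ≤ Real.exp |r - r'| * (4 - r' ^ 2) := by
    refine le_exp_mul (by linarith) ?_
    have e : 4 - r ^ 2 - (4 - r' ^ 2) = -((r + r') * (r - r')) := by ring
    rw [e, abs_neg, abs_mul, mul_comm]
    refine mul_le_mul_of_nonneg_left ?_ (abs_nonneg _)
    exact (abs_le.2 ⟨by linarith, by linarith⟩ : |r + r'| ≤ 1).trans (by linarith)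
  have h2 : 1 + r' * x' ≤ Real.exp (|r - r'| + |x - x'|) * (1 + r * x) := by
    refine le_exp_mul a.le ?_
    have e : 1 + r' * x' - (1 + r * x) = -((r - r') * x' + r * (x - x')) := by ring
    rw [e, abs_neg]
    refine (abs_add_le _ _).trans ?_
    rw [abs_mul, abs_mul]
    nlinarith [abs_nonneg (r - r'), abs_nonneg (x - x'), abs_nonneg r]
  have h3 : (1 + r' * x') ^ 2 ≤ Real.exp (2 * |r - r'| + 2 * |x - x'|) * (1 + r * x) ^ 2 := by
    have := pow_le_pow_left₀ a'.le h2 2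
    rw [mul_pow, ← Real.exp_nat_mul] at this
    refine this.trans (le_of_eq ?_)
    congr 2; push_cast; ring
  unfold diagCoef
  rw [← mul_div_assoc, div_le_div_iff₀ (by positivity) (by positivity)]
  have h5 := mul_le_mul h1 h3 (by positivity) (mul_nonneg (Real.exp_pos _).le (by linarith))
  have e : Real.exp (3 * |r - r'| + 2 * |x - x'|) =
      Real.exp |r - r'| * Real.exp (2 * |r - r'| + 2 * |x - x'|) := by
    rw [← Real.exp_add]; congr 1; ring
  rw [e]
  linarith

theorem coupCoef_nonneg {γ r x : ℝ} (hγ : 0 ≤ γ) (hr : |r| ≤ 41 / 100) (hx : x ∈ Site) :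
    0 ≤ coupCoef γ r x := by
  have h1 := (den_bounds hr hx).2.2.2
  have h2 : 0 < 4 - r ^ 2 := by nlinarith [(abs_le.1 hr).1, (abs_le.1 hr).2]
  unfold coupCoef; positivity

theorem abs_coupCoef_sub_le {γ γ' r r' x x' : ℝ} (hγ : 0 ≤ γ) (hγ1 : γ ≤ 26)
    (hr : |r| ≤ 41 / 100) (hr' : |r'| ≤ 41 / 100) (hx : x ∈ Site) (hx' : x' ∈ Site) :
    |coupCoef γ r x - coupCoef γ' r' x'| ≤ |γ - γ'| + 26 * (|r - r'| + 2 * |x - x'|) := by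
  have b := abs_le.1 hr
  have b' := abs_le.1 hr'
  have h4 : 19 / 5 ≤ 4 - r ^ 2 := by nlinarith
  have h4' : 19 / 5 ≤ 4 - r' ^ 2 := by nlinarith
  have h5 := (den_bounds hr hx).2.2.2
  have h5' := (den_bounds hr' hx').2.2.2
  set q := (1 - 4 * x ^ 2) / (4 - r ^ 2) with hq
  set q' := (1 - 4 * x' ^ 2) / (4 - r' ^ 2) with hq'
  have hq1 : |q'| ≤ 1 := by
    rw [abs_of_nonneg (div_nonneg h5' (by linarith)), div_le_one (by linarith)]
    nlinarith [sq_nonneg x']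
  have hqq : |q - q'| ≤ |r - r'| + 2 * |x - x'| := by
    have e : q - q' = (-(4 * (x + x') * (x - x')) * (4 - r' ^ 2) +
        (1 - 4 * x' ^ 2) * ((r + r') * (r - r'))) / ((4 - r ^ 2) * (4 - r' ^ 2)) := by
      rw [hq, hq', div_sub_div _ _ (by linarith) (by linarith)]; congr 1; ring
    rw [e, abs_div, abs_of_pos (by positivity : 0 < (4 - r ^ 2) * (4 - r' ^ 2)),
      div_le_iff₀ (by positivity)]
    refine (abs_add_le _ _).trans ?_
    rw [abs_mul, abs_neg, abs_mul, abs_mul, abs_mul, abs_mul, abs_of_nonneg h5',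
      abs_of_pos (by linarith : 0 < 4 - r' ^ 2), abs_of_pos (by norm_num : (0 : ℝ) < 4)]
    have h6 : |x + x'| ≤ 1 := abs_le.2 ⟨by linarith [hx.1, hx'.1], by linarith [hx.2, hx'.2]⟩
    have h7 : |r + r'| ≤ 1 := abs_le.2 ⟨by linarith, by linarith⟩
    have h8 : 1 - 4 * x' ^ 2 ≤ 1 := by nlinarith [sq_nonneg x']
    have t1 : 4 * |x + x'| * |x - x'| * (4 - r' ^ 2) ≤ 2 * |x - x'| * ((4 - r ^ 2) * (4 - r' ^ 2)) := by
      have : 4 * |x + x'| * |x - x'| ≤ 2 * |x - x'| * (4 - r ^ 2) := by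
        nlinarith [abs_nonneg (x - x'), mul_nonneg (abs_nonneg (x - x')) (sub_nonneg.2 h6),
          mul_nonneg (abs_nonneg (x - x')) (sub_nonneg.2 h4)]
      nlinarith
    have t2 : (1 - 4 * x' ^ 2) * (|r + r'| * |r - r'|) ≤ |r - r'| * ((4 - r ^ 2) * (4 - r' ^ 2)) := by
      have s1 : |r + r'| * |r - r'| ≤ |r - r'| := mul_le_of_le_one_left (abs_nonneg _) h7
      have s2 : (1 - 4 * x' ^ 2) * (|r + r'| * |r - r'|) ≤ 1 * |r - r'| :=
        mul_le_mul h8 s1 (by positivity) zero_le_one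
      have s3 : 1 ≤ (4 - r ^ 2) * (4 - r' ^ 2) := by nlinarith
      nlinarith [abs_nonneg (r - r')]
    linarith
  have e : coupCoef γ r x - coupCoef γ' r' x' = (γ - γ') * q' + γ * (q - q') := by
    unfold coupCoef; rw [← hq, ← hq']; ring
  rw [e]
  refine (abs_add_le _ _).trans ?_
  rw [abs_mul, abs_mul, abs_of_nonneg hγ]
  have := mul_le_mul hγ1 hqq (abs_nonneg _) (by norm_num)
  nlinarith [abs_nonneg (γ - γ')]

theorem SlopeOn.one_le_factor {g g' : ℝ → ℝ} {c K : ℝ} (h : SlopeOn g g' c K) {N : ℕ} {t : ℝ}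
    (ht : |t| ≤ c - 1 / 2) {x : Fin (N + 1) → ℝ} (hx : x ∈ cube N) :
    1 ≤ 1 + avg fun i => coupCoef (g' (avg x + t)) (g (avg x + t)) (x i) := by
  have hu := h.avg_add_mem ht hx
  have : 0 ≤ avg fun i => coupCoef (g' (avg x + t)) (g (avg x + t)) (x i) :=
    div_nonneg (Finset.sum_nonneg fun i _ => coupCoef_nonneg (h.nonneg _ hu) (h.bound _ hu) (hx i))
      (by positivity)
  linarith

theorem SlopeOn.jac_pos {g g' : ℝ → ℝ} {c K : ℝ} (h : SlopeOn g g' c K) {N : ℕ} {t : ℝ}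
    (ht : |t| ≤ c - 1 / 2) {x : Fin (N + 1) → ℝ} (hx : x ∈ cube N) : 0 < jac g g' t x :=
  mul_pos (Finset.prod_pos fun i _ => diagCoef_pos (h.bound _ (h.avg_add_mem ht hx)) (hx i))
    (one_pos.trans_le (h.one_le_factor ht hx))

/-- Bounded distortion. -/
theorem SlopeOn.jac_le {g g' : ℝ → ℝ} {c K : ℝ} (h : SlopeOn g g' c K) (hK : 0 ≤ K) {N : ℕ} {t : ℝ}
    (ht : |t| ≤ c - 1 / 2) {x x' : Fin (N + 1) → ℝ} (hx : x ∈ cube N) (hx' : x' ∈ cube N) :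
    jac g g' t x ≤ Real.exp ((K + 808) * ∑ i, |x i - x' i|) * jac g g' t x' := by
  have hu := h.avg_add_mem ht hx
  have hu' := h.avg_add_mem ht hx'
  set S := ∑ i, |x i - x' i| with hS
  have hS0 : 0 ≤ S := Finset.sum_nonneg fun i _ => abs_nonneg _
  have hN : (1 : ℝ) ≤ N + 1 := by linarith [Nat.cast_nonneg (α := ℝ) N]
  have em : avg x + t - (avg x' + t) = avg (x - x') := by rw [avg_sub]; ring
  have hm : |avg (x - x')| * (N + 1) ≤ S := by
    have := abs_avg_le (x - x')
    rwa [le_div_iff₀ (by positivity)] at this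
  have hm1 : |avg (x - x')| ≤ S := by nlinarith [abs_nonneg (avg (x - x'))]
  set r := g (avg x + t) with hr
  set r' := g (avg x' + t) with hr'
  have hΔr : |r - r'| ≤ 26 * |avg (x - x')| := by
    obtain ⟨γ, hγ, hγ0, hγ1, -⟩ := h.exists_slope hu hu'
    rw [em] at hγ
    rw [hr, hr', hγ, abs_mul, abs_of_nonneg hγ0]
    exact mul_le_mul_of_nonneg_right (by linarith) (abs_nonneg _)
  have hprod : ∏ i, diagCoef r (x i) ≤ Real.exp (80 * S) * ∏ i, diagCoef r' (x' i) := by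
    have h1 : ∏ i, diagCoef r (x i) ≤
        ∏ i, (Real.exp (3 * |r - r'| + 2 * |x i - x' i|) * diagCoef r' (x' i)) :=
      Finset.prod_le_prod (fun i _ => (diagCoef_pos (h.bound _ hu) (hx i)).le)
        fun i _ => diagCoef_le (h.bound _ hu) (h.bound _ hu') (hx i) (hx' i)
    rw [Finset.prod_mul_distrib, ← Real.exp_sum] at h1
    refine h1.trans (mul_le_mul_of_nonneg_right (Real.exp_le_exp.2 ?_)
      (Finset.prod_nonneg fun i _ => (diagCoef_pos (h.bound _ hu') (hx' i)).le))
    rw [Finset.sum_add_distrib, Finset.sum_const, Finset.card_univ, Fintype.card_fin, nsmul_eq_mul,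
      ← Finset.mul_sum]
    push_cast
    nlinarith [mul_le_mul_of_nonneg_right hΔr (by linarith : (0 : ℝ) ≤ N + 1)]
  have hfac : 1 + avg (fun i => coupCoef (g' (avg x + t)) r (x i)) ≤
      Real.exp ((K + 728) * S) * (1 + avg fun i => coupCoef (g' (avg x' + t)) r' (x' i)) := by
    have hone := h.one_le_factor ht hx'
    rw [← hr'] at hone
    refine le_exp_mul (by linarith) ?_
    have h1 : |avg (fun i => coupCoef (g' (avg x + t)) r (x i)) -
        avg (fun i => coupCoef (g' (avg x' + t)) r' (x' i))| ≤ (K + 728) * S := by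
      rw [← avg_sub]
      refine (abs_avg_le _).trans ?_
      rw [div_le_iff₀ (by positivity)]
      have h2 : ∀ i, |coupCoef (g' (avg x + t)) r (x i) - coupCoef (g' (avg x' + t)) r' (x' i)| ≤
          (K + 676) * |avg (x - x')| + 52 * |x i - x' i| := by
        intro i
        have h3 := abs_coupCoef_sub_le (γ' := g' (avg x' + t)) (h.nonneg _ hu)
          (by linarith [h.le _ hu, abs_nonneg (g (avg x + t))]) (h.bound _ hu) (h.bound _ hu') (hx i) (hx' i)
        have h4 := h.lip _ hu _ hu'
        rw [em] at h4
        linarith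
      refine (Finset.sum_le_sum fun i _ => h2 i).trans ?_
      rw [Finset.sum_add_distrib, Finset.sum_const, Finset.card_univ, Fintype.card_fin, nsmul_eq_mul,
        ← Finset.mul_sum, ← hS]
      push_cast
      nlinarith [mul_le_mul_of_nonneg_left hm (by linarith : 0 ≤ K + 676),
        mul_nonneg (by linarith : 0 ≤ K + 728) (mul_nonneg hS0 (Nat.cast_nonneg (α := ℝ) N))]
    rw [add_sub_add_left_eq_sub]
    refine h1.trans ?_
    exact le_mul_of_one_le_right (by positivity) hone
  unfold jac
  rw [← hr, ← hr']
  have h5 := mul_le_mul hprod hfac (zero_le_one.trans (h.one_le_factor ht hx))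
    (mul_nonneg (Real.exp_pos _).le
      (Finset.prod_nonneg fun i _ => (diagCoef_pos (h.bound _ hu') (hx' i)).le))
  refine h5.trans (le_of_eq ?_)
  rw [show (K + 808) * S = 80 * S + (K + 728) * S by ring, Real.exp_add]
  ring

/-- Change of variables. -/
theorem SlopeOn.lintegral_jac {g g' : ℝ → ℝ} {c K : ℝ} (h : SlopeOn g g' c K) {N : ℕ} {t : ℝ}
    (ht : |t| ≤ c - 1 / 2) {s : Set (Fin (N + 1) → ℝ)} (hs : MeasurableSet s) (hsub : s ⊆ cube N) :
    ∫⁻ x in s, ENNReal.ofReal (jac g g' t x) = volume (liftMap g t '' s) := by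
  rw [← lintegral_abs_det_fderiv_eq_addHaar_image volume hs
    (fun x hx => (h.hasFDerivAt_liftMap ht (hsub hx)).hasFDerivWithinAt)
    ((h.injOn ht).mono hsub)]
  refine setLIntegral_congr_fun hs fun x hx => ?_
  have e : ((Matrix.toLin' (jacMatrix g g' t x)).toContinuousLinearMap).det = jac g g' t x := by
    rw [LinearMap.det_toContinuousLinearMap, LinearMap.det_toLin', det_jacMatrix]
  rw [e, abs_of_pos (h.jac_pos ht (hsub hx))]

/-! ### Inverse branches of the finite-size system -/

/-- Lebesgue measure on `X^{N+1}`. -/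
noncomputable def lebPi (N : ℕ) : Measure (Fin (N + 1) → Site) := Measure.pi fun _ => leb

instance (N : ℕ) : IsProbabilityMeasure (lebPi N) := by unfold lebPi; infer_instance

/-- The inclusion of `X^{N+1}` into the Euclidean space. -/
def emb {N : ℕ} (x : Fin (N + 1) → Site) (i : Fin (N + 1)) : ℝ := x i

theorem emb_mem {N : ℕ} (x : Fin (N + 1) → Site) : emb x ∈ cube N := fun i => (x i).2

theorem measurableEmbedding_emb (N : ℕ) : MeasurableEmbedding (emb (N := N)) := by
  refine Measurable.measurableEmbedding ?_ fun x y h => ?_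
  · exact measurable_pi_lambda _ fun i => measurable_subtype_coe.comp (measurable_pi_apply i)
  · exact funext fun i => Subtype.ext (congrFun h i)

theorem map_emb (N : ℕ) : (lebPi N).map emb = volume.restrict (cube N) := by
  have h1 : cube N = univ.pi fun _ => Site := by
    ext x; simp only [cube, mem_univ_pi]; rfl
  have h2 : SigmaFinite (leb.map (Subtype.val : Site → ℝ)) := by
    rw [map_val_leb]; infer_instance
  rw [h1, volume_pi, Measure.restrict_pi_pi, ← map_val_leb]
  exact Measure.pi_map_pi (f := fun _ => Subtype.val) fun i => measurable_subtype_coe.aemeasurable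

theorem lebPi_apply {N : ℕ} (A : Set (Fin (N + 1) → Site)) : lebPi N A = volume (emb '' A) := by
  have h := (measurableEmbedding_emb N).map_apply (lebPi N) (emb '' A)
  rw [preimage_image_eq _ (measurableEmbedding_emb N).injective, map_emb] at h
  rw [← h]
  have hc : MeasurableSet (cube N) := by
    have : cube N = range emb := by
      ext x
      exact ⟨fun hx => ⟨fun i => ⟨x i, hx i⟩, rfl⟩, by rintro ⟨y, rfl⟩; exact emb_mem y⟩
    rw [this]; exact (measurableEmbedding_emb N).measurableSet_range
  refine Measure.restrict_eq_self _ ?_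
  rintro _ ⟨x, -, rfl⟩
  exact emb_mem x

/-- The integer translate that belongs to a choice of branches. -/
noncomputable def shift {N : ℕ} (ι : Fin (N + 1) → Bool) (i : Fin (N + 1)) : ℝ :=
  if ι i then 1 else 0

theorem shift_mem {N : ℕ} (ι : Fin (N + 1) → Bool) (i : Fin (N + 1)) : shift ι i = 0 ∨ shift ι i = 1 := by
  unfold shift; split_ifs <;> simp

/-- The preimage of `A` under the branch `ι`. -/
def branchSet {N : ℕ} (g : ℝ → ℝ) (t : ℝ) (ι : Fin (N + 1) → Bool) (A : Set (Fin (N + 1) → Site)) :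
    Set (Fin (N + 1) → Site) :=
  {x | liftMap g t (emb x) - shift ι ∈ emb '' A}

theorem measurable_liftMap {N : ℕ} {g : ℝ → ℝ} (hg : Measurable g) (t : ℝ) :
    Measurable (liftMap (N := N) g t) := by
  refine measurable_pi_lambda _ fun i => ?_
  have h : Measurable fun x : Fin (N + 1) → ℝ => g (avg x + t) := by
    refine hg.comp ?_
    unfold avg
    fun_prop
  unfold liftMap fracMap
  exact Measurable.div (((h.add_const _).mul (measurable_pi_apply i)).add (h.add_const _))
    (((h.const_mul _).mul (measurable_pi_apply i)).add_const _)

theorem measurableSet_branchSet {N : ℕ} {g : ℝ → ℝ} (hg : Measurable g) (t : ℝ)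
    (ι : Fin (N + 1) → Bool) {A : Set (Fin (N + 1) → Site)} (hA : MeasurableSet A) :
    MeasurableSet (branchSet g t ι A) :=
  (((measurable_liftMap hg t).comp (measurableEmbedding_emb N).measurable).sub_const _)
    ((measurableEmbedding_emb N).measurableSet_image.2 hA)

theorem SlopeOn.image_branchSet {g g' : ℝ → ℝ} {c K : ℝ} (h : SlopeOn g g' c K) {N : ℕ} {t : ℝ}
    (ht : |t| ≤ c - 1 / 2) (ι : Fin (N + 1) → Bool) (A : Set (Fin (N + 1) → Site)) :
    liftMap g t '' (emb '' branchSet g t ι A) = (fun y => y - shift ι) ⁻¹' (emb '' A) := by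
  ext y
  constructor
  · rintro ⟨_, ⟨x, hx, rfl⟩, rfl⟩
    exact hx
  · rintro ⟨a, ha, he⟩
    have hy : ∀ i, y i ∈ Icc (-1 / 2 : ℝ) (3 / 2) := by
      intro i
      have h1 := (a i).2
      have h2 : (a i : ℝ) = y i - shift ι i := congrFun he i
      rcases shift_mem ι i with h3 | h3 <;> rw [h3] at h2 <;>
        constructor <;> linarith [h1.1, h1.2]
    obtain ⟨x, hx, hxy⟩ := h.surjOn ht hy
    refine ⟨x, ⟨fun i => ⟨x i, hx i⟩, ?_, rfl⟩, hxy⟩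
    refine ⟨a, ha, ?_⟩
    change emb a = liftMap g t x - shift ι
    rw [hxy]; exact he

theorem SlopeOn.lintegral_jac_branchSet {g g' : ℝ → ℝ} {c K : ℝ} (h : SlopeOn g g' c K)
    (hg : Measurable g) {N : ℕ} {t : ℝ} (ht : |t| ≤ c - 1 / 2) (ι : Fin (N + 1) → Bool)
    {A : Set (Fin (N + 1) → Site)} (hA : MeasurableSet A) :
    ∫⁻ x in branchSet g t ι A, ENNReal.ofReal (jac g g' t (emb x)) ∂lebPi N = lebPi N A := by
  have he := measurableEmbedding_emb N
  set B := branchSet g t ι A with hB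
  have hBm : MeasurableSet B := measurableSet_branchSet hg t ι hA
  have hsub : emb '' B ⊆ cube N := by rintro _ ⟨x, -, rfl⟩; exact emb_mem x
  have h1 := h.lintegral_jac ht (he.measurableSet_image.2 hBm) hsub
  rw [hB, h.image_branchSet ht] at h1
  simp only [sub_eq_add_neg] at h1
  rw [measure_preimage_add_right, ← lebPi_apply, ← hB] at h1
  have h2 := he.lintegral_map (μ := (lebPi N).restrict B) fun y => ENNReal.ofReal (jac g g' t y)
  have h3 := he.restrict_map (lebPi N) (emb '' B)
  rw [preimage_image_eq B he.injective, map_emb, Measure.restrict_restrict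
    (he.measurableSet_image.2 hBm), inter_eq_self_of_subset_left hsub] at h3
  rw [← h1, ← h2, h3]

/-- Squared Euclidean distance. -/
noncomputable def sqDist {N : ℕ} (x y : Fin (N + 1) → Site) : ℝ := ∑ i, ((x i : ℝ) - y i) ^ 2

theorem SlopeOn.sqDist_branchSet {g g' : ℝ → ℝ} {c K : ℝ} (h : SlopeOn g g' c K) {N : ℕ} {t : ℝ}
    (ht : |t| ≤ c - 1 / 2) {ι : Fin (N + 1) → Bool} {A B : Set (Fin (N + 1) → Site)} {D : ℝ}
    (hD : ∀ a ∈ A, ∀ b ∈ B, sqDist a b ≤ D ^ 2) :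
    ∀ a ∈ branchSet g t ι A, ∀ b ∈ branchSet g t ι B, sqDist a b ≤ (19 / 20 * D) ^ 2 := by
  rintro x ⟨a, ha, hxa⟩ x' ⟨b, hb, hxb⟩
  have h1 := h.expand ht (emb_mem x) (emb_mem x')
  have h2 : ∑ i, (liftMap g t (emb x) i - liftMap g t (emb x') i) ^ 2 = sqDist a b := by
    refine Finset.sum_congr rfl fun i _ => ?_
    have e1 : (a i : ℝ) = liftMap g t (emb x) i - shift ι i := congrFun hxa i
    have e2 : (b i : ℝ) = liftMap g t (emb x') i - shift ι i := congrFun hxb i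
    rw [e1, e2]; ring
  rw [h2] at h1
  have h3 : sqDist x x' ≤ 9 / 10 * sqDist a b := h1
  have h4 := hD a ha b hb
  nlinarith [sq_nonneg D]

theorem sum_abs_le_sqrt {N : ℕ} {x y : Fin (N + 1) → Site} {D : ℝ} (hD0 : 0 ≤ D)
    (hD : sqDist x y ≤ D ^ 2) : ∑ i, |emb x i - emb y i| ≤ √((N : ℝ) + 1) * D := by
  have h := sq_sum_le_card_mul_sum_sq (s := Finset.univ) (f := fun i => |emb x i - emb y i|)
  simp only [sq_abs, Finset.card_univ, Fintype.card_fin] at h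
  refine abs_le_of_sq_le_sq' ?_ (by positivity) |>.2
  rw [mul_pow, Real.sq_sqrt (by positivity)]
  push_cast at h
  refine h.trans (mul_le_mul_of_nonneg_left hD (by positivity))

theorem siteFun_eq {r x : ℝ} (hr : |r| ≤ 1 / 2) (hx : x ∈ Site) :
    siteFun r x = if fracMap r x ≤ 1 / 2 then fracMap r x else fracMap r x - 1 := by
  unfold siteFun
  have h := fracMap_le_iff hr hx (z := 1 / 2) (by norm_num)
  rw [fracInv_half] at h
  simp only [h]

theorem SlopeOn.emb_coupledStep {g g' : ℝ → ℝ} {c K : ℝ} (h : SlopeOn g g' c K) {N : ℕ} {t : ℝ}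
    (ht : |t| ≤ c - 1 / 2) (x : Fin (N + 1) → Site) (i : Fin (N + 1)) :
    (coupledStep g N x t i : ℝ) = if liftMap g t (emb x) i ≤ 1 / 2 then liftMap g t (emb x) i
      else liftMap g t (emb x) i - 1 := by
  have hb := h.bound _ (h.avg_add_mem ht (emb_mem x))
  have e : (coupledStep g N x t i : ℝ) = siteFun (g (avg (emb x) + t)) (x i) :=
    coe_siteMap (hb.trans_lt (by norm_num)) _
  rw [e, siteFun_eq (by linarith) (x i).2]; rfl

theorem SlopeOn.preimage_subset {g g' : ℝ → ℝ} {c K : ℝ} (h : SlopeOn g g' c K) {N : ℕ} {t : ℝ}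
    (ht : |t| ≤ c - 1 / 2) (A : Set (Fin (N + 1) → Site)) :
    (fun x => coupledStep g N x t) ⁻¹' A ⊆ ⋃ ι, branchSet g t ι A := by
  intro x hx
  refine mem_iUnion.2 ⟨fun i => decide (1 / 2 < liftMap g t (emb x) i), ?_⟩
  refine ⟨_, hx, ?_⟩
  funext i
  change (coupledStep g N x t i : ℝ) = liftMap g t (emb x) i - shift _ i
  rw [h.emb_coupledStep ht]
  by_cases h1 : liftMap g t (emb x) i ≤ 1 / 2
  · simp only [shift, h1, if_true, not_lt.2 h1, decide_false, Bool.false_eq_true, if_false, sub_zero]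
  · simp only [shift, h1, if_false, not_le.1 h1, decide_true, if_true]

theorem SlopeOn.branchSet_subset {g g' : ℝ → ℝ} {c K : ℝ} (h : SlopeOn g g' c K) {N : ℕ} {t : ℝ}
    (ht : |t| ≤ c - 1 / 2) {A : Set (Fin (N + 1) → Site)} (hA : ∀ a ∈ A, ∀ i, (a i : ℝ) ≠ -1 / 2)
    {ι : Fin (N + 1) → Bool} {x : Fin (N + 1) → Site} (hx : x ∈ branchSet g t ι A) :
    coupledStep g N x t ∈ A ∧ ∀ i, ι i = decide (1 / 2 < liftMap g t (emb x) i) := by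
  obtain ⟨a, ha, hax⟩ := hx
  have e1 : ∀ i, (a i : ℝ) = liftMap g t (emb x) i - shift ι i := fun i => congrFun hax i
  have key : ∀ i, ι i = decide (1 / 2 < liftMap g t (emb x) i) := by
    intro i
    have h1 := e1 i
    have h2 := (a i).2
    have h3 := hA a ha i
    cases hi : ι i
    · simp only [shift, hi, Bool.false_eq_true, if_false, sub_zero] at h1
      rw [eq_comm, decide_eq_false_iff_not, ← h1, not_lt]; exact h2.2
    · simp only [shift, hi, if_true] at h1
      rw [eq_comm, decide_eq_true_iff]
      have : -1 / 2 < (a i : ℝ) := lt_of_le_of_ne h2.1 (Ne.symm h3)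
      linarith
  refine ⟨?_, key⟩
  have : coupledStep g N x t = a := by
    funext i
    apply Subtype.ext
    rw [h.emb_coupledStep ht, e1 i]
    simp only [shift, key i, decide_eq_true_eq]
    by_cases h1 : 1 / 2 < liftMap g t (emb x) i
    · rw [if_neg (not_le.2 h1), if_pos h1]
    · rw [if_pos (not_lt.1 h1), if_neg h1, sub_zero]
  rw [this]; exact ha

theorem leb_coe_eq (c : ℝ) : leb {y : Site | (y : ℝ) = c} = 0 := by
  have h := (MeasurableEmbedding.subtype_coe measurableSet_Icc).map_apply leb ({c} : Set ℝ)
  rw [map_val_leb] at h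
  change leb (Subtype.val ⁻¹' {c}) = 0
  rw [← h]
  exact le_antisymm ((Measure.restrict_apply_le _ _).trans_eq Real.volume_singleton) zero_le

theorem lebPi_coord_eq (N : ℕ) (c : ℝ) : lebPi N {x | ∃ i, (x i : ℝ) = c} = 0 := by
  have : {x : Fin (N + 1) → Site | ∃ i, (x i : ℝ) = c} = ⋃ i, Function.eval i ⁻¹' {y : Site | (y : ℝ) = c} := by
    ext x; simp
  rw [this, measure_iUnion_null_iff]
  intro i
  exact Measure.pi_eval_preimage_null _ (leb_coe_eq c)

theorem SlopeOn.lebPi_branchSet {g g' : ℝ → ℝ} {c K : ℝ} (h : SlopeOn g g' c K) (hK : 0 ≤ K)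
    (hg : Measurable g) {N : ℕ} {t : ℝ} (ht : |t| ≤ c - 1 / 2) (ι : Fin (N + 1) → Bool)
    {A : Set (Fin (N + 1) → Site)} (hA : MeasurableSet A) :
    lebPi N (branchSet g t ι A) = 0 ↔ lebPi N A = 0 := by
  have h1 := h.lintegral_jac_branchSet hg ht ι hA
  have hm := measurableSet_branchSet hg t ι hA
  constructor
  · intro h0
    rw [← h1, Measure.restrict_eq_zero.2 h0, lintegral_zero_measure]
  · intro h0
    by_contra hne
    rw [h0] at h1
    obtain ⟨x₀, -⟩ := nonempty_of_measure_ne_zero hne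
    set M := Real.exp ((K + 808) * (N + 1)) with hM
    have hlow : ∀ x ∈ branchSet g t ι A,
        ENNReal.ofReal (M⁻¹ * jac g g' t (emb x₀)) ≤ ENNReal.ofReal (jac g g' t (emb x)) := by
      intro x _
      refine ENNReal.ofReal_le_ofReal ((inv_mul_le_iff₀ (Real.exp_pos _)).2 ?_)
      refine (h.jac_le hK ht (emb_mem x₀) (emb_mem x)).trans
        (mul_le_mul_of_nonneg_right (Real.exp_le_exp.2 ?_) (h.jac_pos ht (emb_mem x)).le)
      refine mul_le_mul_of_nonneg_left ?_ (by linarith)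
      have := Finset.sum_le_card_nsmul Finset.univ (fun i => |emb x₀ i - emb x i|) 1 fun i _ =>
        abs_le.2 ⟨by linarith [(emb_mem x₀ i).1, (emb_mem x i).2],
          by linarith [(emb_mem x₀ i).2, (emb_mem x i).1]⟩
      simpa using this
    have h2 := setLIntegral_mono' (μ := lebPi N) hm hlow
    rw [h1, setLIntegral_const, nonpos_iff_eq_zero, mul_eq_zero] at h2
    refine h2.elim (fun h3 => ?_) hne
    exact absurd (ENNReal.ofReal_eq_zero.1 h3)
      (not_le.2 (mul_pos (inv_pos.2 (Real.exp_pos _)) (h.jac_pos ht (emb_mem x₀))))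

/-- The finite-size system is nonsingular. -/
theorem SlopeOn.nonsingular {g g' : ℝ → ℝ} {c K : ℝ} (h : SlopeOn g g' c K) (hK : 0 ≤ K)
    (hg : Measurable g) {N : ℕ} {t : ℝ} (ht : |t| ≤ c - 1 / 2)
    {A : Set (Fin (N + 1) → Site)} (hA : MeasurableSet A) (h0 : lebPi N A = 0) :
    lebPi N ((fun x => coupledStep g N x t) ⁻¹' A) = 0 :=
  measure_mono_null (h.preimage_subset ht A)
    (measure_iUnion_null fun ι => (h.lebPi_branchSet hK hg ht ι hA).2 h0)

theorem SlopeOn.lebPi_mul_le {g g' : ℝ → ℝ} {c K : ℝ} (h : SlopeOn g g' c K) (hK : 0 ≤ K)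
    (hg : Measurable g) {N : ℕ} {t : ℝ} (ht : |t| ≤ c - 1 / 2) (ι : Fin (N + 1) → Bool)
    {A B : Set (Fin (N + 1) → Site)} (hA : MeasurableSet A) (hB : MeasurableSet B) {D : ℝ}
    (hD0 : 0 ≤ D) (hD : ∀ a ∈ A, ∀ b ∈ B, sqDist a b ≤ D ^ 2) :
    lebPi N (branchSet g t ι A) * lebPi N B ≤
      ENNReal.ofReal (Real.exp ((K + 808) * (√((N : ℝ) + 1) * (19 / 20 * D)))) *
        (lebPi N A * lebPi N (branchSet g t ι B)) := by
  have hAm := measurableSet_branchSet hg t ι hA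
  have hBm := measurableSet_branchSet hg t ι hB
  set M := ENNReal.ofReal (Real.exp ((K + 808) * (√((N : ℝ) + 1) * (19 / 20 * D)))) with hM
  have hpt : ∀ x ∈ branchSet g t ι A, ∀ x' ∈ branchSet g t ι B,
      ENNReal.ofReal (jac g g' t (emb x')) ≤ M * ENNReal.ofReal (jac g g' t (emb x)) := by
    intro x hx x' hx'
    have h1 := h.sqDist_branchSet ht hD x hx x' hx'
    have h2 := sum_abs_le_sqrt (by positivity) h1
    have h3 := h.jac_le hK ht (emb_mem x') (emb_mem x)
    rw [hM, ← ENNReal.ofReal_mul (Real.exp_pos _).le]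
    refine ENNReal.ofReal_le_ofReal (h3.trans ?_)
    refine mul_le_mul_of_nonneg_right (Real.exp_le_exp.2 ?_) (h.jac_pos ht (emb_mem x)).le
    refine mul_le_mul_of_nonneg_left ?_ (by linarith)
    simp only [abs_sub_comm (emb x' _)]
    exact h2
  have h1 : ∀ x ∈ branchSet g t ι A, lebPi N B ≤
      M * ENNReal.ofReal (jac g g' t (emb x)) * lebPi N (branchSet g t ι B) := by
    intro x hx
    rw [← h.lintegral_jac_branchSet hg ht ι hB, ← setLIntegral_const]
    exact setLIntegral_mono' hBm fun x' hx' => hpt x hx x' hx'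
  calc lebPi N (branchSet g t ι A) * lebPi N B = ∫⁻ _ in branchSet g t ι A, lebPi N B ∂lebPi N := by
        rw [setLIntegral_const, mul_comm]
    _ ≤ ∫⁻ x in branchSet g t ι A, M * lebPi N (branchSet g t ι B) *
          ENNReal.ofReal (jac g g' t (emb x)) ∂lebPi N :=
        setLIntegral_mono' hAm fun x hx => (h1 x hx).trans_eq (by ring)
    _ = M * lebPi N (branchSet g t ι B) * lebPi N A := by
        rw [lintegral_const_mul' _ _ (ENNReal.mul_ne_top ENNReal.ofReal_ne_top (measure_ne_top _ _)),
          h.lintegral_jac_branchSet hg ht ι hA]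
    _ = _ := by ring

/-- At scales up to `del` the densities of `m` are comparable: `m A / λ A` and `m B / λ B` differ by
at most the factor `exp (L D + kap)` if all distances between `A` and `B` are at most `D`. -/
def Comparable {N : ℕ} (L del kap : ℝ) (m : Measure (Fin (N + 1) → Site)) : Prop :=
  ∀ A B, MeasurableSet A → MeasurableSet B → ∀ D, 0 ≤ D → D ≤ del →
    (∀ a ∈ A, ∀ b ∈ B, sqDist a b ≤ D ^ 2) →
    m A * lebPi N B ≤ ENNReal.ofReal (Real.exp (L * D + kap)) * (lebPi N A * m B)

theorem ENNReal_cancel {a b c d e f p q : ENNReal} (h1 : a * b ≤ p * (c * d)) (h2 : c * e ≤ q * (f * b))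
    (hb : b ≠ 0) (hb' : b ≠ ⊤) (hc : c ≠ 0) (hc' : c ≠ ⊤) : a * e ≤ p * q * (f * d) := by
  have h3 : (b * c) * (a * e) ≤ (b * c) * (p * q * (f * d)) := by
    calc (b * c) * (a * e) = (a * b) * (c * e) := by ring
      _ ≤ (p * (c * d)) * (q * (f * b)) := mul_le_mul' h1 h2
      _ = _ := by ring
  exact (ENNReal.mul_le_mul_iff_right (mul_ne_zero hb hc) (ENNReal.mul_ne_top hb' hc')).1 h3

theorem SlopeOn.comparable_preimage {g g' : ℝ → ℝ} {c K : ℝ} (h : SlopeOn g g' c K) (hK : 0 ≤ K)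
    (hg : Measurable g) {N : ℕ} {t : ℝ} (ht : |t| ≤ c - 1 / 2) {L del kap : ℝ}
    (hL : 19 / 20 * (L + (K + 808) * √((N : ℝ) + 1)) ≤ L)
    {m : Measure (Fin (N + 1) → Site)} (hm : Comparable L del kap m)
    {A B : Set (Fin (N + 1) → Site)} (hA : MeasurableSet A) (hB : MeasurableSet B) {D : ℝ}
    (hD0 : 0 ≤ D) (hDdel : D ≤ 20 / 19 * del) (hD : ∀ a ∈ A, ∀ b ∈ B, sqDist a b ≤ D ^ 2) :
    m ((fun x => coupledStep g N x t) ⁻¹' A) * lebPi N B ≤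
      ENNReal.ofReal (Real.exp (L * D + kap)) *
        (lebPi N A * m ((fun x => coupledStep g N x t) ⁻¹' B)) := by
  set bd : Set (Fin (N + 1) → Site) := {x | ∃ i, (x i : ℝ) = -1 / 2} with hbd
  have hbdm : MeasurableSet bd := by
    have : bd = ⋃ i, {x : Fin (N + 1) → Site | (x i : ℝ) = -1 / 2} := by ext x; simp [hbd]
    rw [this]
    exact MeasurableSet.iUnion fun i =>
      (measurable_subtype_coe.comp (measurable_pi_apply i)) (measurableSet_singleton _)
  set B' := B \ bd with hB'
  have hB'm : MeasurableSet B' := hB.diff hbdm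
  have hBB' : lebPi N B' = lebPi N B := measure_sdiff_null (lebPi_coord_eq N _)
  have hB'ne : ∀ a ∈ B', ∀ i, (a i : ℝ) ≠ -1 / 2 := fun a ha i he => ha.2 ⟨i, he⟩
  have hD' : ∀ a ∈ A, ∀ b ∈ B', sqDist a b ≤ D ^ 2 := fun a ha b hb => hD a ha b hb.1
  rw [← hBB']
  have hpiece : ∀ ι, m (branchSet g t ι A) * lebPi N B' ≤ ENNReal.ofReal (Real.exp (L * D + kap)) *
      (lebPi N A * m (branchSet g t ι B')) := by
    intro ι
    rcases eq_or_ne (lebPi N B') 0 with h0 | h0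
    · rw [h0, mul_zero]; exact zero_le
    have hb0 := mt (h.lebPi_branchSet hK hg ht ι hB'm).1 h0
    have h1 := hm _ _ (measurableSet_branchSet hg t ι hA) (measurableSet_branchSet hg t ι hB'm)
      (19 / 20 * D) (by positivity) (by linarith) (h.sqDist_branchSet ht hD')
    rcases eq_or_ne (lebPi N A) 0 with h2 | h2
    · have h3 := (h.lebPi_branchSet hK hg ht ι hA).2 h2
      rw [h3, zero_mul, mul_zero, nonpos_iff_eq_zero, mul_eq_zero] at h1
      rw [h1.resolve_right hb0, zero_mul]; exact zero_le
    have ha0 := mt (h.lebPi_branchSet hK hg ht ι hA).1 h2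
    have h3 := h.lebPi_mul_le hK hg ht ι hA hB'm hD0 hD'
    refine (ENNReal_cancel h1 h3 hb0 (measure_ne_top _ _) ha0 (measure_ne_top _ _)).trans ?_
    rw [← ENNReal.ofReal_mul (Real.exp_pos _).le, ← Real.exp_add]
    refine mul_le_mul_left (ENNReal.ofReal_le_ofReal (Real.exp_le_exp.2 ?_)) _
    nlinarith [mul_le_mul_of_nonneg_right hL hD0]
  have hdisj : Pairwise (Function.onFun Disjoint fun ι => branchSet g t ι B') := by
    intro ι κ hne
    refine disjoint_left.2 fun x hx hx' => hne (funext fun i => ?_)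
    rw [(h.branchSet_subset ht hB'ne hx).2 i, (h.branchSet_subset ht hB'ne hx').2 i]
  calc m ((fun x => coupledStep g N x t) ⁻¹' A) * lebPi N B'
      ≤ (∑ ι, m (branchSet g t ι A)) * lebPi N B' := by
        refine mul_le_mul_left ((measure_mono (h.preimage_subset ht A)).trans ?_) _
        exact (measure_iUnion_le _).trans_eq (tsum_fintype _)
    _ = ∑ ι, m (branchSet g t ι A) * lebPi N B' := Finset.sum_mul _ _ _
    _ ≤ ∑ ι, ENNReal.ofReal (Real.exp (L * D + kap)) * (lebPi N A * m (branchSet g t ι B')) :=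
        Finset.sum_le_sum fun ι _ => hpiece ι
    _ = ENNReal.ofReal (Real.exp (L * D + kap)) * (lebPi N A * m (⋃ ι, branchSet g t ι B')) := by
        rw [measure_iUnion hdisj fun ι => measurableSet_branchSet hg t ι hB'm, tsum_fintype,
          Finset.mul_sum, Finset.mul_sum]
    _ ≤ _ := by
        refine mul_le_mul_right (mul_le_mul_right (measure_mono (iUnion_subset fun ι x hx => ?_)) _) _
        exact ((h.branchSet_subset ht hB'ne hx).1).1

/-! ### The action of a noisy system on measures -/

section Push
variable {S : Type*} [MeasurableSpace S]

/-- One step of the noisy system, acting on measures. -/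
noncomputable def pushNoise (Φ : S → ℝ → S) (ϱ : Measure ℝ) (m : Measure S) : Measure S :=
  (m.prod ϱ).map fun p => Φ p.1 p.2

variable {Φ : S → ℝ → S} {ϱ : Measure ℝ}

theorem pushNoise_apply (hΦ : Measurable fun p : S × ℝ => Φ p.1 p.2) [SFinite ϱ] (m : Measure S)
    [SFinite m] {A : Set S} (hA : MeasurableSet A) :
    pushNoise Φ ϱ m A = ∫⁻ t, m ((fun s => Φ s t) ⁻¹' A) ∂ϱ := by
  unfold pushNoise
  rw [Measure.map_apply hΦ hA, Measure.prod_apply_symm (hΦ hA)]; rfl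

theorem isStationary_iff_pushNoise (hΦ : Measurable fun p : S × ℝ => Φ p.1 p.2) [SFinite ϱ]
    (m : Measure S) [SFinite m] : IsStationary Φ ϱ m ↔ pushNoise Φ ϱ m = m := by
  have key : ∀ A, MeasurableSet A → pushNoise Φ ϱ m A = ∫⁻ s, ϱ {t | Φ s t ∈ A} ∂m := by
    intro A hA
    unfold pushNoise
    rw [Measure.map_apply hΦ hA, Measure.prod_apply (hΦ hA)]; rfl
  constructor
  · intro h
    ext A hA
    rw [key A hA, h A hA]
  · intro h A hA
    rw [← key A hA, h]

theorem pushNoise_mono (hΦ : Measurable fun p : S × ℝ => Φ p.1 p.2) [SFinite ϱ] {m m' : Measure S}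
    [SFinite m] [SFinite m'] (h : m ≤ m') : pushNoise Φ ϱ m ≤ pushNoise Φ ϱ m' := by
  refine Measure.le_iff.2 fun A hA => ?_
  rw [pushNoise_apply hΦ _ hA, pushNoise_apply hΦ _ hA]
  exact lintegral_mono fun t => h _

theorem pushNoise_add (hΦ : Measurable fun p : S × ℝ => Φ p.1 p.2) [SFinite ϱ] (m m' : Measure S)
    [SFinite m] [SFinite m'] : pushNoise Φ ϱ (m + m') = pushNoise Φ ϱ m + pushNoise Φ ϱ m' := by
  unfold pushNoise
  rw [Measure.add_prod, Measure.map_add _ _ hΦ]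

theorem pushNoise_smul (Φ : S → ℝ → S) (ϱ : Measure ℝ) [SFinite ϱ] (r : ENNReal) (m : Measure S)
    [SFinite m] : pushNoise Φ ϱ (r • m) = r • pushNoise Φ ϱ m := by
  unfold pushNoise
  rw [Measure.prod_smul_left, Measure.map_smul]

theorem pushNoise_univ (hΦ : Measurable fun p : S × ℝ => Φ p.1 p.2) [IsProbabilityMeasure ϱ]
    (m : Measure S) [SFinite m] : pushNoise Φ ϱ m univ = m univ := by
  rw [pushNoise_apply hΦ _ MeasurableSet.univ]
  simp

end Push

theorem measurable_coupledStep {g : ℝ → ℝ} (hg : Measurable g) (N : ℕ) :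
    Measurable fun p : (Fin (N + 1) → Site) × ℝ => coupledStep g N p.1 p.2 := by
  refine measurable_pi_lambda _ fun i => ?_
  have h1 : Measurable fun p : (Fin (N + 1) → Site) × ℝ =>
      g ((∑ j, (p.1 j : ℝ)) / (N + 1) + p.2) := by
    refine hg.comp (Measurable.add (Measurable.div_const (Finset.measurable_sum _ fun j _ => ?_) _)
      measurable_snd)
    exact measurable_subtype_coe.comp ((measurable_pi_apply j).comp measurable_fst)
  exact measurable_siteMap_uncurry.comp
    (h1.prodMk ((measurable_pi_apply i).comp measurable_fst))

theorem SlopeOn.comparable_pushNoise {g g' : ℝ → ℝ} {c K : ℝ} (h : SlopeOn g g' c K) (hK : 0 ≤ K)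
    (hg : Measurable g) {N : ℕ} {ϱ : Measure ℝ} [IsProbabilityMeasure ϱ]
    (hϱ : ∀ᵐ t ∂ϱ, |t| ≤ c - 1 / 2) {L del kap : ℝ}
    (hL : 19 / 20 * (L + (K + 808) * √((N : ℝ) + 1)) ≤ L)
    {m : Measure (Fin (N + 1) → Site)} [IsFiniteMeasure m] (hm : Comparable L del kap m) :
    Comparable L (20 / 19 * del) kap (pushNoise (coupledStep g N) ϱ m) := by
  intro A B hA hB D hD0 hDdel hD
  have hΦ := measurable_coupledStep hg N
  rw [pushNoise_apply hΦ _ hA, pushNoise_apply hΦ _ hB,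
    ← lintegral_mul_const' _ _ (measure_ne_top _ _), ← lintegral_const_mul' _ _ (measure_ne_top _ _),
    ← lintegral_const_mul' _ _ ENNReal.ofReal_ne_top]
  refine lintegral_mono_ae ?_
  filter_upwards [hϱ] with t ht
  exact h.comparable_preimage hK hg ht hL hm hA hB hD0 hDdel hD

theorem exists_comparable_approx {N : ℕ} {m : Measure (Fin (N + 1) → Site)} [IsFiniteMeasure m]
    (hac : m ≪ lebPi N) {L : ℝ} (hL : 0 ≤ L) {σ : ℝ} (hσ : 0 < σ) :
    ∃ m₀ e : Measure (Fin (N + 1) → Site), IsFiniteMeasure m₀ ∧ IsFiniteMeasure e ∧ m ≤ m₀ + e ∧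
      m₀ ≤ m + e ∧ e univ ≤ ENNReal.ofReal σ ∧ ∃ del > 0, Comparable L del 1 m₀ := by
  set f := fun x => (m.rnDeriv (lebPi N) x).toReal with hf
  have hfi : Integrable f (lebPi N) := Measure.integrable_toReal_rnDeriv
  obtain ⟨h, hh, -⟩ := hfi.exists_boundedContinuous_integral_sub_le (half_pos hσ)
  set g₀ := fun x => max (h x) 0 + σ / 2 with hg₀
  have hcont : Continuous g₀ := by fun_prop
  have hpos : ∀ x, σ / 2 ≤ g₀ x := fun x => by
    have := le_max_right (h x) 0
    simp only [hg₀]; linarith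
  have hgi : Integrable g₀ (lebPi N) := integrable_of_continuous hcont _
  have hfm : Measurable f := (Measure.measurable_rnDeriv _ _).ennreal_toReal
  have hm : m = (lebPi N).withDensity fun x => ENNReal.ofReal (f x) := by
    have := Measure.haveLebesgueDecomposition_of_sigmaFinite m (lebPi N)
    refine (Measure.withDensity_rnDeriv_eq m (lebPi N) hac).symm.trans (withDensity_congr_ae ?_)
    filter_upwards [Measure.rnDeriv_lt_top m (lebPi N)] with x hx
    exact (ENNReal.ofReal_toReal hx.ne).symm
  have hle : ∀ u v : (Fin (N + 1) → Site) → ℝ, Measurable u → Measurable v →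
      (lebPi N).withDensity (fun x => ENNReal.ofReal (u x)) ≤
        (lebPi N).withDensity (fun x => ENNReal.ofReal (v x)) +
        (lebPi N).withDensity (fun x => ENNReal.ofReal |u x - v x|) := by
    intro u v hu hv
    rw [← withDensity_add_left hv.ennreal_ofReal]
    refine withDensity_mono (Eventually.of_forall fun x => ?_)
    refine le_trans ?_ ENNReal.ofReal_add_le
    exact ENNReal.ofReal_le_ofReal (by linarith [le_abs_self (u x - v x)])
  have hfin : ∀ u : (Fin (N + 1) → Site) → ℝ, Integrable u (lebPi N) →
      IsFiniteMeasure ((lebPi N).withDensity fun x => ENNReal.ofReal (u x)) := fun u hu =>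
    isFiniteMeasure_withDensity_ofReal hu.2
  have hdi : Integrable (fun x => |f x - g₀ x|) (lebPi N) := (hfi.sub hgi).abs
  refine ⟨(lebPi N).withDensity fun x => ENNReal.ofReal (g₀ x),
    (lebPi N).withDensity fun x => ENNReal.ofReal |f x - g₀ x|, hfin _ hgi,
    hfin _ hdi, ?_, ?_, ?_, ?_⟩
  · conv_lhs => rw [hm]
    exact hle f g₀ hfm hcont.measurable
  · conv_rhs => rw [hm]
    simp only [abs_sub_comm (f _)]
    exact hle g₀ f hcont.measurable hfm
  · rw [withDensity_apply _ MeasurableSet.univ, Measure.restrict_univ,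
      ← ofReal_integral_eq_lintegral_ofReal hdi (Eventually.of_forall fun _ => abs_nonneg _)]
    refine ENNReal.ofReal_le_ofReal ?_
    have hhi : Integrable (fun x => ‖f x - h x‖) (lebPi N) :=
      (hfi.sub (integrable_of_continuous h.continuous _)).norm
    have h0 : ∀ᵐ x ∂lebPi N, |f x - g₀ x| ≤ ‖f x - h x‖ + σ / 2 := by
      refine Eventually.of_forall fun x => ?_
      have h1 : 0 ≤ f x := ENNReal.toReal_nonneg
      have h2 : |f x - max (h x) 0| ≤ |f x - h x| := by
        rcases le_total (h x) 0 with h3 | h3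
        · rw [max_eq_right h3, sub_zero, abs_of_nonneg h1, abs_of_nonneg (by linarith)]; linarith
        · rw [max_eq_left h3]
      have h3 : f x - g₀ x = (f x - max (h x) 0) + -(σ / 2) := by simp only [hg₀]; ring
      rw [h3, Real.norm_eq_abs]
      refine (abs_add_le _ _).trans ?_
      rw [abs_neg, abs_of_pos (half_pos hσ)]
      linarith
    have h1 := integral_mono_ae hdi (hhi.add (integrable_const (σ / 2))) h0
    refine h1.trans ?_
    simp only [Pi.add_apply]
    rw [integral_add hhi (integrable_const _)]
    simp only [integral_const, probReal_univ, one_smul]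
    linarith
  · obtain ⟨d, hd, hdu⟩ := Metric.uniformContinuous_iff.1
      (CompactSpace.uniformContinuous_of_continuous hcont) (σ / 2) (half_pos hσ)
    refine ⟨d / 2, half_pos hd, ?_⟩
    intro A B hA hB D hD0 hDd hD
    set M := ENNReal.ofReal (Real.exp (L * D + 1)) with hM
    have hpt : ∀ a ∈ A, ∀ b ∈ B, ENNReal.ofReal (g₀ a) ≤ M * ENNReal.ofReal (g₀ b) := by
      intro a ha b hb
      have h1 : dist a b ≤ D := by
        refine (dist_pi_le_iff hD0).2 fun i => ?_
        rw [Subtype.dist_eq, Real.dist_eq]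
        refine abs_le_of_sq_le_sq ?_ hD0
        refine le_trans ?_ (hD a ha b hb)
        exact Finset.single_le_sum (f := fun i => ((a i : ℝ) - b i) ^ 2) (fun i _ => sq_nonneg _)
          (Finset.mem_univ i)
      have h2 := hdu (h1.trans_lt (by linarith))
      rw [Real.dist_eq] at h2
      have h3 : g₀ a ≤ Real.exp (L * D + 1) * g₀ b := by
        have h4 := (abs_lt.1 h2).2
        have h5 := hpos b
        have h6 := Real.add_one_le_exp (L * D + 1)
        nlinarith [mul_nonneg hL hD0]
      rw [hM, ← ENNReal.ofReal_mul (Real.exp_pos _).le]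
      exact ENNReal.ofReal_le_ofReal h3
    rw [withDensity_apply _ hA, withDensity_apply _ hB]
    have h1 : ∀ a ∈ A, ENNReal.ofReal (g₀ a) * lebPi N B ≤
        M * ∫⁻ b in B, ENNReal.ofReal (g₀ b) ∂lebPi N := by
      intro a ha
      rw [← setLIntegral_const, ← lintegral_const_mul' _ _ ENNReal.ofReal_ne_top]
      exact setLIntegral_mono' hB fun b hb => hpt a ha b hb
    rw [← lintegral_mul_const' _ _ (measure_ne_top _ _)]
    refine (setLIntegral_mono' hA h1).trans_eq ?_
    rw [setLIntegral_const]; ring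

/-! ### Stationary densities of the finite-size systems -/

/-- The logarithmic distortion of a stationary density. -/
noncomputable def distortion (K : ℝ) (N : ℕ) : ℝ := 19 * (K + 808) * ((N : ℝ) + 1) + 1

theorem SlopeOn.exists_comparable {g g' : ℝ → ℝ} {c K : ℝ} (h : SlopeOn g g' c K) (hK : 0 ≤ K)
    (hg : Measurable g) {N : ℕ} {ϱ : Measure ℝ} [IsProbabilityMeasure ϱ]
    (hϱ : ∀ᵐ t ∂ϱ, |t| ≤ c - 1 / 2) {m : Measure (Fin (N + 1) → Site)} [IsFiniteMeasure m]
    (hac : m ≪ lebPi N) (hm : IsStationary (coupledStep g N) ϱ m) {L : ℝ} (hL0 : 0 ≤ L)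
    (hL : 19 / 20 * (L + (K + 808) * √((N : ℝ) + 1)) ≤ L) {σ : ℝ} (hσ : 0 < σ) (R : ℝ) :
    ∃ m₀ e : Measure (Fin (N + 1) → Site), m ≤ m₀ + e ∧ m₀ ≤ m + e ∧ e univ ≤ ENNReal.ofReal σ ∧
      Comparable L R 1 m₀ := by
  obtain ⟨m₀, e, i1, i2, h1, h2, h3, del, hdel, hcomp⟩ := exists_comparable_approx hac hL0 hσ
  have hΦ := measurable_coupledStep hg N
  have hP := (isStationary_iff_pushNoise hΦ m).1 hm
  have key : ∀ k : ℕ, ∃ m₀ e : Measure (Fin (N + 1) → Site), IsFiniteMeasure m₀ ∧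
      IsFiniteMeasure e ∧ m ≤ m₀ + e ∧ m₀ ≤ m + e ∧ e univ ≤ ENNReal.ofReal σ ∧
      Comparable L ((20 / 19) ^ k * del) 1 m₀ := by
    intro k
    induction k with
    | zero => exact ⟨m₀, e, i1, i2, h1, h2, h3, by simpa using hcomp⟩
    | succ k ih =>
      obtain ⟨m₁, e₁, j1, j2, g1, g2, g3, g4⟩ := ih
      have fin : ∀ μ : Measure (Fin (N + 1) → Site), IsFiniteMeasure μ →
          IsFiniteMeasure (pushNoise (coupledStep g N) ϱ μ) := fun μ _ =>
        ⟨by rw [pushNoise_univ hΦ]; exact measure_lt_top _ _⟩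
      refine ⟨pushNoise (coupledStep g N) ϱ m₁, pushNoise (coupledStep g N) ϱ e₁, fin _ j1, fin _ j2,
        ?_, ?_, ?_, ?_⟩
      · have := pushNoise_mono (ϱ := ϱ) hΦ g1
        rwa [hP, pushNoise_add hΦ] at this
      · have := pushNoise_mono (ϱ := ϱ) hΦ g2
        rwa [pushNoise_add hΦ, hP] at this
      · rw [pushNoise_univ hΦ]; exact g3
      · rw [pow_succ', mul_assoc]
        exact h.comparable_pushNoise hK hg hϱ hL g4
  obtain ⟨k, hk⟩ := pow_unbounded_of_one_lt (R / del) (by norm_num : (1 : ℝ) < 20 / 19)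
  rw [div_lt_iff₀ hdel] at hk
  obtain ⟨m₁, e₁, -, -, g1, g2, g3, g4⟩ := key k
  exact ⟨m₁, e₁, g1, g2, g3, fun A B hA hB D hD0 hD =>
    g4 A B hA hB D hD0 (hD.trans hk.le)⟩

theorem sqDist_le {N : ℕ} (x y : Fin (N + 1) → Site) : sqDist x y ≤ (N : ℝ) + 1 := by
  have := Finset.sum_le_card_nsmul Finset.univ (fun i => ((x i : ℝ) - y i) ^ 2) 1 fun i _ => by
    have h1 := (x i).2
    have h2 := (y i).2
    exact (sq_le_one_iff_abs_le_one _).2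
      (abs_le.2 ⟨by linarith [h1.1, h2.2], by linarith [h1.2, h2.1]⟩)
  simpa [sqDist] using this

theorem SlopeOn.stationary_mul_le {g g' : ℝ → ℝ} {c K : ℝ} (h : SlopeOn g g' c K) (hK : 0 ≤ K)
    (hg : Measurable g) {N : ℕ} {ϱ : Measure ℝ} [IsProbabilityMeasure ϱ]
    (hϱ : ∀ᵐ t ∂ϱ, |t| ≤ c - 1 / 2) {m : Measure (Fin (N + 1) → Site)} [IsFiniteMeasure m]
    (hac : m ≪ lebPi N) (hm : IsStationary (coupledStep g N) ϱ m)
    {A B : Set (Fin (N + 1) → Site)} (hA : MeasurableSet A) (hB : MeasurableSet B) :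
    m A * lebPi N B ≤ ENNReal.ofReal (Real.exp (distortion K N)) * (lebPi N A * m B) := by
  set C := ENNReal.ofReal (Real.exp (distortion K N)) with hC
  have hsq : √((N : ℝ) + 1) * √((N : ℝ) + 1) = N + 1 := Real.mul_self_sqrt (by positivity)
  have hpos : 0 ≤ (K + 808) * √((N : ℝ) + 1) := by positivity
  have key : ∀ σ : ℝ, 0 < σ → m A * lebPi N B ≤ C * (lebPi N A * m B) +
      (C + 1) * ENNReal.ofReal σ := by
    intro σ hσ
    obtain ⟨m₀, e, h1, h2, h3, h4⟩ := h.exists_comparable hK hg hϱ hac hm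
      (L := 19 * ((K + 808) * √((N : ℝ) + 1))) (by positivity) (by linarith) hσ √((N : ℝ) + 1)
    have h5 := h4 A B hA hB _ (Real.sqrt_nonneg _) le_rfl fun a _ b _ => by
      rw [Real.sq_sqrt (by positivity)]; exact sqDist_le a b
    have e1 : 19 * ((K + 808) * √((N : ℝ) + 1)) * √((N : ℝ) + 1) + 1 = distortion K N := by
      unfold distortion
      rw [mul_assoc, mul_assoc (K + 808), hsq]; ring
    rw [e1, ← hC] at h5
    have heA : ∀ A, e A ≤ ENNReal.ofReal σ := fun A => (measure_mono (subset_univ _)).trans h3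
    calc m A * lebPi N B ≤ (m₀ A + ENNReal.ofReal σ) * lebPi N B := by
          refine mul_le_mul_left ((h1 A).trans ?_) _
          rw [Measure.add_apply]; gcongr; exact heA A
      _ = m₀ A * lebPi N B + ENNReal.ofReal σ * lebPi N B := add_mul _ _ _
      _ ≤ C * (lebPi N A * m₀ B) + ENNReal.ofReal σ * 1 := by gcongr; exact prob_le_one
      _ ≤ C * (lebPi N A * (m B + ENNReal.ofReal σ)) + ENNReal.ofReal σ * 1 := by
          gcongr
          refine (h2 B).trans ?_
          rw [Measure.add_apply]; gcongr; exact heA B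
      _ = C * (lebPi N A * m B) + (C * (lebPi N A * ENNReal.ofReal σ) + ENNReal.ofReal σ) := by ring
      _ ≤ C * (lebPi N A * m B) + (C * (1 * ENNReal.ofReal σ) + ENNReal.ofReal σ) := by
          gcongr; exact prob_le_one
      _ = _ := by ring
  have hlim : Tendsto (fun σ : ℝ => C * (lebPi N A * m B) + (C + 1) * ENNReal.ofReal σ) (𝓝[>] 0)
      (𝓝 (C * (lebPi N A * m B))) := by
    have h1 : Tendsto (fun σ : ℝ => ENNReal.ofReal σ) (𝓝[>] 0) (𝓝 0) := by
      have := (ENNReal.continuous_ofReal.tendsto 0).mono_left (nhdsWithin_le_nhds (s := Ioi 0))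
      rwa [ENNReal.ofReal_zero] at this
    have h2 := (ENNReal.Tendsto.const_mul h1 (Or.inr (by simp [hC] : C + 1 ≠ ⊤))).const_add
      (C * (lebPi N A * m B))
    rwa [mul_zero, add_zero] at h2
  exact ge_of_tendsto hlim (by filter_upwards [self_mem_nhdsWithin] with σ hσ using key σ hσ)

theorem SlopeOn.stationary_unique {g g' : ℝ → ℝ} {c K : ℝ} (h : SlopeOn g g' c K) (hK : 0 ≤ K)
    (hg : Measurable g) {N : ℕ} {ϱ : Measure ℝ} [IsProbabilityMeasure ϱ]
    (hϱ : ∀ᵐ t ∂ϱ, |t| ≤ c - 1 / 2) {m m' : Measure (Fin (N + 1) → Site)} [IsProbabilityMeasure m]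
    [IsProbabilityMeasure m'] (hac : m ≪ lebPi N) (hm : IsStationary (coupledStep g N) ϱ m)
    (hac' : m' ≪ lebPi N) (hm' : IsStationary (coupledStep g N) ϱ m') : m = m' := by
  have hΦ := measurable_coupledStep hg N
  set C := Real.exp (distortion K N) with hC
  have hC1 : 1 ≤ C := Real.one_le_exp (by unfold distortion; positivity)
  set q := C⁻¹ * C⁻¹ with hq
  have hq0 : 0 < q := by positivity
  have hq1 : q ≤ 1 := by
    have := inv_le_one_of_one_le₀ hC1
    exact mul_le_one₀ this (by positivity) this
  -- a lower bound for every finite stationary measure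
  have hlow : ∀ s : Measure (Fin (N + 1) → Site), IsFiniteMeasure s → s ≪ lebPi N →
      IsStationary (coupledStep g N) ϱ s → (s univ * ENNReal.ofReal q) • m' ≤ s := by
    intro s _ hs hst
    refine Measure.le_iff.2 fun B hB => ?_
    have h1 := h.stationary_mul_le hK hg hϱ hs hst MeasurableSet.univ hB
    have h2 := h.stationary_mul_le hK hg hϱ hac' hm' hB MeasurableSet.univ
    rw [measure_univ (μ := lebPi N), one_mul, ← hC] at h1
    rw [measure_univ, measure_univ, mul_one, mul_one, ← hC] at h2
    have h3 : ENNReal.ofReal q * ENNReal.ofReal C * ENNReal.ofReal C = 1 := by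
      rw [← ENNReal.ofReal_mul hq0.le, ← ENNReal.ofReal_mul (by positivity), hq]
      have : C ≠ 0 := by positivity
      rw [show C⁻¹ * C⁻¹ * C * C = 1 by field_simp, ENNReal.ofReal_one]
    rw [Measure.smul_apply, smul_eq_mul]
    calc s univ * ENNReal.ofReal q * m' B
        ≤ s univ * ENNReal.ofReal q * (ENNReal.ofReal C * lebPi N B) := by gcongr
      _ = ENNReal.ofReal q * ENNReal.ofReal C * (s univ * lebPi N B) := by ring
      _ ≤ ENNReal.ofReal q * ENNReal.ofReal C * (ENNReal.ofReal C * s B) :=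
          mul_le_mul_right h1 _
      _ = ENNReal.ofReal q * ENNReal.ofReal C * ENNReal.ofReal C * s B := by ring
      _ = s B := by rw [h3, one_mul]
  have hiter : ∀ k : ℕ, ENNReal.ofReal (1 - (1 - q) ^ k) • m' ≤ m := by
    intro k
    induction k with
    | zero => simpa using Measure.zero_le m
    | succ k ih =>
      have hp0 : 0 ≤ (1 - q) ^ k := pow_nonneg (by linarith) _
      have hp1 : (1 - q) ^ k ≤ 1 := pow_le_one₀ (by linarith) (by linarith)
      set a := ENNReal.ofReal (1 - (1 - q) ^ k) with ha
      have : IsFiniteMeasure (a • m') := ⟨by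
        rw [Measure.smul_apply, smul_eq_mul, measure_univ, mul_one]; exact ENNReal.ofReal_lt_top⟩
      set s := m - a • m' with hs
      have hsum : s + a • m' = m := Measure.sub_add_cancel_of_le ih
      have hsle : s ≤ m := Measure.sub_le
      have hsfin : IsFiniteMeasure s := isFiniteMeasure_of_le m hsle
      have hstat : pushNoise (coupledStep g N) ϱ s = s := by
        have h1 := (isStationary_iff_pushNoise hΦ m).1 hm
        have h2 := (isStationary_iff_pushNoise hΦ m').1 hm'
        have h3 : pushNoise (coupledStep g N) ϱ s + a • m' = s + a • m' := by
          conv_rhs => rw [hsum, ← h1, ← hsum]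
          rw [pushNoise_add hΦ, pushNoise_smul, h2]
        ext A hA
        have h4 := congrArg (fun μ : Measure (Fin (N + 1) → Site) => μ A) h3
        simp only [Measure.add_apply] at h4
        exact (ENNReal.add_left_inj (measure_ne_top (a • m') A)).1 h4
      have hsu : s univ = ENNReal.ofReal ((1 - q) ^ k) := by
        have h4 := congrArg (fun μ : Measure (Fin (N + 1) → Site) => μ univ) hsum
        simp only [Measure.add_apply, Measure.smul_apply, smul_eq_mul, measure_univ, mul_one] at h4
        refine (ENNReal.add_left_inj (ENNReal.ofReal_ne_top (r := 1 - (1 - q) ^ k))).1 (h4.trans ?_)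
        rw [← ENNReal.ofReal_add hp0 (by linarith), add_sub_cancel, ENNReal.ofReal_one]
      have h5 := hlow s hsfin (hsle.absolutelyContinuous.trans hac)
        ((isStationary_iff_pushNoise hΦ s).2 hstat)
      rw [hsu, ← ENNReal.ofReal_mul hp0] at h5
      refine Measure.le_iff.2 fun B hB => ?_
      rw [← hsum, Measure.add_apply]
      refine le_trans (le_of_eq ?_) (add_le_add_left (h5 B) _)
      rw [Measure.smul_apply, Measure.smul_apply, Measure.smul_apply, smul_eq_mul, smul_eq_mul,
        smul_eq_mul, ← add_mul, ha, ← ENNReal.ofReal_add (by positivity) (by linarith)]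
      congr 2; ring
  have hle : m' ≤ m := by
    refine Measure.le_iff.2 fun B _ => ?_
    have h1 : Tendsto (fun k : ℕ => ENNReal.ofReal (1 - (1 - q) ^ k) * m' B) atTop
        (𝓝 (ENNReal.ofReal (1 - 0) * m' B)) := by
      refine ENNReal.Tendsto.mul_const (ENNReal.tendsto_ofReal (tendsto_const_nhds.sub ?_))
        (Or.inr (measure_ne_top _ _))
      exact tendsto_pow_atTop_nhds_zero_of_lt_one (by linarith) (by linarith)
    rw [sub_zero, ENNReal.ofReal_one, one_mul] at h1
    exact le_of_tendsto' h1 fun k => hiter k B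
  exact (Measure.eq_of_le_of_measure_univ_eq hle (by rw [measure_univ, measure_univ])).symm

/-! ### Symmetry of the stationary densities -/

/-- The reflection of `X`. -/
def negSite (x : Site) : Site := ⟨-x, by linarith [x.2.2], by linarith [x.2.1]⟩

/-- The reflection of `X^{N+1}`. -/
def negConf {N : ℕ} (x : Fin (N + 1) → Site) : Fin (N + 1) → Site := fun i => negSite (x i)

theorem continuous_negSite : Continuous negSite :=
  (continuous_neg.comp continuous_subtype_val).subtype_mk _

theorem measurable_negConf (N : ℕ) : Measurable (negConf (N := N)) :=
  measurable_pi_lambda _ fun i => continuous_negSite.measurable.comp (measurable_pi_apply i)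

theorem map_negSite_leb : leb.map negSite = leb := by
  have hv : MeasurableEmbedding (Subtype.val : Site → ℝ) := .subtype_coe measurableSet_Icc
  ext A hA
  rw [Measure.map_apply continuous_negSite.measurable hA, leb, hv.comap_apply, hv.comap_apply]
  rw [← Measure.measure_preimage_neg volume (Subtype.val '' A)]
  congr 1
  ext y
  constructor
  · rintro ⟨x, hx, rfl⟩
    exact ⟨negSite x, hx, rfl⟩
  · rintro ⟨x, hx, he⟩
    refine ⟨negSite x, ?_, ?_⟩
    · have : negSite (negSite x) = x := Subtype.ext (neg_neg _)
      change negSite (negSite x) ∈ A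
      rwa [this]
    · change -(x : ℝ) = y
      rw [he, neg_neg]

theorem map_negConf_lebPi (N : ℕ) : (lebPi N).map negConf = lebPi N := by
  have h2 : SigmaFinite (leb.map negSite) := by rw [map_negSite_leb]; infer_instance
  have := Measure.pi_map_pi (ι := Fin (N + 1)) (μ := fun _ => leb) (f := fun _ => negSite)
    fun i => continuous_negSite.measurable.aemeasurable
  rw [map_negSite_leb] at this
  exact this

theorem fracMap_neg {r x : ℝ} (h : 1 + r * x ≠ 0) : fracMap (-r) (-x) = 1 - fracMap r x := by
  unfold fracMap
  have h1 : 2 * r * x + 2 ≠ 0 := by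
    rw [show 2 * r * x + 2 = 2 * (1 + r * x) by ring]; exact mul_ne_zero two_ne_zero h
  have h2 : 2 * -r * -x + 2 = 2 * r * x + 2 := by ring
  rw [h2, eq_sub_iff_add_eq, ← add_div, div_eq_one_iff_eq h1]
  ring

theorem siteFun_neg {r x : ℝ} (hr : |r| ≤ 41 / 100) (hx : x ∈ Site) (h : siteFun r x ≠ 1 / 2) :
    siteFun (-r) (-x) = -siteFun r x := by
  have hx' : -x ∈ Site := ⟨by linarith [hx.2], by linarith [hx.1]⟩
  have hr2 : |r| ≤ 1 / 2 := hr.trans (by norm_num)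
  rw [siteFun_eq hr2 hx] at h ⊢
  rw [siteFun_eq (by rwa [abs_neg]) hx', fracMap_neg (den_bounds hr hx).1.ne']
  set z := fracMap r x
  rcases lt_trichotomy z (1 / 2) with h1 | h1 | h1
  · rw [if_pos h1.le, if_neg (by linarith)]; ring
  · rw [if_pos h1.le] at h; exact absurd h1 h
  · rw [if_neg (not_le.2 h1), if_pos (by linarith)]; ring

theorem SlopeOn.coupledStep_neg {g g' : ℝ → ℝ} {c K : ℝ} (h : SlopeOn g g' c K)
    (hodd : ∀ u, g (-u) = -g u) {N : ℕ} {t : ℝ} (ht : |t| ≤ c - 1 / 2) {x : Fin (N + 1) → Site}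
    (hx : ∀ i, (coupledStep g N x t i : ℝ) ≠ 1 / 2) :
    coupledStep g N (negConf x) (-t) = negConf (coupledStep g N x t) := by
  have hb := h.bound _ (h.avg_add_mem ht (emb_mem x))
  have hb2 : |g (avg (emb x) + t)| < 2 := hb.trans_lt (by norm_num)
  funext i
  apply Subtype.ext
  have e : (∑ j, ((negConf x j : Site) : ℝ)) / (N + 1) + -t = -(avg (emb x) + t) := by
    have : (∑ j, ((negConf x j : Site) : ℝ)) = -∑ j, emb x j := by
      rw [← Finset.sum_neg_distrib]; rfl
    rw [this]; unfold avg; ring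
  have e1 : (coupledStep g N x t i : ℝ) = siteFun (g (avg (emb x) + t)) (x i) :=
    coe_siteMap hb2 _
  have e2 : (coupledStep g N (negConf x) (-t) i : ℝ) =
      siteFun (-g (avg (emb x) + t)) (-(x i : ℝ)) := by
    change (siteMap (g ((∑ j, ((negConf x j : Site) : ℝ)) / (N + 1) + -t)) (negConf x i) : ℝ) = _
    rw [e, hodd, coe_siteMap (by rwa [abs_neg])]; rfl
  change _ = -(coupledStep g N x t i : ℝ)
  have h1 := hx i
  rw [e1] at h1
  rw [e1, e2, siteFun_neg hb (x i).2 h1]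

theorem measurable_coupledStep_left {g : ℝ → ℝ} (hg : Measurable g) (N : ℕ) (t : ℝ) :
    Measurable fun x : Fin (N + 1) → Site => coupledStep g N x t := by
  have h := measurable_coupledStep hg N
  have h1 : Measurable fun s : Fin (N + 1) → Site => (s, t) :=
    measurable_id.prodMk measurable_const
  have h2 := Measurable.comp h h1
  exact h2

theorem SlopeOn.ae_coupledStep_ne {g g' : ℝ → ℝ} {c K : ℝ} (h : SlopeOn g g' c K) (hK : 0 ≤ K)
    (hg : Measurable g) {N : ℕ} {t : ℝ} (ht : |t| ≤ c - 1 / 2) {m : Measure (Fin (N + 1) → Site)}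
    (hac : m ≪ lebPi N) : ∀ᵐ x ∂m, ∀ i, (coupledStep g N x t i : ℝ) ≠ 1 / 2 := by
  have hbdm : MeasurableSet {x : Fin (N + 1) → Site | ∃ i, (x i : ℝ) = 1 / 2} := by
    have : {x : Fin (N + 1) → Site | ∃ i, (x i : ℝ) = 1 / 2} =
        ⋃ i, {x : Fin (N + 1) → Site | (x i : ℝ) = 1 / 2} := by ext x; simp
    rw [this]
    exact MeasurableSet.iUnion fun i =>
      (measurable_subtype_coe.comp (measurable_pi_apply i)) (measurableSet_singleton _)
  have := hac (h.nonsingular hK hg ht hbdm (lebPi_coord_eq N (1 / 2)))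
  rw [ae_iff]
  refine measure_mono_null (fun x hx => ?_) this
  obtain ⟨i, hi⟩ := not_forall.1 hx
  exact ⟨i, not_not.1 hi⟩

theorem SlopeOn.stationary_symm {g g' : ℝ → ℝ} {c K : ℝ} (h : SlopeOn g g' c K) (hK : 0 ≤ K)
    (hg : Measurable g) (hodd : ∀ u, g (-u) = -g u) {N : ℕ} {ϱ : Measure ℝ}
    [IsProbabilityMeasure ϱ] (hϱ : ∀ᵐ t ∂ϱ, |t| ≤ c - 1 / 2) (hsymm : ϱ.map (fun t => -t) = ϱ)
    {m : Measure (Fin (N + 1) → Site)} [IsProbabilityMeasure m]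
    (hac : m ≪ lebPi N) (hm : IsStationary (coupledStep g N) ϱ m) : m.map negConf = m := by
  have hΦ := measurable_coupledStep hg N
  have hn := measurable_negConf N
  have hp : IsProbabilityMeasure (m.map negConf) := Measure.isProbabilityMeasure_map hn.aemeasurable
  refine h.stationary_unique hK hg hϱ ?_ ?_ hac hm
  · have := hac.map hn
    rwa [map_negConf_lebPi] at this
  · rw [isStationary_iff_pushNoise hΦ]
    have hst := (isStationary_iff_pushNoise hΦ m).1 hm
    ext A hA
    rw [pushNoise_apply hΦ _ hA, Measure.map_apply hn hA]
    conv_lhs => rw [← hsymm]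
    rw [show (fun t : ℝ => -t) = ⇑(MeasurableEquiv.neg ℝ) from rfl,
      (MeasurableEquiv.neg ℝ).measurableEmbedding.lintegral_map]
    conv_rhs => rw [← hst]
    rw [pushNoise_apply hΦ _ (hn hA)]
    refine lintegral_congr_ae ?_
    filter_upwards [hϱ] with t ht
    change (m.map negConf) ((fun s => coupledStep g N s (-t)) ⁻¹' A) = _
    rw [Measure.map_apply hn (measurable_coupledStep_left hg N (-t) hA)]
    refine measure_congr ?_
    filter_upwards [h.ae_coupledStep_ne hK hg ht hac] with x hx
    change (coupledStep g N (negConf x) (-t) ∈ A) = (negConf (coupledStep g N x t) ∈ A)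
    rw [h.coupledStep_neg hodd ht hx]

theorem FeedbackOn.exists_slopeOn {G : ℝ → ℝ} {b c : ℝ} (hb : FeedbackOn G b) (hc : 1 / 2 ≤ c)
    (hcb : c < b) : ∃ K, 0 ≤ K ∧ SlopeOn (clipG G b) (deriv G) c K := by
  have hsub : Icc (-c) c ⊆ Icc (-b) b := Icc_subset_Icc (by linarith) hcb.le
  have hd : AnalyticOnNhd ℝ (deriv G) (Icc (-b) b) := AnalyticOnNhd.deriv hb.analytic
  have hdd := hd.deriv
  obtain ⟨K, hK⟩ := isCompact_Icc.exists_bound_of_continuousOn hdd.continuousOn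
  have hK0 : 0 ≤ K := (norm_nonneg _).trans (hK 0 ⟨by linarith, by linarith⟩)
  refine ⟨K, hK0, ?_, ?_, ?_, ?_, ?_⟩
  · intro u hu
    have hu' : u ∈ Ioo (-b) b := ⟨by linarith [hu.1], by linarith [hu.2]⟩
    refine ((hb.analytic u (hsub hu)).differentiableAt.hasDerivAt).congr_of_eventuallyEq ?_
    filter_upwards [isOpen_Ioo.mem_nhds hu'] with v hv
    exact clipG_of_mem (Ioo_subset_Icc_self hv)
  · exact fun u hu => (hb.deriv_pos u (hsub hu)).le
  · intro u hu
    rw [clipG_of_mem (hsub hu)]; exact hb.deriv_le u (hsub hu)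
  · intro u hu
    rw [clipG_of_mem (hsub hu)]; exact hb.bound u (hsub hu)
  · intro u hu v hv
    have := (convex_Icc (-b) b).norm_image_sub_le_of_norm_deriv_le
      (fun x hx => (hd x hx).differentiableAt) hK (hsub hv) (hsub hu)
    simpa [Real.norm_eq_abs] using this

theorem isStationary_coupledStep_clip {G : ℝ → ℝ} {b ε : ℝ}
    (hε : ε ≤ b - 1 / 2) {ϱ : Measure ℝ} (hϱ : ϱ (Icc (-ε) ε)ᶜ = 0) {N : ℕ}
    {m : Measure (Fin (N + 1) → Site)} :
    IsStationary (coupledStep (clipG G b) N) ϱ m ↔ IsStationary (coupledStep G N) ϱ m := by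
  have key : ∀ A : Set (Fin (N + 1) → Site), ∀ x,
      ϱ {t | coupledStep (clipG G b) N x t ∈ A} = ϱ {t | coupledStep G N x t ∈ A} := by
    intro A x
    refine measure_congr ?_
    have h1 : ∀ᵐ t ∂ϱ, t ∈ Icc (-ε) ε := hϱ
    filter_upwards [h1] with t ht
    have h2 := avg_mem (emb_mem x)
    have h3 : avg (emb x) + t ∈ Icc (-b) b := ⟨by linarith [h2.1, ht.1], by linarith [h2.2, ht.2]⟩
    change (coupledStep (clipG G b) N x t ∈ A) = (coupledStep G N x t ∈ A)
    have h4 : coupledStep (clipG G b) N x t = coupledStep G N x t := by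
      funext i
      change siteMap (clipG G b (avg (emb x) + t)) _ = siteMap (G (avg (emb x) + t)) _
      rw [clipG_of_mem h3]
    rw [h4]
  unfold IsStationary
  simp only [key]

/-- The stationary densities are symmetric, and their distortion grows at most exponentially with
the size of the system. -/
theorem FeedbackOn.acStationary {G : ℝ → ℝ} {b ε : ℝ} (hb : FeedbackOn G b) (hε0 : 0 < ε)
    (hε : ε < b - 1 / 2) {ϱ : Measure ℝ} (hϱ : IsNoise ϱ ε) :
    ∃ K, 0 ≤ K ∧ ∀ N (m : ProbabilityMeasure (Fin (N + 1) → Site)), IsACStationary G ϱ N m →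
      (m : Measure (Fin (N + 1) → Site)).map negConf = m ∧
      ∀ A, MeasurableSet A → (m : Measure (Fin (N + 1) → Site)) A ≤
        ENNReal.ofReal (Real.exp (distortion K N)) * lebPi N A := by
  obtain ⟨K, hK, hS⟩ := hb.exists_slopeOn (c := 1 / 2 + ε) (by linarith) (by linarith)
  refine ⟨K, hK, fun N m hm => ?_⟩
  have := hϱ.prob
  have hg : Measurable (clipG G b) := hb.nice.cont.measurable
  have hae : ∀ᵐ t ∂ϱ, |t| ≤ 1 / 2 + ε - 1 / 2 := by
    have h1 : ∀ᵐ t ∂ϱ, t ∈ Icc (-ε) ε := hϱ.bounded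
    filter_upwards [h1] with t ht
    rw [add_sub_cancel_left]
    exact abs_le.2 ht
  have hst := (isStationary_coupledStep_clip hε.le hϱ.bounded).2 hm.2
  refine ⟨hS.stationary_symm hK hg hb.nice.odd hae hϱ.symm hm.1 hst, fun A hA => ?_⟩
  have := hS.stationary_mul_le hK hg hae hm.1 hst hA MeasurableSet.univ
  rwa [measure_univ, measure_univ, mul_one, mul_one] at this

/-! ### Weak limits of stationary laws -/

/-- The extended continuous mapping theorem. -/
theorem tendsto_map_of_ae {ι X Y : Type*} {L : Filter ι} [L.IsCountablyGenerated]
    [TopologicalSpace X] [MeasurableSpace X] [OpensMeasurableSpace X] [HasOuterApproxClosed X]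
    [TopologicalSpace Y] [MeasurableSpace Y] [OpensMeasurableSpace Y]
    {μs : ι → ProbabilityMeasure X} {μ : ProbabilityMeasure X} (hμ : Tendsto μs L (𝓝 μ))
    {f : ι → X → Y} {f₀ : X → Y} (hf : ∀ i, Measurable (f i)) (hf₀ : Measurable f₀)
    (h : ∀ᵐ x ∂(μ : Measure X), Tendsto (fun p : ι × X => f p.1 p.2) (L ×ˢ 𝓝 x) (𝓝 (f₀ x))) :
    Tendsto (fun i => (μs i).map (hf i).aemeasurable) L (𝓝 (μ.map hf₀.aemeasurable)) := by
  rcases L.eq_or_neBot with rfl | hne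
  · exact tendsto_bot
  refine tendsto_of_forall_isClosed_limsup_le' fun F hF => ?_
  obtain ⟨S, hS⟩ := L.exists_antitone_basis
  set C : ℕ → Set X := fun m => closure (⋃ i ∈ S m, f i ⁻¹' F) with hC
  have hanti : Antitone C := fun a b hab =>
    closure_mono (biUnion_subset_biUnion_left (hS.antitone hab))
  have h1 : ∀ m, L.limsup (fun i => ((μs i).map (hf i).aemeasurable : Measure Y) F) ≤
      (μ : Measure X) (C m) := by
    intro m
    refine le_trans (limsup_le_limsup ?_)
      (ProbabilityMeasure.limsup_measure_closed_le_of_tendsto hμ isClosed_closure)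
    filter_upwards [hS.mem m] with i hi
    change ((μs i : Measure X).map (f i)) F ≤ _
    rw [Measure.map_apply (hf i) hF.measurableSet]
    exact measure_mono ((subset_biUnion_of_mem (u := fun i => f i ⁻¹' F) hi).trans subset_closure)
  have h2 : Tendsto (fun m => (μ : Measure X) (C m)) atTop (𝓝 ((μ : Measure X) (⋂ m, C m))) :=
    tendsto_measure_iInter_atTop (fun m => isClosed_closure.measurableSet.nullMeasurableSet) hanti
      ⟨0, measure_ne_top _ _⟩
  refine (ge_of_tendsto' h2 h1).trans ?_
  change _ ≤ ((μ : Measure X).map f₀) F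
  rw [Measure.map_apply hf₀ hF.measurableSet]
  refine measure_mono_ae ?_
  filter_upwards [h] with x hx hxC
  by_contra hnot
  have h3 := hx (hF.isOpen_compl.mem_nhds hnot)
  obtain ⟨t₁, ht₁, t₂, ht₂, hsub⟩ := mem_prod_iff.1 (mem_map.1 h3)
  obtain ⟨m, -, hm⟩ := hS.1.mem_iff.1 ht₁
  obtain ⟨z, hz, hzU⟩ := mem_closure_iff_nhds.1 (mem_iInter.1 hxC m) t₂ ht₂
  obtain ⟨i, hi, hiz⟩ := mem_iUnion₂.1 hzU
  exact hsub (mk_mem_prod (hm hi) hz) hiz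

theorem continuousAt_siteMap {r : ℝ} (hr : |r| < 2) {x : Site} (hx : (x : ℝ) ≠ -r / 4) :
    ContinuousAt (fun p : ℝ × Site => siteMap p.1 p.2) (r, x) := by
  have hden : 2 * r * (x : ℝ) + 2 ≠ 0 := by
    have h2 : |(x : ℝ)| ≤ 1 / 2 := abs_le.2 ⟨by linarith [x.2.1], x.2.2⟩
    have h1 : |r * (x : ℝ)| < 1 := by
      rw [abs_mul]; nlinarith [abs_nonneg r, abs_nonneg (x : ℝ)]
    have h3 := (abs_lt.1 h1).1
    rw [mul_assoc]
    linarith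
  have hc : Continuous fun p : ℝ × Site => (p.2 : ℝ) := continuous_subtype_val.comp continuous_snd
  have hfr : ContinuousAt (fun p : ℝ × Site => fracMap p.1 p.2) (r, x) := by
    unfold fracMap
    exact ContinuousAt.div (by fun_prop) (by fun_prop) hden
  have hsf : ContinuousAt (fun p : ℝ × Site => siteFun p.1 p.2) (r, x) := by
    rcases lt_or_gt_of_ne hx with h | h
    · refine hfr.congr ?_
      have : ∀ᶠ p : ℝ × Site in 𝓝 (r, x), (p.2 : ℝ) < -p.1 / 4 :=
        (isOpen_lt hc (by fun_prop)).mem_nhds h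
      filter_upwards [this] with p hp
      exact (if_pos hp.le).symm
    · refine (hfr.sub (continuousAt_const (y := (1 : ℝ)))).congr ?_
      have : ∀ᶠ p : ℝ × Site in 𝓝 (r, x), -p.1 / 4 < (p.2 : ℝ) :=
        (isOpen_lt (by fun_prop) hc).mem_nhds h
      filter_upwards [this] with p hp
      exact (if_neg (not_le.2 hp)).symm
  exact continuous_projIcc.continuousAt.comp hsf

theorem Nice.tendsto_param {g : ℝ → ℝ} (hg : Nice g) (ν : ProbabilityMeasure Site) (t : ℝ) :
    Tendsto (fun p : ProbabilityMeasure Site × ℝ => g (field p.1 + p.2)) (𝓝 (ν, t))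
      (𝓝 (g (field ν + t))) := by
  have : Continuous fun p : ProbabilityMeasure Site × ℝ => g (field p.1 + p.2) :=
    hg.cont.comp ((continuous_field.comp continuous_fst).add continuous_snd)
  exact this.tendsto (ν, t)

theorem ae_coe_ne {ν : Measure Site} (hν : ν ≪ leb) (c : ℝ) : ∀ᵐ x : Site ∂ν, (x : ℝ) ≠ c := by
  have : ν {y : Site | (y : ℝ) = c} = 0 := hν (leb_coe_eq _)
  rw [ae_iff]
  simpa only [not_not, ne_eq] using this

instance : FirstCountableTopology (ProbabilityMeasure Site) := by
  let := TopologicalSpace.metrizableSpaceMetric (ProbabilityMeasure Site)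
  infer_instance

theorem tendsto_map_siteMap {ι : Type*} {L : Filter ι} [L.IsCountablyGenerated]
    {νs : ι → ProbabilityMeasure Site} {ν : ProbabilityMeasure Site} (hν : Tendsto νs L (𝓝 ν))
    (hac : (ν : Measure Site) ≪ leb) {ρ : ι → ℝ} {r : ℝ} (hρ : Tendsto ρ L (𝓝 r)) (hr : |r| < 2) :
    Tendsto (fun i => (νs i).map (measurable_siteMap (ρ i)).aemeasurable) L
      (𝓝 (ν.map (measurable_siteMap r).aemeasurable)) := by
  have hae : ∀ᵐ x : Site ∂(ν : Measure Site),
      Tendsto (fun q : ι × Site => siteMap (ρ q.1) q.2) (L ×ˢ 𝓝 x) (𝓝 (siteMap r x)) := by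
    filter_upwards [ae_coe_ne hac (-r / 4)] with x hx
    have h1 : Tendsto (fun p : ℝ × Site => siteMap p.1 p.2) (𝓝 (r, x)) (𝓝 (siteMap r x)) :=
      continuousAt_siteMap hr hx
    have h2 : Tendsto (fun q : ι × Site => (ρ q.1, q.2)) (L ×ˢ 𝓝 x) (𝓝 (r, x)) :=
      (hρ.comp tendsto_fst).prodMk_nhds tendsto_snd
    simpa only [Function.comp_def] using Tendsto.comp h1 h2
  exact tendsto_map_of_ae hν (fun i => measurable_siteMap (ρ i)) (measurable_siteMap r) hae

theorem Nice.tendsto_noisyStep {g : ℝ → ℝ} (hg : Nice g) {ν : ProbabilityMeasure Site}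
    (hν : (ν : Measure Site) ≪ leb) (t : ℝ) :
    Tendsto (fun p : ProbabilityMeasure Site × ℝ => noisyStep g p.1 p.2) (𝓝 (ν, t))
      (𝓝 (noisyStep g ν t)) := by
  have hr := hg.tendsto_param ν t
  have hcg : (𝓝 (ν, t)).IsCountablyGenerated := by
    rw [nhds_prod_eq]; infer_instance
  have hfst : Tendsto (fun p : ProbabilityMeasure Site × ℝ => p.1) (𝓝 (ν, t)) (𝓝 ν) :=
    continuous_fst.tendsto (ν, t)
  exact tendsto_map_siteMap hfst hν hr ((hg.bound _).trans_lt (by norm_num))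

/-- Weak limits of stationary laws are stationary if they charge only absolutely continuous
measures. -/
theorem Nice.isStationary_of_tendsto {g : ℝ → ℝ} (hg : Nice g) {ϱ : Measure ℝ}
    [IsProbabilityMeasure ϱ] {ι : Type*} {L : Filter ι} [L.IsCountablyGenerated] [L.NeBot]
    {Qs : ι → ProbabilityMeasure (ProbabilityMeasure Site)}
    {Q : ProbabilityMeasure (ProbabilityMeasure Site)} (hQ : Tendsto Qs L (𝓝 Q))
    (hs : ∀ i, IsStationary (noisyStep g) ϱ (Qs i : Measure (ProbabilityMeasure Site)))
    (hac : ∀ᵐ ν : ProbabilityMeasure Site ∂(Q : Measure (ProbabilityMeasure Site)),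
      (ν : Measure Site) ≪ leb) :
    IsStationary (noisyStep g) ϱ (Q : Measure (ProbabilityMeasure Site)) := by
  have hΦ := measurable_noisyStep hg.cont.measurable
  let ρ : ProbabilityMeasure ℝ := ⟨ϱ, inferInstance⟩
  have h1 : Tendsto (fun i => (Qs i).prod ρ) L (𝓝 (Q.prod ρ)) :=
    (ProbabilityMeasure.continuous_prod.tendsto (Q, ρ)).comp (hQ.prodMk_nhds tendsto_const_nhds)
  have h2 := tendsto_map_of_ae h1 (f := fun _ p => noisyStep g p.1 p.2)
    (f₀ := fun p => noisyStep g p.1 p.2) (fun _ => hΦ) hΦ (by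
      have h3 : ∀ᵐ p : ProbabilityMeasure Site × ℝ ∂((Q : Measure (ProbabilityMeasure Site)).prod ϱ),
          (p.1 : Measure Site) ≪ leb := Measure.quasiMeasurePreserving_fst.ae hac
      filter_upwards [h3] with p hp
      exact (hg.tendsto_noisyStep hp p.2).comp tendsto_snd)
  have h4 : ∀ i, ((Qs i).prod ρ).map hΦ.aemeasurable = Qs i := fun i =>
    Subtype.ext ((isStationary_iff_pushNoise hΦ _).1 (hs i))
  simp only [h4] at h2
  have h5 := tendsto_nhds_unique hQ h2
  rw [isStationary_iff_pushNoise hΦ]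
  exact (congrArg (fun P : ProbabilityMeasure (ProbabilityMeasure Site) =>
    (P : Measure (ProbabilityMeasure Site))) h5).symm

/-! ### Empirical measures -/

theorem empirical_apply {N : ℕ} (x : Fin (N + 1) → Site) {A : Set Site} (hA : MeasurableSet A) :
    (empirical N x : Measure Site) A = ((N : ENNReal) + 1)⁻¹ * ∑ i, A.indicator 1 (x i) := by
  change (((N : ENNReal) + 1)⁻¹ • ∑ i, Measure.dirac (x i)) A = _
  simp only [Measure.smul_apply, Measure.finsetSum_apply, Measure.dirac_apply' _ hA, smul_eq_mul]

theorem integral_empirical {N : ℕ} (x : Fin (N + 1) → Site) {f : Site → ℝ} (hf : Continuous f) :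
    ∫ y, f y ∂(empirical N x : Measure Site) = (∑ i, f (x i)) / (N + 1) := by
  change ∫ y, f y ∂(((N : ENNReal) + 1)⁻¹ • ∑ i, Measure.dirac (x i)) = _
  rw [integral_smul_measure, integral_finsetSum_measure fun i _ => integrable_of_continuous hf _]
  simp only [integral_dirac, smul_eq_mul]
  rw [ENNReal.toReal_inv, ENNReal.toReal_add (by simp) (by simp)]
  simp only [ENNReal.toReal_natCast, ENNReal.toReal_one]
  rw [inv_mul_eq_div]

theorem map_empirical {N : ℕ} (x : Fin (N + 1) → Site) {f : Site → Site} (hf : Measurable f) :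
    (empirical N x : Measure Site).map f = (empirical N fun i => f (x i) : Measure Site) := by
  ext A hA
  rw [Measure.map_apply hf hA, empirical_apply _ (hf hA), empirical_apply _ hA]; rfl

theorem empirical_coupledStep (G : ℝ → ℝ) {N : ℕ} (x : Fin (N + 1) → Site) (t : ℝ) :
    empirical N (coupledStep G N x t) = noisyStep G (empirical N x) t := by
  apply Subtype.ext
  have h : field (empirical N x) = (∑ j, (x j : ℝ)) / (N + 1) :=
    integral_empirical x continuous_subtype_val
  change _ = (empirical N x : Measure Site).map (siteMap (G (field (empirical N x) + t)))
  rw [map_empirical x (measurable_siteMap _), h]; rfl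

theorem isStationary_empiricalLaw {g : ℝ → ℝ} (hg : Measurable g) {ϱ : Measure ℝ} [SFinite ϱ]
    {N : ℕ} {m : ProbabilityMeasure (Fin (N + 1) → Site)}
    (hm : IsStationary (coupledStep g N) ϱ (m : Measure (Fin (N + 1) → Site))) :
    IsStationary (noisyStep g) ϱ (empiricalLaw N m : Measure (ProbabilityMeasure Site)) := by
  intro A hA
  change (m : Measure (Fin (N + 1) → Site)).map (empirical N) A =
    ∫⁻ ν, ϱ {t | noisyStep g ν t ∈ A} ∂(m : Measure (Fin (N + 1) → Site)).map (empirical N)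
  rw [Measure.map_apply (measurable_empirical N) hA, hm _ (measurable_empirical N hA),
    lintegral_map (measurable_noisyStep_prob hg ϱ A hA) (measurable_empirical N)]
  refine lintegral_congr fun x => ?_
  simp only [mem_preimage, empirical_coupledStep]

theorem lebPi_forall_mem {N : ℕ} (I : Finset (Fin (N + 1))) (A : Set Site) :
    lebPi N {x | ∀ i ∈ I, x i ∈ A} = leb A ^ I.card := by
  have e : {x : Fin (N + 1) → Site | ∀ i ∈ I, x i ∈ A} =
      univ.pi fun i => if i ∈ I then A else univ := by
    ext x
    simp only [mem_univ_pi]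
    refine forall_congr' fun i => ?_
    by_cases h : i ∈ I <;> simp [h]
  have e2 : ∀ i, leb (if i ∈ I then A else univ) = if i ∈ I then leb A else 1 := fun i => by
    split_ifs <;> simp
  rw [e, lebPi, Measure.pi_pi, Finset.prod_congr rfl fun i _ => e2 i, Finset.prod_ite_mem,
    Finset.univ_inter, Finset.prod_const]

/-- It is exponentially unlikely that a small set carries a fixed share of the empirical measure. -/
theorem measure_frequency_le {N : ℕ} {m : Measure (Fin (N + 1) → Site)} {M η : ENNReal}
    (hm : ∀ A, MeasurableSet A → m A ≤ M * lebPi N A) (hη : η ≤ 1) {k : ℕ} {A : Set Site}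
    (hA : MeasurableSet A) (hA' : leb A ≤ η ^ k) :
    m {x | (k : ENNReal)⁻¹ < (empirical N x : Measure Site) A} ≤
      2 ^ (N + 1) * (M * η ^ (N + 1)) := by
  classical
  set J : Finset (Finset (Fin (N + 1))) := Finset.univ.filter fun I => N + 1 ≤ k * I.card with hJ
  have hsub : {x | (k : ENNReal)⁻¹ < (empirical N x : Measure Site) A} ⊆
      ⋃ I ∈ J, {x | ∀ i ∈ I, x i ∈ A} := by
    intro x hx
    refine mem_iUnion₂.2 ⟨Finset.univ.filter fun i => x i ∈ A, ?_, fun i hi => (Finset.mem_filter.1 hi).2⟩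
    refine Finset.mem_filter.2 ⟨Finset.mem_univ _, ?_⟩
    have h1 : (k : ENNReal)⁻¹ < (empirical N x : Measure Site) A := hx
    rw [empirical_apply x hA] at h1
    have h2 : ∑ i, A.indicator (1 : Site → ENNReal) (x i) =
        ((Finset.univ.filter fun i => x i ∈ A).card : ENNReal) := by
      simp [indicator_apply]
    rw [h2] at h1
    set c := (Finset.univ.filter fun i => x i ∈ A).card
    rcases Nat.eq_zero_or_pos k with h0 | h0
    · rw [h0] at h1; simp at h1
    have hk : (k : ENNReal) ≠ 0 := by exact_mod_cast h0.ne'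
    have hn : ((N : ENNReal) + 1) ≠ 0 := by simp
    have h3 : ((N + 1 : ℕ) : ENNReal) ≤ ((k * c : ℕ) : ENNReal) := by
      push_cast
      calc (N : ENNReal) + 1 = (N + 1) * k * (k : ENNReal)⁻¹ := by
            rw [mul_assoc, ENNReal.mul_inv_cancel hk (by simp), mul_one]
        _ ≤ (N + 1) * k * (((N : ENNReal) + 1)⁻¹ * c) := by gcongr
        _ = (((N : ENNReal) + 1) * ((N : ENNReal) + 1)⁻¹) * (k * c) := by ring
        _ = k * c := by rw [ENNReal.mul_inv_cancel hn (by simp), one_mul]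
    exact_mod_cast h3
  have hpiece : ∀ I ∈ J, m {x | ∀ i ∈ I, x i ∈ A} ≤ M * η ^ (N + 1) := by
    intro I hI
    have hmeas : MeasurableSet {x : Fin (N + 1) → Site | ∀ i ∈ I, x i ∈ A} := by
      have : {x : Fin (N + 1) → Site | ∀ i ∈ I, x i ∈ A} = ⋂ i ∈ I, Function.eval i ⁻¹' A := by
        ext x; simp
      rw [this]
      exact Finset.measurableSet_biInter _ fun i _ => measurable_pi_apply i hA
    refine (hm _ hmeas).trans (mul_le_mul_right ?_ _)
    rw [lebPi_forall_mem]
    calc leb A ^ I.card ≤ (η ^ k) ^ I.card := by gcongr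
      _ = η ^ (k * I.card) := (pow_mul _ _ _).symm
      _ ≤ η ^ (N + 1) := pow_le_pow_right_of_le_one' hη (Finset.mem_filter.1 hI).2
  calc m {x | (k : ENNReal)⁻¹ < (empirical N x : Measure Site) A}
      ≤ ∑ I ∈ J, m {x | ∀ i ∈ I, x i ∈ A} :=
        (measure_mono hsub).trans (measure_biUnion_finset_le _ _)
    _ ≤ ∑ _I ∈ J, M * η ^ (N + 1) := Finset.sum_le_sum hpiece
    _ = J.card * (M * η ^ (N + 1)) := by rw [Finset.sum_const, nsmul_eq_mul]
    _ ≤ _ := by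
        gcongr
        have := Finset.card_le_univ J
        rw [Fintype.card_finset, Fintype.card_fin] at this
        exact_mod_cast this

theorem isOpen_setOf_lt_measure {A : Set Site} (hA : IsOpen A) (a : ENNReal) :
    IsOpen {ν : ProbabilityMeasure Site | a < (ν : Measure Site) A} := by
  rw [← isClosed_compl_iff]
  refine isClosed_of_closure_subset fun ν hν => ?_
  obtain ⟨u, hu, hlim⟩ := mem_closure_iff_seq_limit.1 hν
  have h1 := ProbabilityMeasure.le_liminf_measure_open_of_tendsto hlim hA
  have h2 : ∀ n, (u n : Measure Site) A ≤ a := fun n => not_lt.1 (hu n)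
  refine not_lt.2 (h1.trans ?_)
  exact liminf_le_of_frequently_le' (Frequently.of_forall h2)

/-- A probability measure is absolutely continuous if small open sets have small measure. -/
theorem absolutelyContinuous_of_small {ν : Measure Site} [IsFiniteMeasure ν] {η : ENNReal}
    (hη : 0 < η) (h : ∀ F : Set (Set Site), F.Finite →
      F ⊆ TopologicalSpace.countableBasis Site → ∀ k : ℕ, leb (⋃₀ F) ≤ η ^ k →
        ν (⋃₀ F) ≤ (k : ENNReal)⁻¹) : ν ≪ leb := by
  refine Measure.AbsolutelyContinuous.mk fun S hS h0 => ?_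
  by_contra hne
  obtain ⟨C, hCS, hC, hpos⟩ := hS.exists_lt_isCompact (pos_iff_ne_zero.2 hne)
  have hC0 : leb C = 0 := measure_mono_null hCS h0
  have hle : ∀ k : ℕ, ν C ≤ (k : ENNReal)⁻¹ := by
    intro k
    obtain ⟨U, hCU, hU, hUl⟩ := C.exists_isOpen_lt_of_lt (μ := leb) (η ^ k) (by
      rw [hC0]; exact pos_iff_ne_zero.2 (pow_ne_zero _ hη.ne'))
    obtain ⟨β, f, hf, hfB⟩ := (TopologicalSpace.isBasis_countableBasis Site).open_eq_iUnion hU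
    obtain ⟨T, hT⟩ := hC.elim_finite_subcover f
      (fun i => TopologicalSpace.isOpen_of_mem_countableBasis (hfB i)) (hf ▸ hCU)
    have e : ⋃₀ (f '' (T : Set β)) = ⋃ i ∈ T, f i := by rw [sUnion_image]; rfl
    refine (measure_mono hT).trans ?_
    rw [← e]
    refine h _ (T.finite_toSet.image f) (by rintro _ ⟨i, -, rfl⟩; exact hfB i) k ?_
    rw [e]
    refine (measure_mono ?_).trans hUl.le
    rw [hf]
    exact iUnion₂_subset fun i _ => subset_iUnion f i
  have hlim : Tendsto (fun k : ℕ => (k : ENNReal)⁻¹) atTop (𝓝 0) :=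
    ENNReal.tendsto_inv_nat_nhds_zero
  exact hpos.not_ge (ge_of_tendsto' hlim hle)

theorem ae_absolutelyContinuous_of_tendsto {C : ℝ}
    {m : (N : ℕ) → ProbabilityMeasure (Fin (N + 1) → Site)}
    (hm : ∀ N A, MeasurableSet A → (m N : Measure (Fin (N + 1) → Site)) A ≤
      ENNReal.ofReal (Real.exp (C * ((N : ℝ) + 1) + 1)) * lebPi N A)
    {Q : ProbabilityMeasure (ProbabilityMeasure Site)} {k : ℕ → ℕ} (hk : StrictMono k)
    (hQ : Tendsto (fun j => empiricalLaw (k j) (m (k j))) atTop (𝓝 Q)) :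
    ∀ᵐ ν : ProbabilityMeasure Site ∂(Q : Measure (ProbabilityMeasure Site)),
      (ν : Measure Site) ≪ leb := by
  set η := ENNReal.ofReal (min 1 (Real.exp (-C) / 4)) with hη
  have hη0 : 0 < η := ENNReal.ofReal_pos.2 (lt_min one_pos (by positivity))
  have hη1 : η ≤ 1 := ENNReal.ofReal_le_one.2 (min_le_left _ _)
  have hbd : ∀ N : ℕ, 2 ^ (N + 1) * (ENNReal.ofReal (Real.exp (C * ((N : ℝ) + 1) + 1)) * η ^ (N + 1)) ≤
      ENNReal.ofReal (Real.exp 1 * (1 / 2) ^ (N + 1)) := by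
    intro N
    have h2 : (2 : ENNReal) = ENNReal.ofReal 2 := by simp
    rw [h2, hη, ← ENNReal.ofReal_pow (by norm_num), ← ENNReal.ofReal_pow (by positivity),
      ← ENNReal.ofReal_mul (by positivity), ← ENNReal.ofReal_mul (by positivity)]
    refine ENNReal.ofReal_le_ofReal ?_
    have h3 : Real.exp (C * ((N : ℝ) + 1) + 1) = Real.exp 1 * Real.exp C ^ (N + 1) := by
      rw [← Real.exp_nat_mul, ← Real.exp_add]; congr 1; push_cast; ring
    have h4 : (min 1 (Real.exp (-C) / 4)) ^ (N + 1) ≤ (Real.exp (-C) / 4) ^ (N + 1) :=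
      pow_le_pow_left₀ (by positivity) (min_le_right _ _) _
    have h5 : (2 : ℝ) * Real.exp C * (Real.exp (-C) / 4) = 1 / 2 := by
      have : Real.exp C * Real.exp (-C) = 1 := by rw [← Real.exp_add]; simp
      linarith
    calc _ ≤ 2 ^ (N + 1) * (Real.exp 1 * Real.exp C ^ (N + 1) * (Real.exp (-C) / 4) ^ (N + 1)) := by
          rw [h3]; gcongr
      _ = Real.exp 1 * (2 * Real.exp C * (Real.exp (-C) / 4)) ^ (N + 1) := by
          rw [mul_pow, mul_pow]; ring
      _ = _ := by rw [h5]
  have hnull : ∀ A : Set Site, IsOpen A → ∀ p : ℕ, leb A ≤ η ^ p →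
      ∀ᵐ ν : ProbabilityMeasure Site ∂(Q : Measure (ProbabilityMeasure Site)),
        (ν : Measure Site) A ≤ (p : ENNReal)⁻¹ := by
    intro A hA p hAp
    have hO := isOpen_setOf_lt_measure hA (p : ENNReal)⁻¹
    have h1 := ProbabilityMeasure.le_liminf_measure_open_of_tendsto hQ hO
    have h2 : Tendsto (fun j => (empiricalLaw (k j) (m (k j)) : Measure (ProbabilityMeasure Site))
        {ν : ProbabilityMeasure Site | (p : ENNReal)⁻¹ < (ν : Measure Site) A}) atTop (𝓝 0) := by
      have h3 : Tendsto (fun N : ℕ => ENNReal.ofReal (Real.exp 1 * (1 / 2) ^ (N + 1))) atTop (𝓝 0) := by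
        have h4 := ((tendsto_pow_atTop_nhds_zero_of_lt_one (by norm_num : (0 : ℝ) ≤ 1 / 2)
          (by norm_num)).comp (tendsto_add_atTop_nat 1)).const_mul (Real.exp 1)
        have h5 := ENNReal.tendsto_ofReal h4
        rwa [mul_zero, ENNReal.ofReal_zero] at h5
      refine tendsto_of_tendsto_of_tendsto_of_le_of_le tendsto_const_nhds
        (h3.comp hk.tendsto_atTop) (fun _ => zero_le) fun j => ?_
      refine le_trans (le_of_eq ?_)
        ((measure_frequency_le (hm (k j)) hη1 hA.measurableSet hAp).trans (hbd (k j)))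
      exact Measure.map_apply (measurable_empirical (k j)) hO.measurableSet
    rw [h2.liminf_eq, nonpos_iff_eq_zero] at h1
    rw [ae_iff]
    simpa only [not_le] using h1
  have hcount : {F : Set (Set Site) | F.Finite ∧ F ⊆ TopologicalSpace.countableBasis Site}.Countable :=
    countable_ofPred_finite_subset (TopologicalSpace.countable_countableBasis Site)
  have hall : ∀ᵐ ν : ProbabilityMeasure Site ∂(Q : Measure (ProbabilityMeasure Site)),
      ∀ F ∈ {F : Set (Set Site) | F.Finite ∧ F ⊆ TopologicalSpace.countableBasis Site},
        ∀ p : ℕ, leb (⋃₀ F) ≤ η ^ p → (ν : Measure Site) (⋃₀ F) ≤ (p : ENNReal)⁻¹ := by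
    rw [ae_ball_iff hcount]
    intro F hF
    rw [ae_all_iff]
    intro p
    by_cases hp : leb (⋃₀ F) ≤ η ^ p
    · filter_upwards [hnull (⋃₀ F) (isOpen_sUnion fun s hs =>
        TopologicalSpace.isOpen_of_mem_countableBasis (hF.2 hs)) p hp] with ν hν _ using hν
    · exact Eventually.of_forall fun ν h => absurd h hp
  filter_upwards [hall] with ν hν
  exact absolutelyContinuous_of_small hη0 fun F hF hFB p hp => hν F ⟨hF, hFB⟩ p hp

/-! ### Symmetry of the limit law -/

/-- The reflection of `P(X)`. -/
noncomputable def negPM (ν : ProbabilityMeasure Site) : ProbabilityMeasure Site :=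
  ν.map continuous_negSite.measurable.aemeasurable

theorem continuous_negPM : Continuous negPM := ProbabilityMeasure.continuous_map continuous_negSite

theorem field_negPM (ν : ProbabilityMeasure Site) : field (negPM ν) = -field ν := by
  change ∫ x : Site, (x : ℝ) ∂((ν : Measure Site).map negSite) = -∫ x : Site, (x : ℝ) ∂(ν : Measure Site)
  rw [integral_map continuous_negSite.measurable.aemeasurable
    continuous_subtype_val.aestronglyMeasurable, ← integral_neg]
  rfl

theorem negPM_empirical {N : ℕ} (x : Fin (N + 1) → Site) :
    negPM (empirical N x) = empirical N (negConf x) :=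
  Subtype.ext (map_empirical x continuous_negSite.measurable)

theorem map_negPM_empiricalLaw {N : ℕ} {m : ProbabilityMeasure (Fin (N + 1) → Site)}
    (hm : (m : Measure (Fin (N + 1) → Site)).map negConf = m) :
    (empiricalLaw N m).map continuous_negPM.measurable.aemeasurable = empiricalLaw N m := by
  apply Subtype.ext
  change ((m : Measure (Fin (N + 1) → Site)).map (empirical N)).map negPM =
    (m : Measure (Fin (N + 1) → Site)).map (empirical N)
  conv_rhs => rw [← hm]
  rw [Measure.map_map continuous_negPM.measurable (measurable_empirical N),
    Measure.map_map (measurable_empirical N) (measurable_negConf N)]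
  congr 1
  funext x
  exact negPM_empirical x

theorem map_negPM_of_tendsto {ι : Type*} {L : Filter ι} [L.NeBot]
    {Qs : ι → ProbabilityMeasure (ProbabilityMeasure Site)}
    {Q : ProbabilityMeasure (ProbabilityMeasure Site)} (hQ : Tendsto Qs L (𝓝 Q))
    (hs : ∀ i, (Qs i).map continuous_negPM.measurable.aemeasurable = Qs i) :
    (Q : Measure (ProbabilityMeasure Site)).map negPM = Q := by
  have h1 := ProbabilityMeasure.tendsto_map_of_tendsto_of_continuous Qs Q hQ continuous_negPM
  simp only [hs] at h1
  exact (congrArg (fun P : ProbabilityMeasure (ProbabilityMeasure Site) =>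
    (P : Measure (ProbabilityMeasure Site))) (tendsto_nhds_unique hQ h1)).symm

/-- A symmetric law splits evenly. -/
theorem exists_halves {Q : Measure (ProbabilityMeasure Site)} [IsProbabilityMeasure Q]
    (hQ : Q.map negPM = Q) {U V : Set (ProbabilityMeasure Site)}
    (h : ∀ᵐ ν : ProbabilityMeasure Site ∂Q, (field ν < 0 ∧ ν ∈ U) ∨ (0 < field ν ∧ ν ∈ V)) :
    ∃ Q₁ Q₂ : ProbabilityMeasure (ProbabilityMeasure Site),
      (∀ᵐ ν : ProbabilityMeasure Site ∂(Q₁ : Measure (ProbabilityMeasure Site)), ν ∈ U) ∧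
      (∀ᵐ ν : ProbabilityMeasure Site ∂(Q₂ : Measure (ProbabilityMeasure Site)), ν ∈ V) ∧
      Q = (2⁻¹ : ENNReal) • (Q₁ : Measure (ProbabilityMeasure Site)) +
        (2⁻¹ : ENNReal) • (Q₂ : Measure (ProbabilityMeasure Site)) := by
  set S : Set (ProbabilityMeasure Site) := {ν | field ν < 0} with hS
  set T : Set (ProbabilityMeasure Site) := {ν | 0 < field ν} with hT
  have hSm : MeasurableSet S := (isOpen_lt continuous_field continuous_const).measurableSet
  have hTm : MeasurableSet T := (isOpen_lt continuous_const continuous_field).measurableSet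
  have hST : Q S = Q T := by
    conv_lhs => rw [← hQ]
    rw [Measure.map_apply continuous_negPM.measurable hSm]
    congr 1
    ext ν
    change field (negPM ν) < 0 ↔ 0 < field ν
    rw [field_negPM, neg_lt_zero]
  have hcompl : (Sᶜ : Set (ProbabilityMeasure Site)) =ᵐ[Q] T := by
    filter_upwards [h] with ν hν
    refine propext (⟨fun h1 => ?_, fun h1 h2 => lt_asymm (show 0 < field ν from h1) h2⟩)
    rcases hν with h2 | h2
    · exact absurd h2.1 h1
    · exact h2.1
  have hsum : Q.restrict S + Q.restrict T = Q := by
    rw [← Measure.restrict_congr_set hcompl, Measure.restrict_add_restrict_compl hSm]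
  have htwo : 2 * Q S = 1 := by
    have h1 := congrArg (fun μ : Measure (ProbabilityMeasure Site) => μ univ) hsum
    simp only [Measure.add_apply, Measure.restrict_apply_univ, measure_univ] at h1
    rw [two_mul]
    nth_rewrite 2 [hST]
    exact h1
  have hprob : ∀ W, 2 * Q W = 1 → IsProbabilityMeasure ((2 : ENNReal) • Q.restrict W) := fun W hW =>
    ⟨by rw [Measure.smul_apply, Measure.restrict_apply_univ, smul_eq_mul, hW]⟩
  have hae : ∀ (W U' : Set (ProbabilityMeasure Site)), MeasurableSet W →
      (∀ᵐ ν : ProbabilityMeasure Site ∂Q, ν ∈ W → ν ∈ U') →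
      ∀ᵐ ν : ProbabilityMeasure Site ∂((2 : ENNReal) • Q.restrict W), ν ∈ U' := by
    intro W U' hW h1
    exact Measure.ae_smul_measure ((ae_restrict_iff' hW).2 h1) 2
  refine ⟨⟨_, hprob S htwo⟩, ⟨_, hprob T (hST ▸ htwo)⟩, hae S U hSm ?_, hae T V hTm ?_, ?_⟩
  · filter_upwards [h] with ν hν h1
    rcases hν with h2 | h2
    · exact h2.2
    · exact absurd h1 (lt_asymm h2.1)
  · filter_upwards [h] with ν hν h1
    rcases hν with h2 | h2
    · exact absurd h1 (lt_asymm h2.1)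
    · exact h2.2
  · change Q = (2⁻¹ : ENNReal) • ((2 : ENNReal) • Q.restrict S) +
      (2⁻¹ : ENNReal) • ((2 : ENNReal) • Q.restrict T)
    rw [smul_smul, smul_smul, ENNReal.inv_mul_cancel two_ne_zero (by simp), one_smul, one_smul, hsum]

end GCM

theorem mainTheorem9 (G : ℝ → ℝ) (hG : GCM.IsFeedback G)
    (hI : ∀ x ∈ GCM.Site, deriv G x ≤ 25 - 50 * |G x|)
    (hII : GCM.SShapedOn (GCM.feedbackH G) (Set.Icc (-2 / 5) (2 / 5)))
    (hB : 6 < deriv G 0)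
    (rs : ℝ) (hrs_pos : 0 < rs) (hrs_lt : rs < 2 / 3) (hrs : GCM.feedbackH G rs = rs)
    (δ : ℝ) (hδ : 0 < δ) :
    ∃ ε₀ : ℝ, 0 < ε₀ ∧ ∀ ε : ℝ, 0 < ε → ε < ε₀ →
      ∀ ϱ : Measure ℝ, GCM.IsNoise ϱ ε →
        (∀ Q : ProbabilityMeasure (ProbabilityMeasure GCM.Site),
          GCM.IsStationary (GCM.noisyStep G) ϱ (Q : Measure (ProbabilityMeasure GCM.Site)) →
          (∀ᵐ (ν : ProbabilityMeasure GCM.Site) ∂(Q : Measure (ProbabilityMeasure GCM.Site)),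
            (ν : Measure GCM.Site) ≪ GCM.leb) →
          ∀ᵐ (ν : ProbabilityMeasure GCM.Site) ∂(Q : Measure (ProbabilityMeasure GCM.Site)),
            ν ∈ GCM.nearSet (-rs) δ ∪ GCM.nearSet rs δ) ∧
        (∀ m : (N : ℕ) → ProbabilityMeasure (Fin (N + 1) → GCM.Site),
          (∀ N, GCM.IsACStationary G ϱ N (m N)) →
          ∀ (Q : ProbabilityMeasure (ProbabilityMeasure GCM.Site)) (k : ℕ → ℕ), StrictMono k →
          Tendsto (fun j => GCM.empiricalLaw (k j) (m (k j))) atTop (𝓝 Q) →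
          GCM.IsStationary (GCM.noisyStep G) ϱ (Q : Measure (ProbabilityMeasure GCM.Site)) ∧
          ∃ Q₁ Q₂ : ProbabilityMeasure (ProbabilityMeasure GCM.Site),
            (∀ᵐ (ν : ProbabilityMeasure GCM.Site) ∂(Q₁ : Measure (ProbabilityMeasure GCM.Site)),
              ν ∈ GCM.nearSet (-rs) δ) ∧
            (∀ᵐ (ν : ProbabilityMeasure GCM.Site) ∂(Q₂ : Measure (ProbabilityMeasure GCM.Site)),
              ν ∈ GCM.nearSet rs δ) ∧
            (Q : Measure (ProbabilityMeasure GCM.Site)) =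
              (2⁻¹ : ENNReal) • (Q₁ : Measure (ProbabilityMeasure GCM.Site)) +
                (2⁻¹ : ENNReal) • (Q₂ : Measure (ProbabilityMeasure GCM.Site))) := by
  obtain ⟨b, hb⟩ := hG.exists_feedbackOn hI
  obtain ⟨ε₀, hε₀, hε₀b, hmain⟩ := GCM.exists_noise_bound hG hb hII hB hrs_pos hrs_lt hrs hδ
  refine ⟨ε₀, hε₀, fun ε hε hlt ϱ hϱ => ⟨fun Q hQ hac => ?_, fun m hm Q k hk hQ => ?_⟩⟩
  · filter_upwards [hmain ε hε hlt ϱ hϱ Q inferInstance hQ hac] with ν hν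
    exact hν.imp And.right And.right
  · have := hϱ.prob
    have hεb : ε < b - 1 / 2 := hlt.trans_le hε₀b
    obtain ⟨K, -, hK⟩ := hb.acStationary hε hεb hϱ
    have hac := GCM.ae_absolutelyContinuous_of_tendsto (C := 19 * (K + 808))
      (fun N => (hK N (m N) (hm N)).2) hk hQ
    have hstat : GCM.IsStationary (GCM.noisyStep G) ϱ
        (Q : Measure (ProbabilityMeasure GCM.Site)) :=
      (GCM.isStationary_noisyStep_clip hεb.le hϱ.bounded).1 (hb.nice.isStationary_of_tendsto hQ
        (fun j => GCM.isStationary_empiricalLaw hb.nice.cont.measurable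
          ((GCM.isStationary_coupledStep_clip hεb.le hϱ.bounded).2 (hm (k j)).2)) hac)
    exact ⟨hstat, GCM.exists_halves
      (GCM.map_negPM_of_tendsto hQ fun j => GCM.map_negPM_empiricalLaw (hK (k j) (m (k j)) (hm (k j))).1)
      (hmain ε hε hlt ϱ hϱ Q inferInstance hstat hac)⟩
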